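/- **Conventions.** Let $0<q<1$ and $[x]=\frac{q^x-q^{-x}}{q-q^{-1}}$. *The quantum sphere.* $\mathcal A(S^4_q)$ is the unital complex $*$-algebra generated by $x_0=x_0^*,x_1,x_1^*,x_2,x_2^*$ with relations $$x_ix_j=q^2x_jx_i\ (0\le i<j\le 2),\qquad x_i^*x_j=q^2x_jx_i^*\ (i\ne j),$$ $$[x_1^*,x_1]=(1-q^4)x_0^2,\qquad [x_2^*,x_2]=x_1^*x_1-q^4x_1x_1^*,\qquad x_0^2+x_1x_1^*+x_2x_2^*=1$$ (together with their adjoints). *The symmetry.* $U_q(so(5))$ is the $*$-algebra generated by $K_i=K_i^*,K_i^{-1},E_i,F_i=E_i^*$ ($i=1,2$) with relations $[K_1,K_2]=0$, $K_iK_i^{-1}=K_i^{-1}K_i=1$, $[E_i,F_i]=\frac{K_i^2-K_i^{-2}}{q^i-q^{-i}}$, $[E_i,F_j]=0$ for $i\ne j$, $K_iE_iK_i^{-1}=q^iE_i$, $K_iE_jK_i^{-1}=q^{-1}E_j$ for $i\neq j$, $E_1E_2^2-(q^2+q^{-2})E_2E_1E_2+E_2^2E_1=0$, $E_1^3E_2-(q^2+1+q^{-2})(E_1^2E_2E_1-E_1E_2E_1^2)-E_2E_1^3=0$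 (together with their adjoints), coproduct $\Delta K_i=K_i\otimes K_i$, $\Delta E_i=E_i\otimes K_i+K_i^{-1}\otimes E_i$, $\Delta F_i=F_i\otimes K_i+K_i^{-1}\otimes F_i$, and counit $\epsilon(K_i)=1$, $\epsilon(E_i)=\epsilon(F_i)=0$. It acts on $\mathcal A(S^4_q)$ by $h\triangleright(ab)=(h_{(1)}\triangleright a)(h_{(2)}\triangleright b)$, $h\triangleright 1=\epsilon(h)1$ and, on generators: $K_i$ fixes $x_0$; $K_1\triangleright x_1=qx_1$, $K_1\triangleright x_1^*=q^{-1}x_1^*$, $K_1$ fixes $x_2,x_2^*$; $K_2\triangleright x_1=q^{-1}x_1$, $K_2\triangleright x_1^*=qx_1^*$, $K_2\triangleright x_2=qx_2$, $K_2\triangleright x_2^*=q^{-1}x_2^*$; $E_1\triangleright x_0=q^{-1/2}x_1$, $E_1\triangleright x_1^*=-q^{3/2}[2]x_0$, $F_1\triangleright x_1=q^{1/2}[2]x_0$, $F_1\triangleright x_0=-q^{-3/2}x_1^*$, $E_2\triangleright x_1=x_2$, $E_2\triangleright x_2^*=-q^2x_1^*$, $F_2\triangleright x_2=x_1$, $F_2\triangleright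 x_1^*=-q^{-2}x_2^*$; all other values of $E_i,F_i$ on the generators are $0$. *The spinor space.* For $l\in\mathbb N+\frac12$ let $V_l$ have orthonormal basis $|l,m_1,m_2;j\rangle$ with $j=\frac12,\frac32,\dots,l$, $j-|m_1|\in\mathbb N$, $l+\frac12-j-|m_2|\in\mathbb N$; kets with other labels are $0$. Let $\bigoplus_lV_l$ be the algebraic direct sum with its inner product. For labels $l,j,m_2$ let $\epsilon=\pm\frac12$ be the sign for which $l+\epsilon-j-m_2\in2\mathbb N$. Let $\sigma=\bigoplus_l\sigma_l$ be the $*$-representation of $U_q(so(5))$ on $\bigoplus_lV_l$ with $K_1\mapsto q^{m_1}$, $K_2\mapsto q^{m_2-m_1}$, $$\sigma(E_1)|l,m_1,m_2;j\rangle=\sqrt{[j-m_1][j+m_1+1]}\;|l,m_1+1,m_2;j\rangle,$$ $$\begin{aligned}\sigma(E_2)|l,m_1,m_2;j\rangle=&\sqrt{[j-m_1+1][j-m_1+2]}\,a_l(j,m_2)|l,m_1-1,m_2+1;j+1\rangle\\&+\sqrt{[j+m_1][j-m_1+1]}\,b_l(j,m_2)|l,m_1-1,m_2+1;j\rangle\\&+\sqrt{[j+m_1][j+m_1-1]}\,c_l(j,m_2)|l,m_1-1,m_2+1;j-1\rangle,\end{aligned}$$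 $$a_l(j,m_2)=\frac1{[2]}\sqrt{\frac{[l-j-m_2+\epsilon][l+j+m_2+3+\epsilon]}{[2(j+|\epsilon|)+1][2(j-|\epsilon|)+3]}},\qquad c_l(j,m_2)=-\frac1{[2]}\sqrt{\frac{[l-j+m_2+2-\epsilon][l+j-m_2+1-\epsilon]}{[2(j+|\epsilon|)-1][2(j-|\epsilon|)+1]}},$$ $$b_l(j,m_2)=2|\epsilon|\frac{\sqrt{[l-\epsilon(2j+1)-m_2+1][l-\epsilon(2j+1)+m_2+2]}}{[2j][2j+2]}.$$ An *equivariant $*$-representation* of $\mathcal A(S^4_q)$ on $\bigoplus_lV_l$ is a unital homomorphism $\rho:\mathcal A(S^4_q)\to\mathrm{End}(\bigoplus_lV_l)$ with $\langle\rho(a)v,w\rangle=\langle v,\rho(a^*)w\rangle$ and $\sigma(h)\rho(a)=\rho(h_{(1)}\triangleright a)\sigma(h_{(2)})$, i.e. one which together with $\sigma$ gives a $*$-representation of the crossed product $\mathcal A(S^4_q)\rtimes U_q(so(5))$. Two of them are unitarily equivalent if a unitary of $\bigoplus_lV_l$ commuting with $\sigma$ intertwines them. *Coefficients.* Put $$A^+_{j,m_1}=q^{m_1-1}\tfrac{\sqrt{[j+m_1+1][j-m_1+1]}}{[2j+2]},\qquad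 A^0_{j,m_1}=q^{-2}\tfrac{q^{j+m_1+1}[2][j-m_1]-[2j]}{[2j][2j+2]},$$ $$B^+_{j,m_1}=q^{-j+m_1-\frac12}\tfrac{\sqrt{[j+m_1+1][j+m_1+2]}}{[2j+2]},\quad B^0_{j,m_1}=(1+q^2)q^{m_1-\frac12}\tfrac{\sqrt{[j-m_1][j+m_1+1]}}{[2j][2j+2]},\quad B^-_{j,m_1}=-q^{j+m_1+\frac12}\tfrac{\sqrt{[j-m_1][j-m_1-1]}}{[2j]},$$ $$C^+_{l,j,m_2}=-q^{m_2-1-\epsilon}\tfrac{\sqrt{[l+j+m_2+3+\epsilon][l+j-m_2+3-\epsilon]}}{[2l+4]},\qquad C^-_{l,j,m_2}=-q^{m_2-1+\epsilon}\tfrac{\sqrt{[l-j+m_2-\epsilon][l-j-m_2+\epsilon]}}{[2l+2]},$$ $$C^0_{l,j,m_2}=[4\epsilon]\,q^{2\epsilon l+m_2-1+3\epsilon}\tfrac{\sqrt{[l+\frac12+j-2\epsilon m_2+2][l+\frac12-j-2\epsilon m_2]}}{[2l+2][2l+4]},$$ $$H^+_{l,j,m_2}=q^{m_2-1+\epsilon(2j+1)}\tfrac{\sqrt{[l+2\epsilon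 j-m_2+2+\epsilon][l-2\epsilon j+m_2+2-\epsilon]}}{[2l+4]},$$ $$H^0_{l,j,m_2}=\tfrac{[l-\epsilon(2j+1)-m_2+1][l-\epsilon(2j+1)+m_2+2]-q^{-2}[l+\epsilon(2j+1)-m_2+2][l+\epsilon(2j+1)+m_2+1]}{[2l+2][2l+4]},$$ $$D^+_{l,j,m_2}=q^{-l+m_2-\frac32}\tfrac{\sqrt{[l+j+m_2+3+\epsilon][l-j+m_2+2-\epsilon]}}{[2l+4]},\qquad D^-_{l,j,m_2}=-q^{l+m_2+\frac32}\tfrac{\sqrt{[l-j-m_2+\epsilon][l+j-m_2+1-\epsilon]}}{[2l+2]},$$ $$D^0_{l,j,m_2}=[2]q^{m_2+\frac12}\tfrac{\sqrt{[l-2\epsilon j-m_2+1-\epsilon][l-2\epsilon j+m_2+2-\epsilon]}}{[2l+2][2l+4]},$$ where in each coefficient $\epsilon$ is the sign attached to its own labels $l,j,m_2$. **Theorem.** (1) *(The two representations.)* The formulas above define the $*$-representation $\sigma$, and for each of the two signs $\pm$ there is an equivariant $*$-representation $\pi_\pm$ of $\mathcal A(S^4_q)$ on $\bigoplus_lV_l$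 with $$\begin{aligned}\pi_\pm(x_0)|l,m_1,m_2;j\rangle=\ &A^+_{j,m_1}C^+_{l,j,m_2}|l+1,m_1,m_2;j+1\rangle\mp A^+_{j,m_1}C^0_{l,j,m_2}|l,m_1,m_2;j+1\rangle+A^+_{j,m_1}C^-_{l,j,m_2}|l-1,m_1,m_2;j+1\rangle\\ &+A^0_{j,m_1}H^+_{l,j,m_2}|l+1,m_1,m_2;j\rangle\pm A^0_{j,m_1}H^0_{l,j,m_2}|l,m_1,m_2;j\rangle+A^0_{j,m_1}H^+_{l-1,j,m_2}|l-1,m_1,m_2;j\rangle\\ &+A^+_{j-1,m_1}C^-_{l+1,j-1,m_2}|l+1,m_1,m_2;j-1\rangle\mp A^+_{j-1,m_1}C^0_{l,j-1,m_2}|l,m_1,m_2;j-1\rangle+A^+_{j-1,m_1}C^+_{l-1,j-1,m_2}|l-1,m_1,m_2;j-1\rangle,\end{aligned}$$ $$\begin{aligned}\pi_\pm(x_1)|l,m_1,m_2;j\rangle=\ &B^+_{j,m_1}C^+_{l,j,m_2}|l+1,m_1+1,m_2;j+1\rangle\mp B^+_{j,m_1}C^0_{l,j,m_2}|l,m_1+1,m_2;j+1\rangle+B^+_{j,m_1}C^-_{l,j,m_2}|l-1,m_1+1,m_2;j+1\rangle\\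 &+B^0_{j,m_1}H^+_{l,j,m_2}|l+1,m_1+1,m_2;j\rangle\pm B^0_{j,m_1}H^0_{l,j,m_2}|l,m_1+1,m_2;j\rangle+B^0_{j,m_1}H^+_{l-1,j,m_2}|l-1,m_1+1,m_2;j\rangle\\ &+B^-_{j,m_1}C^-_{l+1,j-1,m_2}|l+1,m_1+1,m_2;j-1\rangle\mp B^-_{j,m_1}C^0_{l,j-1,m_2}|l,m_1+1,m_2;j-1\rangle+B^-_{j,m_1}C^+_{l-1,j-1,m_2}|l-1,m_1+1,m_2;j-1\rangle,\end{aligned}$$ $$\pi_\pm(x_2)|l,m_1,m_2;j\rangle=D^+_{l,j,m_2}|l+1,m_1,m_2+1;j\rangle\pm D^0_{l,j,m_2}|l,m_1,m_2+1;j\rangle+D^-_{l,j,m_2}|l-1,m_1,m_2+1;j\rangle.$$ Both $\pi_\pm$ extend to $*$-representations by bounded operators on the Hilbert space completion of $\bigoplus_lV_l$. (2) *(Uniqueness.)* Every equivariant $*$-representation of $\mathcal A(S^4_q)$ on $\bigoplus_lV_l$ is unitarily equivalent to $\pi_+$ or to $\pi_-$. (3) *(Inequivalence.)* $\pi_+$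 and $\pi_-$ are not unitarily equivalent as equivariant representations, and $\bigoplus_lV_l$ with $\pi_+$ and with $\pi_-$ are not even isomorphic as left $\mathcal A(S^4_q)$-modules. (4) *(Chiral spinors.)* The matrix $$e=\frac12\begin{pmatrix}1+x_0&q^3x_2&-qx_1&0\\q^{-3}x_2^*&1-q^2x_0&0&q^3x_1\\-q^{-1}x_1^*&0&1-q^2x_0&q^3x_2\\0&qx_1^*&q^{-3}x_2^*&1+q^4x_0\end{pmatrix}$$ over $\mathcal A(S^4_q)$ is idempotent. There is a faithful state $\varphi$ on $\mathcal A(S^4_q)$ which is invariant, $\varphi(h\triangleright a)=\epsilon(h)\varphi(a)$, such that the following holds. Let $\mathcal A(S^4_q)^4$ (row vectors) carry left multiplication by $\mathcal A(S^4_q)$, the inner product $\langle v,w\rangle=\sum_i\varphi(v_i^*w_i)$, and the $U_q(so(5))$-action $(h\cdot v)_i=\sum_j(h_{(1)}\triangleright v_j)\,s_{ij}(h_{(2)})$, where $s$ is the $4$-dimensional spin $*$-representation $s(K_1)=\mathrm{diag}(q^{1/2},q^{1/2},q^{-1/2},q^{-1/2})$, $s(K_2)=\mathrm{diag}(1,q^{-1},q,1)$,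 $s(E_1)=E_{13}+E_{24}$, $s(E_2)=E_{32}$ ($E_{ij}$ the matrix units). Then $\mathcal A(S^4_q)^4e$ and $\mathcal A(S^4_q)^4(1-e)$ are stable under $U_q(so(5))$, and as representations of the crossed product they are unitarily equivalent to $\bigoplus_lV_l$ with $(\sigma,\pi_+)$ and with $(\sigma,\pi_-)$, respectively. -/

import Mathlib

/-! ### `q`-numbers -/

/-- The `q`-analogue `[x] = (q^x - q^{-x}) / (q - q⁻¹)`. -/
noncomputable def qnum (q x : ℝ) : ℝ := (q ^ x - q ^ (-x)) / (q - q⁻¹)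

/-! ### Involutions from conjugate-linear antihomomorphisms -/

/-- The opposite of a complex algebra `P`, with complex conjugate scalar multiplication: an algebra
map `P → ConjOp P` is a unital conjugate-linear antimultiplicative map `P → P`. -/
def ConjOp (P : Type) : Type := Pᵐᵒᵖ

namespace ConjOp

/-- An element of `P`, seen in `ConjOp P`. -/
def mk {P : Type} (a : P) : ConjOp P := (MulOpposite.op a : Pᵐᵒᵖ)

/-- An element of `ConjOp P`, seen in `P`. -/
def unmk {P : Type} (a : ConjOp P) : P := MulOpposite.unop (a : Pᵐᵒᵖ)

theorem unmk_mk {P : Type} (a : P) : unmk (mk a) = a := rfl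

instance (P : Type) [Ring P] : Ring (ConjOp P) := inferInstanceAs (Ring Pᵐᵒᵖ)

section
variable {P : Type} [Ring P]
theorem mk_mul (a b : P) : mk a * mk b = mk (b * a) := rfl
theorem mk_add (a b : P) : mk a + mk b = mk (a + b) := rfl
theorem mk_sub (a b : P) : mk a - mk b = mk (a - b) := rfl
theorem mk_one : (1 : ConjOp P) = mk 1 := rfl
theorem mk_zero : (0 : ConjOp P) = mk 0 := rfl
theorem unmk_mul (a b : ConjOp P) : unmk (a * b) = unmk b * unmk a := rfl
theorem unmk_add (a b : ConjOp P) : unmk (a + b) = unmk a + unmk b := rfl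
theorem unmk_one : unmk (1 : ConjOp P) = 1 := rfl
theorem unmk_zero : unmk (0 : ConjOp P) = 0 := rfl
end

section
variable {P : Type} [Ring P] [Algebra ℂ P]

noncomputable instance : Algebra ℂ (ConjOp P) :=
  RingHom.toAlgebra' ((algebraMap ℂ Pᵐᵒᵖ).comp (starRingEnd ℂ))
    (fun _ x => Algebra.commutes (R := ℂ) (A := Pᵐᵒᵖ) _ x)

theorem unmk_algebraMap (c : ℂ) :
    unmk (algebraMap ℂ (ConjOp P) c) = algebraMap ℂ P (starRingEnd ℂ c) := rfl

theorem unmk_smul (c : ℂ) (a : ConjOp P) : unmk (c • a) = starRingEnd ℂ c • unmk a := by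
  rw [Algebra.smul_def, Algebra.smul_def, Algebra.commutes]
  rfl

theorem mk_smul (c : ℂ) (a : P) : c • mk a = mk (starRingEnd ℂ c • a) := by
  rw [Algebra.smul_def, Algebra.smul_def, Algebra.commutes]
  rfl

/-- Composing an algebra map `P → ConjOp P` with itself gives an algebra map `P → P`. -/
noncomputable def sq (J : P →ₐ[ℂ] ConjOp P) : P →ₐ[ℂ] P where
  toFun a := unmk (J (unmk (J a)))
  map_one' := by simp [unmk_one]
  map_mul' a b := by simp [unmk_mul]
  map_zero' := by simp [unmk_zero]
  map_add' a b := by simp [unmk_add]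
  commutes' c := by simp [unmk_algebraMap]

end

end ConjOp

/-! ### The quantum 4-sphere -/

/-- Generators of `A(S⁴_q)`; `y₁`, `y₂` stand for `x₁*`, `x₂*`. -/
inductive SGen : Type
  | x₀ | x₁ | y₁ | x₂ | y₂

/-- The involution on the generators of `A(S⁴_q)`. -/
def SGen.star : SGen → SGen
  | x₀ => x₀
  | x₁ => y₁
  | y₁ => x₁
  | x₂ => y₂
  | y₂ => x₂

section
local notation "X₀" => FreeAlgebra.ι ℂ SGen.x₀
local notation "X₁" => FreeAlgebra.ι ℂ SGen.x₁
local notation "Y₁" => FreeAlgebra.ι ℂ SGen.y₁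
local notation "X₂" => FreeAlgebra.ι ℂ SGen.x₂
local notation "Y₂" => FreeAlgebra.ι ℂ SGen.y₂

/-- The defining relations of `A(S⁴_q)`, together with their adjoints. -/
inductive SRel (q : ℝ) : FreeAlgebra ℂ SGen → FreeAlgebra ℂ SGen → Prop
  | x₀x₁ : SRel q (X₀ * X₁) ((q : ℂ) ^ 2 • (X₁ * X₀))
  | x₀x₂ : SRel q (X₀ * X₂) ((q : ℂ) ^ 2 • (X₂ * X₀))
  | x₁x₂ : SRel q (X₁ * X₂) ((q : ℂ) ^ 2 • (X₂ * X₁))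
  | y₁x₀ : SRel q (Y₁ * X₀) ((q : ℂ) ^ 2 • (X₀ * Y₁))
  | y₂x₀ : SRel q (Y₂ * X₀) ((q : ℂ) ^ 2 • (X₀ * Y₂))
  | y₂y₁ : SRel q (Y₂ * Y₁) ((q : ℂ) ^ 2 • (Y₁ * Y₂))
  | y₁x₂ : SRel q (Y₁ * X₂) ((q : ℂ) ^ 2 • (X₂ * Y₁))
  | y₂x₁ : SRel q (Y₂ * X₁) ((q : ℂ) ^ 2 • (X₁ * Y₂))
  | comm₁ : SRel q (Y₁ * X₁ - X₁ * Y₁) ((1 - (q : ℂ) ^ 4) • (X₀ * X₀))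
  | comm₂ : SRel q (Y₂ * X₂ - X₂ * Y₂) (Y₁ * X₁ - (q : ℂ) ^ 4 • (X₁ * Y₁))
  | sphere : SRel q (X₀ * X₀ + X₁ * Y₁ + X₂ * Y₂) 1

end

/-- The coordinate algebra `A(S⁴_q)` of the quantum orthogonal 4-sphere. -/
def S4 (q : ℝ) : Type := RingQuot (SRel q)

namespace S4

variable (q : ℝ)

noncomputable instance : Ring (S4 q) := inferInstanceAs (Ring (RingQuot (SRel q)))

noncomputable instance : Algebra ℂ (S4 q) := inferInstanceAs (Algebra ℂ (RingQuot (SRel q)))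

/-- The class of a generator. -/
noncomputable def gen (x : SGen) : S4 q := RingQuot.mkAlgHom ℂ (SRel q) (FreeAlgebra.ι ℂ x)

noncomputable abbrev x₀ : S4 q := gen q SGen.x₀
noncomputable abbrev x₁ : S4 q := gen q SGen.x₁
noncomputable abbrev y₁ : S4 q := gen q SGen.y₁
noncomputable abbrev x₂ : S4 q := gen q SGen.x₂
noncomputable abbrev y₂ : S4 q := gen q SGen.y₂

/-- The algebra map out of `A(S⁴_q)` determined by images of the generators. -/
noncomputable def lift {B : Type} [Ring B] [Algebra ℂ B] (f : SGen → B)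
    (h : ∀ ⦃a b⦄, SRel q a b → FreeAlgebra.lift ℂ f a = FreeAlgebra.lift ℂ f b) :
    S4 q →ₐ[ℂ] B :=
  RingQuot.liftAlgHom ℂ ⟨FreeAlgebra.lift ℂ f, h⟩

theorem lift_gen {B : Type} [Ring B] [Algebra ℂ B] (f : SGen → B)
    (h : ∀ ⦃a b⦄, SRel q a b → FreeAlgebra.lift ℂ f a = FreeAlgebra.lift ℂ f b) (x : SGen) :
    lift q f h (gen q x) = f x := by
  unfold lift gen
  refine (RingQuot.liftAlgHom_mkAlgHom_apply ℂ _ _ _).trans ?_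
  simp

/-- Images of two related elements of the free algebra agree in `A(S⁴_q)`. -/
theorem rel {a b : FreeAlgebra ℂ SGen} (h : SRel q a b) :
    FreeAlgebra.lift ℂ (gen q) a = FreeAlgebra.lift ℂ (gen q) b := by
  have key : FreeAlgebra.lift ℂ (gen q) =
      (RingQuot.mkAlgHom ℂ (SRel q) : FreeAlgebra ℂ SGen →ₐ[ℂ] S4 q) := by
    apply FreeAlgebra.hom_ext
    funext x
    simp only [Function.comp_apply, FreeAlgebra.lift_ι_apply]
    rfl
  rw [key]
  exact RingQuot.mkAlgHom_rel ℂ h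

theorem r_x₀x₁ : x₀ q * x₁ q = (q : ℂ) ^ 2 • (x₁ q * x₀ q) := by simpa using rel q SRel.x₀x₁
theorem r_x₀x₂ : x₀ q * x₂ q = (q : ℂ) ^ 2 • (x₂ q * x₀ q) := by simpa using rel q SRel.x₀x₂
theorem r_x₁x₂ : x₁ q * x₂ q = (q : ℂ) ^ 2 • (x₂ q * x₁ q) := by simpa using rel q SRel.x₁x₂
theorem r_y₁x₀ : y₁ q * x₀ q = (q : ℂ) ^ 2 • (x₀ q * y₁ q) := by simpa using rel q SRel.y₁x₀
theorem r_y₂x₀ : y₂ q * x₀ q = (q : ℂ) ^ 2 • (x₀ q * y₂ q) := by simpa using rel q SRel.y₂x₀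
theorem r_y₂y₁ : y₂ q * y₁ q = (q : ℂ) ^ 2 • (y₁ q * y₂ q) := by simpa using rel q SRel.y₂y₁
theorem r_y₁x₂ : y₁ q * x₂ q = (q : ℂ) ^ 2 • (x₂ q * y₁ q) := by simpa using rel q SRel.y₁x₂
theorem r_y₂x₁ : y₂ q * x₁ q = (q : ℂ) ^ 2 • (x₁ q * y₂ q) := by simpa using rel q SRel.y₂x₁
theorem r_comm₁ : y₁ q * x₁ q - x₁ q * y₁ q = (1 - (q : ℂ) ^ 4) • (x₀ q * x₀ q) := by
  simpa using rel q SRel.comm₁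
theorem r_comm₂ : y₂ q * x₂ q - x₂ q * y₂ q = y₁ q * x₁ q - (q : ℂ) ^ 4 • (x₁ q * y₁ q) := by
  simpa using rel q SRel.comm₂
theorem r_sphere : x₀ q * x₀ q + x₁ q * y₁ q + x₂ q * y₂ q = 1 := by
  simpa using rel q SRel.sphere

theorem hom_ext {B : Type} [Ring B] [Algebra ℂ B] {f g : S4 q →ₐ[ℂ] B}
    (h : ∀ x, f (gen q x) = g (gen q x)) : f = g := by
  refine RingQuot.ringQuot_ext' ℂ (s := SRel q) f g ?_
  apply FreeAlgebra.hom_ext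
  funext x
  exact h x

/-- The conjugate-linear antihomomorphism of `A(S⁴_q)` with `x₀ ↦ x₀`, `xᵢ ↔ yᵢ`. -/
noncomputable def conj : S4 q →ₐ[ℂ] ConjOp (S4 q) :=
  lift q (fun x => ConjOp.mk (gen q x.star)) <| by
    intro a b h
    have e₁ := r_comm₁ q
    have e₂ := r_comm₂ q
    have e₃ := r_sphere q
    cases h <;>
      simp only [map_mul, map_smul, map_sub, map_add, map_one, FreeAlgebra.lift_ι_apply, SGen.star,
        ConjOp.mk_mul, ConjOp.mk_smul, ConjOp.mk_add, ConjOp.mk_sub, ConjOp.mk_one,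
        map_pow, Complex.conj_ofReal, r_x₀x₁, r_x₀x₂, r_x₁x₂, r_y₁x₀, r_y₂x₀, r_y₂y₁, r_y₁x₂,
        r_y₂x₁, e₁, e₂, e₃]

theorem conj_gen (x : SGen) : conj q (gen q x) = ConjOp.mk (gen q x.star) := lift_gen q _ _ x

theorem sq_conj : ConjOp.sq (conj q) = AlgHom.id ℂ (S4 q) := by
  apply hom_ext
  intro x
  change ConjOp.unmk (conj q (ConjOp.unmk (conj q (gen q x)))) = gen q x
  rw [conj_gen, ConjOp.unmk_mk, conj_gen, ConjOp.unmk_mk]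
  cases x <;> rfl

noncomputable instance : StarRing (S4 q) where
  star a := ConjOp.unmk (conj q a)
  star_involutive a := DFunLike.congr_fun (sq_conj q) a
  star_mul a b := by rw [map_mul]; rfl
  star_add a b := by rw [map_add]; rfl

instance : StarModule ℂ (S4 q) :=
  ⟨fun c a => by
    change ConjOp.unmk (conj q (c • a)) = _
    rw [map_smul, ConjOp.unmk_smul]; rfl⟩

theorem star_gen (x : SGen) : star (gen q x) = gen q x.star := by
  change ConjOp.unmk (conj q (gen q x)) = _
  rw [conj_gen, ConjOp.unmk_mk]

theorem r_comm₁' : y₁ q * x₁ q = x₁ q * y₁ q + (1 - (q : ℂ) ^ 4) • (x₀ q * x₀ q) := by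
  rw [← r_comm₁]; abel

theorem r_sphere' : x₂ q * y₂ q = 1 - x₀ q * x₀ q - x₁ q * y₁ q := by
  rw [← r_sphere q]; abel

theorem r_comm₂' : y₂ q * x₂ q = 1 - (q : ℂ) ^ 4 • (x₀ q * x₀ q + x₁ q * y₁ q) := by
  have h := r_comm₂ q
  rw [sub_eq_iff_eq_add, r_comm₁', r_sphere'] at h
  rw [h]; module

end S4

/-! ### The Hopf algebra `U_q(so(5))` -/

/-- Generators of `U_q(so(5))`; the index `0, 1 : Fin 2` stands for the index `1, 2`. -/
inductive UGen : Type
  | K (i : Fin 2) | Kinv (i : Fin 2) | E (i : Fin 2) | F (i : Fin 2)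

namespace UGen

/-- The involution on the generators: `Kᵢ* = Kᵢ`, `Eᵢ* = Fᵢ`. -/
def star : UGen → UGen
  | K i => K i
  | Kinv i => Kinv i
  | E i => F i
  | F i => E i

/-- The coproduct on the generators, as a list of pairs `(h₁, h₂)` with `Δ h = ∑ h₁ ⊗ h₂`:
`Δ Kᵢ = Kᵢ ⊗ Kᵢ`, `Δ Eᵢ = Eᵢ ⊗ Kᵢ + Kᵢ⁻¹ ⊗ Eᵢ`, and likewise for `Kᵢ⁻¹`, `Fᵢ`. -/
def coprod : UGen → List (UGen × UGen)
  | K i => [(K i, K i)]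
  | Kinv i => [(Kinv i, Kinv i)]
  | E i => [(E i, K i), (Kinv i, E i)]
  | F i => [(F i, K i), (Kinv i, F i)]

/-- The counit on the generators. -/
def counit : UGen → ℂ
  | K _ => 1
  | Kinv _ => 1
  | E _ => 0
  | F _ => 0

end UGen

section
local notation "κ" i:max => FreeAlgebra.ι ℂ (UGen.K i)
local notation "κ'" i:max => FreeAlgebra.ι ℂ (UGen.Kinv i)
local notation "ε" i:max => FreeAlgebra.ι ℂ (UGen.E i)
local notation "ϕ" i:max => FreeAlgebra.ι ℂ (UGen.F i)

/-- The left hand side `a b² - (q² + q⁻²) b a b + b² a` of the first Serre relation. -/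
noncomputable def serre₁ (q : ℝ) {P : Type} [Ring P] [Algebra ℂ P] (a b : P) : P :=
  a * b ^ 2 - ((q : ℂ) ^ 2 + ((q : ℂ) ^ 2)⁻¹) • (b * a * b) + b ^ 2 * a

/-- The left hand side `a³ b - (q² + 1 + q⁻²) (a² b a - a b a²) - b a³` of the second Serre
relation. -/
noncomputable def serre₂ (q : ℝ) {P : Type} [Ring P] [Algebra ℂ P] (a b : P) : P :=
  a ^ 3 * b - ((q : ℂ) ^ 2 + 1 + ((q : ℂ) ^ 2)⁻¹) • (a ^ 2 * b * a - a * b * a ^ 2) - b * a ^ 3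

theorem map_serre₁ (q : ℝ) {P Q : Type} [Ring P] [Algebra ℂ P] [Ring Q] [Algebra ℂ Q]
    (f : P →ₐ[ℂ] Q) (a b : P) : f (serre₁ q a b) = serre₁ q (f a) (f b) := by
  simp [serre₁]

theorem map_serre₂ (q : ℝ) {P Q : Type} [Ring P] [Algebra ℂ P] [Ring Q] [Algebra ℂ Q]
    (f : P →ₐ[ℂ] Q) (a b : P) : f (serre₂ q a b) = serre₂ q (f a) (f b) := by
  simp [serre₂]

theorem mk_serre₁ (q : ℝ) {P : Type} [Ring P] [Algebra ℂ P] (a b : P) :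
    serre₁ q (ConjOp.mk a) (ConjOp.mk b) = ConjOp.mk (serre₁ q a b) := by
  simp only [serre₁, pow_succ, pow_zero, one_mul, ConjOp.mk_mul, ConjOp.mk_smul, ConjOp.mk_sub,
    ConjOp.mk_add, mul_assoc, map_add, map_mul, map_inv₀, Complex.conj_ofReal]
  congr 1
  abel

theorem mk_serre₂ (q : ℝ) {P : Type} [Ring P] [Algebra ℂ P] (a b : P) :
    serre₂ q (ConjOp.mk a) (ConjOp.mk b) = ConjOp.mk (-serre₂ q a b) := by
  simp only [serre₂, pow_succ, pow_zero, one_mul, ConjOp.mk_mul, ConjOp.mk_smul, ConjOp.mk_sub,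
    mul_assoc, map_add, map_mul, map_one, map_inv₀, Complex.conj_ofReal]
  congr 1
  module

/-- The defining relations of `U_q(so(5))`, together with their adjoints. -/
inductive URel (q : ℝ) : FreeAlgebra ℂ UGen → FreeAlgebra ℂ UGen → Prop
  | KK : URel q (κ 0 * κ 1) (κ 1 * κ 0)
  | KKinv (i : Fin 2) : URel q (κ i * κ' i) 1
  | KinvK (i : Fin 2) : URel q (κ' i * κ i) 1
  | EF (i : Fin 2) : URel q (ε i * ϕ i - ϕ i * ε i)
      (((q : ℂ) ^ (i.val + 1) - ((q : ℂ) ^ (i.val + 1))⁻¹)⁻¹ • (κ i ^ 2 - κ' i ^ 2))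
  | EF_ne (i j : Fin 2) (h : i ≠ j) : URel q (ε i * ϕ j) (ϕ j * ε i)
  | KE (i : Fin 2) : URel q (κ i * ε i) ((q : ℂ) ^ (i.val + 1) • (ε i * κ i))
  | FK (i : Fin 2) : URel q (ϕ i * κ i) ((q : ℂ) ^ (i.val + 1) • (κ i * ϕ i))
  | KE_ne (i j : Fin 2) (h : i ≠ j) : URel q (κ i * ε j) ((q : ℂ)⁻¹ • (ε j * κ i))
  | FK_ne (i j : Fin 2) (h : i ≠ j) : URel q (ϕ j * κ i) ((q : ℂ)⁻¹ • (κ i * ϕ j))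
  | serreE₁ : URel q (serre₁ q (ε 0) (ε 1)) 0
  | serreF₁ : URel q (serre₁ q (ϕ 0) (ϕ 1)) 0
  | serreE₂ : URel q (serre₂ q (ε 0) (ε 1)) 0
  | serreF₂ : URel q (serre₂ q (ϕ 0) (ϕ 1)) 0

end

/-- The algebra `U_q(so(5))`. -/
def Uq (q : ℝ) : Type := RingQuot (URel q)

namespace Uq

variable (q : ℝ)

noncomputable instance : Ring (Uq q) := inferInstanceAs (Ring (RingQuot (URel q)))

noncomputable instance : Algebra ℂ (Uq q) := inferInstanceAs (Algebra ℂ (RingQuot (URel q)))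

/-- The class of a generator. -/
noncomputable def gen (h : UGen) : Uq q := RingQuot.mkAlgHom ℂ (URel q) (FreeAlgebra.ι ℂ h)

/-- The algebra map out of `U_q(so(5))` determined by images of the generators. -/
noncomputable def lift {B : Type} [Ring B] [Algebra ℂ B] (f : UGen → B)
    (h : ∀ ⦃a b⦄, URel q a b → FreeAlgebra.lift ℂ f a = FreeAlgebra.lift ℂ f b) :
    Uq q →ₐ[ℂ] B :=
  RingQuot.liftAlgHom ℂ ⟨FreeAlgebra.lift ℂ f, h⟩

theorem lift_gen {B : Type} [Ring B] [Algebra ℂ B] (f : UGen → B)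
    (h : ∀ ⦃a b⦄, URel q a b → FreeAlgebra.lift ℂ f a = FreeAlgebra.lift ℂ f b) (x : UGen) :
    lift q f h (gen q x) = f x := by
  unfold lift gen
  refine (RingQuot.liftAlgHom_mkAlgHom_apply ℂ _ _ _).trans ?_
  simp

/-- Images of two related elements of the free algebra agree in `U_q(so(5))`. -/
theorem rel {a b : FreeAlgebra ℂ UGen} (h : URel q a b) :
    FreeAlgebra.lift ℂ (gen q) a = FreeAlgebra.lift ℂ (gen q) b := by
  have key : FreeAlgebra.lift ℂ (gen q) =
      (RingQuot.mkAlgHom ℂ (URel q) : FreeAlgebra ℂ UGen →ₐ[ℂ] Uq q) := by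
    apply FreeAlgebra.hom_ext
    funext x
    simp only [Function.comp_apply, FreeAlgebra.lift_ι_apply]
    rfl
  rw [key]
  exact RingQuot.mkAlgHom_rel ℂ h

theorem hom_ext {B : Type} [Ring B] [Algebra ℂ B] {f g : Uq q →ₐ[ℂ] B}
    (h : ∀ x, f (gen q x) = g (gen q x)) : f = g := by
  refine RingQuot.ringQuot_ext' ℂ (s := URel q) f g ?_
  apply FreeAlgebra.hom_ext
  funext x
  exact h x

/-- The conjugate-linear antihomomorphism of `U_q(so(5))` with `Kᵢ ↦ Kᵢ`, `Eᵢ ↔ Fᵢ`. -/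
noncomputable def conj : Uq q →ₐ[ℂ] ConjOp (Uq q) :=
  lift q (fun x => ConjOp.mk (gen q x.star)) <| by
    intro a b h
    have hr := @rel q
    cases h
    case KK => simpa [UGen.star, ConjOp.mk_mul] using congrArg ConjOp.mk (hr URel.KK).symm
    case KKinv i =>
      simpa [UGen.star, ConjOp.mk_mul, ConjOp.mk_one] using congrArg ConjOp.mk (hr (URel.KinvK i))
    case KinvK i =>
      simpa [UGen.star, ConjOp.mk_mul, ConjOp.mk_one] using congrArg ConjOp.mk (hr (URel.KKinv i))
    case EF i =>
      simpa [UGen.star, ConjOp.mk_mul, ConjOp.mk_sub, ConjOp.mk_smul, pow_two] using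
        congrArg ConjOp.mk (hr (URel.EF i))
    case EF_ne i j h =>
      simpa [UGen.star, ConjOp.mk_mul] using congrArg ConjOp.mk (hr (URel.EF_ne j i h.symm))
    case KE i =>
      simpa [UGen.star, ConjOp.mk_mul, ConjOp.mk_smul] using congrArg ConjOp.mk (hr (URel.FK i))
    case FK i =>
      simpa [UGen.star, ConjOp.mk_mul, ConjOp.mk_smul] using congrArg ConjOp.mk (hr (URel.KE i))
    case KE_ne i j h =>
      simpa [UGen.star, ConjOp.mk_mul, ConjOp.mk_smul] using
        congrArg ConjOp.mk (hr (URel.FK_ne i j h))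
    case FK_ne i j h =>
      simpa [UGen.star, ConjOp.mk_mul, ConjOp.mk_smul] using
        congrArg ConjOp.mk (hr (URel.KE_ne i j h))
    case serreE₁ =>
      have h := hr URel.serreF₁
      rw [map_serre₁, FreeAlgebra.lift_ι_apply, FreeAlgebra.lift_ι_apply, map_zero] at h
      rw [map_serre₁, FreeAlgebra.lift_ι_apply, FreeAlgebra.lift_ι_apply, map_zero, mk_serre₁]
      change ConjOp.mk (serre₁ q (gen q (UGen.F 0)) (gen q (UGen.F 1))) = 0
      rw [h]
      rfl
    case serreF₁ =>
      have h := hr URel.serreE₁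
      rw [map_serre₁, FreeAlgebra.lift_ι_apply, FreeAlgebra.lift_ι_apply, map_zero] at h
      rw [map_serre₁, FreeAlgebra.lift_ι_apply, FreeAlgebra.lift_ι_apply, map_zero, mk_serre₁]
      change ConjOp.mk (serre₁ q (gen q (UGen.E 0)) (gen q (UGen.E 1))) = 0
      rw [h]
      rfl
    case serreE₂ =>
      have h := hr URel.serreF₂
      rw [map_serre₂, FreeAlgebra.lift_ι_apply, FreeAlgebra.lift_ι_apply, map_zero] at h
      rw [map_serre₂, FreeAlgebra.lift_ι_apply, FreeAlgebra.lift_ι_apply, map_zero, mk_serre₂]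
      change ConjOp.mk (-serre₂ q (gen q (UGen.F 0)) (gen q (UGen.F 1))) = 0
      rw [h, neg_zero]
      rfl
    case serreF₂ =>
      have h := hr URel.serreE₂
      rw [map_serre₂, FreeAlgebra.lift_ι_apply, FreeAlgebra.lift_ι_apply, map_zero] at h
      rw [map_serre₂, FreeAlgebra.lift_ι_apply, FreeAlgebra.lift_ι_apply, map_zero, mk_serre₂]
      change ConjOp.mk (-serre₂ q (gen q (UGen.E 0)) (gen q (UGen.E 1))) = 0
      rw [h, neg_zero]
      rfl

theorem conj_gen (x : UGen) : conj q (gen q x) = ConjOp.mk (gen q x.star) := lift_gen q _ _ x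

theorem sq_conj : ConjOp.sq (conj q) = AlgHom.id ℂ (Uq q) := by
  apply hom_ext
  intro x
  change ConjOp.unmk (conj q (ConjOp.unmk (conj q (gen q x)))) = gen q x
  rw [conj_gen, ConjOp.unmk_mk, conj_gen, ConjOp.unmk_mk]
  cases x <;> rfl

noncomputable instance : StarRing (Uq q) where
  star a := ConjOp.unmk (conj q a)
  star_involutive a := DFunLike.congr_fun (sq_conj q) a
  star_mul a b := by rw [map_mul]; rfl
  star_add a b := by rw [map_add]; rfl

instance : StarModule ℂ (Uq q) :=
  ⟨fun c a => by
    change ConjOp.unmk (conj q (c • a)) = _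
    rw [map_smul, ConjOp.unmk_smul]; rfl⟩

theorem star_gen (x : UGen) : star (gen q x) = gen q x.star := by
  change ConjOp.unmk (conj q (gen q x)) = _
  rw [conj_gen, ConjOp.unmk_mk]

end Uq

/-! ### The action of `U_q(so(5))` on `A(S⁴_q)` -/

namespace S4

variable (q : ℝ)

/-- Upper triangular matrices of size two. -/
def tri {P : Type} [Zero P] (a d b : P) : Matrix (Fin 2) (Fin 2) P := !![a, d; 0, b]

theorem tri_mul {P : Type} [Ring P] (a d b a' d' b' : P) :
    tri a d b * tri a' d' b' = tri (a * a') (a * d' + d * b') (b * b') := by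
  simp [tri]

theorem tri_add {P : Type} [Ring P] (a d b a' d' b' : P) :
    tri a d b + tri a' d' b' = tri (a + a') (d + d') (b + b') := by
  simp [tri]

theorem tri_sub {P : Type} [Ring P] (a d b a' d' b' : P) :
    tri a d b - tri a' d' b' = tri (a - a') (d - d') (b - b') := by
  simp [tri]

theorem tri_smul {P : Type} [Ring P] [Algebra ℂ P] (c : ℂ) (a d b : P) :
    c • tri a d b = tri (c • a) (c • d) (c • b) := by
  simp [tri]

theorem tri_one {P : Type} [Ring P] : (1 : Matrix (Fin 2) (Fin 2) P) = tri 1 0 1 := by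
  simp [tri, Matrix.one_fin_two]

theorem tri_congr {P : Type} [Ring P] {a d b a' d' b' : P} (h₁ : a = a') (h₂ : d = d')
    (h₃ : b = b') : tri a d b = tri a' d' b' := by rw [h₁, h₂, h₃]

/-- The weight of a generator of `A(S⁴_q)` under `Kᵢ`: `Kᵢ ▷ x = wt i x • x`. -/
noncomputable def wt : Fin 2 → SGen → ℂ
  | 0, SGen.x₁ => q
  | 0, SGen.y₁ => (q : ℂ)⁻¹
  | 1, SGen.x₁ => (q : ℂ)⁻¹
  | 1, SGen.y₁ => q
  | 1, SGen.x₂ => q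
  | 1, SGen.y₂ => (q : ℂ)⁻¹
  | _, _ => 1

/-- The values of `Eᵢ ▷` on the generators of `A(S⁴_q)`. -/
noncomputable def actE : Fin 2 → SGen → S4 q
  | 0, SGen.x₀ => ((q ^ (-1 / 2 : ℝ) : ℝ) : ℂ) • x₁ q
  | 0, SGen.y₁ => -((q ^ (3 / 2 : ℝ) * qnum q 2 : ℝ) : ℂ) • x₀ q
  | 1, SGen.x₁ => x₂ q
  | 1, SGen.y₂ => -(q : ℂ) ^ 2 • y₁ q
  | _, _ => 0

/-- The values of `Fᵢ ▷` on the generators of `A(S⁴_q)`. -/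
noncomputable def actF : Fin 2 → SGen → S4 q
  | 0, SGen.x₁ => ((q ^ (1 / 2 : ℝ) * qnum q 2 : ℝ) : ℂ) • x₀ q
  | 0, SGen.x₀ => -((q ^ (-3 / 2 : ℝ) : ℝ) : ℂ) • y₁ q
  | 1, SGen.x₂ => x₁ q
  | 1, SGen.y₁ => -((q : ℂ) ^ 2)⁻¹ • y₂ q
  | _, _ => 0

theorem wt_spec (hq : 0 < q) (i : Fin 2) : wt q i SGen.x₀ = 1 ∧
    wt q i SGen.x₁ * wt q i SGen.y₁ = 1 ∧ wt q i SGen.x₂ * wt q i SGen.y₂ = 1 := by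
  have h0 : (q : ℂ) ≠ 0 := by exact_mod_cast hq.ne'
  fin_cases i <;> simp [wt, h0]

/-- The algebra endomorphism which multiplies each generator `x` by a scalar `c x`. -/
noncomputable def scale (c : SGen → ℂ) (hc : c SGen.x₀ = 1 ∧ c SGen.x₁ * c SGen.y₁ = 1 ∧
    c SGen.x₂ * c SGen.y₂ = 1) : S4 q →ₐ[ℂ] S4 q :=
  lift q (fun x => c x • gen q x) <| by
    obtain ⟨h₀, h₁, h₂⟩ := hc
    have h₁' := (mul_comm _ _).trans h₁
    have h₂' := (mul_comm _ _).trans h₂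
    intro a b h
    cases h <;>
      simp only [map_mul, map_smul, map_sub, map_add, map_one, FreeAlgebra.lift_ι_apply,
        mul_smul_comm, smul_mul_assoc, smul_smul, h₀, h₁, h₂, h₁', h₂', one_smul,
        r_x₀x₁, r_x₀x₂, r_x₁x₂, r_y₁x₀, r_y₂x₀, r_y₂y₁, r_y₁x₂,
        r_y₂x₁, r_comm₁', r_comm₂', r_sphere'] <;> module

theorem qnum_two (hq : q ∈ Set.Ioo (0 : ℝ) 1) : qnum q 2 = q + q⁻¹ := by
  have h0 := hq.1.ne'
  have h1 : q - q⁻¹ ≠ 0 := by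
    have : q < q⁻¹ := hq.2.trans ((one_lt_inv₀ hq.1).2 hq.2)
    exact (sub_neg.2 this).ne
  rw [qnum, Real.rpow_neg hq.1.le, div_eq_iff h1]
  norm_num
  field_simp
  ring

theorem rpow_half (hq : 0 < q) : ∃ h : ℂ, h ≠ 0 ∧ (q : ℂ) = h ^ 2 ∧
    ((q ^ (1 / 2 : ℝ) : ℝ) : ℂ) = h ∧ ((q ^ (-1 / 2 : ℝ) : ℝ) : ℂ) = h⁻¹ ∧
    ((q ^ (3 / 2 : ℝ) : ℝ) : ℂ) = h ^ 3 ∧ ((q ^ (-3 / 2 : ℝ) : ℝ) : ℂ) = (h ^ 3)⁻¹ := by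
  have hp : 0 < q ^ (1 / 2 : ℝ) := Real.rpow_pos_of_pos hq _
  have e₃ : q ^ (3 / 2 : ℝ) = (q ^ (1 / 2 : ℝ)) ^ 3 := by
    rw [← Real.rpow_natCast, ← Real.rpow_mul hq.le]; norm_num
  refine ⟨((q ^ (1 / 2 : ℝ) : ℝ) : ℂ), by exact_mod_cast hp.ne', ?_, rfl, ?_, ?_, ?_⟩
  · norm_cast
    rw [← Real.rpow_natCast, ← Real.rpow_mul hq.le]; norm_num
  · rw [neg_div, Real.rpow_neg hq.le, Complex.ofReal_inv]
  · rw [e₃, Complex.ofReal_pow]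
  · rw [neg_div, Real.rpow_neg hq.le, e₃, Complex.ofReal_inv, Complex.ofReal_pow]

/-- `Kᵢ⁻¹ ▷` multiplies the generators by the inverse weights. -/
theorem wt_inv_spec (hq : 0 < q) (i : Fin 2) : (wt q i SGen.x₀)⁻¹ = 1 ∧
    (wt q i SGen.x₁)⁻¹ * (wt q i SGen.y₁)⁻¹ = 1 ∧
    (wt q i SGen.x₂)⁻¹ * (wt q i SGen.y₂)⁻¹ = 1 := by
  have h0 : (q : ℂ) ≠ 0 := by exact_mod_cast hq.ne'
  fin_cases i <;> simp [wt, h0]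

/-- The algebra map `a ↦ !![Kᵢ⁻¹ ▷ a, Eᵢ ▷ a; 0, Kᵢ ▷ a]`, which is multiplicative because
`Eᵢ ▷ (a b) = (Eᵢ ▷ a) (Kᵢ ▷ b) + (Kᵢ⁻¹ ▷ a) (Eᵢ ▷ b)`. -/
noncomputable def twE (hq : q ∈ Set.Ioo (0 : ℝ) 1) (i : Fin 2) :
    S4 q →ₐ[ℂ] Matrix (Fin 2) (Fin 2) (S4 q) :=
  lift q (fun x => tri ((wt q i x)⁻¹ • gen q x) (actE q i x) (wt q i x • gen q x)) <| by
    obtain ⟨h, h0, hh, e₁, e₂, e₃, e₄⟩ := rpow_half q hq.1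
    intro a b hab
    fin_cases i <;> cases hab <;>
      simp only [map_mul, map_smul, map_sub, map_add, map_one, FreeAlgebra.lift_ι_apply,
        tri_mul, tri_add, tri_sub, tri_smul, tri_one, Fin.zero_eta, Fin.mk_one, wt, actE,
        Complex.ofReal_mul, Complex.ofReal_add, Complex.ofReal_inv,
        qnum_two q hq, e₂, e₃] <;>
      refine tri_congr ?_ ?_ ?_ <;>
      simp only [mul_smul_comm, smul_mul_assoc, smul_smul, mul_zero, zero_mul, smul_zero, one_smul,
        inv_one, inv_inv, add_zero, zero_add, neg_smul, mul_neg, neg_mul, smul_neg,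
        r_x₀x₁, r_x₀x₂, r_x₁x₂, r_y₁x₀, r_y₂x₀, r_y₂y₁, r_y₁x₂,
        r_y₂x₁, r_comm₁', r_comm₂', r_sphere'] <;>
      match_scalars <;> (try simp only [hh]) <;> field_simp <;> ring

/-- The algebra map `a ↦ !![Kᵢ⁻¹ ▷ a, Fᵢ ▷ a; 0, Kᵢ ▷ a]`, which is multiplicative because
`Fᵢ ▷ (a b) = (Fᵢ ▷ a) (Kᵢ ▷ b) + (Kᵢ⁻¹ ▷ a) (Fᵢ ▷ b)`. -/
noncomputable def twF (hq : q ∈ Set.Ioo (0 : ℝ) 1) (i : Fin 2) :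
    S4 q →ₐ[ℂ] Matrix (Fin 2) (Fin 2) (S4 q) :=
  lift q (fun x => tri ((wt q i x)⁻¹ • gen q x) (actF q i x) (wt q i x • gen q x)) <| by
    obtain ⟨h, h0, hh, e₁, e₂, e₃, e₄⟩ := rpow_half q hq.1
    intro a b hab
    fin_cases i <;> cases hab <;>
      simp only [map_mul, map_smul, map_sub, map_add, map_one, FreeAlgebra.lift_ι_apply,
        tri_mul, tri_add, tri_sub, tri_smul, tri_one, Fin.zero_eta, Fin.mk_one, wt, actF,
        Complex.ofReal_mul, Complex.ofReal_add, Complex.ofReal_inv,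
        qnum_two q hq, e₁, e₄] <;>
      refine tri_congr ?_ ?_ ?_ <;>
      simp only [mul_smul_comm, smul_mul_assoc, smul_smul, mul_zero, zero_mul, smul_zero, one_smul,
        inv_one, inv_inv, add_zero, zero_add, neg_smul, mul_neg, neg_mul, smul_neg,
        r_x₀x₁, r_x₀x₂, r_x₁x₂, r_y₁x₀, r_y₂x₀, r_y₂y₁, r_y₁x₂,
        r_y₂x₁, r_comm₁', r_comm₂', r_sphere'] <;>
      match_scalars <;> (try simp only [hh]) <;> field_simp <;> ring

/-- The action `h ▷ a` of the generators `h` of `U_q(so(5))` on `A(S⁴_q)`. -/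
noncomputable def act (hq : q ∈ Set.Ioo (0 : ℝ) 1) : UGen → (S4 q →ₗ[ℂ] S4 q)
  | UGen.K i => (scale q (wt q i) (wt_spec q hq.1 i)).toLinearMap
  | UGen.Kinv i => (scale q (fun x => (wt q i x)⁻¹) (wt_inv_spec q hq.1 i)).toLinearMap
  | UGen.E i => Matrix.entryLinearMap ℂ (S4 q) 0 1 ∘ₗ (twE q hq i).toLinearMap
  | UGen.F i => Matrix.entryLinearMap ℂ (S4 q) 0 1 ∘ₗ (twF q hq i).toLinearMap

theorem induction {p : S4 q → Prop} (hc : ∀ c, p (algebraMap ℂ _ c)) (hg : ∀ x, p (gen q x))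
    (hm : ∀ a b, p a → p b → p (a * b)) (ha : ∀ a b, p a → p b → p (a + b)) (a : S4 q) : p a := by
  obtain ⟨b, rfl⟩ : ∃ b : FreeAlgebra ℂ SGen, (RingQuot.mkAlgHom ℂ (SRel q) b : S4 q) = a :=
    RingQuot.mkAlgHom_surjective ℂ (SRel q) a
  induction b using FreeAlgebra.induction with
  | grade0 c => rw [AlgHom.commutes]; exact hc c
  | grade1 x => exact hg x
  | mul a b h₁ h₂ => rw [map_mul]; exact hm _ _ h₁ h₂
  | add a b h₁ h₂ => rw [map_add]; exact ha _ _ h₁ h₂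

theorem twE_eq (hq : q ∈ Set.Ioo (0 : ℝ) 1) (i : Fin 2) (a : S4 q) : twE q hq i a =
    tri (act q hq (UGen.Kinv i) a) (act q hq (UGen.E i) a) (act q hq (UGen.K i) a) := by
  suffices h : ∃ d, twE q hq i a =
      tri (act q hq (UGen.Kinv i) a) d (act q hq (UGen.K i) a) by
    obtain ⟨d, h⟩ := h
    have hd : act q hq (UGen.E i) a = d := by
      change twE q hq i a 0 1 = d
      rw [h]; rfl
    rw [h, hd]
  induction a using induction with
  | hc c => exact ⟨0, by
      ext j k; fin_cases j <;> fin_cases k <;>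
        simp [tri, act, Matrix.algebraMap_matrix_apply]⟩
  | hg x => exact ⟨actE q i x, by simp [twE, lift_gen, act, scale]⟩
  | hm a b h₁ h₂ =>
    obtain ⟨d, h⟩ := h₁
    obtain ⟨d', h'⟩ := h₂
    exact ⟨_, by rw [map_mul, h, h', tri_mul]; simp only [act, AlgHom.toLinearMap_apply, map_mul]; rfl⟩
  | ha a b h₁ h₂ =>
    obtain ⟨d, h⟩ := h₁
    obtain ⟨d', h'⟩ := h₂
    exact ⟨_, by rw [map_add, h, h', tri_add, map_add, map_add]⟩

theorem twF_eq (hq : q ∈ Set.Ioo (0 : ℝ) 1) (i : Fin 2) (a : S4 q) : twF q hq i a =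
    tri (act q hq (UGen.Kinv i) a) (act q hq (UGen.F i) a) (act q hq (UGen.K i) a) := by
  suffices h : ∃ d, twF q hq i a =
      tri (act q hq (UGen.Kinv i) a) d (act q hq (UGen.K i) a) by
    obtain ⟨d, h⟩ := h
    have hd : act q hq (UGen.F i) a = d := by
      change twF q hq i a 0 1 = d
      rw [h]; rfl
    rw [h, hd]
  induction a using induction with
  | hc c => exact ⟨0, by
      ext j k; fin_cases j <;> fin_cases k <;>
        simp [tri, act, Matrix.algebraMap_matrix_apply]⟩
  | hg x => exact ⟨actF q i x, by simp [twF, lift_gen, act, scale]⟩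
  | hm a b h₁ h₂ =>
    obtain ⟨d, h⟩ := h₁
    obtain ⟨d', h'⟩ := h₂
    exact ⟨_, by rw [map_mul, h, h', tri_mul]; simp only [act, AlgHom.toLinearMap_apply, map_mul]; rfl⟩
  | ha a b h₁ h₂ =>
    obtain ⟨d, h⟩ := h₁
    obtain ⟨d', h'⟩ := h₂
    exact ⟨_, by rw [map_add, h, h', tri_add, map_add, map_add]⟩

/-- The values of the action on generators of `A(S⁴_q)`. -/
theorem act_gen (hq : q ∈ Set.Ioo (0 : ℝ) 1) (i : Fin 2) (x : SGen) :
    act q hq (UGen.K i) (gen q x) = wt q i x • gen q x ∧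
    act q hq (UGen.Kinv i) (gen q x) = (wt q i x)⁻¹ • gen q x ∧
    act q hq (UGen.E i) (gen q x) = actE q i x ∧
    act q hq (UGen.F i) (gen q x) = actF q i x := by
  refine ⟨lift_gen q _ _ x, lift_gen q _ _ x, ?_, ?_⟩
  · change twE q hq i (gen q x) 0 1 = _
    rw [twE, lift_gen]; rfl
  · change twF q hq i (gen q x) 0 1 = _
    rw [twF, lift_gen]; rfl

/-- `h ▷ (a b) = (h₁ ▷ a) (h₂ ▷ b)`. -/
theorem act_mul (hq : q ∈ Set.Ioo (0 : ℝ) 1) (h : UGen) (a b : S4 q) :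
    act q hq h (a * b) = (h.coprod.map fun p => act q hq p.1 a * act q hq p.2 b).sum := by
  have key : ∀ {u v w u' v' w' : S4 q}, tri u v w = tri u' v' w' → v = v' := fun h =>
    congrFun (congrFun h 0) 1
  cases h with
  | K i => simp [UGen.coprod, act]
  | Kinv i => simp [UGen.coprod, act]
  | E i =>
    have h := twE_eq q hq i (a * b)
    rw [map_mul, twE_eq, twE_eq, tri_mul] at h
    simp only [UGen.coprod, List.map_cons, List.map_nil, List.sum_cons, List.sum_nil, add_zero]
    rw [← key h, add_comm]
  | F i =>
    have h := twF_eq q hq i (a * b)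
    rw [map_mul, twF_eq, twF_eq, tri_mul] at h
    simp only [UGen.coprod, List.map_cons, List.map_nil, List.sum_cons, List.sum_nil, add_zero]
    rw [← key h, add_comm]

end S4

/-! ### The pre-Hilbert space `⨁ V_l`, `l ∈ ℕ + 1/2` -/

/-- Admissible labels, in doubled form: `L = 2l`, `M₁ = 2m₁`, `M₂ = 2m₂`, `J = 2j`, where
`l ∈ ℕ + 1/2`, `j = 1/2, 3/2, …, l`, `j - |m₁| ∈ ℕ`, `l + 1/2 - j - |m₂| ∈ ℕ`. -/
def Admissible (L M₁ M₂ J : ℤ) : Prop :=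
  Odd L ∧ Odd J ∧ 1 ≤ J ∧ J ≤ L ∧ (∃ n : ℕ, J - |M₁| = 2 * n) ∧
    ∃ n : ℕ, L + 1 - J - |M₂| = 2 * n

/-- Labels of the orthonormal basis `|l, m₁, m₂; j⟩`. -/
structure Idx : Type where
  L : ℤ
  M₁ : ℤ
  M₂ : ℤ
  J : ℤ
  adm : Admissible L M₁ M₂ J

/-- The space `⨁_{l ∈ ℕ + 1/2} V_l`, with its basis labelled by `Idx`. -/
abbrev Spin : Type := Idx →₀ ℂ

open Classical in
/-- The basis vector `|l, m₁, m₂; j⟩`, where vectors with inadmissible labels are zero. -/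
noncomputable def ket (L M₁ M₂ J : ℤ) : Spin :=
  if h : Admissible L M₁ M₂ J then Finsupp.single ⟨L, M₁, M₂, J, h⟩ 1 else 0

/-- The inner product, conjugate-linear in the first argument, for which the basis vectors are
orthonormal. -/
noncomputable def hip (v w : Spin) : ℂ := v.sum fun i c => starRingEnd ℂ c * w i

/-- The linear operator with given values on the basis vectors. -/
noncomputable def opOfKet (f : ℤ → ℤ → ℤ → ℤ → Spin) : Module.End ℂ Spin :=
  Finsupp.linearCombination ℂ fun i : Idx => f i.L i.M₁ i.M₂ i.J

/-- The Hilbert space completion of `Spin`. -/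
abbrev HSpin : Type := lp (fun _ : Idx => ℂ) 2

open Classical in
/-- The inclusion of `Spin` in its completion. -/
noncomputable def toH : Spin →ₗ[ℂ] HSpin :=
  Finsupp.linearCombination ℂ fun i : Idx => lp.single 2 i (1 : ℂ)

section Coefficients

variable (q : ℝ)

/-- The sign `ε = ±1/2` with `l + ε - j - m₂ ∈ 2ℕ`. -/
noncomputable def eps (L M₂ J : ℤ) : ℝ := if (L + 1 - J - M₂) % 4 = 0 then 1 / 2 else -1 / 2

/-! The coefficients `a_l(j, m₂)`, `b_l(j, m₂)`, `c_l(j, m₂)` for half-integer `l`. -/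

noncomputable def coefa (L M₂ J : ℤ) : ℝ :=
  let l : ℝ := L / 2; let m : ℝ := M₂ / 2; let j : ℝ := J / 2; let ε := eps L M₂ J;
  1 / qnum q 2 * √(qnum q (l - j - m + ε) * qnum q (l + j + m + 3 + ε) /
    (qnum q (2 * (j + |ε|) + 1) * qnum q (2 * (j - |ε|) + 3)))

noncomputable def coefb (L M₂ J : ℤ) : ℝ :=
  let l : ℝ := L / 2; let m : ℝ := M₂ / 2; let j : ℝ := J / 2; let ε := eps L M₂ J;
  2 * |ε| * (√(qnum q (l - ε * (2 * j + 1) - m + 1) * qnum q (l - ε * (2 * j + 1) + m + 2)) /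
    (qnum q (2 * j) * qnum q (2 * j + 2)))

noncomputable def coefc (L M₂ J : ℤ) : ℝ :=
  let l : ℝ := L / 2; let m : ℝ := M₂ / 2; let j : ℝ := J / 2; let ε := eps L M₂ J;
  -1 / qnum q 2 * √(qnum q (l - j + m + 2 - ε) * qnum q (l + j - m + 1 - ε) /
    (qnum q (2 * (j + |ε|) - 1) * qnum q (2 * (j - |ε|) + 1)))

/-! The coefficients which depend on `j, m₁`. -/

noncomputable def coefAp (J M₁ : ℤ) : ℝ :=
  let j : ℝ := J / 2; let m : ℝ := M₁ / 2;
  q ^ (m - 1) * (√(qnum q (j + m + 1) * qnum q (j - m + 1)) / qnum q (2 * j + 2))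

noncomputable def coefA0 (J M₁ : ℤ) : ℝ :=
  let j : ℝ := J / 2; let m : ℝ := M₁ / 2;
  q ^ (-2 : ℝ) * ((q ^ (j + m + 1) * qnum q 2 * qnum q (j - m) - qnum q (2 * j)) /
    (qnum q (2 * j) * qnum q (2 * j + 2)))

noncomputable def coefBp (J M₁ : ℤ) : ℝ :=
  let j : ℝ := J / 2; let m : ℝ := M₁ / 2;
  q ^ (-j + m - 1 / 2) * (√(qnum q (j + m + 1) * qnum q (j + m + 2)) / qnum q (2 * j + 2))

noncomputable def coefB0 (J M₁ : ℤ) : ℝ :=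
  let j : ℝ := J / 2; let m : ℝ := M₁ / 2;
  (1 + q ^ 2) * q ^ (m - 1 / 2) *
    (√(qnum q (j - m) * qnum q (j + m + 1)) / (qnum q (2 * j) * qnum q (2 * j + 2)))

noncomputable def coefBm (J M₁ : ℤ) : ℝ :=
  let j : ℝ := J / 2; let m : ℝ := M₁ / 2;
  -q ^ (j + m + 1 / 2) * (√(qnum q (j - m) * qnum q (j - m - 1)) / qnum q (2 * j))

/-! The coefficients which depend on `l, j, m₂`. -/

noncomputable def coefCp (L J M₂ : ℤ) : ℝ :=
  let l : ℝ := L / 2; let m : ℝ := M₂ / 2; let j : ℝ := J / 2; let ε := eps L M₂ J;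
  -q ^ (m - 1 - ε) * (√(qnum q (l + j + m + 3 + ε) * qnum q (l + j - m + 3 - ε)) / qnum q (2 * l + 4))

noncomputable def coefC0 (L J M₂ : ℤ) : ℝ :=
  let l : ℝ := L / 2; let m : ℝ := M₂ / 2; let j : ℝ := J / 2; let ε := eps L M₂ J;
  qnum q (4 * ε) * q ^ (2 * ε * l + m - 1 + 3 * ε) *
    (√(qnum q (l + 1 / 2 + j - 2 * ε * m + 2) * qnum q (l + 1 / 2 - j - 2 * ε * m)) /
      (qnum q (2 * l + 2) * qnum q (2 * l + 4)))

noncomputable def coefCm (L J M₂ : ℤ) : ℝ :=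
  let l : ℝ := L / 2; let m : ℝ := M₂ / 2; let j : ℝ := J / 2; let ε := eps L M₂ J;
  -q ^ (m - 1 + ε) * (√(qnum q (l - j + m - ε) * qnum q (l - j - m + ε)) / qnum q (2 * l + 2))

noncomputable def coefHp (L J M₂ : ℤ) : ℝ :=
  let l : ℝ := L / 2; let m : ℝ := M₂ / 2; let j : ℝ := J / 2; let ε := eps L M₂ J;
  q ^ (m - 1 + ε * (2 * j + 1)) *
    (√(qnum q (l + 2 * ε * j - m + 2 + ε) * qnum q (l - 2 * ε * j + m + 2 - ε)) / qnum q (2 * l + 4))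

noncomputable def coefH0 (L J M₂ : ℤ) : ℝ :=
  let l : ℝ := L / 2; let m : ℝ := M₂ / 2; let j : ℝ := J / 2; let ε := eps L M₂ J;
  (qnum q (l - ε * (2 * j + 1) - m + 1) * qnum q (l - ε * (2 * j + 1) + m + 2) -
      q ^ (-2 : ℝ) * (qnum q (l + ε * (2 * j + 1) - m + 2) * qnum q (l + ε * (2 * j + 1) + m + 1))) /
    (qnum q (2 * l + 2) * qnum q (2 * l + 4))

noncomputable def coefDp (L J M₂ : ℤ) : ℝ :=
  let l : ℝ := L / 2; let m : ℝ := M₂ / 2; let j : ℝ := J / 2; let ε := eps L M₂ J;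
  q ^ (-l + m - 3 / 2) * (√(qnum q (l + j + m + 3 + ε) * qnum q (l - j + m + 2 - ε)) / qnum q (2 * l + 4))

noncomputable def coefD0 (L J M₂ : ℤ) : ℝ :=
  let l : ℝ := L / 2; let m : ℝ := M₂ / 2; let j : ℝ := J / 2; let ε := eps L M₂ J;
  qnum q 2 * q ^ (m + 1 / 2) *
    (√(qnum q (l - 2 * ε * j - m + 1 - ε) * qnum q (l - 2 * ε * j + m + 2 - ε)) /
      (qnum q (2 * l + 2) * qnum q (2 * l + 4)))

noncomputable def coefDm (L J M₂ : ℤ) : ℝ :=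
  let l : ℝ := L / 2; let m : ℝ := M₂ / 2; let j : ℝ := J / 2; let ε := eps L M₂ J;
  -q ^ (l + m + 3 / 2) * (√(qnum q (l - j - m + ε) * qnum q (l + j - m + 1 - ε)) / qnum q (2 * l + 2))

/-! The operators `σ(K₁)`, `σ(K₂)`, `σ(E₁)`, `σ(E₂)` on `⨁ V_l`. -/

noncomputable def opK₁ : Module.End ℂ Spin := opOfKet fun L M₁ M₂ J =>
  q ^ ((M₁ : ℝ) / 2) • ket L M₁ M₂ J

noncomputable def opK₂ : Module.End ℂ Spin := opOfKet fun L M₁ M₂ J =>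
  q ^ ((M₂ : ℝ) / 2 - (M₁ : ℝ) / 2) • ket L M₁ M₂ J

noncomputable def opE₁ : Module.End ℂ Spin := opOfKet fun L M₁ M₂ J =>
  let j : ℝ := J / 2; let m : ℝ := M₁ / 2;
  √(qnum q (j - m) * qnum q (j + m + 1)) • ket L (M₁ + 2) M₂ J

noncomputable def opE₂ : Module.End ℂ Spin := opOfKet fun L M₁ M₂ J =>
  let j : ℝ := J / 2; let m : ℝ := M₁ / 2;
  (√(qnum q (j - m + 1) * qnum q (j - m + 2)) * coefa q L M₂ J) • ket L (M₁ - 2) (M₂ + 2) (J + 2) +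
  (√(qnum q (j + m) * qnum q (j - m + 1)) * coefb q L M₂ J) • ket L (M₁ - 2) (M₂ + 2) J +
  (√(qnum q (j + m) * qnum q (j + m - 1)) * coefc q L M₂ J) • ket L (M₁ - 2) (M₂ + 2) (J - 2)

/-! The operators `x₀`, `x₁`, `x₂` of the chiral representation of sign `s`. -/

noncomputable def opX₀ (s : ℤˣ) : Module.End ℂ Spin := opOfKet fun L M₁ M₂ J =>
  let s' : ℝ := ((s : ℤ) : ℝ);
  (coefAp q J M₁ * coefCp q L J M₂) • ket (L + 2) M₁ M₂ (J + 2) -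
  (s' * (coefAp q J M₁ * coefC0 q L J M₂)) • ket L M₁ M₂ (J + 2) +
  (coefAp q J M₁ * coefCm q L J M₂) • ket (L - 2) M₁ M₂ (J + 2) +
  (coefA0 q J M₁ * coefHp q L J M₂) • ket (L + 2) M₁ M₂ J +
  (s' * (coefA0 q J M₁ * coefH0 q L J M₂)) • ket L M₁ M₂ J +
  (coefA0 q J M₁ * coefHp q (L - 2) J M₂) • ket (L - 2) M₁ M₂ J +
  (coefAp q (J - 2) M₁ * coefCm q (L + 2) (J - 2) M₂) • ket (L + 2) M₁ M₂ (J - 2) -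
  (s' * (coefAp q (J - 2) M₁ * coefC0 q L (J - 2) M₂)) • ket L M₁ M₂ (J - 2) +
  (coefAp q (J - 2) M₁ * coefCp q (L - 2) (J - 2) M₂) • ket (L - 2) M₁ M₂ (J - 2)

noncomputable def opX₁ (s : ℤˣ) : Module.End ℂ Spin := opOfKet fun L M₁ M₂ J =>
  let s' : ℝ := ((s : ℤ) : ℝ);
  (coefBp q J M₁ * coefCp q L J M₂) • ket (L + 2) (M₁ + 2) M₂ (J + 2) -
  (s' * (coefBp q J M₁ * coefC0 q L J M₂)) • ket L (M₁ + 2) M₂ (J + 2) +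
  (coefBp q J M₁ * coefCm q L J M₂) • ket (L - 2) (M₁ + 2) M₂ (J + 2) +
  (coefB0 q J M₁ * coefHp q L J M₂) • ket (L + 2) (M₁ + 2) M₂ J +
  (s' * (coefB0 q J M₁ * coefH0 q L J M₂)) • ket L (M₁ + 2) M₂ J +
  (coefB0 q J M₁ * coefHp q (L - 2) J M₂) • ket (L - 2) (M₁ + 2) M₂ J +
  (coefBm q J M₁ * coefCm q (L + 2) (J - 2) M₂) • ket (L + 2) (M₁ + 2) M₂ (J - 2) -
  (s' * (coefBm q J M₁ * coefC0 q L (J - 2) M₂)) • ket L (M₁ + 2) M₂ (J - 2) +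
  (coefBm q J M₁ * coefCp q (L - 2) (J - 2) M₂) • ket (L - 2) (M₁ + 2) M₂ (J - 2)

noncomputable def opX₂ (s : ℤˣ) : Module.End ℂ Spin := opOfKet fun L M₁ M₂ J =>
  let s' : ℝ := ((s : ℤ) : ℝ);
  coefDp q L J M₂ • ket (L + 2) M₁ (M₂ + 2) J +
  (s' * coefD0 q L J M₂) • ket L M₁ (M₂ + 2) J +
  coefDm q L J M₂ • ket (L - 2) M₁ (M₂ + 2) J

end Coefficients

/-! ### Equivariant representations -/

section

variable (q : ℝ)

/-- A representation by operators on `⨁ V_l` is a `*`-representation if the operator of `a*` is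
adjoint to the operator of `a`. -/
def IsStarRep {P : Type} [Ring P] [Algebra ℂ P] [StarRing P]
    (ρ : P →ₐ[ℂ] Module.End ℂ Spin) : Prop :=
  ∀ (a : P) (v w : Spin), hip (ρ a v) w = hip v (ρ (star a) w)

/-- The representation `⨁ σ_l` of `U_q(so(5))`: the `*`-representation with the given operators
for `Kᵢ` and `Eᵢ`. -/
structure IsSpinRep (σ : Uq q →ₐ[ℂ] Module.End ℂ Spin) : Prop where
  K₁ : σ (Uq.gen q (UGen.K 0)) = opK₁ q
  K₂ : σ (Uq.gen q (UGen.K 1)) = opK₂ q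
  E₁ : σ (Uq.gen q (UGen.E 0)) = opE₁ q
  E₂ : σ (Uq.gen q (UGen.E 1)) = opE₂ q
  star : IsStarRep σ

variable {q} (hq : q ∈ Set.Ioo (0 : ℝ) 1)

/-- `ρ` is a `*`-representation of `A(S⁴_q)` which together with `σ` satisfies the relations
`h a = (h₁ ▷ a) h₂` of the crossed product `A(S⁴_q) ⋊ U_q(so(5))`. -/
structure IsEquivariant (σ : Uq q →ₐ[ℂ] Module.End ℂ Spin) (ρ : S4 q →ₐ[ℂ] Module.End ℂ Spin) :
    Prop where
  star : IsStarRep ρ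
  crossed : ∀ (h : UGen) (a : S4 q), σ (Uq.gen q h) * ρ a =
    (h.coprod.map fun p => ρ (S4.act q hq p.1 a) * σ (Uq.gen q p.2)).sum

/-- Unitary equivalence of two representations of the crossed product, both of which restrict
to `σ` on `U_q(so(5))`. -/
def UnitarilyEquivalent (σ : Uq q →ₐ[ℂ] Module.End ℂ Spin)
    (ρ ρ' : S4 q →ₐ[ℂ] Module.End ℂ Spin) : Prop :=
  ∃ W : Spin ≃ₗ[ℂ] Spin, (∀ v w, hip (W v) (W w) = hip v w) ∧
    (∀ h v, W (σ h v) = σ h (W v)) ∧ ∀ a v, W (ρ a v) = ρ' a (W v)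

/-- Equivalence of two representations of the algebra `A(S⁴_q)` alone: isomorphism of left
`A(S⁴_q)`-modules. -/
def ModuleEquivalent (ρ ρ' : S4 q →ₐ[ℂ] Module.End ℂ Spin) : Prop :=
  ∃ W : Spin ≃ₗ[ℂ] Spin, ∀ a v, W (ρ a v) = ρ' a (W v)

/-! ### The modules of chiral spinors -/

/-- The invariant faithful state of `A(S⁴_q)`. -/
structure IsHaarState (φ : S4 q →ₗ[ℂ] ℂ) : Prop where
  one : φ 1 = 1
  invariant : ∀ (h : UGen) (a : S4 q), φ (S4.act q hq h a) = h.counit * φ a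
  faithful : ∀ a : S4 q, a ≠ 0 → 0 < (φ (star a * a)).re ∧ (φ (star a * a)).im = 0

variable (q) in
/-- The `4 × 4` matrix representation of `U_q(so(5))` on generators (the spin representation). -/
noncomputable def spinMat : UGen → Matrix (Fin 4) (Fin 4) ℂ
  | UGen.K 0 => Matrix.diagonal fun i => ((![q ^ (1 / 2 : ℝ), q ^ (1 / 2 : ℝ), q ^ (-1 / 2 : ℝ),
      q ^ (-1 / 2 : ℝ)] i : ℝ) : ℂ)
  | UGen.K 1 => Matrix.diagonal fun i => ((![1, q⁻¹, q, 1] i : ℝ) : ℂ)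
  | UGen.Kinv 0 => Matrix.diagonal fun i => ((![q ^ (-1 / 2 : ℝ), q ^ (-1 / 2 : ℝ),
      q ^ (1 / 2 : ℝ), q ^ (1 / 2 : ℝ)] i : ℝ) : ℂ)
  | UGen.Kinv 1 => Matrix.diagonal fun i => ((![1, q, q⁻¹, 1] i : ℝ) : ℂ)
  | UGen.E 0 => !![0, 0, 1, 0; 0, 0, 0, 1; 0, 0, 0, 0; 0, 0, 0, 0]
  | UGen.E 1 => !![0, 0, 0, 0; 0, 0, 0, 0; 0, 1, 0, 0; 0, 0, 0, 0]
  | UGen.F 0 => !![0, 0, 0, 0; 0, 0, 0, 0; 1, 0, 0, 0; 0, 1, 0, 0]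
  | UGen.F 1 => !![0, 0, 0, 0; 0, 0, 1, 0; 0, 0, 0, 0; 0, 0, 0, 0]

/-- The action of the generators of `U_q(so(5))` on `A(S⁴_q)⁴`:
`(h · v)ᵢ = ∑ⱼ (h₁ ▷ vⱼ) σᵢⱼ(h₂)`. -/
noncomputable def tensorAct (h : UGen) (v : Fin 4 → S4 q) : Fin 4 → S4 q := fun i =>
  (h.coprod.map fun p => ∑ j, spinMat q p.2 i j • S4.act q hq p.1 (v j)).sum

variable (q) in
/-- The idempotent `e`. -/
noncomputable def idem : Matrix (Fin 4) (Fin 4) (S4 q) :=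
  let x₀ := S4.x₀ q; let x₁ := S4.x₁ q; let x₂ := S4.x₂ q; let y₁ := S4.y₁ q; let y₂ := S4.y₂ q
  let c : ℂ := q
  (1 / 2 : ℂ) •
    !![1 + x₀, c ^ 3 • x₂, -(c • x₁), 0;
       (c ^ 3)⁻¹ • y₂, 1 - c ^ 2 • x₀, 0, c ^ 3 • x₁;
       -(c⁻¹ • y₁), 0, 1 - c ^ 2 • x₀, c ^ 3 • x₂;
       0, c • y₁, (c ^ 3)⁻¹ • y₂, 1 + c ^ 4 • x₀]

/-- The left `A(S⁴_q)`-module `A(S⁴_q)⁴ p`. -/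
noncomputable def rowModule (p : Matrix (Fin 4) (Fin 4) (S4 q)) :
    Submodule (S4 q) (Fin 4 → S4 q) :=
  LinearMap.range (Matrix.vecMulLinear p)

/-- `A(S⁴_q)⁴ p` is stable under `U_q(so(5))`, and with the inner product
`⟨v, w⟩ = ∑ᵢ φ(vᵢ* wᵢ)` it is unitarily equivalent to the representation `(σ, ρ)` of the crossed
product. -/
def CorrespondsTo (σ : Uq q →ₐ[ℂ] Module.End ℂ Spin) (ρ : S4 q →ₐ[ℂ] Module.End ℂ Spin)
    (φ : S4 q →ₗ[ℂ] ℂ) (p : Matrix (Fin 4) (Fin 4) (S4 q)) : Prop :=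
  ∃ T : rowModule p ≃ₗ[ℂ] Spin,
    (∀ v w : rowModule p, hip (T v) (T w) =
      ∑ i, φ (star ((v : Fin 4 → S4 q) i) * (w : Fin 4 → S4 q) i)) ∧
    (∀ (a : S4 q) (v : rowModule p), T (a • v) = ρ a (T v)) ∧
    ∀ (h : UGen) (v : rowModule p), ∃ hv : tensorAct hq h v ∈ rowModule p,
      T ⟨tensorAct hq h v, hv⟩ = σ (Uq.gen q h) (T v)

end

set_option linter.unusedSimpArgs false

/-! ### Elementary properties of `q`-numbers -/

section QNumbers

variable {q : ℝ}

theorem qnum_zero : qnum q 0 = 0 := by simp [qnum]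

theorem qnum_neg (x : ℝ) : qnum q (-x) = -qnum q x := by
  rw [qnum, qnum, neg_neg, ← neg_div, neg_sub]

theorem sub_inv_neg (hq : q ∈ Set.Ioo (0 : ℝ) 1) : q - q⁻¹ < 0 :=
  sub_neg.2 (hq.2.trans ((one_lt_inv₀ hq.1).2 hq.2))

theorem qnum_pos (hq : q ∈ Set.Ioo (0 : ℝ) 1) {x : ℝ} (hx : 0 < x) : 0 < qnum q x := by
  refine div_pos_of_neg_of_neg ?_ (sub_inv_neg hq)
  exact sub_neg.2 (Real.rpow_lt_rpow_of_exponent_gt hq.1 hq.2 (by linarith))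

theorem qnum_nonneg (hq : q ∈ Set.Ioo (0 : ℝ) 1) {x : ℝ} (hx : 0 ≤ x) : 0 ≤ qnum q x := by
  rcases hx.eq_or_lt with rfl | h
  · rw [qnum_zero]
  · exact (qnum_pos hq h).le

theorem qnum_one (hq : q ∈ Set.Ioo (0 : ℝ) 1) : qnum q 1 = 1 := by
  rw [qnum, Real.rpow_neg hq.1.le, Real.rpow_one, div_self (sub_inv_neg hq).ne]

/-- The square root of `[x]`. -/
noncomputable def rt (q x : ℝ) : ℝ := √(qnum q x)

theorem rt_mul_self (hq : q ∈ Set.Ioo (0 : ℝ) 1) {x : ℝ} (hx : 0 ≤ x) :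
    rt q x * rt q x = qnum q x := Real.mul_self_sqrt (qnum_nonneg hq hx)

theorem rt_sq (hq : q ∈ Set.Ioo (0 : ℝ) 1) {x : ℝ} (hx : 0 ≤ x) :
    rt q x ^ 2 = qnum q x := Real.sq_sqrt (qnum_nonneg hq hx)

theorem sqrt_qnum_mul (hq : q ∈ Set.Ioo (0 : ℝ) 1) {x : ℝ} (hx : 0 ≤ x) (y : ℝ) :
    √(qnum q x * qnum q y) = rt q x * rt q y := Real.sqrt_mul (qnum_nonneg hq hx) _

end QNumbers

/-! ### The standard inner product on finitely supported functions -/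

section InnerProduct

variable {ι : Type}

/-- The standard inner product, conjugate-linear in the first argument. -/
noncomputable def fip (v w : ι →₀ ℂ) : ℂ := v.sum fun i c => starRingEnd ℂ c * w i

theorem fip_single_left (i : ι) (a : ℂ) (w : ι →₀ ℂ) :
    fip (Finsupp.single i a) w = starRingEnd ℂ a * w i := by
  simp [fip]

theorem fip_add_left (u v w : ι →₀ ℂ) : fip (u + v) w = fip u w + fip v w := by
  classical
  exact Finsupp.sum_add_index' (by simp) (by intros; simp [add_mul])

theorem fip_smul_left (c : ℂ) (v w : ι →₀ ℂ) : fip (c • v) w = starRingEnd ℂ c * fip v w := by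
  rw [fip, Finsupp.sum_smul_index' (by simp), fip, Finsupp.mul_sum]
  simp [mul_assoc]

theorem fip_add_right (u v w : ι →₀ ℂ) : fip u (v + w) = fip u v + fip u w := by
  simp [fip, mul_add, Finsupp.sum_add]

theorem fip_smul_right (c : ℂ) (v w : ι →₀ ℂ) : fip v (c • w) = c * fip v w := by
  rw [fip, fip, Finsupp.mul_sum]
  simp [mul_left_comm]

theorem fip_zero_left (w : ι →₀ ℂ) : fip 0 w = 0 := by simp [fip]

theorem fip_zero_right (w : ι →₀ ℂ) : fip w 0 = 0 := by simp [fip]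

theorem fip_sum_left {κ : Type} (s : Finset κ) (f : κ → ι →₀ ℂ) (w : ι →₀ ℂ) :
    fip (∑ i ∈ s, f i) w = ∑ i ∈ s, fip (f i) w := by
  classical
  induction s using Finset.induction_on with
  | empty => simp [fip_zero_left]
  | insert a s ha ih => rw [Finset.sum_insert ha, Finset.sum_insert ha, fip_add_left, ih]

theorem fip_sum_right {κ : Type} (s : Finset κ) (f : κ → ι →₀ ℂ) (w : ι →₀ ℂ) :
    fip w (∑ i ∈ s, f i) = ∑ i ∈ s, fip w (f i) := by
  classical
  induction s using Finset.induction_on with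
  | empty => simp [fip_zero_right]
  | insert a s ha ih => rw [Finset.sum_insert ha, Finset.sum_insert ha, fip_add_right, ih]

theorem fip_sub_right (u v w : ι →₀ ℂ) : fip u (v - w) = fip u v - fip u w := by
  rw [eq_sub_iff_add_eq, ← fip_add_right, sub_add_cancel]

theorem fip_conj (v w : ι →₀ ℂ) : starRingEnd ℂ (fip v w) = fip w v := by
  induction v using Finsupp.induction_linear with
  | zero => simp [fip_zero_left, fip_zero_right]
  | add f g hf hg => rw [fip_add_left, fip_add_right, map_add, hf, hg]
  | single i a =>
    induction w using Finsupp.induction_linear with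
    | zero => simp [fip_zero_left, fip_zero_right]
    | add f g hf hg => rw [fip_add_left, fip_add_right, map_add, hf, hg]
    | single j b =>
      classical
      rw [fip_single_left, fip_single_left, Finsupp.single_apply, Finsupp.single_apply]
      by_cases h : i = j
      · subst h; simp [mul_comm]
      · simp [h, Ne.symm h]

/-- The squared norm. -/
noncomputable def fnsq (v : ι →₀ ℂ) : ℝ := v.sum fun _ c => ‖c‖ ^ 2

theorem fip_self (v : ι →₀ ℂ) : fip v v = (fnsq v : ℂ) := by
  rw [fip, fnsq, Finsupp.sum, Finsupp.sum, Complex.ofReal_sum]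
  refine Finset.sum_congr rfl fun i _ => ?_
  rw [← Complex.normSq_eq_conj_mul_self, Complex.normSq_eq_norm_sq]

theorem fnsq_nonneg (v : ι →₀ ℂ) : 0 ≤ fnsq v := Finset.sum_nonneg fun _ _ => by positivity

theorem fnsq_eq_zero {v : ι →₀ ℂ} (h : fnsq v = 0) : v = 0 := by
  ext i
  by_contra hi
  have := (Finset.sum_eq_zero_iff_of_nonneg (fun i _ => by positivity)).1 h i
    (Finsupp.mem_support_iff.2 hi)
  exact hi (by simpa using this)

theorem fip_ext {v w : ι →₀ ℂ} (h : ∀ u, fip u v = fip u w) : v = w := by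
  ext i
  simpa [fip_single_left] using h (Finsupp.single i 1)

/-- `Y` is the formal adjoint of `X`. -/
def IsAdj (X Y : Module.End ℂ (ι →₀ ℂ)) : Prop := ∀ v w, fip (X v) w = fip v (Y w)

namespace IsAdj

variable {X Y X' Y' : Module.End ℂ (ι →₀ ℂ)}

theorem symm (h : IsAdj X Y) : IsAdj Y X := fun v w => by
  rw [← fip_conj, ← h, fip_conj]

theorem mul (h : IsAdj X Y) (h' : IsAdj X' Y') : IsAdj (X * X') (Y' * Y) := fun v w => by
  simp only [Module.End.mul_apply, h _ _, h' _ _]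

theorem add (h : IsAdj X Y) (h' : IsAdj X' Y') : IsAdj (X + X') (Y + Y') := fun v w => by
  simp only [LinearMap.add_apply, fip_add_left, fip_add_right, h _ _, h' _ _]

theorem smul (h : IsAdj X Y) (c : ℂ) : IsAdj (c • X) (starRingEnd ℂ c • Y) := fun v w => by
  simp only [LinearMap.smul_apply, fip_smul_left, fip_smul_right, h _ _]

theorem smul_real (h : IsAdj X Y) (c : ℝ) : IsAdj ((c : ℂ) • X) ((c : ℂ) • Y) := by
  simpa using h.smul (c : ℂ)

theorem sub (h : IsAdj X Y) (h' : IsAdj X' Y') : IsAdj (X - X') (Y - Y') := fun v w => by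
  rw [LinearMap.sub_apply, LinearMap.sub_apply, sub_eq_add_neg, fip_add_left,
    ← neg_one_smul ℂ (X' v), fip_smul_left, h, h', fip_sub_right, map_neg, map_one, neg_one_mul,
    sub_eq_add_neg]

theorem one : IsAdj (1 : Module.End ℂ (ι →₀ ℂ)) 1 := fun _ _ => rfl

theorem zero : IsAdj (0 : Module.End ℂ (ι →₀ ℂ)) 0 := fun v w => by
  simp [fip_zero_left, fip_zero_right]

theorem algebraMap (c : ℂ) : IsAdj (algebraMap ℂ (Module.End ℂ (ι →₀ ℂ)) c)
    (algebraMap ℂ _ (starRingEnd ℂ c)) := by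
  rw [Algebra.algebraMap_eq_smul_one, Algebra.algebraMap_eq_smul_one]
  exact one.smul c

theorem eq (h : IsAdj X Y) (h' : IsAdj X Y') : Y = Y' :=
  LinearMap.ext fun w => fip_ext fun u => by rw [← h, ← h']

end IsAdj

end InnerProduct

/-! ### Weighted shift operators on `⨁ V_l` -/

theorem ket_of_adm {L M₁ M₂ J : ℤ} (h : Admissible L M₁ M₂ J) :
    ket L M₁ M₂ J = Finsupp.single ⟨L, M₁, M₂, J, h⟩ 1 := by
  rw [ket, dif_pos h]

theorem ket_of_not_adm {L M₁ M₂ J : ℤ} (h : ¬Admissible L M₁ M₂ J) : ket L M₁ M₂ J = 0 := by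
  rw [ket, dif_neg h]

theorem ket_idx (i : Idx) : ket i.L i.M₁ i.M₂ i.J = Finsupp.single i 1 := ket_of_adm i.adm

theorem opOfKet_ket (f : ℤ → ℤ → ℤ → ℤ → Spin) {L M₁ M₂ J : ℤ} (h : Admissible L M₁ M₂ J) :
    opOfKet f (ket L M₁ M₂ J) = f L M₁ M₂ J := by
  rw [ket_of_adm h, opOfKet, Finsupp.linearCombination_single, one_smul]

theorem fip_ket_ket {L M₁ M₂ J L' M₁' M₂' J' : ℤ} : fip (ket L M₁ M₂ J) (ket L' M₁' M₂' J') =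
    open Classical in
    if Admissible L M₁ M₂ J ∧ L = L' ∧ M₁ = M₁' ∧ M₂ = M₂' ∧ J = J' then 1 else 0 := by
  classical
  by_cases h : Admissible L M₁ M₂ J
  · by_cases h' : Admissible L' M₁' M₂' J'
    · rw [ket_of_adm h, ket_of_adm h', fip_single_left, Finsupp.single_apply]
      simp only [map_one, one_mul, h, true_and, Idx.mk.injEq]
      congr 1
      exact propext ⟨fun ⟨a, b, c, d⟩ => ⟨a.symm, b.symm, c.symm, d.symm⟩,
        fun ⟨a, b, c, d⟩ => ⟨a.symm, b.symm, c.symm, d.symm⟩⟩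
    · rw [ket_of_not_adm h', fip_zero_right, if_neg]
      rintro ⟨_, rfl, rfl, rfl, rfl⟩
      exact h' h
  · rw [ket_of_not_adm h, fip_zero_left, if_neg fun H => h H.1]

theorem fip_ket_self {L M₁ M₂ J : ℤ} (h : Admissible L M₁ M₂ J) :
    fip (ket L M₁ M₂ J) (ket L M₁ M₂ J) = 1 := by
  rw [fip_ket_ket, if_pos ⟨h, rfl, rfl, rfl, rfl⟩]

theorem fip_ket_of_ne {L M₁ M₂ J L' M₁' M₂' J' : ℤ}
    (h : ¬(L = L' ∧ M₁ = M₁' ∧ M₂ = M₂' ∧ J = J')) :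
    fip (ket L M₁ M₂ J) (ket L' M₁' M₂' J') = 0 := by
  rw [fip_ket_ket, if_neg fun H => h H.2]

theorem end_ext {X Y : Module.End ℂ Spin}
    (h : ∀ L M₁ M₂ J, Admissible L M₁ M₂ J → X (ket L M₁ M₂ J) = Y (ket L M₁ M₂ J)) : X = Y := by
  refine Finsupp.lhom_ext' fun i => LinearMap.ext_ring ?_
  have := h i.L i.M₁ i.M₂ i.J i.adm
  rw [ket_idx] at this
  exact this

theorem isAdj_of_ket {X Y : Module.End ℂ Spin}
    (h : ∀ L M₁ M₂ J, Admissible L M₁ M₂ J → ∀ L' M₁' M₂' J', Admissible L' M₁' M₂' J' →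
      fip (X (ket L M₁ M₂ J)) (ket L' M₁' M₂' J') = fip (ket L M₁ M₂ J) (Y (ket L' M₁' M₂' J'))) :
    IsAdj X Y := by
  intro v w
  induction v using Finsupp.induction_linear with
  | zero => simp [fip_zero_left]
  | add f g hf hg => rw [map_add, fip_add_left, fip_add_left, hf, hg]
  | single i a =>
    induction w using Finsupp.induction_linear with
    | zero => simp [fip_zero_right]
    | add f g hf hg => rw [map_add, fip_add_right, fip_add_right, hf, hg]
    | single j b =>
      have := h _ _ _ _ i.adm _ _ _ _ j.adm
      rw [ket_idx, ket_idx] at this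
      have e : ∀ (k : Idx) (c : ℂ), Finsupp.single k c = c • Finsupp.single k 1 := by simp
      rw [e i, e j, map_smul, map_smul, fip_smul_left, fip_smul_left, fip_smul_right,
        fip_smul_right, this]

/-- The operator `|L, M₁, M₂; J⟩ ↦ f(L, M₁, M₂, J) |L + a, M₁ + b, M₂ + c; J + d⟩`. -/
noncomputable def sh (a b c d : ℤ) (f : ℤ → ℤ → ℤ → ℤ → ℝ) : Module.End ℂ Spin :=
  opOfKet fun L M₁ M₂ J => (f L M₁ M₂ J : ℂ) • ket (L + a) (M₁ + b) (M₂ + c) (J + d)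

theorem sh_ket (a b c d : ℤ) (f : ℤ → ℤ → ℤ → ℤ → ℝ) {L M₁ M₂ J : ℤ}
    (h : Admissible L M₁ M₂ J) : sh a b c d f (ket L M₁ M₂ J) =
      (f L M₁ M₂ J : ℂ) • ket (L + a) (M₁ + b) (M₂ + c) (J + d) := opOfKet_ket _ h

theorem sh_congr {a b c d : ℤ} {f g : ℤ → ℤ → ℤ → ℤ → ℝ}
    (h : ∀ L M₁ M₂ J, Admissible L M₁ M₂ J → Admissible (L + a) (M₁ + b) (M₂ + c) (J + d) →
      f L M₁ M₂ J = g L M₁ M₂ J) : sh a b c d f = sh a b c d g := by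
  refine end_ext fun L M₁ M₂ J hi => ?_
  rw [sh_ket _ _ _ _ _ hi, sh_ket _ _ _ _ _ hi]
  by_cases h' : Admissible (L + a) (M₁ + b) (M₂ + c) (J + d)
  · rw [h _ _ _ _ hi h']
  · rw [ket_of_not_adm h', smul_zero, smul_zero]

theorem sh_add (a b c d : ℤ) (f g : ℤ → ℤ → ℤ → ℤ → ℝ) : sh a b c d f + sh a b c d g =
    sh a b c d fun L M₁ M₂ J => f L M₁ M₂ J + g L M₁ M₂ J :=
  end_ext fun L M₁ M₂ J hi => by
    rw [LinearMap.add_apply, sh_ket _ _ _ _ _ hi, sh_ket _ _ _ _ _ hi, sh_ket _ _ _ _ _ hi,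
      ← add_smul, Complex.ofReal_add]

theorem sh_smul (a b c d : ℤ) (r : ℝ) (f : ℤ → ℤ → ℤ → ℤ → ℝ) : (r : ℂ) • sh a b c d f =
    sh a b c d fun L M₁ M₂ J => r * f L M₁ M₂ J :=
  end_ext fun L M₁ M₂ J hi => by
    rw [LinearMap.smul_apply, sh_ket _ _ _ _ _ hi, sh_ket _ _ _ _ _ hi, smul_smul,
      Complex.ofReal_mul]

theorem sh_sub (a b c d : ℤ) (f g : ℤ → ℤ → ℤ → ℤ → ℝ) : sh a b c d f - sh a b c d g =
    sh a b c d fun L M₁ M₂ J => f L M₁ M₂ J - g L M₁ M₂ J :=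
  end_ext fun L M₁ M₂ J hi => by
    rw [LinearMap.sub_apply, sh_ket _ _ _ _ _ hi, sh_ket _ _ _ _ _ hi, sh_ket _ _ _ _ _ hi,
      ← sub_smul, Complex.ofReal_sub]

theorem sh_mul {a b c d a' b' c' d' : ℤ} {f g : ℤ → ℤ → ℤ → ℤ → ℝ}
    (h : ∀ L M₁ M₂ J, Admissible L M₁ M₂ J →
      Admissible (L + a + a') (M₁ + b + b') (M₂ + c + c') (J + d + d') →
      ¬Admissible (L + a) (M₁ + b) (M₂ + c) (J + d) →
      f L M₁ M₂ J = 0 ∨ g (L + a) (M₁ + b) (M₂ + c) (J + d) = 0) :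
    sh a' b' c' d' g * sh a b c d f = sh (a + a') (b + b') (c + c') (d + d')
      fun L M₁ M₂ J => f L M₁ M₂ J * g (L + a) (M₁ + b) (M₂ + c) (J + d) := by
  refine end_ext fun L M₁ M₂ J hi => ?_
  rw [Module.End.mul_apply, sh_ket _ _ _ _ _ hi, sh_ket _ _ _ _ _ hi, map_smul]
  simp only [← add_assoc]
  by_cases h1 : Admissible (L + a) (M₁ + b) (M₂ + c) (J + d)
  · rw [sh_ket _ _ _ _ _ h1, smul_smul, Complex.ofReal_mul]
  · rw [ket_of_not_adm h1, map_zero, smul_zero]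
    by_cases h2 : Admissible (L + a + a') (M₁ + b + b') (M₂ + c + c') (J + d + d')
    · rw [mul_eq_zero.2 (h _ _ _ _ hi h2 h1), Complex.ofReal_zero, zero_smul]
    · rw [ket_of_not_adm h2, smul_zero]

theorem sh_isAdj (a b c d : ℤ) (f : ℤ → ℤ → ℤ → ℤ → ℝ) : IsAdj (sh a b c d f)
    (sh (-a) (-b) (-c) (-d) fun L M₁ M₂ J => f (L - a) (M₁ - b) (M₂ - c) (J - d)) := by
  refine isAdj_of_ket fun L M₁ M₂ J hi L' M₁' M₂' J' hj => ?_
  rw [sh_ket _ _ _ _ _ hi, sh_ket _ _ _ _ _ hj, fip_smul_left, fip_smul_right]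
  by_cases h : L' = L + a ∧ M₁' = M₁ + b ∧ M₂' = M₂ + c ∧ J' = J + d
  · obtain ⟨rfl, rfl, rfl, rfl⟩ := h
    simp only [add_neg_cancel_right, add_sub_cancel_right, Complex.conj_ofReal]
    rw [fip_ket_self hi, fip_ket_self hj]
  · rw [fip_ket_of_ne fun H => h ⟨H.1.symm, H.2.1.symm, H.2.2.1.symm, H.2.2.2.symm⟩,
      fip_ket_of_ne fun H => h ?_, mul_zero, mul_zero]
    obtain ⟨h1, h2, h3, h4⟩ := H
    refine ⟨?_, ?_, ?_, ?_⟩ <;> omega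

theorem opOfKet_add (f g : ℤ → ℤ → ℤ → ℤ → Spin) : (opOfKet fun L M₁ M₂ J =>
    f L M₁ M₂ J + g L M₁ M₂ J) = opOfKet f + opOfKet g :=
  end_ext fun L M₁ M₂ J hi => by
    rw [LinearMap.add_apply, opOfKet_ket _ hi, opOfKet_ket _ hi, opOfKet_ket _ hi]

theorem admissible_iff {L M₁ M₂ J : ℤ} : Admissible L M₁ M₂ J ↔
    L % 2 = 1 ∧ J % 2 = 1 ∧ 1 ≤ J ∧ J ≤ L ∧ (M₁ % 2 = 1 ∧ -J ≤ M₁ ∧ M₁ ≤ J) ∧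
      M₂ % 2 = 1 ∧ -(L + 1 - J) ≤ M₂ ∧ M₂ ≤ L + 1 - J := by
  have key : ∀ a b : ℤ, (∃ n : ℕ, a - |b| = 2 * n) ↔ ((a - b) % 2 = 0 ∧ -a ≤ b ∧ b ≤ a) := by
    intro a b
    constructor
    · rintro ⟨n, hn⟩
      rcases abs_cases b with ⟨h, _⟩ | ⟨h, _⟩ <;> omega
    · rintro ⟨h1, h2, h3⟩
      refine ⟨((a - |b|) / 2).toNat, ?_⟩
      rcases abs_cases b with ⟨h, _⟩ | ⟨h, _⟩ <;> omega
  unfold Admissible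
  rw [key, key, Int.odd_iff, Int.odd_iff]
  omega



section QNumberExpansions

variable {q : ℝ}

theorem qnum_eq (hq : q ∈ Set.Ioo (0 : ℝ) 1) (x : ℝ) :
    qnum q x = (q ^ x - (q ^ x)⁻¹) / (q - q⁻¹) := by
  rw [qnum, Real.rpow_neg hq.1.le]

theorem sqrt_qnum_div (hq : q ∈ Set.Ioo (0 : ℝ) 1) {x z w : ℝ} (hx : 0 ≤ x) (hz : 0 ≤ z)
    (hw : w = z) (y : ℝ) :
    √(qnum q x * qnum q y / (qnum q z * qnum q w)) = rt q x * rt q y / qnum q z := by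
  rw [hw, Real.sqrt_div' _ (mul_self_nonneg _), Real.sqrt_mul_self (qnum_nonneg hq hz),
    sqrt_qnum_mul hq hx]

theorem qnum_ne (hq : q ∈ Set.Ioo (0 : ℝ) 1) {x : ℝ} (hx : 0 < x) : qnum q x ≠ 0 :=
  (qnum_pos hq hx).ne'

theorem abs_half : |(1 / 2 : ℝ)| = 1 / 2 := abs_of_pos (by norm_num)

theorem abs_neg_half : |(-1 / 2 : ℝ)| = 1 / 2 := by rw [neg_div, abs_neg, abs_half]

theorem eps_pos {L M₂ J : ℤ} (h : (L + 1 - J - M₂) % 4 = 0) : eps L M₂ J = 1 / 2 := if_pos h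

theorem eps_neg {L M₂ J : ℤ} (h : (L + 1 - J - M₂) % 4 = 2) : eps L M₂ J = -1 / 2 :=
  if_neg (by omega)

theorem rpow_half_pow (hq : 0 < q) (n : ℕ) : q ^ ((n : ℝ) / 2) = (q ^ (1 / 2 : ℝ)) ^ n := by
  rw [← Real.rpow_natCast, ← Real.rpow_mul hq.le]; congr 1; ring

theorem rpow_int_mul (hq : 0 < q) (x : ℝ) (n : ℕ) : q ^ (x * n) = (q ^ x) ^ n := by
  rw [Real.rpow_mul hq.le, Real.rpow_natCast]

theorem rt_sq_eq (hq : q ∈ Set.Ioo (0 : ℝ) 1) {x : ℝ} (hx : 0 ≤ x) :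
    rt q x ^ 2 = (q ^ x - (q ^ x)⁻¹) / (q - q⁻¹) := by rw [rt_sq hq hx, qnum_eq hq]

theorem rpow_mul_two (hq : 0 < q) (x : ℝ) : q ^ (x * 2) = (q ^ x) ^ 2 := by
  exact_mod_cast rpow_int_mul hq x 2

theorem half_powers (hq : 0 < q) : ∃ h : ℝ, 0 < h ∧ q = h ^ 2 ∧ q ^ (1 / 2 : ℝ) = h ∧
    q ^ (3 / 2 : ℝ) = h ^ 3 ∧ q ^ (5 / 2 : ℝ) = h ^ 5 ∧ q ^ (7 / 2 : ℝ) = h ^ 7 ∧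
    q ^ (9 / 2 : ℝ) = h ^ 9 := by
  refine ⟨q ^ (1 / 2 : ℝ), Real.rpow_pos_of_pos hq _, ?_, rfl, ?_, ?_, ?_, ?_⟩
  · simpa using rpow_half_pow hq 2
  · exact_mod_cast rpow_half_pow hq 3
  · exact_mod_cast rpow_half_pow hq 5
  · exact_mod_cast rpow_half_pow hq 7
  · exact_mod_cast rpow_half_pow hq 9

theorem one_sub_sq_ne (hq : q ∈ Set.Ioo (0 : ℝ) 1) : q ^ 2 - 1 ≠ 0 := by
  have := hq.1; have := hq.2; nlinarith

theorem sub_inv_eq (hq : q ∈ Set.Ioo (0 : ℝ) 1) : q - q⁻¹ = (q ^ 2 - 1) / q := by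
  have := hq.1.ne'; field_simp

theorem qnum_two_eq (hq : q ∈ Set.Ioo (0 : ℝ) 1) : qnum q 2 = (q ^ 2 + 1) / q := by
  have := hq.1.ne'; rw [S4.qnum_two q hq]; field_simp

theorem qnum_neg_two_eq (hq : q ∈ Set.Ioo (0 : ℝ) 1) : qnum q (-2) = -((q ^ 2 + 1) / q) := by
  rw [qnum_neg, qnum_two_eq hq]

theorem rpow_mul_half (hq : 0 < q) (x : ℝ) : q ^ (x * (1 / 2)) = √(q ^ x) := by
  rw [Real.rpow_mul hq.le, Real.sqrt_eq_rpow]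

theorem rpow_mul_neg_half (hq : 0 < q) (x : ℝ) : q ^ (x * -(1 / 2)) = (√(q ^ x))⁻¹ := by
  rw [← rpow_mul_half hq, ← Real.rpow_neg hq.le]; congr 1; ring

theorem exists_sq {x : ℝ} (hx : 0 < x) : ∃ y, 0 < y ∧ x = y ^ 2 :=
  ⟨√x, Real.sqrt_pos.2 hx, (Real.sq_sqrt hx.le).symm⟩

end QNumberExpansions

theorem F₁_x₁ {q : ℝ} (hq : q ∈ Set.Ioo (0 : ℝ) 1) {s t : ℤ} (hs : 0 ≤ s) (ht : 0 ≤ t) (hst : 1 ≤ s + t) :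
    (coefBp q (s + t) (t - s) * √(qnum q (s + 1) * qnum q (t + 2)) =
      q ^ (1 / 2 : ℝ) * qnum q 2 * (q ^ (t / 2 - s / 2 : ℝ) * coefAp q (s + t) (t - s)) +
        q⁻¹ * (√(qnum q (s + 1) * qnum q t) * coefBp q (s + t) (t - s - 2))) ∧
    (coefB0 q (s + t) (t - s) * √(qnum q s * qnum q (t + 1)) =
      q ^ (1 / 2 : ℝ) * qnum q 2 * (q ^ (t / 2 - s / 2 : ℝ) * coefA0 q (s + t) (t - s)) +
        q⁻¹ * (√(qnum q (s + 1) * qnum q t) * coefB0 q (s + t) (t - s - 2))) ∧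
    (1 ≤ s → 1 ≤ t → coefBm q (s + t) (t - s) * √(qnum q (s - 1) * qnum q t) =
      q ^ (1 / 2 : ℝ) * qnum q 2 * (q ^ (t / 2 - s / 2 : ℝ) * coefAp q (s + t - 2) (t - s)) +
        q⁻¹ * (√(qnum q (s + 1) * qnum q t) * coefBm q (s + t) (t - s - 2))) := by
  refine ⟨?_, ?_, fun h1 h2 => ?_⟩
  all_goals
    rify at *
    simp (disch := omega) only [coefAp, coefA0, coefBp, coefB0, coefBm, coefa, coefb, coefc, eps_pos, eps_neg,
      Int.cast_add, Int.cast_sub, Int.cast_mul, Int.cast_one, Int.cast_ofNat, abs_half, abs_neg_half]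
    try simp (disch := grind) only [sqrt_qnum_div hq, sqrt_qnum_mul hq]
    ring_nf
    try simp (disch := grind) only [rt_sq_eq hq, sub_inv_eq hq, qnum_two_eq hq, qnum_neg_two_eq hq]
    have N0 := qnum_ne hq (show (0 : ℝ) < s + t by linarith)
    generalize hn0 : qnum q (s + t) = n0 at *
    have N1 := qnum_ne hq (show (0 : ℝ) < 2 + s + t by linarith)
    generalize hn1 : qnum q (2 + s + t) = n1 at *
    try simp only [qnum_eq hq, sub_inv_eq hq]
    have q0 := hq.1
    have q1 := one_sub_sq_ne hq
    obtain ⟨h, h0, hqh, f1, f3, f5, f7, f9⟩ := half_powers q0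
    simp only [Real.rpow_add q0, Real.rpow_sub q0, Real.rpow_neg q0.le, neg_div, f1, f3, f5, f7, f9,
      rpow_mul_two q0, Real.rpow_ofNat, Real.rpow_one, rpow_mul_half q0, rpow_mul_neg_half q0]
    clear f1 f3 f5 f7 f9
    have hXs := Real.rpow_pos_of_pos q0 (s : ℝ)
    generalize q ^ (s : ℝ) = Xs at *
    have hXt := Real.rpow_pos_of_pos q0 (t : ℝ)
    generalize q ^ (t : ℝ) = Xt at *
    obtain ⟨Ys, hYs, rfl⟩ := exists_sq hXs
    obtain ⟨Yt, hYt, rfl⟩ := exists_sq hXt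
    simp only [Real.sqrt_sq hYs.le, Real.sqrt_sq hYt.le]
    subst hqh
    have q2 : h ^ 4 - 1 ≠ 0 := by rwa [← pow_mul] at q1
    field_simp
    try ring

theorem E₂_F₂_zero {q : ℝ} (hq : q ∈ Set.Ioo (0 : ℝ) 1) {s t k p J : ℤ} (hs : 0 ≤ s) (ht : 0 ≤ t)
    (hk : 0 ≤ k) (hp : 0 ≤ p) (hJ : J = s + t) (hJ1 : 1 ≤ J) :
    (qnum q (t + 2) * qnum q (t + 1) * coefc q (J + 2 * k + 2 * p) (2 * p - 2 * k + 1 - 2) (J + 2) ^ 2 +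
        qnum q (t + 1) * qnum q s * coefb q (J + 2 * k + 2 * p) (2 * p - 2 * k + 1 - 2) J ^ 2 +
        qnum q (s - 1) * qnum q s * coefa q (J + 2 * k + 2 * p) (2 * p - 2 * k + 1 - 2) (J - 2) ^ 2 =
      qnum q (s + 1) * qnum q (s + 2) * coefa q (J + 2 * k + 2 * p) (2 * p - 2 * k + 1) J ^ 2 +
        qnum q t * qnum q (s + 1) * coefb q (J + 2 * k + 2 * p) (2 * p - 2 * k + 1) J ^ 2 +
        qnum q t * qnum q (t - 1) * coefc q (J + 2 * k + 2 * p) (2 * p - 2 * k + 1) J ^ 2 +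
        qnum q (((2 * p - 2 * k + 1 : ℤ) : ℝ) - t + s) / qnum q 2) ∧
    (qnum q (t + 2) * qnum q (t + 1) * coefc q (J + 2 * k + 2 * p) (2 * p - 2 * k - 1 - 2) (J + 2) ^ 2 +
        qnum q (t + 1) * qnum q s * coefb q (J + 2 * k + 2 * p) (2 * p - 2 * k - 1 - 2) J ^ 2 +
        qnum q (s - 1) * qnum q s * coefa q (J + 2 * k + 2 * p) (2 * p - 2 * k - 1 - 2) (J - 2) ^ 2 =
      qnum q (s + 1) * qnum q (s + 2) * coefa q (J + 2 * k + 2 * p) (2 * p - 2 * k - 1) J ^ 2 +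
        qnum q t * qnum q (s + 1) * coefb q (J + 2 * k + 2 * p) (2 * p - 2 * k - 1) J ^ 2 +
        qnum q t * qnum q (t - 1) * coefc q (J + 2 * k + 2 * p) (2 * p - 2 * k - 1) J ^ 2 +
        qnum q (((2 * p - 2 * k - 1 : ℤ) : ℝ) - t + s) / qnum q 2) := by
  subst hJ
  refine ⟨?_, ?_⟩
  all_goals
    rify at *
    simp (disch := omega) only [coefa, coefb, coefc, eps_pos, eps_neg, Int.cast_add, Int.cast_sub,
      Int.cast_mul, Int.cast_one, Int.cast_ofNat, abs_half, abs_neg_half]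
    simp (disch := grind) only [sqrt_qnum_div hq, sqrt_qnum_mul hq]
    ring_nf
    simp (disch := grind) only [rt_sq_eq hq, sub_inv_eq hq, qnum_two_eq hq]
    have N₀ := qnum_ne hq (show (0 : ℝ) < t + s by linarith)
    have N₁ := qnum_ne hq (show (0 : ℝ) < 2 + t + s by linarith)
    have q0 := hq.1
    have q1 := one_sub_sq_ne hq
    simp only [qnum_eq hq, sub_inv_eq hq, Real.rpow_add q0, Real.rpow_sub q0, Real.rpow_neg q0.le,
      rpow_mul_two q0, Real.rpow_ofNat, Real.rpow_one] at N₀ N₁ ⊢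
    have hS := Real.rpow_pos_of_pos q0 (s : ℝ)
    have hT := Real.rpow_pos_of_pos q0 (t : ℝ)
    have hU := Real.rpow_pos_of_pos q0 (k : ℝ)
    have hV := Real.rpow_pos_of_pos q0 (p : ℝ)
    generalize q ^ (s : ℝ) = S at *
    generalize q ^ (t : ℝ) = T at *
    generalize q ^ (k : ℝ) = U at *
    generalize q ^ (p : ℝ) = V at *
    have N₂ : T ^ 2 * S ^ 2 - 1 ≠ 0 := by
      rintro h; apply N₀
      rw [show T * S - (T * S)⁻¹ = (T ^ 2 * S ^ 2 - 1) / (T * S) by field_simp, h, zero_div, zero_div]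
    have N₃ : q ^ 4 * T ^ 2 * S ^ 2 - 1 ≠ 0 := by
      rintro h; apply N₁
      rw [show q ^ 2 * T * S - (q ^ 2 * T * S)⁻¹ = (q ^ 4 * T ^ 2 * S ^ 2 - 1) / (q ^ 2 * T * S) by
        field_simp, h, zero_div, zero_div]
    clear N₀ N₁
    field_simp
    ring

theorem E₂_F₂_one {q : ℝ} (hq : q ∈ Set.Ioo (0 : ℝ) 1) {s t k p J : ℤ} (hs : 0 ≤ s) (ht : 0 ≤ t)
    (hk : 0 ≤ k) (hp : 0 ≤ p) (hJ : J = s + t) (hJ1 : 1 ≤ J) :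
    (1 ≤ k → qnum q (t + 2) * (coefc q (J + 2 * k + 2 * p) (2 * p - 2 * k + 1 - 2) (J + 2) * coefb q (J + 2 * k + 2 * p) (2 * p - 2 * k + 1 - 2) (J + 2)) +
        qnum q s * (coefb q (J + 2 * k + 2 * p) (2 * p - 2 * k + 1 - 2) J * coefa q (J + 2 * k + 2 * p) (2 * p - 2 * k + 1 - 2) J) =
      qnum q (s + 2) * (coefa q (J + 2 * k + 2 * p) (2 * p - 2 * k + 1) J * coefb q (J + 2 * k + 2 * p) (2 * p - 2 * k + 1) (J + 2)) +
        qnum q t * (coefb q (J + 2 * k + 2 * p) (2 * p - 2 * k + 1) J * coefc q (J + 2 * k + 2 * p) (2 * p - 2 * k + 1) (J + 2))) ∧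
    (1 ≤ p → qnum q (t + 2) * (coefc q (J + 2 * k + 2 * p) (2 * p - 2 * k - 1 - 2) (J + 2) * coefb q (J + 2 * k + 2 * p) (2 * p - 2 * k - 1 - 2) (J + 2)) +
        qnum q s * (coefb q (J + 2 * k + 2 * p) (2 * p - 2 * k - 1 - 2) J * coefa q (J + 2 * k + 2 * p) (2 * p - 2 * k - 1 - 2) J) =
      qnum q (s + 2) * (coefa q (J + 2 * k + 2 * p) (2 * p - 2 * k - 1) J * coefb q (J + 2 * k + 2 * p) (2 * p - 2 * k - 1) (J + 2)) +
        qnum q t * (coefb q (J + 2 * k + 2 * p) (2 * p - 2 * k - 1) J * coefc q (J + 2 * k + 2 * p) (2 * p - 2 * k - 1) (J + 2))) := by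
  subst hJ
  refine ⟨fun h1 => ?_, fun h1 => ?_⟩
  all_goals
    rify at *
    simp (disch := omega) only [coefa, coefb, coefc, eps_pos, eps_neg, Int.cast_add, Int.cast_sub,
      Int.cast_mul, Int.cast_one, Int.cast_ofNat, abs_half, abs_neg_half]
    simp (disch := grind) only [sqrt_qnum_div hq, sqrt_qnum_mul hq]
    ring_nf
    simp (disch := grind) only [rt_sq_eq hq, sub_inv_eq hq, qnum_two_eq hq]
    have N₀ := qnum_ne hq (show (0 : ℝ) < t + s by linarith)
    have N₁ := qnum_ne hq (show (0 : ℝ) < 2 + t + s by linarith)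
    have N₂ := qnum_ne hq (show (0 : ℝ) < 4 + t + s by linarith)
    have q0 := hq.1
    have q1 := one_sub_sq_ne hq
    simp only [qnum_eq hq, sub_inv_eq hq, Real.rpow_add q0, Real.rpow_sub q0, Real.rpow_neg q0.le,
      rpow_mul_two q0, Real.rpow_ofNat, Real.rpow_one] at N₀ N₁ N₂ ⊢
    have hS := Real.rpow_pos_of_pos q0 (s : ℝ)
    have hT := Real.rpow_pos_of_pos q0 (t : ℝ)
    have hU := Real.rpow_pos_of_pos q0 (k : ℝ)
    have hV := Real.rpow_pos_of_pos q0 (p : ℝ)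
    generalize q ^ (s : ℝ) = S at *
    generalize q ^ (t : ℝ) = T at *
    generalize q ^ (k : ℝ) = U at *
    generalize q ^ (p : ℝ) = V at *
    have N₃ : T ^ 2 * S ^ 2 - 1 ≠ 0 := by
      rintro h; apply N₀
      rw [show T * S - (T * S)⁻¹ = (T ^ 2 * S ^ 2 - 1) / (T * S) by field_simp, h, zero_div, zero_div]
    have N₄ : q ^ 4 * T ^ 2 * S ^ 2 - 1 ≠ 0 := by
      rintro h; apply N₁
      rw [show q ^ 2 * T * S - (q ^ 2 * T * S)⁻¹ = (q ^ 4 * T ^ 2 * S ^ 2 - 1) / (q ^ 2 * T * S) by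
        field_simp, h, zero_div, zero_div]
    have N₅ : q ^ 8 * T ^ 2 * S ^ 2 - 1 ≠ 0 := by
      rintro h; apply N₂
      rw [show q ^ 4 * T * S - (q ^ 4 * T * S)⁻¹ = (q ^ 8 * T ^ 2 * S ^ 2 - 1) / (q ^ 4 * T * S) by
        field_simp, h, zero_div, zero_div]
    clear N₀ N₁ N₂
    field_simp
    ring

theorem E₂_F₂_two {q : ℝ} (hq : q ∈ Set.Ioo (0 : ℝ) 1) {k p J : ℤ} (hJ1 : 1 ≤ J)
    (hk : 1 ≤ k) (hp : 1 ≤ p) :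
    (coefc q (J + 2 * k + 2 * p) (2 * p - 2 * k + 1 - 2) (J + 2) * coefa q (J + 2 * k + 2 * p) (2 * p - 2 * k + 1 - 2) (J + 2) =
      coefa q (J + 2 * k + 2 * p) (2 * p - 2 * k + 1) J * coefc q (J + 2 * k + 2 * p) (2 * p - 2 * k + 1) (J + 4)) ∧
    (coefc q (J + 2 * k + 2 * p) (2 * p - 2 * k - 1 - 2) (J + 2) * coefa q (J + 2 * k + 2 * p) (2 * p - 2 * k - 1 - 2) (J + 2) =
      coefa q (J + 2 * k + 2 * p) (2 * p - 2 * k - 1) J * coefc q (J + 2 * k + 2 * p) (2 * p - 2 * k - 1) (J + 4)) := by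
  refine ⟨?_, ?_⟩
  all_goals
    rify at *
    simp (disch := omega) only [coefa, coefb, coefc, eps_pos, eps_neg, Int.cast_add, Int.cast_sub,
      Int.cast_mul, Int.cast_one, Int.cast_ofNat, abs_half, abs_neg_half]
    simp (disch := grind) only [sqrt_qnum_div hq, sqrt_qnum_mul hq]
    ring_nf

theorem coefa_wall {q : ℝ} {k p J : ℤ} : (k = 0 → coefa q (J + 2 * k + 2 * p) (2 * p - 2 * k + 1) J = 0) ∧
    (k = 0 → coefa q (J + 2 * k + 2 * p) (2 * p - 2 * k - 1) J = 0) := by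
  refine ⟨fun h => ?_, fun h => ?_⟩
  all_goals
    subst h
    simp (disch := omega) only [coefa, eps_pos, eps_neg, Int.cast_add, Int.cast_sub, Int.cast_mul,
      Int.cast_one, Int.cast_ofNat, Int.cast_zero, abs_half, abs_neg_half]
    ring_nf
    simp [qnum_zero]

theorem coefb_wall {q : ℝ} {k p J : ℤ} : (k = 0 → coefb q (J + 2 * k + 2 * p) (2 * p - 2 * k + 1) J = 0) := by
  intro h
  all_goals
    subst h
    simp (disch := omega) only [coefb, eps_pos, eps_neg, Int.cast_add, Int.cast_sub, Int.cast_mul,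
      Int.cast_one, Int.cast_ofNat, Int.cast_zero, abs_half, abs_neg_half]
    ring_nf
    simp [qnum_zero]

theorem coefb_wall_sub {q : ℝ} {k p J : ℤ} : (p = 0 → coefb q (J + 2 * k + 2 * p) (2 * p - 2 * k - 1 - 2) J = 0) := by
  intro h
  all_goals
    subst h
    simp (disch := omega) only [coefb, eps_pos, eps_neg, Int.cast_add, Int.cast_sub, Int.cast_mul,
      Int.cast_one, Int.cast_ofNat, Int.cast_zero, abs_half, abs_neg_half]
    ring_nf
    simp [qnum_zero]

theorem coefc_wall_sub {q : ℝ} {k p J : ℤ} : (p = 0 → coefc q (J + 2 * k + 2 * p) (2 * p - 2 * k + 1 - 2) (J + 2) = 0) ∧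
    (p = 0 → coefc q (J + 2 * k + 2 * p) (2 * p - 2 * k - 1 - 2) (J + 2) = 0) := by
  refine ⟨fun h => ?_, fun h => ?_⟩
  all_goals
    subst h
    simp (disch := omega) only [coefc, eps_pos, eps_neg, Int.cast_add, Int.cast_sub, Int.cast_mul,
      Int.cast_one, Int.cast_ofNat, Int.cast_zero, abs_half, abs_neg_half]
    ring_nf
    simp [qnum_zero]

theorem coefD0_wall {q : ℝ} {k p J : ℤ} : (k = 0 → coefD0 q (J + 2 * k + 2 * p) J (2 * p - 2 * k + 1) = 0) := by
  intro h
  all_goals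
    subst h
    simp (disch := omega) only [coefD0, eps_pos, eps_neg, Int.cast_add, Int.cast_sub, Int.cast_mul,
      Int.cast_one, Int.cast_ofNat, Int.cast_zero, abs_half, abs_neg_half]
    ring_nf
    simp [qnum_zero]

theorem coefDm_wall {q : ℝ} {k p J : ℤ} : (k = 0 → coefDm q (J + 2 * k + 2 * p) J (2 * p - 2 * k + 1) = 0) ∧
    (k = 0 → coefDm q (J + 2 * k + 2 * p) J (2 * p - 2 * k - 1) = 0) := by
  refine ⟨fun h => ?_, fun h => ?_⟩
  all_goals
    subst h
    simp (disch := omega) only [coefDm, eps_pos, eps_neg, Int.cast_add, Int.cast_sub, Int.cast_mul,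
      Int.cast_one, Int.cast_ofNat, Int.cast_zero, abs_half, abs_neg_half]
    ring_nf
    simp [qnum_zero]

theorem E₁_F₁_diag {q : ℝ} (hq : q ∈ Set.Ioo (0 : ℝ) 1) (s t : ℝ) :
    qnum q (s + 1) * qnum q t - qnum q s * qnum q (t + 1) = qnum q (t - s) := by
  have q0 := hq.1
  have q1 := one_sub_sq_ne hq
  simp only [qnum_eq hq, sub_inv_eq hq, Real.rpow_add q0, Real.rpow_sub q0, Real.rpow_one]
  have hS := Real.rpow_pos_of_pos q0 s
  have hT := Real.rpow_pos_of_pos q0 t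
  generalize q ^ s = S at *
  generalize q ^ t = T at *
  field_simp
  ring




set_option maxHeartbeats 4000000 in
theorem E₂_x₂ {q : ℝ} (hq : q ∈ Set.Ioo (0 : ℝ) 1) {J k p : ℤ}
    (hJ : J % 2 = 1) (hi : 1 ≤ J) (hk : 0 ≤ k) (hp : 0 ≤ p) :
    ((1 ≤ k → coefa q (J + 2 * k + 2 * p + 2) (2 * p - 2 * k + 1 + 2) J * coefDp q (J + 2 * k + 2 * p) J (2 * p - 2 * k + 1) =
      q⁻¹ * (coefDp q (J + 2 * k + 2 * p) (J + 2) (2 * p - 2 * k + 1 + 2) * coefa q (J + 2 * k + 2 * p) (2 * p - 2 * k + 1) J)) ∧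
    (coefa q (J + 2 * k + 2 * p + 2) (2 * p - 2 * k - 1 + 2) J * coefDp q (J + 2 * k + 2 * p) J (2 * p - 2 * k - 1) =
      q⁻¹ * (coefDp q (J + 2 * k + 2 * p) (J + 2) (2 * p - 2 * k - 1 + 2) * coefa q (J + 2 * k + 2 * p) (2 * p - 2 * k - 1) J))) ∧
    ((coefb q (J + 2 * k + 2 * p + 2) (2 * p - 2 * k + 1 + 2) J * coefDp q (J + 2 * k + 2 * p) J (2 * p - 2 * k + 1) =
      q⁻¹ * (coefDp q (J + 2 * k + 2 * p) J (2 * p - 2 * k + 1 + 2) * coefb q (J + 2 * k + 2 * p) (2 * p - 2 * k + 1) J)) ∧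
    (coefb q (J + 2 * k + 2 * p + 2) (2 * p - 2 * k - 1 + 2) J * coefDp q (J + 2 * k + 2 * p) J (2 * p - 2 * k - 1) =
      q⁻¹ * (coefDp q (J + 2 * k + 2 * p) J (2 * p - 2 * k - 1 + 2) * coefb q (J + 2 * k + 2 * p) (2 * p - 2 * k - 1) J))) ∧
    ((3 ≤ J → coefc q (J + 2 * k + 2 * p + 2) (2 * p - 2 * k + 1 + 2) J * coefDp q (J + 2 * k + 2 * p) J (2 * p - 2 * k + 1) =
      q⁻¹ * (coefDp q (J + 2 * k + 2 * p) (J - 2) (2 * p - 2 * k + 1 + 2) * coefc q (J + 2 * k + 2 * p) (2 * p - 2 * k + 1) J)) ∧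
    (3 ≤ J → coefc q (J + 2 * k + 2 * p + 2) (2 * p - 2 * k - 1 + 2) J * coefDp q (J + 2 * k + 2 * p) J (2 * p - 2 * k - 1) =
      q⁻¹ * (coefDp q (J + 2 * k + 2 * p) (J - 2) (2 * p - 2 * k - 1 + 2) * coefc q (J + 2 * k + 2 * p) (2 * p - 2 * k - 1) J))) ∧
    ((1 ≤ k → coefa q (J + 2 * k + 2 * p) (2 * p - 2 * k + 1 + 2) J * coefD0 q (J + 2 * k + 2 * p) J (2 * p - 2 * k + 1) =
      q⁻¹ * (coefD0 q (J + 2 * k + 2 * p) (J + 2) (2 * p - 2 * k + 1 + 2) * coefa q (J + 2 * k + 2 * p) (2 * p - 2 * k + 1) J)) ∧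
    (1 ≤ k → coefa q (J + 2 * k + 2 * p) (2 * p - 2 * k - 1 + 2) J * coefD0 q (J + 2 * k + 2 * p) J (2 * p - 2 * k - 1) =
      q⁻¹ * (coefD0 q (J + 2 * k + 2 * p) (J + 2) (2 * p - 2 * k - 1 + 2) * coefa q (J + 2 * k + 2 * p) (2 * p - 2 * k - 1) J))) ∧
    ((1 ≤ k → coefb q (J + 2 * k + 2 * p) (2 * p - 2 * k + 1 + 2) J * coefD0 q (J + 2 * k + 2 * p) J (2 * p - 2 * k + 1) =
      q⁻¹ * (coefD0 q (J + 2 * k + 2 * p) J (2 * p - 2 * k + 1 + 2) * coefb q (J + 2 * k + 2 * p) (2 * p - 2 * k + 1) J)) ∧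
    (coefb q (J + 2 * k + 2 * p) (2 * p - 2 * k - 1 + 2) J * coefD0 q (J + 2 * k + 2 * p) J (2 * p - 2 * k - 1) =
      q⁻¹ * (coefD0 q (J + 2 * k + 2 * p) J (2 * p - 2 * k - 1 + 2) * coefb q (J + 2 * k + 2 * p) (2 * p - 2 * k - 1) J))) ∧
    ((3 ≤ J → coefc q (J + 2 * k + 2 * p) (2 * p - 2 * k + 1 + 2) J * coefD0 q (J + 2 * k + 2 * p) J (2 * p - 2 * k + 1) =
      q⁻¹ * (coefD0 q (J + 2 * k + 2 * p) (J - 2) (2 * p - 2 * k + 1 + 2) * coefc q (J + 2 * k + 2 * p) (2 * p - 2 * k + 1) J)) ∧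
    (3 ≤ J → coefc q (J + 2 * k + 2 * p) (2 * p - 2 * k - 1 + 2) J * coefD0 q (J + 2 * k + 2 * p) J (2 * p - 2 * k - 1) =
      q⁻¹ * (coefD0 q (J + 2 * k + 2 * p) (J - 2) (2 * p - 2 * k - 1 + 2) * coefc q (J + 2 * k + 2 * p) (2 * p - 2 * k - 1) J))) ∧
    ((2 ≤ k → coefa q (J + 2 * k + 2 * p - 2) (2 * p - 2 * k + 1 + 2) J * coefDm q (J + 2 * k + 2 * p) J (2 * p - 2 * k + 1) =
      q⁻¹ * (coefDm q (J + 2 * k + 2 * p) (J + 2) (2 * p - 2 * k + 1 + 2) * coefa q (J + 2 * k + 2 * p) (2 * p - 2 * k + 1) J)) ∧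
    (2 ≤ k → coefa q (J + 2 * k + 2 * p - 2) (2 * p - 2 * k - 1 + 2) J * coefDm q (J + 2 * k + 2 * p) J (2 * p - 2 * k - 1) =
      q⁻¹ * (coefDm q (J + 2 * k + 2 * p) (J + 2) (2 * p - 2 * k - 1 + 2) * coefa q (J + 2 * k + 2 * p) (2 * p - 2 * k - 1) J))) ∧
    ((1 ≤ k → coefb q (J + 2 * k + 2 * p - 2) (2 * p - 2 * k + 1 + 2) J * coefDm q (J + 2 * k + 2 * p) J (2 * p - 2 * k + 1) =
      q⁻¹ * (coefDm q (J + 2 * k + 2 * p) J (2 * p - 2 * k + 1 + 2) * coefb q (J + 2 * k + 2 * p) (2 * p - 2 * k + 1) J)) ∧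
    (1 ≤ k → coefb q (J + 2 * k + 2 * p - 2) (2 * p - 2 * k - 1 + 2) J * coefDm q (J + 2 * k + 2 * p) J (2 * p - 2 * k - 1) =
      q⁻¹ * (coefDm q (J + 2 * k + 2 * p) J (2 * p - 2 * k - 1 + 2) * coefb q (J + 2 * k + 2 * p) (2 * p - 2 * k - 1) J))) ∧
    ((1 ≤ k → 3 ≤ J → coefc q (J + 2 * k + 2 * p - 2) (2 * p - 2 * k + 1 + 2) J * coefDm q (J + 2 * k + 2 * p) J (2 * p - 2 * k + 1) =
      q⁻¹ * (coefDm q (J + 2 * k + 2 * p) (J - 2) (2 * p - 2 * k + 1 + 2) * coefc q (J + 2 * k + 2 * p) (2 * p - 2 * k + 1) J)) ∧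
    (3 ≤ J → coefc q (J + 2 * k + 2 * p - 2) (2 * p - 2 * k - 1 + 2) J * coefDm q (J + 2 * k + 2 * p) J (2 * p - 2 * k - 1) =
      q⁻¹ * (coefDm q (J + 2 * k + 2 * p) (J - 2) (2 * p - 2 * k - 1 + 2) * coefc q (J + 2 * k + 2 * p) (2 * p - 2 * k - 1) J))) := by
  obtain ⟨i, rfl⟩ : ∃ i, J = 2 * i + 1 := ⟨J / 2, by omega⟩
  refine ⟨⟨?_, ?_⟩, ⟨?_, ?_⟩, ⟨?_, ?_⟩, ⟨?_, ?_⟩, ⟨?_, ?_⟩, ⟨?_, ?_⟩, ⟨?_, ?_⟩, ⟨?_, ?_⟩, ⟨?_, ?_⟩⟩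
  all_goals
    intros
    rify at *
    simp (disch := omega) only [coefDp, coefD0, coefDm, coefa, coefb, coefc, coefCp, coefC0, coefCm,
      coefHp, coefH0, eps_pos, eps_neg, Int.cast_add, Int.cast_sub, Int.cast_mul, Int.cast_one,
      Int.cast_ofNat, abs_half, abs_neg_half]
    simp (disch := grind) only [sqrt_qnum_div hq, sqrt_qnum_mul hq]
    ring_nf
    try simp (disch := grind) only [rt_sq_eq hq, sub_inv_eq hq, qnum_two_eq hq, qnum_neg_two_eq hq]
    have N₁ := qnum_ne hq (show (0 : ℝ) < 1 + i * 2 by linarith)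
    have N₂ := qnum_ne hq (show (0 : ℝ) < 3 + i * 2 by linarith)
    have N₃ := qnum_ne hq (show (0 : ℝ) < 3 + i * 2 + k * 2 + p * 2 by linarith)
    have N₄ := qnum_ne hq (show (0 : ℝ) < 5 + i * 2 + k * 2 + p * 2 by linarith)
    generalize qnum q (1 + i * 2) = n₁ at *
    generalize qnum q (3 + i * 2) = n₂ at *
    generalize qnum q (3 + i * 2 + k * 2 + p * 2) = n₃ at *
    generalize qnum q (5 + i * 2 + k * 2 + p * 2) = n₄ at *
    try simp only [qnum_eq hq, sub_inv_eq hq]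
    have q0 := hq.1
    have q1 := one_sub_sq_ne hq
    obtain ⟨h, h0, hqh, f1, f3, f5, f7, f9⟩ := half_powers q0
    simp only [Real.rpow_add q0, Real.rpow_sub q0, Real.rpow_neg q0.le, neg_div, f1, f3, f5, f7, f9,
      rpow_mul_two q0, Real.rpow_ofNat, Real.rpow_one]
    have hX := Real.rpow_pos_of_pos q0 (i : ℝ)
    have hU := Real.rpow_pos_of_pos q0 (k : ℝ)
    have hV := Real.rpow_pos_of_pos q0 (p : ℝ)
    clear f1 f3 f5 f7 f9
    generalize q ^ (i : ℝ) = X at *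
    generalize q ^ (k : ℝ) = U at *
    generalize q ^ (p : ℝ) = V at *
    subst hqh
    have q2 : h ^ 4 - 1 ≠ 0 := by rwa [← pow_mul] at q1
    field_simp
    try ring

set_option maxHeartbeats 4000000 in
theorem F₂_x₂ {q : ℝ} (hq : q ∈ Set.Ioo (0 : ℝ) 1) {J k p : ℤ}
    (hJ : J % 2 = 1) (hi : 1 ≤ J) (hk : 0 ≤ k) (hp : 0 ≤ p) :
    ((coefc q (J + 2 * k + 2 * p + 2) (2 * p - 2 * k + 1) (J + 2) * coefDp q (J + 2 * k + 2 * p) J (2 * p - 2 * k + 1) =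
      q ^ (-(J / 2 : ℝ) - 1 / 2 + ((2 * p - 2 * k + 1 : ℤ) : ℝ) / 2) / qnum q (2 * (J / 2) + 2) * (coefCp q (J + 2 * k + 2 * p) J (2 * p - 2 * k + 1)) +
      q⁻¹ * (coefDp q (J + 2 * k + 2 * p) (J + 2) (2 * p - 2 * k + 1 - 2) * coefc q (J + 2 * k + 2 * p) (2 * p - 2 * k + 1 - 2) (J + 2))) ∧
    (coefc q (J + 2 * k + 2 * p + 2) (2 * p - 2 * k - 1) (J + 2) * coefDp q (J + 2 * k + 2 * p) J (2 * p - 2 * k - 1) =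
      q ^ (-(J / 2 : ℝ) - 1 / 2 + ((2 * p - 2 * k - 1 : ℤ) : ℝ) / 2) / qnum q (2 * (J / 2) + 2) * (coefCp q (J + 2 * k + 2 * p) J (2 * p - 2 * k - 1)) +
      q⁻¹ * (coefDp q (J + 2 * k + 2 * p) (J + 2) (2 * p - 2 * k - 1 - 2) * coefc q (J + 2 * k + 2 * p) (2 * p - 2 * k - 1 - 2) (J + 2)))) ∧
    ((coefb q (J + 2 * k + 2 * p + 2) (2 * p - 2 * k + 1) J * coefDp q (J + 2 * k + 2 * p) J (2 * p - 2 * k + 1) =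
      (1 + q ^ 2) * q ^ (-1 / 2 + ((2 * p - 2 * k + 1 : ℤ) : ℝ) / 2) / (qnum q (2 * (J / 2)) * qnum q (2 * (J / 2) + 2)) * (coefHp q (J + 2 * k + 2 * p) J (2 * p - 2 * k + 1)) +
      q⁻¹ * (coefDp q (J + 2 * k + 2 * p) J (2 * p - 2 * k + 1 - 2) * coefb q (J + 2 * k + 2 * p) (2 * p - 2 * k + 1 - 2) J)) ∧
    (coefb q (J + 2 * k + 2 * p + 2) (2 * p - 2 * k - 1) J * coefDp q (J + 2 * k + 2 * p) J (2 * p - 2 * k - 1) =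
      (1 + q ^ 2) * q ^ (-1 / 2 + ((2 * p - 2 * k - 1 : ℤ) : ℝ) / 2) / (qnum q (2 * (J / 2)) * qnum q (2 * (J / 2) + 2)) * (coefHp q (J + 2 * k + 2 * p) J (2 * p - 2 * k - 1)) +
      q⁻¹ * (coefDp q (J + 2 * k + 2 * p) J (2 * p - 2 * k - 1 - 2) * coefb q (J + 2 * k + 2 * p) (2 * p - 2 * k - 1 - 2) J))) ∧
    ((3 ≤ J → coefa q (J + 2 * k + 2 * p + 2) (2 * p - 2 * k + 1) (J - 2) * coefDp q (J + 2 * k + 2 * p) J (2 * p - 2 * k + 1) =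
      -q ^ ((J / 2 : ℝ) + 1 / 2 + ((2 * p - 2 * k + 1 : ℤ) : ℝ) / 2) / qnum q (2 * (J / 2)) * (coefCm q (J + 2 * k + 2 * p + 2) (J - 2) (2 * p - 2 * k + 1)) +
      q⁻¹ * (coefDp q (J + 2 * k + 2 * p) (J - 2) (2 * p - 2 * k + 1 - 2) * coefa q (J + 2 * k + 2 * p) (2 * p - 2 * k + 1 - 2) (J - 2))) ∧
    (3 ≤ J → coefa q (J + 2 * k + 2 * p + 2) (2 * p - 2 * k - 1) (J - 2) * coefDp q (J + 2 * k + 2 * p) J (2 * p - 2 * k - 1) =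
      -q ^ ((J / 2 : ℝ) + 1 / 2 + ((2 * p - 2 * k - 1 : ℤ) : ℝ) / 2) / qnum q (2 * (J / 2)) * (coefCm q (J + 2 * k + 2 * p + 2) (J - 2) (2 * p - 2 * k - 1)) +
      q⁻¹ * (coefDp q (J + 2 * k + 2 * p) (J - 2) (2 * p - 2 * k - 1 - 2) * coefa q (J + 2 * k + 2 * p) (2 * p - 2 * k - 1 - 2) (J - 2)))) ∧
    ((1 ≤ k → coefc q (J + 2 * k + 2 * p) (2 * p - 2 * k + 1) (J + 2) * coefD0 q (J + 2 * k + 2 * p) J (2 * p - 2 * k + 1) =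
      q ^ (-(J / 2 : ℝ) - 1 / 2 + ((2 * p - 2 * k + 1 : ℤ) : ℝ) / 2) / qnum q (2 * (J / 2) + 2) * (-coefC0 q (J + 2 * k + 2 * p) J (2 * p - 2 * k + 1)) +
      q⁻¹ * (coefD0 q (J + 2 * k + 2 * p) (J + 2) (2 * p - 2 * k + 1 - 2) * coefc q (J + 2 * k + 2 * p) (2 * p - 2 * k + 1 - 2) (J + 2))) ∧
    (1 ≤ p → coefc q (J + 2 * k + 2 * p) (2 * p - 2 * k - 1) (J + 2) * coefD0 q (J + 2 * k + 2 * p) J (2 * p - 2 * k - 1) =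
      q ^ (-(J / 2 : ℝ) - 1 / 2 + ((2 * p - 2 * k - 1 : ℤ) : ℝ) / 2) / qnum q (2 * (J / 2) + 2) * (-coefC0 q (J + 2 * k + 2 * p) J (2 * p - 2 * k - 1)) +
      q⁻¹ * (coefD0 q (J + 2 * k + 2 * p) (J + 2) (2 * p - 2 * k - 1 - 2) * coefc q (J + 2 * k + 2 * p) (2 * p - 2 * k - 1 - 2) (J + 2)))) ∧
    ((coefb q (J + 2 * k + 2 * p) (2 * p - 2 * k + 1) J * coefD0 q (J + 2 * k + 2 * p) J (2 * p - 2 * k + 1) =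
      (1 + q ^ 2) * q ^ (-1 / 2 + ((2 * p - 2 * k + 1 : ℤ) : ℝ) / 2) / (qnum q (2 * (J / 2)) * qnum q (2 * (J / 2) + 2)) * (coefH0 q (J + 2 * k + 2 * p) J (2 * p - 2 * k + 1)) +
      q⁻¹ * (coefD0 q (J + 2 * k + 2 * p) J (2 * p - 2 * k + 1 - 2) * coefb q (J + 2 * k + 2 * p) (2 * p - 2 * k + 1 - 2) J)) ∧
    (coefb q (J + 2 * k + 2 * p) (2 * p - 2 * k - 1) J * coefD0 q (J + 2 * k + 2 * p) J (2 * p - 2 * k - 1) =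
      (1 + q ^ 2) * q ^ (-1 / 2 + ((2 * p - 2 * k - 1 : ℤ) : ℝ) / 2) / (qnum q (2 * (J / 2)) * qnum q (2 * (J / 2) + 2)) * (coefH0 q (J + 2 * k + 2 * p) J (2 * p - 2 * k - 1)) +
      q⁻¹ * (coefD0 q (J + 2 * k + 2 * p) J (2 * p - 2 * k - 1 - 2) * coefb q (J + 2 * k + 2 * p) (2 * p - 2 * k - 1 - 2) J))) ∧
    ((3 ≤ J → coefa q (J + 2 * k + 2 * p) (2 * p - 2 * k + 1) (J - 2) * coefD0 q (J + 2 * k + 2 * p) J (2 * p - 2 * k + 1) =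
      -q ^ ((J / 2 : ℝ) + 1 / 2 + ((2 * p - 2 * k + 1 : ℤ) : ℝ) / 2) / qnum q (2 * (J / 2)) * (-coefC0 q (J + 2 * k + 2 * p) (J - 2) (2 * p - 2 * k + 1)) +
      q⁻¹ * (coefD0 q (J + 2 * k + 2 * p) (J - 2) (2 * p - 2 * k + 1 - 2) * coefa q (J + 2 * k + 2 * p) (2 * p - 2 * k + 1 - 2) (J - 2))) ∧
    (3 ≤ J → coefa q (J + 2 * k + 2 * p) (2 * p - 2 * k - 1) (J - 2) * coefD0 q (J + 2 * k + 2 * p) J (2 * p - 2 * k - 1) =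
      -q ^ ((J / 2 : ℝ) + 1 / 2 + ((2 * p - 2 * k - 1 : ℤ) : ℝ) / 2) / qnum q (2 * (J / 2)) * (-coefC0 q (J + 2 * k + 2 * p) (J - 2) (2 * p - 2 * k - 1)) +
      q⁻¹ * (coefD0 q (J + 2 * k + 2 * p) (J - 2) (2 * p - 2 * k - 1 - 2) * coefa q (J + 2 * k + 2 * p) (2 * p - 2 * k - 1 - 2) (J - 2)))) ∧
    ((1 ≤ k → 1 ≤ p → coefc q (J + 2 * k + 2 * p - 2) (2 * p - 2 * k + 1) (J + 2) * coefDm q (J + 2 * k + 2 * p) J (2 * p - 2 * k + 1) =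
      q ^ (-(J / 2 : ℝ) - 1 / 2 + ((2 * p - 2 * k + 1 : ℤ) : ℝ) / 2) / qnum q (2 * (J / 2) + 2) * (coefCm q (J + 2 * k + 2 * p) J (2 * p - 2 * k + 1)) +
      q⁻¹ * (coefDm q (J + 2 * k + 2 * p) (J + 2) (2 * p - 2 * k + 1 - 2) * coefc q (J + 2 * k + 2 * p) (2 * p - 2 * k + 1 - 2) (J + 2))) ∧
    (1 ≤ k → 1 ≤ p → coefc q (J + 2 * k + 2 * p - 2) (2 * p - 2 * k - 1) (J + 2) * coefDm q (J + 2 * k + 2 * p) J (2 * p - 2 * k - 1) =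
      q ^ (-(J / 2 : ℝ) - 1 / 2 + ((2 * p - 2 * k - 1 : ℤ) : ℝ) / 2) / qnum q (2 * (J / 2) + 2) * (coefCm q (J + 2 * k + 2 * p) J (2 * p - 2 * k - 1)) +
      q⁻¹ * (coefDm q (J + 2 * k + 2 * p) (J + 2) (2 * p - 2 * k - 1 - 2) * coefc q (J + 2 * k + 2 * p) (2 * p - 2 * k - 1 - 2) (J + 2)))) ∧
    ((1 ≤ k → coefb q (J + 2 * k + 2 * p - 2) (2 * p - 2 * k + 1) J * coefDm q (J + 2 * k + 2 * p) J (2 * p - 2 * k + 1) =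
      (1 + q ^ 2) * q ^ (-1 / 2 + ((2 * p - 2 * k + 1 : ℤ) : ℝ) / 2) / (qnum q (2 * (J / 2)) * qnum q (2 * (J / 2) + 2)) * (coefHp q (J + 2 * k + 2 * p - 2) J (2 * p - 2 * k + 1)) +
      q⁻¹ * (coefDm q (J + 2 * k + 2 * p) J (2 * p - 2 * k + 1 - 2) * coefb q (J + 2 * k + 2 * p) (2 * p - 2 * k + 1 - 2) J)) ∧
    (1 ≤ p → coefb q (J + 2 * k + 2 * p - 2) (2 * p - 2 * k - 1) J * coefDm q (J + 2 * k + 2 * p) J (2 * p - 2 * k - 1) =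
      (1 + q ^ 2) * q ^ (-1 / 2 + ((2 * p - 2 * k - 1 : ℤ) : ℝ) / 2) / (qnum q (2 * (J / 2)) * qnum q (2 * (J / 2) + 2)) * (coefHp q (J + 2 * k + 2 * p - 2) J (2 * p - 2 * k - 1)) +
      q⁻¹ * (coefDm q (J + 2 * k + 2 * p) J (2 * p - 2 * k - 1 - 2) * coefb q (J + 2 * k + 2 * p) (2 * p - 2 * k - 1 - 2) J))) ∧
    ((3 ≤ J → coefa q (J + 2 * k + 2 * p - 2) (2 * p - 2 * k + 1) (J - 2) * coefDm q (J + 2 * k + 2 * p) J (2 * p - 2 * k + 1) =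
      -q ^ ((J / 2 : ℝ) + 1 / 2 + ((2 * p - 2 * k + 1 : ℤ) : ℝ) / 2) / qnum q (2 * (J / 2)) * (coefCp q (J + 2 * k + 2 * p - 2) (J - 2) (2 * p - 2 * k + 1)) +
      q⁻¹ * (coefDm q (J + 2 * k + 2 * p) (J - 2) (2 * p - 2 * k + 1 - 2) * coefa q (J + 2 * k + 2 * p) (2 * p - 2 * k + 1 - 2) (J - 2))) ∧
    (3 ≤ J → coefa q (J + 2 * k + 2 * p - 2) (2 * p - 2 * k - 1) (J - 2) * coefDm q (J + 2 * k + 2 * p) J (2 * p - 2 * k - 1) =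
      -q ^ ((J / 2 : ℝ) + 1 / 2 + ((2 * p - 2 * k - 1 : ℤ) : ℝ) / 2) / qnum q (2 * (J / 2)) * (coefCp q (J + 2 * k + 2 * p - 2) (J - 2) (2 * p - 2 * k - 1)) +
      q⁻¹ * (coefDm q (J + 2 * k + 2 * p) (J - 2) (2 * p - 2 * k - 1 - 2) * coefa q (J + 2 * k + 2 * p) (2 * p - 2 * k - 1 - 2) (J - 2)))) := by
  obtain ⟨i, rfl⟩ : ∃ i, J = 2 * i + 1 := ⟨J / 2, by omega⟩
  refine ⟨⟨?_, ?_⟩, ⟨?_, ?_⟩, ⟨?_, ?_⟩, ⟨?_, ?_⟩, ⟨?_, ?_⟩, ⟨?_, ?_⟩, ⟨?_, ?_⟩, ⟨?_, ?_⟩, ⟨?_, ?_⟩⟩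
  all_goals
    intros
    rify at *
    simp (disch := omega) only [coefDp, coefD0, coefDm, coefa, coefb, coefc, coefCp, coefC0, coefCm,
      coefHp, coefH0, eps_pos, eps_neg, Int.cast_add, Int.cast_sub, Int.cast_mul, Int.cast_one,
      Int.cast_ofNat, abs_half, abs_neg_half]
    simp (disch := grind) only [sqrt_qnum_div hq, sqrt_qnum_mul hq]
    ring_nf
    try simp (disch := grind) only [rt_sq_eq hq, sub_inv_eq hq, qnum_two_eq hq, qnum_neg_two_eq hq]
    have N₁ := qnum_ne hq (show (0 : ℝ) < 1 + i * 2 by linarith)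
    have N₂ := qnum_ne hq (show (0 : ℝ) < 3 + i * 2 by linarith)
    have N₃ := qnum_ne hq (show (0 : ℝ) < 3 + i * 2 + k * 2 + p * 2 by linarith)
    have N₄ := qnum_ne hq (show (0 : ℝ) < 5 + i * 2 + k * 2 + p * 2 by linarith)
    generalize qnum q (1 + i * 2) = n₁ at *
    generalize qnum q (3 + i * 2) = n₂ at *
    generalize qnum q (3 + i * 2 + k * 2 + p * 2) = n₃ at *
    generalize qnum q (5 + i * 2 + k * 2 + p * 2) = n₄ at *
    try simp only [qnum_eq hq, sub_inv_eq hq]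
    have q0 := hq.1
    have q1 := one_sub_sq_ne hq
    obtain ⟨h, h0, hqh, f1, f3, f5, f7, f9⟩ := half_powers q0
    simp only [Real.rpow_add q0, Real.rpow_sub q0, Real.rpow_neg q0.le, neg_div, f1, f3, f5, f7, f9,
      rpow_mul_two q0, Real.rpow_ofNat, Real.rpow_one]
    have hX := Real.rpow_pos_of_pos q0 (i : ℝ)
    have hU := Real.rpow_pos_of_pos q0 (k : ℝ)
    have hV := Real.rpow_pos_of_pos q0 (p : ℝ)
    clear f1 f3 f5 f7 f9
    generalize q ^ (i : ℝ) = X at *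
    generalize q ^ (k : ℝ) = U at *
    generalize q ^ (p : ℝ) = V at *
    subst hqh
    have q2 : h ^ 4 - 1 ≠ 0 := by rwa [← pow_mul] at q1
    field_simp
    try ring



/-! ### Walls -/

theorem lab_cases {L M₁ M₂ J : ℤ} (h : Admissible L M₁ M₂ J) : ∃ s t k p : ℤ, 0 ≤ s ∧ 0 ≤ t ∧
    0 ≤ k ∧ 0 ≤ p ∧ J = s + t ∧ M₁ = t - s ∧ L = s + t + 2 * k + 2 * p ∧
    (M₂ = 2 * p - 2 * k + 1 ∨ M₂ = 2 * p - 2 * k - 1) ∧ (s + t) % 2 = 1 ∧ 1 ≤ s + t := by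
  rw [admissible_iff] at h
  rcases (show (L + 1 - J - M₂) % 4 = 0 ∨ (L + 1 - J - M₂) % 4 = 2 by omega) with h4 | h4
  · exact ⟨(J - M₁) / 2, (J + M₁) / 2, (L + 1 - J - M₂) / 4, (L - 1 - J + M₂) / 4, by omega⟩
  · exact ⟨(J - M₁) / 2, (J + M₁) / 2, (L - 1 - J - M₂) / 4, (L + 1 - J + M₂) / 4, by omega⟩

/-- The coefficient `f` of a shift operator vanishes when the shift leaves the admissible labels. -/
def Wall (a b c d : ℤ) (f : ℤ → ℤ → ℤ → ℤ → ℝ) : Prop := ∀ L M₁ M₂ J, Admissible L M₁ M₂ J →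
  ¬Admissible (L + a) (M₁ + b) (M₂ + c) (J + d) → f L M₁ M₂ J = 0

theorem Wall.mul_sh {a b c d : ℤ} {f : ℤ → ℤ → ℤ → ℤ → ℝ} (h : Wall a b c d f) (a' b' c' d' : ℤ)
    (g : ℤ → ℤ → ℤ → ℤ → ℝ) : sh a' b' c' d' g * sh a b c d f =
    sh (a + a') (b + b') (c + c') (d + d')
      fun L M₁ M₂ J => f L M₁ M₂ J * g (L + a) (M₁ + b) (M₂ + c) (J + d) :=
  sh_mul fun _ _ _ _ h1 _ h3 => Or.inl (h _ _ _ _ h1 h3)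

section

variable (q : ℝ)

/-! The `m₁`-dependent factors of the coefficients of `E₁`, `E₂`. -/

noncomputable def fac₁ (J M₁ : ℤ) : ℝ :=
  √(qnum q ((J : ℝ) / 2 - (M₁ : ℝ) / 2) * qnum q ((J : ℝ) / 2 + (M₁ : ℝ) / 2 + 1))

noncomputable def faca (J M₁ : ℤ) : ℝ :=
  √(qnum q ((J : ℝ) / 2 - (M₁ : ℝ) / 2 + 1) * qnum q ((J : ℝ) / 2 - (M₁ : ℝ) / 2 + 2))

noncomputable def facb (J M₁ : ℤ) : ℝ :=
  √(qnum q ((J : ℝ) / 2 + (M₁ : ℝ) / 2) * qnum q ((J : ℝ) / 2 - (M₁ : ℝ) / 2 + 1))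

noncomputable def facc (J M₁ : ℤ) : ℝ :=
  √(qnum q ((J : ℝ) / 2 + (M₁ : ℝ) / 2) * qnum q ((J : ℝ) / 2 + (M₁ : ℝ) / 2 - 1))

end

variable {q : ℝ}

theorem fac₁_eq (s t : ℤ) : fac₁ q (s + t) (t - s) = √(qnum q s * qnum q (t + 1)) := by
  rw [fac₁]; push_cast; ring_nf

theorem faca_eq (s t : ℤ) : faca q (s + t) (t - s) = √(qnum q (s + 1) * qnum q (s + 2)) := by
  rw [faca]; push_cast; ring_nf

theorem facb_eq (s t : ℤ) : facb q (s + t) (t - s) = √(qnum q t * qnum q (s + 1)) := by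
  rw [facb]; push_cast; ring_nf

theorem facc_eq (s t : ℤ) : facc q (s + t) (t - s) = √(qnum q t * qnum q (t - 1)) := by
  rw [facc]; push_cast; ring_nf

theorem fac_eq' {f : ℤ → ℤ → ℝ} {g : ℤ → ℤ → ℝ} (h : ∀ s t, f (s + t) (t - s) = g s t) {J M₁ : ℤ}
    (s t : ℤ) (hJ : J = s + t) (hM : M₁ = t - s) : f J M₁ = g s t := by
  rw [hJ, hM, h]

theorem coefa_zero {L M₁ M₂ J : ℤ} (h : Admissible L M₁ M₂ J) (h' : L + 1 - J - M₂ < 4) :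
    coefa q L M₂ J = 0 := by
  obtain ⟨s, t, k, p, hs, ht, hk, hp, rfl, rfl, rfl, rfl | rfl, h1, h2⟩ := lab_cases h
  · exact coefa_wall.1 (by omega)
  · exact coefa_wall.2 (by omega)

theorem coefb_zero {L M₁ M₂ J : ℤ} (h : Admissible L M₁ M₂ J) (h' : L + 1 - J - M₂ < 2) :
    coefb q L M₂ J = 0 := by
  obtain ⟨s, t, k, p, hs, ht, hk, hp, rfl, rfl, rfl, rfl | rfl, h1, h2⟩ := lab_cases h
  · exact coefb_wall (by omega)
  · omega

theorem coefD0_zero {L M₁ M₂ J : ℤ} (h : Admissible L M₁ M₂ J) (h' : L + 1 - J - M₂ < 2) :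
    coefD0 q L J M₂ = 0 := by
  obtain ⟨s, t, k, p, hs, ht, hk, hp, rfl, rfl, rfl, rfl | rfl, h1, h2⟩ := lab_cases h
  · exact coefD0_wall (by omega)
  · omega

theorem coefDm_zero {L M₁ M₂ J : ℤ} (h : Admissible L M₁ M₂ J) (h' : L + 1 - J - M₂ < 4) :
    coefDm q L J M₂ = 0 := by
  obtain ⟨s, t, k, p, hs, ht, hk, hp, rfl, rfl, rfl, rfl | rfl, h1, h2⟩ := lab_cases h
  · exact coefDm_wall.1 (by omega)
  · exact coefDm_wall.2 (by omega)

theorem coefb_sub_zero {L M₁ M₂ J : ℤ} (h : Admissible L M₁ M₂ J) (h' : L + 1 - J + M₂ < 2) :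
    coefb q L (M₂ - 2) J = 0 := by
  obtain ⟨s, t, k, p, hs, ht, hk, hp, rfl, rfl, rfl, rfl | rfl, h1, h2⟩ := lab_cases h
  · omega
  · exact coefb_wall_sub (by omega)

theorem coefc_sub_zero {L M₁ M₂ J : ℤ} (h : Admissible L M₁ M₂ J) (h' : L + 1 - J + M₂ < 4) :
    coefc q L (M₂ - 2) (J + 2) = 0 := by
  obtain ⟨s, t, k, p, hs, ht, hk, hp, rfl, rfl, rfl, rfl | rfl, h1, h2⟩ := lab_cases h
  · exact coefc_wall_sub.1 (by omega)
  · exact coefc_wall_sub.2 (by omega)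

section

variable (q : ℝ)

noncomputable def cE₁ (_ M₁ _ J : ℤ) : ℝ := fac₁ q J M₁
noncomputable def cF₁ (_ M₁ _ J : ℤ) : ℝ := fac₁ q J (M₁ - 2)
noncomputable def cEa (L M₁ M₂ J : ℤ) : ℝ := faca q J M₁ * coefa q L M₂ J
noncomputable def cEb (L M₁ M₂ J : ℤ) : ℝ := facb q J M₁ * coefb q L M₂ J
noncomputable def cEc (L M₁ M₂ J : ℤ) : ℝ := facc q J M₁ * coefc q L M₂ J
noncomputable def cFa (L M₁ M₂ J : ℤ) : ℝ := faca q (J - 2) (M₁ + 2) * coefa q L (M₂ - 2) (J - 2)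
noncomputable def cFb (L M₁ M₂ J : ℤ) : ℝ := facb q J (M₁ + 2) * coefb q L (M₂ - 2) J
noncomputable def cFc (L M₁ M₂ J : ℤ) : ℝ := facc q (J + 2) (M₁ + 2) * coefc q L (M₂ - 2) (J + 2)

noncomputable def opF₁ : Module.End ℂ Spin := sh 0 (-2) 0 0 (cF₁ q)
noncomputable def opF₂ : Module.End ℂ Spin :=
  sh 0 2 (-2) (-2) (cFa q) + sh 0 2 (-2) 0 (cFb q) + sh 0 2 (-2) 2 (cFc q)

theorem opE₁_eq : opE₁ q = sh 0 2 0 0 (cE₁ q) := by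
  unfold opE₁ sh cE₁ fac₁
  simp

theorem opE₂_eq : opE₂ q = sh 0 (-2) 2 2 (cEa q) + sh 0 (-2) 2 0 (cEb q) +
    sh 0 (-2) 2 (-2) (cEc q) := by
  unfold opE₂ sh cEa cEb cEc faca facb facc
  simp only [← opOfKet_add, add_zero, ← sub_eq_add_neg, ← Complex.coe_smul]

theorem opF₁_isAdj : IsAdj (opE₁ q) (opF₁ q) := by
  rw [opE₁_eq]
  have h := sh_isAdj 0 2 0 0 (cE₁ q)
  simp only [neg_zero, sub_zero] at h
  exact h

theorem opF₂_isAdj : IsAdj (opE₂ q) (opF₂ q) := by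
  rw [opE₂_eq]
  have ha := sh_isAdj 0 (-2) 2 2 (cEa q)
  have hb := sh_isAdj 0 (-2) 2 0 (cEb q)
  have hc := sh_isAdj 0 (-2) 2 (-2) (cEc q)
  simp only [neg_zero, sub_zero, neg_neg, sub_neg_eq_add] at ha hb hc
  exact (ha.add hb).add hc

end


theorem fac₁_F (s t : ℤ) : fac₁ q (s + t) (t - s - 2) = √(qnum q (s + 1) * qnum q t) := by
  rw [fac_eq' fac₁_eq (s + 1) (t - 1) (by ring) (by ring)]; push_cast; ring_nf

theorem faca_F (s t : ℤ) : faca q (s + t - 2) (t - s + 2) = √(qnum q (s - 1) * qnum q s) := by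
  rw [fac_eq' faca_eq (s - 2) t (by ring) (by ring)]; push_cast; ring_nf

theorem facb_F (s t : ℤ) : facb q (s + t) (t - s + 2) = √(qnum q (t + 1) * qnum q s) := by
  rw [fac_eq' facb_eq (s - 1) (t + 1) (by ring) (by ring)]; push_cast; ring_nf

theorem facc_F (s t : ℤ) : facc q (s + t + 2) (t - s + 2) =
    √(qnum q (t + 2) * qnum q (t + 1)) := by
  rw [fac_eq' facc_eq s (t + 2) (by ring) (by ring)]; push_cast; ring_nf

theorem wall_E₁ : Wall 0 2 0 0 (cE₁ q) := fun L M₁ M₂ J h h' => by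
  obtain ⟨s, t, k, p, hs, ht, hk, hp, rfl, rfl, hL, h0, h1, h2⟩ := lab_cases h
  obtain rfl : s = 0 := by rw [admissible_iff] at h h'; omega
  (rw [cE₁, fac₁_eq]; simp [qnum_zero])

theorem wall_F₁ : Wall 0 (-2) 0 0 (cF₁ q) := fun L M₁ M₂ J h h' => by
  obtain ⟨s, t, k, p, hs, ht, hk, hp, rfl, rfl, hL, h0, h1, h2⟩ := lab_cases h
  obtain rfl : t = 0 := by rw [admissible_iff] at h h'; omega
  (rw [cF₁, fac₁_F]; simp [qnum_zero])

theorem wall_Ea : Wall 0 (-2) 2 2 (cEa q) := fun L M₁ M₂ J h h' => by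
  rw [cEa, coefa_zero h (by rw [admissible_iff] at h h'; omega), mul_zero]

theorem wall_Eb : Wall 0 (-2) 2 0 (cEb q) := fun L M₁ M₂ J h h' => by
  by_cases h3 : L + 1 - J - M₂ < 2
  · rw [cEb, coefb_zero h h3, mul_zero]
  obtain ⟨s, t, k, p, hs, ht, hk, hp, rfl, rfl, hL, h0, h1, h2⟩ := lab_cases h
  obtain rfl : t = 0 := by rw [admissible_iff] at h h'; omega
  (rw [cEb, facb_eq]; simp [qnum_zero])

theorem wall_Ec : Wall 0 (-2) 2 (-2) (cEc q) := fun L M₁ M₂ J h h' => by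
  obtain ⟨s, t, k, p, hs, ht, hk, hp, rfl, rfl, hL, h0, h1, h2⟩ := lab_cases h
  rcases (show t = 0 ∨ t = 1 by rw [admissible_iff] at h h'; omega) with rfl | rfl <;>
    (rw [cEc, facc_eq]; simp [qnum_zero])

theorem wall_Fa : Wall 0 2 (-2) (-2) (cFa q) := fun L M₁ M₂ J h h' => by
  obtain ⟨s, t, k, p, hs, ht, hk, hp, rfl, rfl, hL, h0, h1, h2⟩ := lab_cases h
  rcases (show s = 0 ∨ s = 1 by rw [admissible_iff] at h h'; omega) with rfl | rfl <;>
    (rw [cFa, faca_F]; simp [qnum_zero])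

theorem wall_Fb : Wall 0 2 (-2) 0 (cFb q) := fun L M₁ M₂ J h h' => by
  by_cases h3 : L + 1 - J + M₂ < 2
  · rw [cFb, coefb_sub_zero h h3, mul_zero]
  obtain ⟨s, t, k, p, hs, ht, hk, hp, rfl, rfl, hL, h0, h1, h2⟩ := lab_cases h
  obtain rfl : s = 0 := by rw [admissible_iff] at h h'; omega
  (rw [cFb, facb_F]; simp [qnum_zero])

theorem wall_Fc : Wall 0 2 (-2) 2 (cFc q) := fun L M₁ M₂ J h h' => by
  rw [cFc, coefc_sub_zero h (by rw [admissible_iff] at h h'; omega), mul_zero]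

theorem Wall.comm {a b c d a' b' c' d' : ℤ} {f g : ℤ → ℤ → ℤ → ℤ → ℝ} (hf : Wall a b c d f)
    (hg : Wall a' b' c' d' g) {r : ℝ} (h : ∀ L M₁ M₂ J, Admissible L M₁ M₂ J →
      Admissible (L + (a + a')) (M₁ + (b + b')) (M₂ + (c + c')) (J + (d + d')) →
      f L M₁ M₂ J * g (L + a) (M₁ + b) (M₂ + c) (J + d) =
        r * (g L M₁ M₂ J * f (L + a') (M₁ + b') (M₂ + c') (J + d'))) :
    sh a' b' c' d' g * sh a b c d f = (r : ℂ) • (sh a b c d f * sh a' b' c' d' g) := by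
  rw [hf.mul_sh, hg.mul_sh, sh_smul, add_comm a' a, add_comm b' b, add_comm c' c, add_comm d' d]
  exact sh_congr h

theorem opE₂_F₁ (hq : q ∈ Set.Ioo (0 : ℝ) 1) : opE₂ q * opF₁ q = opF₁ q * opE₂ q := by
  have key : ∀ {d : ℤ} {f : ℤ → ℤ → ℤ → ℤ → ℝ}, Wall 0 (-2) 2 d f → d ≤ 2 →
      (∀ L M₂ s t : ℤ, 0 ≤ s → 1 ≤ t → Admissible L (t - s) M₂ (s + t) →
        Admissible L (t - s - 4) (M₂ + 2) (s + t + d) →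
        fac₁ q (s + t) (t - s - 2) * f L (t - s - 2) M₂ (s + t) =
          f L (t - s) M₂ (s + t) * fac₁ q (s + t + d) (t - s - 4)) →
      sh 0 (-2) 2 d f * opF₁ q = opF₁ q * sh 0 (-2) 2 d f := by
    intro d f hf hd h
    rw [opF₁]
    have := (wall_F₁ (q := q)).comm hf (r := 1) (fun L M₁ M₂ J h1 h2 => by
      obtain ⟨s, t, k, p, hs, ht, hk, hp, rfl, rfl, hL, h0, -, -⟩ := lab_cases h1
      rw [one_mul, cF₁, cF₁]
      simp only [add_zero, zero_add, ← sub_eq_add_neg] at h2 ⊢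
      rw [show t - s + (-2 - 2) = t - s - 4 by ring] at h2
      rw [h _ _ _ _ hs (by rw [admissible_iff] at h1 h2; omega) h1 h2]
      congr 2
      ring)
    rw [this, Complex.ofReal_one, one_smul]
  simp only [opE₂_eq, add_mul, mul_add]
  rw [key wall_Ea le_rfl, key wall_Eb (by norm_num), key wall_Ec (by norm_num)]
  all_goals
    intro L M₂ s t hs ht h1 h2
    rw [admissible_iff] at h2
    rify at hs ht
    simp only [cEa, cEb, cEc, fac₁_F, facc_eq, facb_eq, faca_eq]
  · rw [fac_eq' facc_eq (s + 1) (t - 1) (by ring) (by ring),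
      fac_eq' fac₁_eq (s + 1) (t - 3) (by ring) (by ring)]
    have ht' : (2 : ℝ) ≤ t := by norm_cast; omega
    push_cast
    simp (disch := grind) only [sqrt_qnum_mul hq]
    ring_nf
  · rw [fac_eq' facb_eq (s + 1) (t - 1) (by ring) (by ring),
      fac_eq' fac₁_eq (s + 2) (t - 2) (by ring) (by ring)]
    push_cast
    simp (disch := grind) only [sqrt_qnum_mul hq]
    ring_nf
  · rw [fac_eq' faca_eq (s + 1) (t - 1) (by ring) (by ring),
      fac_eq' fac₁_eq (s + 3) (t - 1) (by ring) (by ring)]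
    push_cast
    simp (disch := grind) only [sqrt_qnum_mul hq]
    ring_nf



section

variable (q : ℝ)

noncomputable def opKi₁ : Module.End ℂ Spin := sh 0 0 0 0 fun _ M₁ _ _ => q ^ (-((M₁ : ℝ) / 2))

noncomputable def opKi₂ : Module.End ℂ Spin :=
  sh 0 0 0 0 fun _ M₁ M₂ _ => q ^ (-((M₂ : ℝ) / 2 - (M₁ : ℝ) / 2))

theorem opK₁_eq : opK₁ q = sh 0 0 0 0 fun _ M₁ _ _ => q ^ ((M₁ : ℝ) / 2) := by
  unfold opK₁ sh
  simp only [add_zero, ← Complex.coe_smul]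

theorem opK₂_eq : opK₂ q = sh 0 0 0 0 fun _ M₁ M₂ _ => q ^ ((M₂ : ℝ) / 2 - (M₁ : ℝ) / 2) := by
  unfold opK₂ sh
  simp only [add_zero, ← Complex.coe_smul]

theorem wall_diag (f : ℤ → ℤ → ℤ → ℤ → ℝ) : Wall 0 0 0 0 f := fun L M₁ M₂ J h h' => by
  simp only [add_zero] at h'
  exact absurd h h'

theorem sh_diag_mul (f g : ℤ → ℤ → ℤ → ℤ → ℝ) : sh 0 0 0 0 g * sh 0 0 0 0 f =
    sh 0 0 0 0 fun L M₁ M₂ J => f L M₁ M₂ J * g L M₁ M₂ J := by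
  rw [(wall_diag f).mul_sh]
  simp only [add_zero]

theorem sh_diag_one : sh 0 0 0 0 (fun _ _ _ _ => 1) = 1 :=
  end_ext fun L M₁ M₂ J h => by
    rw [sh_ket _ _ _ _ _ h]
    simp

theorem isAdj_diag (f : ℤ → ℤ → ℤ → ℤ → ℝ) : IsAdj (sh 0 0 0 0 f) (sh 0 0 0 0 f) := by
  have h := sh_isAdj 0 0 0 0 f
  simp only [neg_zero, sub_zero] at h
  exact h

variable {q}

theorem opK₁_opKi₁ (hq : 0 < q) : opK₁ q * opKi₁ q = 1 ∧ opKi₁ q * opK₁ q = 1 := by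
  rw [opK₁_eq, opKi₁, sh_diag_mul, sh_diag_mul, ← sh_diag_one]
  constructor <;> refine sh_congr fun L M₁ M₂ J _ _ => ?_ <;> rw [← Real.rpow_add hq] <;> simp

theorem opK₂_opKi₂ (hq : 0 < q) : opK₂ q * opKi₂ q = 1 ∧ opKi₂ q * opK₂ q = 1 := by
  rw [opK₂_eq, opKi₂, sh_diag_mul, sh_diag_mul, ← sh_diag_one]
  constructor <;> refine sh_congr fun L M₁ M₂ J _ _ => ?_ <;> rw [← Real.rpow_add hq] <;> simp

theorem opK₁_opK₂ : opK₁ q * opK₂ q = opK₂ q * opK₁ q := by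
  rw [opK₁_eq, opK₂_eq, sh_diag_mul, sh_diag_mul]
  simp only [mul_comm]

theorem opK₁_sh (hq : 0 < q) (a b c d : ℤ) (f : ℤ → ℤ → ℤ → ℤ → ℝ) :
    opK₁ q * sh a b c d f = ((q ^ ((b : ℝ) / 2) : ℝ) : ℂ) • (sh a b c d f * opK₁ q) := by
  rw [opK₁_eq, (wall_diag _).mul_sh, sh_mul, sh_smul]
  · simp only [add_zero, zero_add]
    refine sh_congr fun L M₁ M₂ J _ _ => ?_
    rw [Int.cast_add, add_div, Real.rpow_add hq]
    ring
  · intro L M₁ M₂ J _ h2 h3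
    simp only [add_zero] at h2
    exact absurd h2 h3

theorem opK₂_sh (hq : 0 < q) (a b c d : ℤ) (f : ℤ → ℤ → ℤ → ℤ → ℝ) :
    opK₂ q * sh a b c d f =
      ((q ^ ((c : ℝ) / 2 - (b : ℝ) / 2) : ℝ) : ℂ) • (sh a b c d f * opK₂ q) := by
  rw [opK₂_eq, (wall_diag _).mul_sh, sh_mul, sh_smul]
  · simp only [add_zero, zero_add]
    refine sh_congr fun L M₁ M₂ J _ _ => ?_
    rw [Int.cast_add, add_div, Int.cast_add, add_div, add_sub_add_comm, Real.rpow_add hq]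
    ring
  · intro L M₁ M₂ J _ h2 h3
    simp only [add_zero] at h2
    exact absurd h2 h3

theorem opK₁_E₁ (hq : 0 < q) : opK₁ q * opE₁ q = (q : ℂ) • (opE₁ q * opK₁ q) := by
  rw [opE₁_eq, opK₁_sh hq]
  norm_num

theorem opK₂_E₁ (hq : 0 < q) : opK₂ q * opE₁ q = (q : ℂ)⁻¹ • (opE₁ q * opK₂ q) := by
  rw [opE₁_eq, opK₂_sh hq]
  norm_num [Real.rpow_neg_one]

theorem opK₁_E₂ (hq : 0 < q) : opK₁ q * opE₂ q = (q : ℂ)⁻¹ • (opE₂ q * opK₁ q) := by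
  rw [opE₂_eq]
  simp only [mul_add, add_mul, opK₁_sh hq, smul_add]
  norm_num [Real.rpow_neg_one]

theorem opK₂_E₂ (hq : 0 < q) : opK₂ q * opE₂ q = (q : ℂ) ^ 2 • (opE₂ q * opK₂ q) := by
  rw [opE₂_eq]
  simp only [mul_add, add_mul, opK₂_sh hq, smul_add]
  norm_num

theorem opK₁_isAdj : IsAdj (opK₁ q) (opK₁ q) := by rw [opK₁_eq]; exact isAdj_diag _
theorem opK₂_isAdj : IsAdj (opK₂ q) (opK₂ q) := by rw [opK₂_eq]; exact isAdj_diag _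
theorem opKi₁_isAdj : IsAdj (opKi₁ q) (opKi₁ q) := isAdj_diag _
theorem opKi₂_isAdj : IsAdj (opKi₂ q) (opKi₂ q) := isAdj_diag _

theorem opE₁_F₁ (hq : q ∈ Set.Ioo (0 : ℝ) 1) : opE₁ q * opF₁ q =
    opF₁ q * opE₁ q + ((q : ℂ) - (q : ℂ)⁻¹)⁻¹ • (opK₁ q ^ 2 - opKi₁ q ^ 2) := by
  have e : ((q : ℂ) - (q : ℂ)⁻¹)⁻¹ = ((q - q⁻¹ : ℝ)⁻¹ : ℝ) := by push_cast; rfl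
  rw [e, pow_two, pow_two, opE₁_eq, opF₁, opK₁_eq, opKi₁, sh_diag_mul, sh_diag_mul, sh_sub, sh_smul,
    wall_E₁.mul_sh, wall_F₁.mul_sh]
  simp only [add_zero, add_neg_cancel, neg_add_cancel]
  rw [sh_add]
  refine sh_congr fun L M₁ M₂ J h _ => ?_
  obtain ⟨s, t, k, p, hs, ht, hk, hp, rfl, rfl, hL, h0, -, -⟩ := lab_cases h
  have key := E₁_F₁_diag hq s t
  rify at hs ht
  simp only [cE₁, cF₁, ← sub_eq_add_neg, add_sub_cancel_right, fac₁_F, fac₁_eq]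
  rw [Real.mul_self_sqrt, Real.mul_self_sqrt, ← Real.rpow_add hq.1, ← Real.rpow_add hq.1,
    ← neg_add, add_halves]
  · rw [sub_eq_iff_eq_add] at key
    rw [key, qnum, div_eq_inv_mul]
    push_cast
    ring
  · exact mul_nonneg (qnum_nonneg hq (by linarith)) (qnum_nonneg hq (by linarith))
  · exact mul_nonneg (qnum_nonneg hq (by linarith)) (qnum_nonneg hq (by linarith))

theorem opE₂_F₂_zero (hq : q ∈ Set.Ioo (0 : ℝ) 1) :
    sh 0 (-2) 2 2 (cEa q) * sh 0 2 (-2) (-2) (cFa q) + sh 0 (-2) 2 0 (cEb q) * sh 0 2 (-2) 0 (cFb q) +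
      sh 0 (-2) 2 (-2) (cEc q) * sh 0 2 (-2) 2 (cFc q) =
    sh 0 2 (-2) (-2) (cFa q) * sh 0 (-2) 2 2 (cEa q) + sh 0 2 (-2) 0 (cFb q) * sh 0 (-2) 2 0 (cEb q) +
      sh 0 2 (-2) 2 (cFc q) * sh 0 (-2) 2 (-2) (cEc q) +
      sh 0 0 0 0 fun _ M₁ M₂ _ => qnum q (M₂ - M₁) / qnum q 2 := by
  rw [wall_Ea.mul_sh, wall_Eb.mul_sh, wall_Ec.mul_sh, wall_Fa.mul_sh, wall_Fb.mul_sh, wall_Fc.mul_sh]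
  simp only [add_zero, add_neg_cancel, neg_add_cancel, sh_add]
  refine sh_congr fun L M₁ M₂ J h _ => ?_
  obtain ⟨s, t, k, p, hs, ht, hk, hp, rfl, rfl, rfl, h0, -, hJ⟩ := lab_cases h
  have key := E₂_F₂_zero hq hs ht hk hp rfl hJ
  rify at hs ht
  have e : ∀ x y c : ℝ, √(x * y) * c * (√(x * y) * c) = √(x * y) * √(x * y) * c ^ 2 := by
    intros; ring
  have hns : 0 ≤ qnum q (s - 1) * qnum q s := by
    rcases (show s = 0 ∨ s = 1 ∨ 1 ≤ s - 1 by norm_cast at hs; omega) with rfl | rfl | h1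
    · simp [qnum_zero]
    · simp [qnum_zero]
    · rify at h1
      exact mul_nonneg (qnum_nonneg hq (by linarith)) (qnum_nonneg hq (by linarith))
  have hnt : 0 ≤ qnum q t * qnum q (t - 1) := by
    rcases (show t = 0 ∨ t = 1 ∨ 1 ≤ t - 1 by norm_cast at ht; omega) with rfl | rfl | h1
    · simp [qnum_zero]
    · simp [qnum_zero]
    · rify at h1
      exact mul_nonneg (qnum_nonneg hq (by linarith)) (qnum_nonneg hq (by linarith))
  have hn : ∀ x y : ℝ, 0 ≤ x → 0 ≤ y → 0 ≤ qnum q x * qnum q y := fun x y hx hy =>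
    mul_nonneg (qnum_nonneg hq hx) (qnum_nonneg hq hy)
  simp only [cEa, cEb, cEc, cFa, cFb, cFc, ← sub_eq_add_neg, add_sub_cancel_right, sub_add_cancel,
    faca_F, facb_F, facc_F, faca_eq, facb_eq, facc_eq, e]
  rw [Real.mul_self_sqrt hns, Real.mul_self_sqrt hnt, Real.mul_self_sqrt (hn _ _ (by linarith) hs),
    Real.mul_self_sqrt (hn _ _ (by linarith) (by linarith)),
    Real.mul_self_sqrt (hn _ _ (by linarith) (by linarith)),
    Real.mul_self_sqrt (hn _ _ (by linarith) (by linarith))]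
  rw [show ((t - s : ℤ) : ℝ) = t - s by push_cast; rfl, ← sub_add]
  rcases h0 with rfl | rfl
  · linarith [key.1]
  · linarith [key.2]

theorem opE₂_F₂_one (hq : q ∈ Set.Ioo (0 : ℝ) 1) :
    sh 0 (-2) 2 2 (cEa q) * sh 0 2 (-2) 0 (cFb q) + sh 0 (-2) 2 0 (cEb q) * sh 0 2 (-2) 2 (cFc q) =
    sh 0 2 (-2) 0 (cFb q) * sh 0 (-2) 2 2 (cEa q) + sh 0 2 (-2) 2 (cFc q) * sh 0 (-2) 2 0 (cEb q) := by
  rw [wall_Ea.mul_sh, wall_Eb.mul_sh, wall_Fb.mul_sh, wall_Fc.mul_sh]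
  simp only [add_zero, zero_add, add_neg_cancel, neg_add_cancel, sh_add]
  refine sh_congr fun L M₁ M₂ J h h' => ?_
  obtain ⟨s, t, k, p, hs, ht, hk, hp, rfl, rfl, rfl, h0, -, hJ⟩ := lab_cases h
  have key := E₂_F₂_one hq hs ht hk hp rfl hJ
  rw [admissible_iff] at h'
  simp only [cEa, cEb, cEc, cFa, cFb, cFc, ← sub_eq_add_neg, add_sub_cancel_right, sub_add_cancel,
    faca_F, facb_F, facc_F, faca_eq, facb_eq, facc_eq]
  rw [fac_eq' faca_eq (s - 1) (t + 1) (by ring) (by ring),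
    fac_eq' facb_eq s (t + 2) (by ring) (by ring),
    fac_eq' facb_eq (s + 1) (t + 1) (by ring) (by ring),
    fac_eq' facc_eq (s + 1) (t + 1) (by ring) (by ring)]
  rify at hs ht
  push_cast
  simp (disch := grind) only [sqrt_qnum_mul hq]
  have e1 := rt_mul_self hq hs
  have e2 := rt_mul_self hq ht
  have e3 := rt_mul_self hq (show (0 : ℝ) ≤ s + 2 by linarith)
  have e4 := rt_mul_self hq (show (0 : ℝ) ≤ t + 2 by linarith)
  simp only [← e1, ← e2, ← e3, ← e4] at key
  ring_nf at key ⊢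
  rcases h0 with rfl | rfl
  · have := key.1 (by omega)
    try ring_nf at this
    ring_nf
    linear_combination (rt q (1 + t) * rt q (1 + s)) * this
  · have := key.2 (by omega)
    try ring_nf at this
    ring_nf
    linear_combination (rt q (1 + t) * rt q (1 + s)) * this

theorem opE₂_F₂_two (hq : q ∈ Set.Ioo (0 : ℝ) 1) :
    sh 0 (-2) 2 2 (cEa q) * sh 0 2 (-2) 2 (cFc q) =
      sh 0 2 (-2) 2 (cFc q) * sh 0 (-2) 2 2 (cEa q) := by
  rw [wall_Ea.mul_sh, wall_Fc.mul_sh]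
  simp only [add_zero, zero_add, add_neg_cancel, neg_add_cancel, sh_add]
  refine sh_congr fun L M₁ M₂ J h h' => ?_
  obtain ⟨s, t, k, p, hs, ht, hk, hp, rfl, rfl, rfl, h0, -, hJ⟩ := lab_cases h
  rw [admissible_iff] at h'
  have key := E₂_F₂_two hq (k := k) (p := p) hJ (by omega) (by omega)
  simp only [cEa, cEb, cEc, cFa, cFb, cFc, ← sub_eq_add_neg, add_sub_cancel_right, sub_add_cancel,
    faca_F, facb_F, facc_F, faca_eq, facb_eq, facc_eq]
  rw [fac_eq' faca_eq s (t + 2) (by ring) (by ring),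
    fac_eq' facc_eq (s + 2) (t + 2) (by ring) (by ring)]
  push_cast
  rw [show s + t + 2 + 2 = s + t + 4 by ring, show (t : ℝ) + 2 - 1 = t + 1 by ring]
  rcases h0 with rfl | rfl
  · linear_combination (√(qnum q (t + 2) * qnum q (t + 1)) * √(qnum q (s + 1) * qnum q (s + 2))) * key.1
  · linear_combination (√(qnum q (t + 2) * qnum q (t + 1)) * √(qnum q (s + 1) * qnum q (s + 2))) * key.2

theorem IsAdj.eq_of_eq {ι : Type} {X Y X' Y' : Module.End ℂ (ι →₀ ℂ)} (h : IsAdj X Y)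
    (h' : IsAdj X' Y') (e : X = X') : Y = Y' := h.eq (e ▸ h')

theorem ring_bracket_three {P : Type} [Ring P] {a b c x y z d : P}
    (h₀ : a * x + b * y + c * z = x * a + y * b + z * c + d) (h₁ : a * y + b * z = y * a + z * b)
    (h₂ : a * z = z * a) (h₃ : b * x + c * y = x * b + y * c) (h₄ : c * x = x * c) :
    (a + b + c) * (x + y + z) = (x + y + z) * (a + b + c) + d := by
  calc (a + b + c) * (x + y + z) = (a * x + b * y + c * z) + (a * y + b * z) + a * z +
        (b * x + c * y) + c * x := by noncomm_ring
    _ = _ := by rw [h₀, h₁, h₂, h₃, h₄]; noncomm_ring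

theorem opE₂_F₂ (hq : q ∈ Set.Ioo (0 : ℝ) 1) : opE₂ q * opF₂ q =
    opF₂ q * opE₂ q + ((q : ℂ) ^ 2 - ((q : ℂ) ^ 2)⁻¹)⁻¹ • (opK₂ q ^ 2 - opKi₂ q ^ 2) := by
  have e : ((q : ℂ) ^ 2 - ((q : ℂ) ^ 2)⁻¹)⁻¹ = ((q ^ 2 - (q ^ 2)⁻¹ : ℝ)⁻¹ : ℝ) := by push_cast; rfl
  have hd : ((q : ℂ) ^ 2 - ((q : ℂ) ^ 2)⁻¹)⁻¹ • (opK₂ q ^ 2 - opKi₂ q ^ 2) =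
      sh 0 0 0 0 fun _ M₁ M₂ _ => qnum q (M₂ - M₁) / qnum q 2 := by
    rw [e, pow_two (opK₂ q), pow_two (opKi₂ q), opK₂_eq, opKi₂, sh_diag_mul, sh_diag_mul, sh_sub,
      sh_smul]
    refine sh_congr fun L M₁ M₂ J h _ => ?_
    rw [← Real.rpow_add hq.1, ← Real.rpow_add hq.1, ← neg_add,
      show (M₂ : ℝ) / 2 - M₁ / 2 + (M₂ / 2 - M₁ / 2) = M₂ - M₁ by ring, qnum, qnum, div_div_div_cancel_right₀
      (sub_inv_neg hq).ne, div_eq_inv_mul, Real.rpow_neg hq.1.le 2, Real.rpow_two]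
  have ha := sh_isAdj 0 (-2) 2 2 (cEa q)
  have hb := sh_isAdj 0 (-2) 2 0 (cEb q)
  have hc := sh_isAdj 0 (-2) 2 (-2) (cEc q)
  simp only [neg_zero, sub_zero, neg_neg, sub_neg_eq_add] at ha hb hc
  have h1 := opE₂_F₂_one hq
  have h2 := opE₂_F₂_two hq
  rw [hd, opE₂_eq, opF₂]
  refine ring_bracket_three (P := Module.End ℂ Spin) (opE₂_F₂_zero hq) h1 h2 ?_ ?_
  · have l := (ha.mul hb.symm).add (hb.mul hc.symm)
    have r := (hb.symm.mul ha).add (hc.symm.mul hb)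
    exact l.eq_of_eq r h1
  · exact (ha.mul hc.symm).eq_of_eq (hc.symm.mul ha) h2

end



/-! ### Components of the operators `x₂`, `x₁`, `x₀` -/

theorem lab_cases' {L M₁ M₂ J : ℤ} (h : Admissible L M₁ M₂ J) : ∃ k p : ℤ, 0 ≤ k ∧ 0 ≤ p ∧
    L = J + 2 * k + 2 * p ∧ (M₂ = 2 * p - 2 * k + 1 ∨ M₂ = 2 * p - 2 * k - 1) ∧ J % 2 = 1 ∧
    1 ≤ J := by
  obtain ⟨s, t, k, p, hs, ht, hk, hp, rfl, rfl, hL, h0, h1, h2⟩ := lab_cases h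
  exact ⟨k, p, hk, hp, hL, h0, h1, h2⟩

/-- The coefficient `f` of a shift operator vanishes when the shift enters the admissible labels
from outside. -/
def CoWall (a b c d : ℤ) (f : ℤ → ℤ → ℤ → ℤ → ℝ) : Prop := ∀ L M₁ M₂ J,
  Admissible (L + a) (M₁ + b) (M₂ + c) (J + d) → ¬Admissible L M₁ M₂ J → f L M₁ M₂ J = 0

theorem CoWall.mul_sh {a b c d a' b' c' d' : ℤ} {g : ℤ → ℤ → ℤ → ℤ → ℝ}
    (h : CoWall a' b' c' d' g) (f : ℤ → ℤ → ℤ → ℤ → ℝ) : sh a' b' c' d' g * sh a b c d f =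
    sh (a + a') (b + b') (c + c') (d + d')
      fun L M₁ M₂ J => f L M₁ M₂ J * g (L + a) (M₁ + b) (M₂ + c) (J + d) :=
  sh_mul fun _ _ _ _ _ h2 h3 => Or.inr (h _ _ _ _ h2 h3)

section

variable (q : ℝ)

noncomputable def cXp (L _ M₂ J : ℤ) : ℝ := coefDp q L J M₂
noncomputable def cXz (L _ M₂ J : ℤ) : ℝ := coefD0 q L J M₂
noncomputable def cXm (L _ M₂ J : ℤ) : ℝ := coefDm q L J M₂

noncomputable def opX₂p : Module.End ℂ Spin := sh 2 0 2 0 (cXp q)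
noncomputable def opX₂z : Module.End ℂ Spin := sh 0 0 2 0 (cXz q)
noncomputable def opX₂m : Module.End ℂ Spin := sh (-2) 0 2 0 (cXm q)

/-- The operator with `m₁`-shift `b`, `l`-shift `a`, where the coefficients for the three `j`-shifts
are products of functions of `(j, m₁)` and of `(l, j, m₂)`. -/
noncomputable def three (a b : ℤ) (f₁ f₂ f₃ : ℤ → ℤ → ℝ) (g₁ g₂ g₃ : ℤ → ℤ → ℤ → ℝ) :
    Module.End ℂ Spin :=
  sh a b 0 2 (fun L M₁ M₂ J => f₁ J M₁ * g₁ L J M₂) +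
  sh a b 0 0 (fun L M₁ M₂ J => f₂ J M₁ * g₂ L J M₂) +
  sh a b 0 (-2) (fun L M₁ M₂ J => f₃ J M₁ * g₃ L J M₂)

noncomputable def opX₁p : Module.End ℂ Spin := three 2 2 (coefBp q) (coefB0 q) (coefBm q)
  (coefCp q) (coefHp q) fun L J M₂ => coefCm q (L + 2) (J - 2) M₂
noncomputable def opX₁z : Module.End ℂ Spin := three 0 2 (coefBp q) (coefB0 q) (coefBm q)
  (fun L J M₂ => -coefC0 q L J M₂) (coefH0 q) fun L J M₂ => -coefC0 q L (J - 2) M₂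
noncomputable def opX₁m : Module.End ℂ Spin := three (-2) 2 (coefBp q) (coefB0 q) (coefBm q)
  (coefCm q) (fun L J M₂ => coefHp q (L - 2) J M₂) fun L J M₂ => coefCp q (L - 2) (J - 2) M₂

noncomputable def opX₀p : Module.End ℂ Spin := three 2 0 (coefAp q) (coefA0 q)
  (fun J M₁ => coefAp q (J - 2) M₁) (coefCp q) (coefHp q) fun L J M₂ => coefCm q (L + 2) (J - 2) M₂
noncomputable def opX₀z : Module.End ℂ Spin := three 0 0 (coefAp q) (coefA0 q)
  (fun J M₁ => coefAp q (J - 2) M₁) (fun L J M₂ => -coefC0 q L J M₂) (coefH0 q)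
  fun L J M₂ => -coefC0 q L (J - 2) M₂
noncomputable def opX₀m : Module.End ℂ Spin := three (-2) 0 (coefAp q) (coefA0 q)
  (fun J M₁ => coefAp q (J - 2) M₁) (coefCm q) (fun L J M₂ => coefHp q (L - 2) J M₂)
  fun L J M₂ => coefCp q (L - 2) (J - 2) M₂

variable {q}

theorem wall_Xp : Wall 2 0 2 0 (cXp q) := fun L M₁ M₂ J h h' => by
  rw [admissible_iff] at h h'; omega

theorem wall_Xz : Wall 0 0 2 0 (cXz q) := fun L M₁ M₂ J h h' =>
  coefD0_zero h (by rw [admissible_iff] at h h'; omega)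

theorem wall_Xm : Wall (-2) 0 2 0 (cXm q) := fun L M₁ M₂ J h h' =>
  coefDm_zero h (by rw [admissible_iff] at h h'; omega)

theorem coWall_F₁ : CoWall 0 (-2) 0 0 (cF₁ q) := fun L M₁ M₂ J h h' => by
  have := wall_E₁ (q := q) (L + 0) (M₁ + -2) (M₂ + 0) (J + 0) h fun h1 => h' (by simpa using h1)
  simpa only [cE₁, cF₁, add_zero, ← sub_eq_add_neg] using this

theorem E₁_X₂p : opE₁ q * opX₂p q = opX₂p q * opE₁ q := by
  have := (wall_Xp (q := q)).comm (wall_E₁ (q := q)) (r := 1) fun L M₁ M₂ J h1 h2 => by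
    simp only [cE₁, cXp, add_zero, one_mul]
    ring
  rwa [Complex.ofReal_one, one_smul, ← opE₁_eq] at this

theorem F₁_X₂p : opF₁ q * opX₂p q = opX₂p q * opF₁ q := by
  have := (wall_Xp (q := q)).comm (wall_F₁ (q := q)) (r := 1) fun L M₁ M₂ J h1 h2 => by
    simp only [cF₁, cXp, add_zero, one_mul]
    ring
  rwa [Complex.ofReal_one, one_smul] at this

theorem E₂_X₂p (hq : q ∈ Set.Ioo (0 : ℝ) 1) :
    opE₂ q * opX₂p q = (q : ℂ)⁻¹ • (opX₂p q * opE₂ q) := by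
  rw [opX₂p, opE₂_eq, ← Complex.ofReal_inv]
  simp only [add_mul, mul_add, smul_add]
  rw [wall_Xp.comm wall_Ea (r := q⁻¹), wall_Xp.comm wall_Eb (r := q⁻¹),
    wall_Xp.comm wall_Ec (r := q⁻¹)]
  all_goals
    intro L M₁ M₂ J h1 h2
    obtain ⟨k, p, hk, hp, rfl, h0, hJ, hJ1⟩ := lab_cases' h1
    rw [admissible_iff] at h1 h2
    simp only [cXp, cEa, cEb, cEc, add_zero, ← sub_eq_add_neg]
  · rcases h0 with rfl | rfl
    · linear_combination facc q J M₁ * (E₂_x₂ hq hJ hJ1 hk hp).2.2.1.1 (by omega)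
    · linear_combination facc q J M₁ * (E₂_x₂ hq hJ hJ1 hk hp).2.2.1.2 (by omega)
  · rcases h0 with rfl | rfl
    · linear_combination facb q J M₁ * (E₂_x₂ hq hJ hJ1 hk hp).2.1.1
    · linear_combination facb q J M₁ * (E₂_x₂ hq hJ hJ1 hk hp).2.1.2
  · rcases h0 with rfl | rfl
    · linear_combination faca q J M₁ * (E₂_x₂ hq hJ hJ1 hk hp).1.1 (by omega)
    · linear_combination faca q J M₁ * (E₂_x₂ hq hJ hJ1 hk hp).1.2

theorem E₁_X₂z : opE₁ q * opX₂z q = opX₂z q * opE₁ q := by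
  have := (wall_Xz (q := q)).comm (wall_E₁ (q := q)) (r := 1) fun L M₁ M₂ J h1 h2 => by
    simp only [cE₁, cXz, add_zero, one_mul]
    ring
  rwa [Complex.ofReal_one, one_smul, ← opE₁_eq] at this

theorem F₁_X₂z : opF₁ q * opX₂z q = opX₂z q * opF₁ q := by
  have := (wall_Xz (q := q)).comm (wall_F₁ (q := q)) (r := 1) fun L M₁ M₂ J h1 h2 => by
    simp only [cF₁, cXz, add_zero, one_mul]
    ring
  rwa [Complex.ofReal_one, one_smul] at this

theorem E₂_X₂z (hq : q ∈ Set.Ioo (0 : ℝ) 1) :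
    opE₂ q * opX₂z q = (q : ℂ)⁻¹ • (opX₂z q * opE₂ q) := by
  rw [opX₂z, opE₂_eq, ← Complex.ofReal_inv]
  simp only [add_mul, mul_add, smul_add]
  rw [wall_Xz.comm wall_Ea (r := q⁻¹), wall_Xz.comm wall_Eb (r := q⁻¹),
    wall_Xz.comm wall_Ec (r := q⁻¹)]
  all_goals
    intro L M₁ M₂ J h1 h2
    obtain ⟨k, p, hk, hp, rfl, h0, hJ, hJ1⟩ := lab_cases' h1
    rw [admissible_iff] at h1 h2
    simp only [cXz, cEa, cEb, cEc, add_zero, ← sub_eq_add_neg]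
  · rcases h0 with rfl | rfl
    · linear_combination facc q J M₁ * (E₂_x₂ hq hJ hJ1 hk hp).2.2.2.2.2.1.1 (by omega)
    · linear_combination facc q J M₁ * (E₂_x₂ hq hJ hJ1 hk hp).2.2.2.2.2.1.2 (by omega)
  · rcases h0 with rfl | rfl
    · linear_combination facb q J M₁ * (E₂_x₂ hq hJ hJ1 hk hp).2.2.2.2.1.1 (by omega)
    · linear_combination facb q J M₁ * (E₂_x₂ hq hJ hJ1 hk hp).2.2.2.2.1.2
  · rcases h0 with rfl | rfl
    · linear_combination faca q J M₁ * (E₂_x₂ hq hJ hJ1 hk hp).2.2.2.1.1 (by omega)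
    · linear_combination faca q J M₁ * (E₂_x₂ hq hJ hJ1 hk hp).2.2.2.1.2 (by omega)

theorem E₁_X₂m : opE₁ q * opX₂m q = opX₂m q * opE₁ q := by
  have := (wall_Xm (q := q)).comm (wall_E₁ (q := q)) (r := 1) fun L M₁ M₂ J h1 h2 => by
    simp only [cE₁, cXm, add_zero, one_mul]
    ring
  rwa [Complex.ofReal_one, one_smul, ← opE₁_eq] at this

theorem F₁_X₂m : opF₁ q * opX₂m q = opX₂m q * opF₁ q := by
  have := (wall_Xm (q := q)).comm (wall_F₁ (q := q)) (r := 1) fun L M₁ M₂ J h1 h2 => by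
    simp only [cF₁, cXm, add_zero, one_mul]
    ring
  rwa [Complex.ofReal_one, one_smul] at this

theorem E₂_X₂m (hq : q ∈ Set.Ioo (0 : ℝ) 1) :
    opE₂ q * opX₂m q = (q : ℂ)⁻¹ • (opX₂m q * opE₂ q) := by
  rw [opX₂m, opE₂_eq, ← Complex.ofReal_inv]
  simp only [add_mul, mul_add, smul_add]
  rw [wall_Xm.comm wall_Ea (r := q⁻¹), wall_Xm.comm wall_Eb (r := q⁻¹),
    wall_Xm.comm wall_Ec (r := q⁻¹)]
  all_goals
    intro L M₁ M₂ J h1 h2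
    obtain ⟨k, p, hk, hp, rfl, h0, hJ, hJ1⟩ := lab_cases' h1
    rw [admissible_iff] at h1 h2
    simp only [cXm, cEa, cEb, cEc, add_zero, ← sub_eq_add_neg]
  · rcases h0 with rfl | rfl
    · linear_combination facc q J M₁ * (E₂_x₂ hq hJ hJ1 hk hp).2.2.2.2.2.2.2.2.1 (by omega) (by omega)
    · linear_combination facc q J M₁ * (E₂_x₂ hq hJ hJ1 hk hp).2.2.2.2.2.2.2.2.2 (by omega)
  · rcases h0 with rfl | rfl
    · linear_combination facb q J M₁ * (E₂_x₂ hq hJ hJ1 hk hp).2.2.2.2.2.2.2.1.1 (by omega)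
    · linear_combination facb q J M₁ * (E₂_x₂ hq hJ hJ1 hk hp).2.2.2.2.2.2.2.1.2 (by omega)
  · rcases h0 with rfl | rfl
    · linear_combination faca q J M₁ * (E₂_x₂ hq hJ hJ1 hk hp).2.2.2.2.2.2.1.1 (by omega)
    · linear_combination faca q J M₁ * (E₂_x₂ hq hJ hJ1 hk hp).2.2.2.2.2.2.1.2 (by omega)

theorem coefBp_mul (hq : 0 < q) (J M₁ M₂ : ℤ) :
    coefBp q J M₁ * q ^ ((M₂ : ℝ) / 2 - (M₁ : ℝ) / 2) =
      q ^ (-(J / 2 : ℝ) - 1 / 2 + (M₂ : ℝ) / 2) / qnum q (2 * (J / 2) + 2) * facc q (J + 2) (M₁ + 2) := by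
  simp only [coefBp, facc]
  rw [mul_comm (qnum q _) (qnum q _)]
  push_cast
  ring_nf
  simp only [Real.rpow_add hq, Real.rpow_sub hq, Real.rpow_neg hq.le, neg_div]
  have e : q ^ (-((M₁ : ℝ) / 2)) = (q ^ ((M₁ : ℝ) / 2))⁻¹ := Real.rpow_neg hq.le _
  have := Real.rpow_pos_of_pos hq ((M₁ : ℝ) / 2)
  field_simp
  try rw [e]
  try field_simp

theorem coefB0_mul (hq : 0 < q) (J M₁ M₂ : ℤ) :
    coefB0 q J M₁ * q ^ ((M₂ : ℝ) / 2 - (M₁ : ℝ) / 2) =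
      (1 + q ^ 2) * q ^ (-1 / 2 + (M₂ : ℝ) / 2) / (qnum q (2 * (J / 2)) * qnum q (2 * (J / 2) + 2)) * facb q J (M₁ + 2) := by
  simp only [coefB0, facb]
  rw [mul_comm (qnum q _) (qnum q _)]
  push_cast
  ring_nf
  simp only [Real.rpow_add hq, Real.rpow_sub hq, Real.rpow_neg hq.le, neg_div]
  have e : q ^ (-((M₁ : ℝ) / 2)) = (q ^ ((M₁ : ℝ) / 2))⁻¹ := Real.rpow_neg hq.le _
  have := Real.rpow_pos_of_pos hq ((M₁ : ℝ) / 2)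
  field_simp
  try rw [e]
  try field_simp

theorem coefBm_mul (hq : 0 < q) (J M₁ M₂ : ℤ) :
    coefBm q J M₁ * q ^ ((M₂ : ℝ) / 2 - (M₁ : ℝ) / 2) =
      -q ^ ((J / 2 : ℝ) + 1 / 2 + (M₂ : ℝ) / 2) / qnum q (2 * (J / 2)) * faca q (J - 2) (M₁ + 2) := by
  simp only [coefBm, faca]
  rw [mul_comm (qnum q _) (qnum q _)]
  push_cast
  ring_nf
  simp only [Real.rpow_add hq, Real.rpow_sub hq, Real.rpow_neg hq.le, neg_div]
  have e : q ^ (-((M₁ : ℝ) / 2)) = (q ^ ((M₁ : ℝ) / 2))⁻¹ := Real.rpow_neg hq.le _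
  have := Real.rpow_pos_of_pos hq ((M₁ : ℝ) / 2)
  field_simp
  try rw [e]
  try field_simp

theorem add_rearrange {P : Type} [AddCommMonoid P] {a b c x y z u v w : P} (h₁ : a = x + u)
    (h₂ : b = y + v) (h₃ : c = z + w) : c + b + a = x + y + z + (w + v + u) := by
  rw [h₁, h₂, h₃]; abel

theorem F₂_X₂p (hq : q ∈ Set.Ioo (0 : ℝ) 1) :
    opF₂ q * opX₂p q = opX₁p q * opK₂ q + (q : ℂ)⁻¹ • (opX₂p q * opF₂ q) := by
  rw [opX₂p, opX₁p, three, opF₂, opK₂_eq, ← Complex.ofReal_inv]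
  simp only [add_mul, mul_add, smul_add, wall_Xp.mul_sh, wall_Fa.mul_sh, wall_Fb.mul_sh,
    wall_Fc.mul_sh, (wall_diag _).mul_sh]
  simp only [sh_smul, add_zero, zero_add, ← sub_eq_add_neg]
  norm_num only
  refine add_rearrange ?_ ?_ ?_ <;> rw [sh_add] <;> refine sh_congr fun L M₁ M₂ J h1 h2 => ?_
  all_goals
    obtain ⟨k, p, hk, hp, rfl, h0, hJ, hJ1⟩ := lab_cases' h1
    rw [admissible_iff] at h1 h2
    simp only [cXp, cFa, cFb, cFc, add_zero, ← sub_eq_add_neg, add_sub_cancel_right,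
      sub_add_cancel]
  · rcases h0 with rfl | rfl
    · linear_combination facc q (J + 2) (M₁ + 2) * (F₂_x₂ hq hJ hJ1 hk hp).1.1 -
        (coefCp q (J + 2 * k + 2 * p) J (2 * p - 2 * k + 1)) * coefBp_mul hq.1 J M₁ (2 * p - 2 * k + 1)
    · linear_combination facc q (J + 2) (M₁ + 2) * (F₂_x₂ hq hJ hJ1 hk hp).1.2 -
        (coefCp q (J + 2 * k + 2 * p) J (2 * p - 2 * k - 1)) * coefBp_mul hq.1 J M₁ (2 * p - 2 * k - 1)
  · rcases h0 with rfl | rfl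
    · linear_combination facb q J (M₁ + 2) * (F₂_x₂ hq hJ hJ1 hk hp).2.1.1 -
        (coefHp q (J + 2 * k + 2 * p) J (2 * p - 2 * k + 1)) * coefB0_mul hq.1 J M₁ (2 * p - 2 * k + 1)
    · linear_combination facb q J (M₁ + 2) * (F₂_x₂ hq hJ hJ1 hk hp).2.1.2 -
        (coefHp q (J + 2 * k + 2 * p) J (2 * p - 2 * k - 1)) * coefB0_mul hq.1 J M₁ (2 * p - 2 * k - 1)
  · rcases h0 with rfl | rfl
    · linear_combination faca q (J - 2) (M₁ + 2) * (F₂_x₂ hq hJ hJ1 hk hp).2.2.1.1 (by omega) -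
        (coefCm q (J + 2 * k + 2 * p + 2) (J - 2) (2 * p - 2 * k + 1)) * coefBm_mul hq.1 J M₁ (2 * p - 2 * k + 1)
    · linear_combination faca q (J - 2) (M₁ + 2) * (F₂_x₂ hq hJ hJ1 hk hp).2.2.1.2 (by omega) -
        (coefCm q (J + 2 * k + 2 * p + 2) (J - 2) (2 * p - 2 * k - 1)) * coefBm_mul hq.1 J M₁ (2 * p - 2 * k - 1)

theorem F₂_X₂z (hq : q ∈ Set.Ioo (0 : ℝ) 1) :
    opF₂ q * opX₂z q = opX₁z q * opK₂ q + (q : ℂ)⁻¹ • (opX₂z q * opF₂ q) := by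
  rw [opX₂z, opX₁z, three, opF₂, opK₂_eq, ← Complex.ofReal_inv]
  simp only [add_mul, mul_add, smul_add, wall_Xz.mul_sh, wall_Fa.mul_sh, wall_Fb.mul_sh,
    wall_Fc.mul_sh, (wall_diag _).mul_sh]
  simp only [sh_smul, add_zero, zero_add, ← sub_eq_add_neg]
  norm_num only
  refine add_rearrange ?_ ?_ ?_ <;> rw [sh_add] <;> refine sh_congr fun L M₁ M₂ J h1 h2 => ?_
  all_goals
    obtain ⟨k, p, hk, hp, rfl, h0, hJ, hJ1⟩ := lab_cases' h1
    rw [admissible_iff] at h1 h2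
    simp only [cXz, cFa, cFb, cFc, add_zero, ← sub_eq_add_neg, add_sub_cancel_right,
      sub_add_cancel]
  · rcases h0 with rfl | rfl
    · linear_combination facc q (J + 2) (M₁ + 2) * (F₂_x₂ hq hJ hJ1 hk hp).2.2.2.1.1 (by omega) -
        (-coefC0 q (J + 2 * k + 2 * p) J (2 * p - 2 * k + 1)) * coefBp_mul hq.1 J M₁ (2 * p - 2 * k + 1)
    · linear_combination facc q (J + 2) (M₁ + 2) * (F₂_x₂ hq hJ hJ1 hk hp).2.2.2.1.2 (by omega) -
        (-coefC0 q (J + 2 * k + 2 * p) J (2 * p - 2 * k - 1)) * coefBp_mul hq.1 J M₁ (2 * p - 2 * k - 1)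
  · rcases h0 with rfl | rfl
    · linear_combination facb q J (M₁ + 2) * (F₂_x₂ hq hJ hJ1 hk hp).2.2.2.2.1.1 -
        (coefH0 q (J + 2 * k + 2 * p) J (2 * p - 2 * k + 1)) * coefB0_mul hq.1 J M₁ (2 * p - 2 * k + 1)
    · linear_combination facb q J (M₁ + 2) * (F₂_x₂ hq hJ hJ1 hk hp).2.2.2.2.1.2 -
        (coefH0 q (J + 2 * k + 2 * p) J (2 * p - 2 * k - 1)) * coefB0_mul hq.1 J M₁ (2 * p - 2 * k - 1)
  · rcases h0 with rfl | rfl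
    · linear_combination faca q (J - 2) (M₁ + 2) * (F₂_x₂ hq hJ hJ1 hk hp).2.2.2.2.2.1.1 (by omega) -
        (-coefC0 q (J + 2 * k + 2 * p) (J - 2) (2 * p - 2 * k + 1)) * coefBm_mul hq.1 J M₁ (2 * p - 2 * k + 1)
    · linear_combination faca q (J - 2) (M₁ + 2) * (F₂_x₂ hq hJ hJ1 hk hp).2.2.2.2.2.1.2 (by omega) -
        (-coefC0 q (J + 2 * k + 2 * p) (J - 2) (2 * p - 2 * k - 1)) * coefBm_mul hq.1 J M₁ (2 * p - 2 * k - 1)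

theorem F₂_X₂m (hq : q ∈ Set.Ioo (0 : ℝ) 1) :
    opF₂ q * opX₂m q = opX₁m q * opK₂ q + (q : ℂ)⁻¹ • (opX₂m q * opF₂ q) := by
  rw [opX₂m, opX₁m, three, opF₂, opK₂_eq, ← Complex.ofReal_inv]
  simp only [add_mul, mul_add, smul_add, wall_Xm.mul_sh, wall_Fa.mul_sh, wall_Fb.mul_sh,
    wall_Fc.mul_sh, (wall_diag _).mul_sh]
  simp only [sh_smul, add_zero, zero_add, ← sub_eq_add_neg]
  norm_num only
  refine add_rearrange ?_ ?_ ?_ <;> rw [sh_add] <;> refine sh_congr fun L M₁ M₂ J h1 h2 => ?_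
  all_goals
    obtain ⟨k, p, hk, hp, rfl, h0, hJ, hJ1⟩ := lab_cases' h1
    rw [admissible_iff] at h1 h2
    simp only [cXm, cFa, cFb, cFc, add_zero, ← sub_eq_add_neg, add_sub_cancel_right,
      sub_add_cancel]
  · rcases h0 with rfl | rfl
    · linear_combination facc q (J + 2) (M₁ + 2) * (F₂_x₂ hq hJ hJ1 hk hp).2.2.2.2.2.2.1.1 (by omega) (by omega) -
        (coefCm q (J + 2 * k + 2 * p) J (2 * p - 2 * k + 1)) * coefBp_mul hq.1 J M₁ (2 * p - 2 * k + 1)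
    · linear_combination facc q (J + 2) (M₁ + 2) * (F₂_x₂ hq hJ hJ1 hk hp).2.2.2.2.2.2.1.2 (by omega) (by omega) -
        (coefCm q (J + 2 * k + 2 * p) J (2 * p - 2 * k - 1)) * coefBp_mul hq.1 J M₁ (2 * p - 2 * k - 1)
  · rcases h0 with rfl | rfl
    · linear_combination facb q J (M₁ + 2) * (F₂_x₂ hq hJ hJ1 hk hp).2.2.2.2.2.2.2.1.1 (by omega) -
        (coefHp q (J + 2 * k + 2 * p - 2) J (2 * p - 2 * k + 1)) * coefB0_mul hq.1 J M₁ (2 * p - 2 * k + 1)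
    · linear_combination facb q J (M₁ + 2) * (F₂_x₂ hq hJ hJ1 hk hp).2.2.2.2.2.2.2.1.2 (by omega) -
        (coefHp q (J + 2 * k + 2 * p - 2) J (2 * p - 2 * k - 1)) * coefB0_mul hq.1 J M₁ (2 * p - 2 * k - 1)
  · rcases h0 with rfl | rfl
    · linear_combination faca q (J - 2) (M₁ + 2) * (F₂_x₂ hq hJ hJ1 hk hp).2.2.2.2.2.2.2.2.1 (by omega) -
        (coefCp q (J + 2 * k + 2 * p - 2) (J - 2) (2 * p - 2 * k + 1)) * coefBm_mul hq.1 J M₁ (2 * p - 2 * k + 1)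
    · linear_combination faca q (J - 2) (M₁ + 2) * (F₂_x₂ hq hJ hJ1 hk hp).2.2.2.2.2.2.2.2.2 (by omega) -
        (coefCp q (J + 2 * k + 2 * p - 2) (J - 2) (2 * p - 2 * k - 1)) * coefBm_mul hq.1 J M₁ (2 * p - 2 * k - 1)

end



section

variable {q : ℝ}

theorem add_rearrange' {P : Type} [AddCommMonoid P] {a b c x y z u v w : P} (h₁ : a = x + u)
    (h₂ : b = y + v) (h₃ : c = z + w) : a + b + c = x + y + z + (u + v + w) := by
  rw [h₁, h₂, h₃]; abel

theorem F₁_three (hq : q ∈ Set.Ioo (0 : ℝ) 1) (a : ℤ) (g₁ g₂ g₃ : ℤ → ℤ → ℤ → ℝ) :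
    opF₁ q * three a 2 (coefBp q) (coefB0 q) (coefBm q) g₁ g₂ g₃ =
      ((q ^ (1 / 2 : ℝ) * qnum q 2 : ℝ) : ℂ) • (three a 0 (coefAp q) (coefA0 q)
        (fun J M₁ => coefAp q (J - 2) M₁) g₁ g₂ g₃ * opK₁ q) +
      (q : ℂ)⁻¹ • (three a 2 (coefBp q) (coefB0 q) (coefBm q) g₁ g₂ g₃ * opF₁ q) := by
  rw [three, three, opF₁, opK₁_eq, ← Complex.ofReal_inv]
  simp only [add_mul, mul_add, smul_add, coWall_F₁.mul_sh, wall_F₁.mul_sh, (wall_diag _).mul_sh]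
  simp only [sh_smul, add_zero, zero_add, ← sub_eq_add_neg]
  norm_num only
  refine add_rearrange' ?_ ?_ ?_ <;> rw [sh_add] <;> refine sh_congr fun L M₁ M₂ J h1 h2 => ?_
  all_goals
    obtain ⟨s, t, k, p, hs, ht, hk, hp, rfl, rfl, hL, h0, -, hJ⟩ := lab_cases h1
    rw [admissible_iff] at h1 h2
    simp only [cF₁, add_zero, ← sub_eq_add_neg, add_sub_cancel_right, fac₁_F, fac₁_eq]
  · rw [fac_eq' fac₁_eq (s + 1) (t + 1) (by ring) (by ring)]
    have := (F₁_x₁ hq hs ht hJ).1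
    push_cast at this ⊢
    rw [show (t : ℝ) + 1 + 1 = t + 2 by ring, sub_div]
    linear_combination (g₁ L (s + t) M₂) * this
  · have := (F₁_x₁ hq hs ht hJ).2.1
    push_cast at this ⊢
    rw [sub_div]
    linear_combination (g₂ L (s + t) M₂) * this
  · rw [fac_eq' fac₁_eq (s - 1) (t - 1) (by ring) (by ring)]
    have := (F₁_x₁ hq hs ht hJ).2.2 (by omega) (by omega)
    push_cast at this ⊢
    rw [sub_add_cancel, sub_div]
    linear_combination (g₃ L (s + t) M₂) * this

theorem F₁_X₁p (hq : q ∈ Set.Ioo (0 : ℝ) 1) : opF₁ q * opX₁p q =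
    ((q ^ (1 / 2 : ℝ) * qnum q 2 : ℝ) : ℂ) • (opX₀p q * opK₁ q) +
      (q : ℂ)⁻¹ • (opX₁p q * opF₁ q) := F₁_three hq _ _ _ _

theorem F₁_X₁z (hq : q ∈ Set.Ioo (0 : ℝ) 1) : opF₁ q * opX₁z q =
    ((q ^ (1 / 2 : ℝ) * qnum q 2 : ℝ) : ℂ) • (opX₀z q * opK₁ q) +
      (q : ℂ)⁻¹ • (opX₁z q * opF₁ q) := F₁_three hq _ _ _ _

theorem F₁_X₁m (hq : q ∈ Set.Ioo (0 : ℝ) 1) : opF₁ q * opX₁m q =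
    ((q ^ (1 / 2 : ℝ) * qnum q 2 : ℝ) : ℂ) • (opX₀m q * opK₁ q) +
      (q : ℂ)⁻¹ • (opX₁m q * opF₁ q) := F₁_three hq _ _ _ _

theorem add_rev {P : Type} [AddCommMonoid P] (a b c : P) : c + b + a = a + b + c := by abel

theorem three_isAdj (a b : ℤ) (f₁ f₂ f₃ : ℤ → ℤ → ℝ) (g₁ g₂ g₃ : ℤ → ℤ → ℤ → ℝ) :
    IsAdj (three a b f₁ f₂ f₃ g₁ g₂ g₃) (three (-a) (-b)
      (fun J M₁ => f₃ (J + 2) (M₁ - b)) (fun J M₁ => f₂ J (M₁ - b)) (fun J M₁ => f₁ (J - 2) (M₁ - b))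
      (fun L J M₂ => g₃ (L - a) (J + 2) M₂) (fun L J M₂ => g₂ (L - a) J M₂)
      fun L J M₂ => g₁ (L - a) (J - 2) M₂) := by
  have h := ((sh_isAdj a b 0 2 fun L M₁ M₂ J => f₁ J M₁ * g₁ L J M₂).add
    (sh_isAdj a b 0 0 fun L M₁ M₂ J => f₂ J M₁ * g₂ L J M₂)).add
    (sh_isAdj a b 0 (-2) fun L M₁ M₂ J => f₃ J M₁ * g₃ L J M₂)
  simp only [neg_zero, sub_zero, neg_neg, sub_neg_eq_add] at h
  rw [three, three]
  refine (congrArg (IsAdj _) (add_rev _ _ _)).mpr ?_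
  exact h

theorem X₀p_isAdj : IsAdj (opX₀p q) (opX₀m q) := by
  have h := three_isAdj 2 0 (coefAp q) (coefA0 q)
    (fun J M₁ => coefAp q (J - 2) M₁) (coefCp q) (coefHp q) fun L J M₂ => coefCm q (L + 2) (J - 2) M₂
  simp only [neg_zero, sub_zero, add_sub_cancel_right, sub_add_cancel] at h
  exact h

theorem X₀z_isAdj : IsAdj (opX₀z q) (opX₀z q) := by
  have h := three_isAdj 0 0 (coefAp q) (coefA0 q)
    (fun J M₁ => coefAp q (J - 2) M₁) (fun L J M₂ => -coefC0 q L J M₂) (coefH0 q)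
    fun L J M₂ => -coefC0 q L (J - 2) M₂
  simp only [neg_zero, sub_zero, add_sub_cancel_right, sub_add_cancel] at h
  exact h

theorem opX₂_eq (s : ℤˣ) : opX₂ q s = opX₂p q + ((s : ℤ) : ℂ) • opX₂z q + opX₂m q := by
  rw [opX₂p, opX₂z, opX₂m, ← Complex.ofReal_intCast, sh_smul]
  unfold opX₂ sh cXp cXz cXm
  simp only [← opOfKet_add, add_zero, ← sub_eq_add_neg, ← Complex.coe_smul]

theorem opX₁_eq (s : ℤˣ) : opX₁ q s = opX₁p q + ((s : ℤ) : ℂ) • opX₁z q + opX₁m q := by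
  rw [opX₁p, opX₁z, opX₁m, ← Complex.ofReal_intCast]
  simp only [three, smul_add, sh_smul]
  unfold opX₁ sh
  simp only [← opOfKet_add, add_zero, ← sub_eq_add_neg, ← Complex.coe_smul]
  congr 1
  funext L M₁ M₂ J
  simp only [mul_neg, Complex.ofReal_neg, neg_smul]
  abel

theorem opX₀_eq (s : ℤˣ) : opX₀ q s = opX₀p q + ((s : ℤ) : ℂ) • opX₀z q + opX₀m q := by
  rw [opX₀p, opX₀z, opX₀m, ← Complex.ofReal_intCast]
  simp only [three, smul_add, sh_smul]
  unfold opX₀ sh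
  simp only [← opOfKet_add, add_zero, ← sub_eq_add_neg, ← Complex.coe_smul]
  congr 1
  funext L M₁ M₂ J
  simp only [mul_neg, Complex.ofReal_neg, neg_smul]
  abel

end



/-! ### Extremal vectors -/

theorem ladder_mem {V : Type} [AddCommGroup V] [Module ℂ V] (S : Submodule ℂ V)
    {X₁ X₂ : V →ₗ[ℂ] V} (s₁ : ∀ v ∈ S, X₁ v ∈ S) (s₂ : ∀ v ∈ S, X₂ v ∈ S) (N : ℕ)
    (v : ℕ → ℕ → ℕ → V) (h₀ : v 0 0 0 ∈ S)
    (h₁ : ∀ n r i, n ≤ N → r ≤ 2 * (N - n) + 1 → i ≤ 2 * n →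
      ∃ c : ℂ, c ≠ 0 ∧ X₁ (v n r i) = c • v n r (i + 1))
    (h₂ : ∀ n, n < N → ∃ c : ℂ, c ≠ 0 ∧ X₂ (v n 0 0) = c • v (n + 1) 0 0)
    (h₃ : ∀ n r, n ≤ N → r ≤ 2 * (N - n) → ∃ c c' : ℂ, c ≠ 0 ∧
      X₂ (v n r 1) = c • v n (r + 1) 0 + c' • v (n + 1) r 1 ∧
      (v (n + 1) r 1 = 0 ∨ n < N ∧ r ≤ 2 * (N - (n + 1)) + 1)) :
    ∀ n r i, n ≤ N → r ≤ 2 * (N - n) + 1 → i ≤ 2 * n + 1 → v n r i ∈ S := by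
  have of_smul : ∀ {c : ℂ} {w : V}, c ≠ 0 → c • w ∈ S → w ∈ S := fun hc h =>
    (S.smul_mem_iff hc).1 h
  have row : ∀ n r, n ≤ N → r ≤ 2 * (N - n) + 1 → v n r 0 ∈ S → ∀ i, i ≤ 2 * n + 1 → v n r i ∈ S := by
    intro n r hn hr h i
    induction i with
    | zero => exact fun _ => h
    | succ i ih =>
      intro hi
      obtain ⟨c, hc, e⟩ := h₁ n r i hn hr (by omega)
      exact of_smul hc (e ▸ s₁ _ (ih (by omega)))
  have base : ∀ n, n ≤ N → v n 0 0 ∈ S := by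
    intro n
    induction n with
    | zero => exact fun _ => h₀
    | succ n ih =>
      intro hn
      obtain ⟨c, hc, e⟩ := h₂ n (by omega)
      exact of_smul hc (e ▸ s₂ _ (ih (by omega)))
  suffices h : ∀ r n, n ≤ N → r ≤ 2 * (N - n) + 1 → ∀ i, i ≤ 2 * n + 1 → v n r i ∈ S from
    fun n r i hn hr hi => h r n hn hr i hi
  intro r
  induction r with
  | zero => exact fun n hn hr => row n 0 hn hr (base n hn)
  | succ r ih =>
    intro n hn hr
    refine row n (r + 1) hn hr ?_
    obtain ⟨c, c', hc, e, h⟩ := h₃ n r hn (by omega)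
    have h1 := s₂ _ (ih n hn (by omega) 1 (by omega))
    rw [e] at h1
    refine of_smul hc ((S.add_mem_iff_left ?_).1 h1)
    rcases h with h | ⟨h, h'⟩
    · rw [h, smul_zero]; exact S.zero_mem
    · exact S.smul_mem _ (ih (n + 1) h h' 1 (by omega))

section

variable {q : ℝ}

theorem coefa_ne (hq : q ∈ Set.Ioo (0 : ℝ) 1) {L M₁ M₂ J : ℤ} (h : Admissible L M₁ M₂ J)
    (h' : 4 ≤ L + 1 - J - M₂) : coefa q L M₂ J ≠ 0 := by
  obtain ⟨k, p, hk, hp, rfl, h0, hJ, hJ1⟩ := lab_cases' h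
  have hk1 : 1 ≤ k := by omega
  have h2 := qnum_pos hq (show (0 : ℝ) < 2 by norm_num)
  clear h h'
  rify at hk hp hJ1 hk1
  rcases h0 with rfl | rfl <;>
  · simp (disch := omega) only [coefa, eps_pos, eps_neg, abs_half, abs_neg_half]
    refine mul_ne_zero (by positivity) (Real.sqrt_pos.2 (div_pos (mul_pos ?_ ?_) (mul_pos ?_ ?_))).ne' <;>
      refine qnum_pos hq ?_ <;> push_cast <;> linarith

theorem coefb_ne (hq : q ∈ Set.Ioo (0 : ℝ) 1) {L M₁ M₂ J : ℤ} (h : Admissible L M₁ M₂ J)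
    (h' : 2 ≤ L + 1 - J - M₂) : coefb q L M₂ J ≠ 0 := by
  obtain ⟨k, p, hk, hp, rfl, h0, hJ, hJ1⟩ := lab_cases' h
  have h4 : ∀ x y : ℝ, 0 < x → 0 < y → 0 < qnum q x * qnum q y := fun x y hx hy =>
    mul_pos (qnum_pos hq hx) (qnum_pos hq hy)
  rcases h0 with rfl | rfl
  · have hk1 : 1 ≤ k := by omega
    clear h h'
    rify at *
    simp (disch := omega) only [coefb, eps_pos, eps_neg, abs_half, abs_neg_half]
    refine mul_ne_zero (by norm_num) (div_ne_zero (Real.sqrt_pos.2 (h4 _ _ ?_ ?_)).ne' (h4 _ _ ?_ ?_).ne') <;>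
      push_cast <;> linarith
  · clear h h'
    rify at *
    simp (disch := omega) only [coefb, eps_pos, eps_neg, abs_half, abs_neg_half]
    refine mul_ne_zero (by norm_num) (div_ne_zero (Real.sqrt_pos.2 (h4 _ _ ?_ ?_)).ne' (h4 _ _ ?_ ?_).ne') <;>
      push_cast <;> linarith

theorem coefb_sub_ne (hq : q ∈ Set.Ioo (0 : ℝ) 1) {L M₁ M₂ J : ℤ} (h : Admissible L M₁ M₂ J)
    (h' : 2 ≤ L + 1 - J + M₂) : coefb q L (M₂ - 2) J ≠ 0 :=
  coefb_ne hq (M₁ := M₁) (by rw [admissible_iff] at h ⊢; omega) (by rw [admissible_iff] at h; omega)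

theorem coefc_sub_ne (hq : q ∈ Set.Ioo (0 : ℝ) 1) {L M₁ M₂ J : ℤ} (h : Admissible L M₁ M₂ J)
    (h' : 4 ≤ L + 1 - J + M₂) : coefc q L (M₂ - 2) (J + 2) ≠ 0 := by
  obtain ⟨k, p, hk, hp, rfl, h0, hJ, hJ1⟩ := lab_cases' h
  have hk1 : 1 ≤ p := by omega
  have h2 := qnum_pos hq (show (0 : ℝ) < 2 by norm_num)
  clear h h'
  rify at hk hp hJ1 hk1
  rcases h0 with rfl | rfl <;>
  · simp (disch := omega) only [coefc, eps_pos, eps_neg, abs_half, abs_neg_half]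
    refine mul_ne_zero (div_ne_zero (by norm_num) h2.ne')
      (Real.sqrt_pos.2 (div_pos (mul_pos ?_ ?_) (mul_pos ?_ ?_))).ne' <;>
      refine qnum_pos hq ?_ <;> push_cast <;> linarith

theorem opE₁_ket {L M₁ M₂ J : ℤ} (h : Admissible L M₁ M₂ J) : opE₁ q (ket L M₁ M₂ J) =
    (fac₁ q J M₁ : ℂ) • ket L (M₁ + 2) M₂ J := by
  rw [opE₁_eq, sh_ket _ _ _ _ _ h]; simp only [add_zero, cE₁]

theorem opF₁_ket {L M₁ M₂ J : ℤ} (h : Admissible L M₁ M₂ J) : opF₁ q (ket L M₁ M₂ J) =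
    (fac₁ q J (M₁ - 2) : ℂ) • ket L (M₁ - 2) M₂ J := by
  rw [opF₁, sh_ket _ _ _ _ _ h]; simp only [add_zero, cF₁, ← sub_eq_add_neg]

theorem opE₂_ket {L M₁ M₂ J : ℤ} (h : Admissible L M₁ M₂ J) : opE₂ q (ket L M₁ M₂ J) =
    ((faca q J M₁ * coefa q L M₂ J : ℝ) : ℂ) • ket L (M₁ - 2) (M₂ + 2) (J + 2) +
    ((facb q J M₁ * coefb q L M₂ J : ℝ) : ℂ) • ket L (M₁ - 2) (M₂ + 2) J +
    ((facc q J M₁ * coefc q L M₂ J : ℝ) : ℂ) • ket L (M₁ - 2) (M₂ + 2) (J - 2) := by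
  rw [opE₂_eq, LinearMap.add_apply, LinearMap.add_apply, sh_ket _ _ _ _ _ h, sh_ket _ _ _ _ _ h,
    sh_ket _ _ _ _ _ h]
  simp only [add_zero, cEa, cEb, cEc, ← sub_eq_add_neg]

theorem opF₂_ket {L M₁ M₂ J : ℤ} (h : Admissible L M₁ M₂ J) : opF₂ q (ket L M₁ M₂ J) =
    ((faca q (J - 2) (M₁ + 2) * coefa q L (M₂ - 2) (J - 2) : ℝ) : ℂ) •
      ket L (M₁ + 2) (M₂ - 2) (J - 2) +
    ((facb q J (M₁ + 2) * coefb q L (M₂ - 2) J : ℝ) : ℂ) • ket L (M₁ + 2) (M₂ - 2) J +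
    ((facc q (J + 2) (M₁ + 2) * coefc q L (M₂ - 2) (J + 2) : ℝ) : ℂ) •
      ket L (M₁ + 2) (M₂ - 2) (J + 2) := by
  rw [opF₂, LinearMap.add_apply, LinearMap.add_apply, sh_ket _ _ _ _ _ h, sh_ket _ _ _ _ _ h,
    sh_ket _ _ _ _ _ h]
  simp only [add_zero, cFa, cFb, cFc, ← sub_eq_add_neg]

theorem sqrt_qnum_ne (hq : q ∈ Set.Ioo (0 : ℝ) 1) {x y : ℝ} (hx : 0 < x) (hy : 0 < y) :
    √(qnum q x * qnum q y) ≠ 0 := (Real.sqrt_pos.2 (mul_pos (qnum_pos hq hx) (qnum_pos hq hy))).ne'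

theorem ket_mem_of_lowest (hq : q ∈ Set.Ioo (0 : ℝ) 1) {S : Submodule ℂ Spin}
    (s₁ : ∀ v ∈ S, opE₁ q v ∈ S) (s₂ : ∀ v ∈ S, opE₂ q v ∈ S) {L : ℤ}
    (h₀ : ket L (-1) (-L) 1 ∈ S) (M₁ M₂ J : ℤ) : ket L M₁ M₂ J ∈ S := by
  by_cases h : Admissible L M₁ M₂ J
  swap
  · rw [ket_of_not_adm h]; exact S.zero_mem
  have ha := admissible_iff.1 h
  obtain ⟨N, rfl⟩ : ∃ N : ℕ, L = 2 * N + 1 := ⟨(L / 2).toNat, by omega⟩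
  have key := ladder_mem S s₁ s₂ N
    (fun n r i => ket (2 * N + 1) (-(2 * n + 1) + 2 * i) (-(2 * N + 1 - 2 * n) + 2 * r) (2 * n + 1))
    (by simpa using h₀)
    (fun n r i hn hr hi => by
      have h1 : Admissible (2 * N + 1) (-(2 * n + 1) + 2 * i) (-(2 * N + 1 - 2 * n) + 2 * r)
        (2 * n + 1) := admissible_iff.2 (by omega)
      refine ⟨(fac₁ q (2 * n + 1) (-(2 * n + 1) + 2 * i) : ℂ), ?_, (opE₁_ket h1).trans ?_⟩
      · rw [fac_eq' fac₁_eq (2 * n + 1 - i) i (by ring) (by ring)]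
        exact Complex.ofReal_ne_zero.2 (sqrt_qnum_ne hq (Int.cast_pos.2 (by omega))
          (add_pos_of_nonneg_of_pos (Int.cast_nonneg (by omega)) one_pos))
      · congr 2
        push_cast; ring)
    (fun n hn => by
      have h1 : Admissible (2 * N + 1) (-(2 * n + 1) + 2 * (0 : ℕ)) (-(2 * N + 1 - 2 * n) + 2 * (0 : ℕ))
        (2 * n + 1) := admissible_iff.2 (by omega)
      refine ⟨((faca q (2 * n + 1) (-(2 * n + 1) + 2 * (0 : ℕ)) *
          coefa q (2 * N + 1) (-(2 * N + 1 - 2 * n) + 2 * (0 : ℕ)) (2 * n + 1) : ℝ) : ℂ), ?_,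
        (opE₂_ket h1).trans ?_⟩
      · refine Complex.ofReal_ne_zero.2 (mul_ne_zero ?_ (coefa_ne hq h1 (by omega)))
        rw [fac_eq' faca_eq (2 * n + 1) 0 (by ring) (by push_cast; ring)]
        refine sqrt_qnum_ne hq ?_ ?_ <;> norm_cast <;> omega
      · rw [fac_eq' facb_eq (2 * n + 1) 0 (by ring) (by push_cast; ring),
          fac_eq' facc_eq (2 * n + 1) 0 (by ring) (by push_cast; ring), Int.cast_zero, qnum_zero]
        simp only [zero_mul, Real.sqrt_zero, Complex.ofReal_zero, zero_smul, add_zero]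
        congr 2 <;> push_cast <;> ring)
    (fun n r hn hr => by
      have h1 : Admissible (2 * N + 1) (-(2 * n + 1) + 2 * (1 : ℕ)) (-(2 * N + 1 - 2 * n) + 2 * r)
        (2 * n + 1) := admissible_iff.2 (by omega)
      refine ⟨((facb q (2 * n + 1) (-(2 * n + 1) + 2 * (1 : ℕ)) *
          coefb q (2 * N + 1) (-(2 * N + 1 - 2 * n) + 2 * r) (2 * n + 1) : ℝ) : ℂ),
        ((faca q (2 * n + 1) (-(2 * n + 1) + 2 * (1 : ℕ)) *
          coefa q (2 * N + 1) (-(2 * N + 1 - 2 * n) + 2 * r) (2 * n + 1) : ℝ) : ℂ), ?_,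
        (opE₂_ket h1).trans ?_, ?_⟩
      · refine Complex.ofReal_ne_zero.2 (mul_ne_zero ?_ (coefb_ne hq h1 (by omega)))
        rw [fac_eq' facb_eq (2 * n) 1 (by ring) (by push_cast; ring)]
        refine sqrt_qnum_ne hq ?_ ?_ <;> norm_cast <;> omega
      · rw [fac_eq' facc_eq (2 * n) 1 (by ring) (by push_cast; ring), Int.cast_one, sub_self, qnum_zero]
        simp only [mul_zero, zero_mul, Real.sqrt_zero, Complex.ofReal_zero, zero_smul, add_zero]
        rw [add_comm]
        congr 3 <;> push_cast <;> ring
      · by_cases h2 : n < N ∧ r ≤ 2 * (N - (n + 1)) + 1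
        · exact Or.inr h2
        · exact Or.inl (ket_of_not_adm fun h3 => by rw [admissible_iff] at h3; omega))
    ((J / 2).toNat) (((2 * N + 1 + 1 - J + M₂) / 2).toNat) (((J + M₁) / 2).toNat)
    (by omega) (by omega) (by omega)
  convert key using 2 <;> omega

theorem ket_mem_of_highest (hq : q ∈ Set.Ioo (0 : ℝ) 1) {S : Submodule ℂ Spin}
    (s₁ : ∀ v ∈ S, opF₁ q v ∈ S) (s₂ : ∀ v ∈ S, opF₂ q v ∈ S) {L : ℤ}
    (h₀ : ket L 1 L 1 ∈ S) (M₁ M₂ J : ℤ) : ket L M₁ M₂ J ∈ S := by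
  by_cases h : Admissible L M₁ M₂ J
  swap
  · rw [ket_of_not_adm h]; exact S.zero_mem
  have ha := admissible_iff.1 h
  obtain ⟨N, rfl⟩ : ∃ N : ℕ, L = 2 * N + 1 := ⟨(L / 2).toNat, by omega⟩
  have key := ladder_mem S s₁ s₂ N
    (fun n r i => ket (2 * N + 1) (2 * n + 1 - 2 * i) (2 * N + 1 - 2 * n - 2 * r) (2 * n + 1))
    (by simpa using h₀)
    (fun n r i hn hr hi => by
      have h1 : Admissible (2 * N + 1) (2 * n + 1 - 2 * i) (2 * N + 1 - 2 * n - 2 * r)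
        (2 * n + 1) := admissible_iff.2 (by omega)
      refine ⟨(fac₁ q (2 * n + 1) (2 * n + 1 - 2 * i - 2) : ℂ), ?_, (opF₁_ket h1).trans ?_⟩
      · rw [fac_eq' fac₁_eq (i + 1) (2 * n - i) (by ring) (by ring)]
        refine Complex.ofReal_ne_zero.2 (sqrt_qnum_ne hq ?_ ?_) <;> norm_cast <;> omega
      · congr 2
        push_cast; ring)
    (fun n hn => by
      have h1 : Admissible (2 * N + 1) (2 * n + 1 - 2 * (0 : ℕ)) (2 * N + 1 - 2 * n - 2 * (0 : ℕ))
        (2 * n + 1) := admissible_iff.2 (by omega)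
      refine ⟨((facc q (2 * n + 1 + 2) (2 * n + 1 - 2 * (0 : ℕ) + 2) *
          coefc q (2 * N + 1) (2 * N + 1 - 2 * n - 2 * (0 : ℕ) - 2) (2 * n + 1 + 2) : ℝ) : ℂ), ?_,
        (opF₂_ket h1).trans ?_⟩
      · refine Complex.ofReal_ne_zero.2 (mul_ne_zero ?_ (coefc_sub_ne hq h1 (by omega)))
        rw [fac_eq' facc_eq 0 (2 * n + 1 + 2) (by ring) (by push_cast; ring)]
        refine sqrt_qnum_ne hq ?_ ?_ <;> push_cast <;> linarith
      · rw [fac_eq' facb_eq (-1) (2 * n + 2) (by ring) (by push_cast; ring),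
          fac_eq' faca_eq (-2) (2 * n + 1) (by ring) (by push_cast; ring)]
        push_cast
        norm_num [qnum_zero]
        congr 2
        ring)
    (fun n r hn hr => by
      have h1 : Admissible (2 * N + 1) (2 * n + 1 - 2 * (1 : ℕ)) (2 * N + 1 - 2 * n - 2 * r)
        (2 * n + 1) := admissible_iff.2 (by omega)
      refine ⟨((facb q (2 * n + 1) (2 * n + 1 - 2 * (1 : ℕ) + 2) *
          coefb q (2 * N + 1) (2 * N + 1 - 2 * n - 2 * r - 2) (2 * n + 1) : ℝ) : ℂ),
        ((facc q (2 * n + 1 + 2) (2 * n + 1 - 2 * (1 : ℕ) + 2) *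
          coefc q (2 * N + 1) (2 * N + 1 - 2 * n - 2 * r - 2) (2 * n + 1 + 2) : ℝ) : ℂ), ?_,
        (opF₂_ket h1).trans ?_, ?_⟩
      · refine Complex.ofReal_ne_zero.2 (mul_ne_zero ?_ (coefb_sub_ne hq h1 (by omega)))
        rw [fac_eq' facb_eq 0 (2 * n + 1) (by ring) (by push_cast; ring)]
        refine sqrt_qnum_ne hq ?_ ?_ <;> push_cast <;> linarith
      · rw [fac_eq' faca_eq (-1) (2 * n) (by ring) (by push_cast; ring), Int.cast_neg, Int.cast_one,
          neg_add_cancel, qnum_zero]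
        simp only [mul_zero, zero_mul, Real.sqrt_zero, Complex.ofReal_zero, zero_smul, zero_add]
        congr 3 <;> push_cast <;> ring
      · by_cases h2 : n < N ∧ r ≤ 2 * (N - (n + 1)) + 1
        · exact Or.inr h2
        · exact Or.inl (ket_of_not_adm fun h3 => by rw [admissible_iff] at h3; omega))
    ((J / 2).toNat) (((2 * N + 1 + 1 - J - M₂) / 2).toNat) (((J - M₁) / 2).toNat)
    (by omega) (by omega) (by omega)
  convert key using 2 <;> omega

theorem eq_zero_of_highest (hq : q ∈ Set.Ioo (0 : ℝ) 1) {T : Module.End ℂ Spin}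
    (h₁ : ∀ v, T v = 0 → T (opF₁ q v) = 0) (h₂ : ∀ v, T v = 0 → T (opF₂ q v) = 0)
    (h₀ : ∀ L, Admissible L 1 L 1 → T (ket L 1 L 1) = 0) : T = 0 :=
  end_ext fun L M₁ M₂ J h => ket_mem_of_highest hq (S := LinearMap.ker T) h₁ h₂
    (h₀ L (by rw [admissible_iff] at *; omega)) M₁ M₂ J

end

/-! ### Weights -/

/-- The span of the basis vectors with given `L`, `M₁`, `M₂`. -/
noncomputable def wspace (L M₁ M₂ : ℤ) : Submodule ℂ Spin :=
  Submodule.span ℂ (Set.range fun J => ket L M₁ M₂ J)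

theorem ket_mem_wspace (L M₁ M₂ J : ℤ) : ket L M₁ M₂ J ∈ wspace L M₁ M₂ :=
  Submodule.subset_span ⟨J, rfl⟩

theorem wspace_eq_bot {L M₁ M₂ : ℤ} (h : ∀ J, ¬Admissible L M₁ M₂ J) : wspace L M₁ M₂ = ⊥ := by
  rw [wspace, Submodule.span_eq_bot]
  rintro _ ⟨J, rfl⟩
  exact ket_of_not_adm (h J)

/-- `T` shifts the labels `L`, `M₁`, `M₂` by `a`, `b`, `c`. -/
def Shifts (a b c : ℤ) (T : Module.End ℂ Spin) : Prop :=
  ∀ L M₁ M₂, ∀ v ∈ wspace L M₁ M₂, T v ∈ wspace (L + a) (M₁ + b) (M₂ + c)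

namespace Shifts

variable {a b c a' b' c' : ℤ} {T T' : Module.End ℂ Spin}

theorem of_ket (h : ∀ L M₁ M₂ J, Admissible L M₁ M₂ J →
    T (ket L M₁ M₂ J) ∈ wspace (L + a) (M₁ + b) (M₂ + c)) : Shifts a b c T := by
  intro L M₁ M₂ v hv
  suffices H : wspace L M₁ M₂ ≤ (wspace (L + a) (M₁ + b) (M₂ + c)).comap T from H hv
  refine Submodule.span_le.2 ?_
  rintro _ ⟨J, rfl⟩
  by_cases hJ : Admissible L M₁ M₂ J
  · exact h _ _ _ _ hJ
  · change T (ket L M₁ M₂ J) ∈ wspace (L + a) (M₁ + b) (M₂ + c)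
    rw [ket_of_not_adm hJ, map_zero]
    exact Submodule.zero_mem _

theorem add (h : Shifts a b c T) (h' : Shifts a b c T') : Shifts a b c (T + T') :=
  fun L M₁ M₂ v hv => Submodule.add_mem _ (h _ _ _ v hv) (h' _ _ _ v hv)

theorem sub (h : Shifts a b c T) (h' : Shifts a b c T') : Shifts a b c (T - T') :=
  fun L M₁ M₂ v hv => Submodule.sub_mem _ (h _ _ _ v hv) (h' _ _ _ v hv)

theorem smul (h : Shifts a b c T) (r : ℂ) : Shifts a b c (r • T) :=
  fun L M₁ M₂ v hv => Submodule.smul_mem _ _ (h _ _ _ v hv)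

theorem mul' (h : Shifts a b c T) (h' : Shifts a' b' c' T') :
    Shifts (a' + a) (b' + b) (c' + c) (T * T') :=
  fun L M₁ M₂ v hv => by
    rw [← add_assoc, ← add_assoc, ← add_assoc]
    exact h _ _ _ _ (h' _ _ _ v hv)

theorem mul {a'' b'' c'' : ℤ} (h : Shifts a b c T) (h' : Shifts a' b' c' T')
    (ha : a' + a = a'' := by rfl) (hb : b' + b = b'' := by rfl) (hc : c' + c = c'' := by rfl) :
    Shifts a'' b'' c'' (T * T') := ha ▸ hb ▸ hc ▸ h.mul' h'

end Shifts

theorem shifts_sh (a b c d : ℤ) (f : ℤ → ℤ → ℤ → ℤ → ℝ) : Shifts a b c (sh a b c d f) :=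
  Shifts.of_ket fun L M₁ M₂ J h => by
    rw [sh_ket _ _ _ _ _ h]
    exact Submodule.smul_mem _ _ (ket_mem_wspace _ _ _ _)

section

variable {q : ℝ}

theorem shifts_E₁ : Shifts 0 2 0 (opE₁ q) := by rw [opE₁_eq]; exact shifts_sh _ _ _ _ _
theorem shifts_E₂ : Shifts 0 (-2) 2 (opE₂ q) := by
  rw [opE₂_eq]
  exact ((shifts_sh _ _ _ _ _).add (shifts_sh _ _ _ _ _)).add (shifts_sh _ _ _ _ _)

end



theorem mul_reassoc {P : Type} [Semigroup P] {a b c : P} (h : a * b = c) (x : P) :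
    a * (b * x) = c * x := by rw [← mul_assoc, h]

/-- The relations between the generators of `U_q(so(5))` other than the Serre relations. -/
structure PreSerre (q : ℝ) {P : Type} [Ring P] [Algebra ℂ P] (E₁ E₂ F₁ F₂ K₁ K₂ L₁ L₂ : P) :
    Prop where
  K₁L₁ : K₁ * L₁ = 1
  L₁K₁ : L₁ * K₁ = 1
  K₂L₂ : K₂ * L₂ = 1
  L₂K₂ : L₂ * K₂ = 1
  K₁K₂ : K₁ * K₂ = K₂ * K₁
  K₁E₁ : K₁ * E₁ = (q : ℂ) • (E₁ * K₁)
  K₁E₂ : K₁ * E₂ = (q : ℂ)⁻¹ • (E₂ * K₁)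
  K₂E₁ : K₂ * E₁ = (q : ℂ)⁻¹ • (E₁ * K₂)
  K₂E₂ : K₂ * E₂ = (q : ℂ) ^ 2 • (E₂ * K₂)
  F₁K₁ : F₁ * K₁ = (q : ℂ) • (K₁ * F₁)
  F₂K₁ : F₂ * K₁ = (q : ℂ)⁻¹ • (K₁ * F₂)
  F₁K₂ : F₁ * K₂ = (q : ℂ)⁻¹ • (K₂ * F₁)
  F₂K₂ : F₂ * K₂ = (q : ℂ) ^ 2 • (K₂ * F₂)
  E₁F₁ : E₁ * F₁ = F₁ * E₁ + ((q : ℂ) - (q : ℂ)⁻¹)⁻¹ • (K₁ ^ 2 - L₁ ^ 2)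
  E₂F₂ : E₂ * F₂ = F₂ * E₂ + ((q : ℂ) ^ 2 - ((q : ℂ) ^ 2)⁻¹)⁻¹ • (K₂ ^ 2 - L₂ ^ 2)
  E₁F₂ : E₁ * F₂ = F₂ * E₁
  E₂F₁ : E₂ * F₁ = F₁ * E₂

namespace PreSerre

theorem inv_comm {P : Type} [Ring P] [Algebra ℂ P] {K L X : P} {c d : ℂ} (hd : d * c = 1)
    (h₁ : K * L = 1) (h₂ : L * K = 1) (h : K * X = c • (X * K)) : L * X = d • (X * L) := by
  have : X * L = c • (L * X) := by
    calc X * L = L * (K * X) * L := by rw [← mul_assoc, h₂, one_mul]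
      _ = c • (L * X) := by rw [h, mul_smul_comm, smul_mul_assoc, mul_assoc, mul_assoc, h₁, mul_one]
  rw [this, smul_smul, hd, one_smul]

variable {q : ℝ} {P : Type} [Ring P] [Algebra ℂ P] {E₁ E₂ F₁ F₂ K₁ K₂ L₁ L₂ : P}

theorem L₁E₁ (h : PreSerre q E₁ E₂ F₁ F₂ K₁ K₂ L₁ L₂) (q0 : (q : ℂ) ≠ 0) :
    L₁ * E₁ = (q : ℂ)⁻¹ • (E₁ * L₁) := inv_comm (by field_simp) h.K₁L₁ h.L₁K₁ h.K₁E₁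
theorem L₁E₂ (h : PreSerre q E₁ E₂ F₁ F₂ K₁ K₂ L₁ L₂) (q0 : (q : ℂ) ≠ 0) :
    L₁ * E₂ = (q : ℂ) • (E₂ * L₁) := inv_comm (by field_simp) h.K₁L₁ h.L₁K₁ h.K₁E₂
theorem L₂E₁ (h : PreSerre q E₁ E₂ F₁ F₂ K₁ K₂ L₁ L₂) (q0 : (q : ℂ) ≠ 0) :
    L₂ * E₁ = (q : ℂ) • (E₁ * L₂) := inv_comm (by field_simp) h.K₂L₂ h.L₂K₂ h.K₂E₁
theorem L₂E₂ (h : PreSerre q E₁ E₂ F₁ F₂ K₁ K₂ L₁ L₂) (q0 : (q : ℂ) ≠ 0) :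
    L₂ * E₂ = ((q : ℂ) ^ 2)⁻¹ • (E₂ * L₂) := inv_comm (by field_simp) h.K₂L₂ h.L₂K₂ h.K₂E₂

theorem F₁E₁ (h : PreSerre q E₁ E₂ F₁ F₂ K₁ K₂ L₁ L₂) :
    F₁ * E₁ = E₁ * F₁ - ((q : ℂ) - (q : ℂ)⁻¹)⁻¹ • (K₁ * K₁ - L₁ * L₁) := by
  rw [h.E₁F₁, pow_two, pow_two, add_sub_cancel_right]

theorem F₂E₂ (h : PreSerre q E₁ E₂ F₁ F₂ K₁ K₂ L₁ L₂) :
    F₂ * E₂ = E₂ * F₂ - ((q : ℂ) ^ 2 - ((q : ℂ) ^ 2)⁻¹)⁻¹ • (K₂ * K₂ - L₂ * L₂) := by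
  rw [h.E₂F₂, pow_two K₂, pow_two L₂, add_sub_cancel_right]

theorem serre_comm (h : PreSerre q E₁ E₂ F₁ F₂ K₁ K₂ L₁ L₂) (q0 : (q : ℂ) ≠ 0)
    (q2 : (q : ℂ) ^ 2 - 1 ≠ 0) (q4 : (q : ℂ) ^ 2 + 1 ≠ 0) :
    F₁ * serre₁ q E₁ E₂ = serre₁ q E₁ E₂ * F₁ ∧ F₂ * serre₁ q E₁ E₂ = serre₁ q E₁ E₂ * F₂ ∧
    F₁ * serre₂ q E₁ E₂ = serre₂ q E₁ E₂ * F₁ ∧ F₂ * serre₂ q E₁ E₂ = serre₂ q E₁ E₂ * F₂ := by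
  have e1 : ((q : ℂ) - (q : ℂ)⁻¹)⁻¹ = q / (q ^ 2 - 1) := by field_simp
  have q8 : (q : ℂ) ^ 4 - 1 ≠ 0 := by
    rw [show (q : ℂ) ^ 4 - 1 = (q ^ 2 - 1) * (q ^ 2 + 1) by ring]; exact mul_ne_zero q2 q4
  have e2 : ((q : ℂ) ^ 2 - ((q : ℂ) ^ 2)⁻¹)⁻¹ = q ^ 2 / (q ^ 4 - 1) := by field_simp
  refine ⟨?_, ?_, ?_, ?_⟩
  all_goals
    simp only [serre₁, serre₂, pow_succ, pow_zero, one_mul, mul_assoc, mul_add, add_mul, mul_sub, sub_mul, mul_smul_comm,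
      smul_mul_assoc, smul_add, smul_sub, h.F₁E₁, mul_reassoc h.F₁E₁, h.F₂E₂, mul_reassoc h.F₂E₂,
      ← h.E₁F₂, mul_reassoc h.E₁F₂.symm, ← h.E₂F₁, mul_reassoc h.E₂F₁.symm,
      h.K₁E₁, mul_reassoc h.K₁E₁, h.K₁E₂, mul_reassoc h.K₁E₂, h.K₂E₁, mul_reassoc h.K₂E₁,
      h.K₂E₂, mul_reassoc h.K₂E₂, h.L₁E₁ q0, mul_reassoc (h.L₁E₁ q0), h.L₁E₂ q0,
      mul_reassoc (h.L₁E₂ q0), h.L₂E₁ q0, mul_reassoc (h.L₂E₁ q0), h.L₂E₂ q0,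
      mul_reassoc (h.L₂E₂ q0), smul_smul]
    simp only [← pow_succ, ← pow_two, e1, e2]
    match_scalars <;> field_simp <;> ring

end PreSerre

theorem Uq.induction {q : ℝ} {p : Uq q → Prop} (hc : ∀ c, p (algebraMap ℂ _ c))
    (hg : ∀ x, p (Uq.gen q x)) (hm : ∀ a b, p a → p b → p (a * b))
    (ha : ∀ a b, p a → p b → p (a + b)) (a : Uq q) : p a := by
  obtain ⟨b, rfl⟩ : ∃ b : FreeAlgebra ℂ UGen, (RingQuot.mkAlgHom ℂ (URel q) b : Uq q) = a :=
    RingQuot.mkAlgHom_surjective ℂ (URel q) a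
  induction b using FreeAlgebra.induction with
  | grade0 c => rw [AlgHom.commutes]; exact hc c
  | grade1 x => exact hg x
  | mul a b h₁ h₂ => rw [map_mul]; exact hm _ _ h₁ h₂
  | add a b h₁ h₂ => rw [map_add]; exact ha _ _ h₁ h₂

section

variable {q : ℝ}

theorem preSerre_op (hq : q ∈ Set.Ioo (0 : ℝ) 1) : PreSerre q (opE₁ q) (opE₂ q) (opF₁ q) (opF₂ q)
    (opK₁ q) (opK₂ q) (opKi₁ q) (opKi₂ q) where
  K₁L₁ := (opK₁_opKi₁ hq.1).1
  L₁K₁ := (opK₁_opKi₁ hq.1).2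
  K₂L₂ := (opK₂_opKi₂ hq.1).1
  L₂K₂ := (opK₂_opKi₂ hq.1).2
  K₁K₂ := opK₁_opK₂
  K₁E₁ := opK₁_E₁ hq.1
  K₁E₂ := opK₁_E₂ hq.1
  K₂E₁ := opK₂_E₁ hq.1
  K₂E₂ := opK₂_E₂ hq.1
  F₁K₁ := by
    have := ((opK₁_isAdj (q := q)).mul (opF₁_isAdj q)).eq_of_eq
      (((opF₁_isAdj q).mul opK₁_isAdj).smul_real q) (opK₁_E₁ hq.1)
    exact this
  F₂K₁ := by
    have := ((opK₁_isAdj (q := q)).mul (opF₂_isAdj q)).eq_of_eq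
      (((opF₂_isAdj q).mul opK₁_isAdj).smul_real q⁻¹) (by rw [opK₁_E₂ hq.1, Complex.ofReal_inv])
    rwa [Complex.ofReal_inv] at this
  F₁K₂ := by
    have := ((opK₂_isAdj (q := q)).mul (opF₁_isAdj q)).eq_of_eq
      (((opF₁_isAdj q).mul opK₂_isAdj).smul_real q⁻¹) (by rw [opK₂_E₁ hq.1, Complex.ofReal_inv])
    rwa [Complex.ofReal_inv] at this
  F₂K₂ := by
    have := ((opK₂_isAdj (q := q)).mul (opF₂_isAdj q)).eq_of_eq
      (((opF₂_isAdj q).mul opK₂_isAdj).smul_real (q ^ 2)) (by rw [opK₂_E₂ hq.1, Complex.ofReal_pow])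
    rwa [Complex.ofReal_pow] at this
  E₁F₁ := opE₁_F₁ hq
  E₂F₂ := opE₂_F₂ hq
  E₁F₂ := (((opF₁_isAdj q).symm.mul (opF₂_isAdj q)).eq_of_eq
    ((opF₂_isAdj q).mul (opF₁_isAdj q).symm) (opE₂_F₁ hq).symm).symm
  E₂F₁ := opE₂_F₁ hq

theorem eq_zero_of_comm_F (hq : q ∈ Set.Ioo (0 : ℝ) 1) {T : Module.End ℂ Spin}
    (h₁ : opF₁ q * T = T * opF₁ q) (h₂ : opF₂ q * T = T * opF₂ q) {b c : ℤ}
    (h₀ : Shifts 0 b c T) (hc : 2 ≤ c) : T = 0 := by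
  refine eq_zero_of_highest hq (fun v hv => ?_) (fun v hv => ?_) fun L _ => ?_
  · rw [← Module.End.mul_apply, ← h₁, Module.End.mul_apply, hv, map_zero]
  · rw [← Module.End.mul_apply, ← h₂, Module.End.mul_apply, hv, map_zero]
  · have := h₀ _ _ _ _ (ket_mem_wspace L 1 L 1)
    rwa [wspace_eq_bot (fun J hJ => by rw [admissible_iff] at hJ; omega), Submodule.mem_bot] at this

theorem ofReal_ne (hq : q ∈ Set.Ioo (0 : ℝ) 1) : (q : ℂ) ≠ 0 := Complex.ofReal_ne_zero.2 hq.1.ne'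

theorem ofReal_sq_sub_one_ne (hq : q ∈ Set.Ioo (0 : ℝ) 1) : (q : ℂ) ^ 2 - 1 ≠ 0 := by
  exact_mod_cast one_sub_sq_ne hq

theorem ofReal_sq_add_one_ne (q : ℝ) : (q : ℂ) ^ 2 + 1 ≠ 0 := by
  have : q ^ 2 + 1 ≠ 0 := by positivity
  exact_mod_cast this

theorem serre_E (hq : q ∈ Set.Ioo (0 : ℝ) 1) :
    serre₁ q (opE₁ q) (opE₂ q) = 0 ∧ serre₂ q (opE₁ q) (opE₂ q) = 0 := by
  have h := (preSerre_op hq).serre_comm (ofReal_ne hq) (ofReal_sq_sub_one_ne hq)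
    (ofReal_sq_add_one_ne q)
  have s1 := shifts_E₁ (q := q)
  have s2 := shifts_E₂ (q := q)
  constructor
  · refine eq_zero_of_comm_F hq h.1 h.2.1 (b := -2) (c := 4) ?_ (by norm_num)
    unfold serre₁
    simp only [pow_two]
    exact Shifts.add (Shifts.sub (Shifts.mul s1 (Shifts.mul s2 s2))
      ((Shifts.mul (Shifts.mul s2 s1) s2).smul _)) (Shifts.mul (Shifts.mul s2 s2) s1)
  · refine eq_zero_of_comm_F hq h.2.2.1 h.2.2.2 (b := 4) (c := 2) ?_ (by norm_num)
    unfold serre₂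
    simp only [pow_succ, pow_zero, one_mul]
    have s11 := s1.mul' s1
    have s111 := s11.mul' s1
    exact Shifts.sub (Shifts.sub (Shifts.mul s111 s2)
      ((Shifts.sub (Shifts.mul (Shifts.mul s11 s2) s1) (Shifts.mul (Shifts.mul s1 s2) s11)).smul _))
      (Shifts.mul s2 s111)

theorem IsAdj.serre {ι : Type} {a b a' b' : Module.End ℂ (ι →₀ ℂ)} (ha : IsAdj a a') (hb : IsAdj b b') :
    IsAdj (serre₁ q a b) (serre₁ q a' b') ∧ IsAdj (serre₂ q a b) (-serre₂ q a' b') := by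
  have c1 : ((q : ℂ) ^ 2 + ((q : ℂ) ^ 2)⁻¹) = ((q ^ 2 + (q ^ 2)⁻¹ : ℝ) : ℂ) := by push_cast; rfl
  have c2 : ((q : ℂ) ^ 2 + 1 + ((q : ℂ) ^ 2)⁻¹) = ((q ^ 2 + 1 + (q ^ 2)⁻¹ : ℝ) : ℂ) := by
    push_cast; rfl
  constructor
  · have h := ((ha.mul (hb.mul hb)).sub (((hb.mul ha).mul hb).smul_real (q ^ 2 + (q ^ 2)⁻¹))).add
      ((hb.mul hb).mul ha)
    have e : serre₁ q a' b' = b' * b' * a' - ((q ^ 2 + (q ^ 2)⁻¹ : ℝ) : ℂ) • (b' * (a' * b')) +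
        a' * (b' * b') := by
      rw [serre₁, c1, pow_two, mul_assoc b' a' b']; abel
    rw [e, serre₁, c1, pow_two]
    exact h
  · have h := ((((ha.mul ha).mul ha).mul hb).sub (((((ha.mul ha).mul hb).mul ha).sub
      ((ha.mul hb).mul (ha.mul ha))).smul_real (q ^ 2 + 1 + (q ^ 2)⁻¹))).sub
      (hb.mul ((ha.mul ha).mul ha))
    have e : -serre₂ q a' b' = b' * (a' * (a' * a')) - ((q ^ 2 + 1 + (q ^ 2)⁻¹ : ℝ) : ℂ) •
        (a' * (b' * (a' * a')) - a' * a' * (b' * a')) - a' * (a' * a') * b' := by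
      rw [serre₂, c2]
      simp only [pow_succ, pow_zero, one_mul, mul_assoc]
      module
    have a2 : a ^ 2 = a * a := pow_two a
    have a3 : a ^ 3 = a * a * a := by rw [pow_succ, a2]
    rw [e, serre₂, c2, a2, a3]
    exact h

theorem serre_F (hq : q ∈ Set.Ioo (0 : ℝ) 1) :
    serre₁ q (opF₁ q) (opF₂ q) = 0 ∧ serre₂ q (opF₁ q) (opF₂ q) = 0 := by
  have h := IsAdj.serre (q := q) (opF₁_isAdj q) (opF₂_isAdj q)
  rw [(serre_E hq).1, (serre_E hq).2] at h
  refine ⟨h.1.eq IsAdj.zero, ?_⟩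
  exact (neg_eq_zero (α := Module.End ℂ Spin)).1 (h.2.eq IsAdj.zero)

variable (q) in
/-- The operators representing the generators of `U_q(so(5))`. -/
noncomputable def opU : UGen → Module.End ℂ Spin
  | UGen.K 0 => opK₁ q
  | UGen.K 1 => opK₂ q
  | UGen.Kinv 0 => opKi₁ q
  | UGen.Kinv 1 => opKi₂ q
  | UGen.E 0 => opE₁ q
  | UGen.E 1 => opE₂ q
  | UGen.F 0 => opF₁ q
  | UGen.F 1 => opF₂ q

/-- The representation `σ`. -/
noncomputable def spinRep (hq : q ∈ Set.Ioo (0 : ℝ) 1) : Uq q →ₐ[ℂ] Module.End ℂ Spin :=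
  Uq.lift q (opU q) <| by
    have h := preSerre_op hq
    intro a b hab
    cases hab with
    | KK => simpa [opU] using h.K₁K₂
    | KKinv i => fin_cases i <;> simp [opU, h.K₁L₁, h.K₂L₂]
    | KinvK i => fin_cases i <;> simp [opU, h.L₁K₁, h.L₂K₂]
    | EF i =>
      fin_cases i
      · simpa [opU] using sub_eq_iff_eq_add'.2 h.E₁F₁
      · simpa [opU] using sub_eq_iff_eq_add'.2 h.E₂F₂
    | EF_ne i j hij =>
      fin_cases i <;> fin_cases j <;> simp [opU, h.E₁F₂, h.E₂F₁] at hij ⊢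
    | KE i => fin_cases i <;> simp [opU, h.K₁E₁, h.K₂E₂, -Complex.coe_smul]
    | FK i => fin_cases i <;> simp [opU, h.F₁K₁, h.F₂K₂, -Complex.coe_smul]
    | KE_ne i j hij =>
      fin_cases i <;> fin_cases j <;> simp [opU, h.K₁E₂, h.K₂E₁, -Complex.coe_smul] at hij ⊢
    | FK_ne i j hij =>
      fin_cases i <;> fin_cases j <;> simp [opU, h.F₁K₂, h.F₂K₁, -Complex.coe_smul] at hij ⊢
    | serreE₁ =>
      rw [map_zero]
      refine (map_serre₁ q (FreeAlgebra.lift ℂ (opU q)) _ _).trans ?_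
      rw [FreeAlgebra.lift_ι_apply, FreeAlgebra.lift_ι_apply]
      exact (serre_E hq).1
    | serreF₁ =>
      rw [map_zero]
      refine (map_serre₁ q (FreeAlgebra.lift ℂ (opU q)) _ _).trans ?_
      rw [FreeAlgebra.lift_ι_apply, FreeAlgebra.lift_ι_apply]
      exact (serre_F hq).1
    | serreE₂ =>
      rw [map_zero]
      refine (map_serre₂ q (FreeAlgebra.lift ℂ (opU q)) _ _).trans ?_
      rw [FreeAlgebra.lift_ι_apply, FreeAlgebra.lift_ι_apply]
      exact (serre_E hq).2
    | serreF₂ =>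
      rw [map_zero]
      refine (map_serre₂ q (FreeAlgebra.lift ℂ (opU q)) _ _).trans ?_
      rw [FreeAlgebra.lift_ι_apply, FreeAlgebra.lift_ι_apply]
      exact (serre_F hq).2

theorem spinRep_gen (hq : q ∈ Set.Ioo (0 : ℝ) 1) (h : UGen) :
    spinRep hq (Uq.gen q h) = opU q h := Uq.lift_gen q _ _ h

theorem opU_isAdj (h : UGen) : IsAdj (opU q h) (opU q h.star) := by
  cases h with
  | K i => fin_cases i; exacts [opK₁_isAdj, opK₂_isAdj]
  | Kinv i => fin_cases i; exacts [opKi₁_isAdj, opKi₂_isAdj]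
  | E i => fin_cases i; exacts [opF₁_isAdj q, opF₂_isAdj q]
  | F i => fin_cases i; exacts [(opF₁_isAdj q).symm, (opF₂_isAdj q).symm]

theorem spinRep_isSpinRep (hq : q ∈ Set.Ioo (0 : ℝ) 1) : IsSpinRep q (spinRep hq) where
  K₁ := spinRep_gen hq _
  K₂ := spinRep_gen hq _
  E₁ := spinRep_gen hq _
  E₂ := spinRep_gen hq _
  star := by
    suffices h : ∀ a, IsAdj (spinRep hq a) (spinRep hq (star a)) from fun a => h a
    intro a
    induction a using Uq.induction with
    | hc c => rw [← algebraMap_star_comm, AlgHom.commutes, AlgHom.commutes]; exact IsAdj.algebraMap c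
    | hg x => rw [Uq.star_gen, spinRep_gen, spinRep_gen]; exact opU_isAdj x
    | hm a b h₁ h₂ => rw [star_mul, map_mul, map_mul]; exact h₁.mul h₂
    | ha a b h₁ h₂ => rw [star_add, map_add, map_add]; exact h₁.add h₂

end



/-- The relations which say that `x₂` is a highest weight vector and that `x₁`, `x₀` are obtained from
it by the action of `F₂`, `F₁`. Here `h² = q`. -/
structure HighRel (q : ℝ) (h : ℂ) {P : Type} [Ring P] [Algebra ℂ P] (E₁ E₂ F₁ F₂ K₁ K₂ x₀ x₁ x₂ : P) :
    Prop where
  E₁x₂ : E₁ * x₂ = x₂ * E₁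
  F₁x₂ : F₁ * x₂ = x₂ * F₁
  E₂x₂ : E₂ * x₂ = (q : ℂ)⁻¹ • (x₂ * E₂)
  F₂x₂ : F₂ * x₂ = x₁ * K₂ + (q : ℂ)⁻¹ • (x₂ * F₂)
  F₁x₁ : F₁ * x₁ = (h * (q + (q : ℂ)⁻¹)) • (x₀ * K₁) + (q : ℂ)⁻¹ • (x₁ * F₁)
  K₁x₂ : K₁ * x₂ = x₂ * K₁
  K₂x₂ : K₂ * x₂ = (q : ℂ) • (x₂ * K₂)

/-- The commutation relations of the generators of `U_q(so(5))` with `x₀`, `x₁`, `x₂`, apart from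
those of `F₁` with `x₀` and of `F₂` with `x₀`, `x₁`. -/
structure XRel (q : ℝ) (h : ℂ) {P : Type} [Ring P] [Algebra ℂ P] (E₁ E₂ F₁ F₂ K₁ K₂ x₀ x₁ x₂ : P) :
    Prop extends HighRel q h E₁ E₂ F₁ F₂ K₁ K₂ x₀ x₁ x₂ where
  K₁x₁ : K₁ * x₁ = (q : ℂ) • (x₁ * K₁)
  K₂x₁ : K₂ * x₁ = (q : ℂ)⁻¹ • (x₁ * K₂)
  K₁x₀ : K₁ * x₀ = x₀ * K₁
  K₂x₀ : K₂ * x₀ = x₀ * K₂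
  E₁x₁ : E₁ * x₁ = (q : ℂ)⁻¹ • (x₁ * E₁)
  E₂x₁ : E₂ * x₁ = x₂ * K₂ + (q : ℂ) • (x₁ * E₂)
  E₁x₀ : E₁ * x₀ = h⁻¹ • (x₁ * K₁) + x₀ * E₁
  E₂x₀ : E₂ * x₀ = x₀ * E₂

theorem mul_right_cancel_of_inv {P : Type} [Ring P] {A B K L : P} (h : K * L = 1)
    (e : A * K = B * K) : A = B := by
  have := congrArg (· * L) e
  simpa only [mul_assoc, h, mul_one] using this

section

variable {q : ℝ} {h : ℂ} {P : Type} [Ring P] [Algebra ℂ P] {E₁ E₂ F₁ F₂ K₁ K₂ L₁ L₂ x₀ x₁ x₂ : P}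

theorem smul_inv_comm {P : Type} [AddCommGroup P] [Module ℂ P] {a b : P} {c : ℂ} (hc : c ≠ 0)
    (e : a = c • b) : b = c⁻¹ • a := by rw [e, smul_smul, inv_mul_cancel₀ hc, one_smul]

theorem HighRel.xRel (H : HighRel q h E₁ E₂ F₁ F₂ K₁ K₂ x₀ x₁ x₂)
    (u : PreSerre q E₁ E₂ F₁ F₂ K₁ K₂ L₁ L₂) (hh : (q : ℂ) = h ^ 2) (h0 : h ≠ 0)
    (q2 : (q : ℂ) ^ 2 - 1 ≠ 0) (q4 : (q : ℂ) ^ 2 + 1 ≠ 0) :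
    XRel q h E₁ E₂ F₁ F₂ K₁ K₂ x₀ x₁ x₂ := by
  have q0 : (q : ℂ) ≠ 0 := by rw [hh]; exact pow_ne_zero 2 h0
  have q2' : h ^ 4 - 1 ≠ 0 := by rwa [hh, ← pow_mul] at q2
  have q4' : h ^ 4 + 1 ≠ 0 := by rwa [hh, ← pow_mul] at q4
  have q8 : h ^ 8 - 1 ≠ 0 := by
    rw [show h ^ 8 - 1 = (h ^ 4 - 1) * (h ^ 4 + 1) by ring]; exact mul_ne_zero q2' q4'
  have e1 : ((q : ℂ) - (q : ℂ)⁻¹)⁻¹ = h ^ 2 / (h ^ 4 - 1) := by rw [hh]; field_simp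
  have e2 : ((q : ℂ) ^ 2 - ((q : ℂ) ^ 2)⁻¹)⁻¹ = h ^ 4 / (h ^ 8 - 1) := by rw [hh]; field_simp
  have e3 : h * ((q : ℂ) + (q : ℂ)⁻¹) = (h ^ 4 + 1) / h := by rw [hh]; field_simp
  have c0 : (h ^ 4 + 1) / h ≠ 0 := div_ne_zero q4' h0
  have k1f1 := smul_inv_comm q0 u.F₁K₁
  have k1f2 := smul_inv_comm (inv_ne_zero q0) u.F₂K₁
  have k2f1 := smul_inv_comm (inv_ne_zero q0) u.F₁K₂
  have k2f2 := smul_inv_comm (pow_ne_zero 2 q0) u.F₂K₂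
  have e1k1 := smul_inv_comm q0 u.K₁E₁
  have e1k2 := smul_inv_comm (inv_ne_zero q0) u.K₂E₁
  have e2k1 := smul_inv_comm (inv_ne_zero q0) u.K₁E₂
  have e2k2 := smul_inv_comm (pow_ne_zero 2 q0) u.K₂E₂
  have x1k2 : x₁ * K₂ = F₂ * x₂ - (q : ℂ)⁻¹ • (x₂ * F₂) := by rw [H.F₂x₂]; abel
  have x0k1 : x₀ * K₁ = ((h ^ 4 + 1) / h)⁻¹ • (F₁ * x₁ - (q : ℂ)⁻¹ • (x₁ * F₁)) := by
    rw [H.F₁x₁, e3, add_sub_cancel_right, smul_smul, inv_mul_cancel₀ c0, one_smul]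
  have l2x2 : L₂ * x₂ = (q : ℂ)⁻¹ • (x₂ * L₂) :=
    PreSerre.inv_comm (by field_simp) u.K₂L₂ u.L₂K₂ H.K₂x₂
  have p1 : K₁ * x₁ = (q : ℂ) • (x₁ * K₁) ∧ K₂ * x₁ = (q : ℂ)⁻¹ • (x₁ * K₂) ∧
      E₁ * x₁ = (q : ℂ)⁻¹ • (x₁ * E₁) ∧ E₂ * x₁ = x₂ * K₂ + (q : ℂ) • (x₁ * E₂) := by
    refine ⟨?_, ?_, ?_, ?_⟩ <;> apply mul_right_cancel_of_inv u.K₂L₂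
    all_goals
      simp only [mul_assoc, mul_add, add_mul, mul_sub, sub_mul, mul_smul_comm, smul_mul_assoc, smul_add,
        smul_sub, u.K₁K₂, mul_reassoc u.K₁K₂, k1f2, mul_reassoc k1f2, k2f2, mul_reassoc k2f2,
        e1k2, mul_reassoc e1k2, e2k2, mul_reassoc e2k2, x1k2, mul_reassoc x1k2,
        H.K₁x₂, mul_reassoc H.K₁x₂, H.K₂x₂, mul_reassoc H.K₂x₂, H.E₁x₂, mul_reassoc H.E₁x₂, H.E₂x₂,
        mul_reassoc H.E₂x₂, u.E₂F₂, mul_reassoc u.E₂F₂, u.E₁F₂, mul_reassoc u.E₁F₂, pow_two K₂,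
        pow_two L₂, l2x2, mul_reassoc l2x2, smul_smul, e2]
      match_scalars <;> simp only [hh] <;> field_simp <;> ring
  obtain ⟨k1x1, k2x1, e1x1, e2x1⟩ := p1
  have l1x1 : L₁ * x₁ = (q : ℂ)⁻¹ • (x₁ * L₁) :=
    PreSerre.inv_comm (by field_simp) u.K₁L₁ u.L₁K₁ k1x1
  have p0 : K₁ * x₀ = x₀ * K₁ ∧ K₂ * x₀ = x₀ * K₂ ∧
      E₁ * x₀ = h⁻¹ • (x₁ * K₁) + x₀ * E₁ ∧ E₂ * x₀ = x₀ * E₂ := by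
    refine ⟨?_, ?_, ?_, ?_⟩ <;> apply mul_right_cancel_of_inv u.K₁L₁
    all_goals
      simp only [mul_assoc, mul_add, add_mul, mul_sub, sub_mul, mul_smul_comm, smul_mul_assoc, smul_add,
        smul_sub, ← u.K₁K₂, mul_reassoc u.K₁K₂.symm, k1f1, mul_reassoc k1f1, k2f1, mul_reassoc k2f1,
        e1k1, mul_reassoc e1k1, e2k1, mul_reassoc e2k1, x0k1, mul_reassoc x0k1,
        k1x1, mul_reassoc k1x1, k2x1, mul_reassoc k2x1, e1x1, mul_reassoc e1x1, e2x1,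
        mul_reassoc e2x1, u.E₁F₁, mul_reassoc u.E₁F₁, u.E₂F₁, mul_reassoc u.E₂F₁, pow_two K₁,
        pow_two L₁, l1x1, mul_reassoc l1x1, H.F₁x₂, mul_reassoc H.F₁x₂, smul_smul, e1]
      match_scalars <;> simp only [hh] <;> field_simp <;> ring
  exact { H with
    K₁x₁ := k1x1, K₂x₁ := k2x1, E₁x₁ := e1x1, E₂x₁ := e2x1
    K₁x₀ := p0.1, K₂x₀ := p0.2.1, E₁x₀ := p0.2.2.1, E₂x₀ := p0.2.2.2 }

theorem XRel.F₂x₁_sub (H : XRel q h E₁ E₂ F₁ F₂ K₁ K₂ x₀ x₁ x₂)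
    (u : PreSerre q E₁ E₂ F₁ F₂ K₁ K₂ L₁ L₂) (q0 : (q : ℂ) ≠ 0)
    (q2 : (q : ℂ) ^ 2 - 1 ≠ 0) (q4 : (q : ℂ) ^ 2 + 1 ≠ 0) :
    E₁ * (F₂ * x₁ - (q : ℂ) • (x₁ * F₂)) = (q : ℂ)⁻¹ • ((F₂ * x₁ - (q : ℂ) • (x₁ * F₂)) * E₁) ∧
    E₂ * (F₂ * x₁ - (q : ℂ) • (x₁ * F₂)) = (q : ℂ) • ((F₂ * x₁ - (q : ℂ) • (x₁ * F₂)) * E₂) := by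
  have q8 : (q : ℂ) ^ 4 - 1 ≠ 0 := by
    rw [show (q : ℂ) ^ 4 - 1 = (q ^ 2 - 1) * (q ^ 2 + 1) by ring]; exact mul_ne_zero q2 q4
  have e2 : ((q : ℂ) ^ 2 - ((q : ℂ) ^ 2)⁻¹)⁻¹ = q ^ 2 / (q ^ 4 - 1) := by field_simp
  have l2x1 : L₂ * x₁ = (q : ℂ) • (x₁ * L₂) :=
    PreSerre.inv_comm (by field_simp) u.K₂L₂ u.L₂K₂ H.K₂x₁
  have k2f2 := smul_inv_comm (pow_ne_zero 2 q0) u.F₂K₂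
  constructor
  all_goals
    simp only [mul_assoc, mul_add, add_mul, mul_sub, sub_mul, mul_smul_comm, smul_mul_assoc, smul_add,
      smul_sub, H.E₁x₁, mul_reassoc H.E₁x₁, H.E₂x₁, mul_reassoc H.E₂x₁, u.E₂F₂, mul_reassoc u.E₂F₂,
      u.E₁F₂, mul_reassoc u.E₁F₂, H.K₂x₁, mul_reassoc H.K₂x₁, l2x1, mul_reassoc l2x1, pow_two K₂,
      pow_two L₂, H.F₂x₂, mul_reassoc H.F₂x₂, k2f2, mul_reassoc k2f2, smul_smul, e2]
    match_scalars <;> field_simp <;> ring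

/-- All commutation relations of `U_q(so(5))` with the generators of `A(S⁴_q)`. -/
structure Crossed (q : ℝ) (h : ℂ) {P : Type} [Ring P] [Algebra ℂ P]
    (E₁ E₂ F₁ F₂ K₁ K₂ x₀ x₁ y₁ x₂ y₂ : P) : Prop
    extends XRel q h E₁ E₂ F₁ F₂ K₁ K₂ x₀ x₁ x₂ where
  K₁y₁ : K₁ * y₁ = (q : ℂ)⁻¹ • (y₁ * K₁)
  K₂y₁ : K₂ * y₁ = (q : ℂ) • (y₁ * K₂)
  K₁y₂ : K₁ * y₂ = y₂ * K₁
  K₂y₂ : K₂ * y₂ = (q : ℂ)⁻¹ • (y₂ * K₂)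
  E₁y₁ : E₁ * y₁ = -(h ^ 3 * (q + (q : ℂ)⁻¹)) • (x₀ * K₁) + (q : ℂ) • (y₁ * E₁)
  E₁y₂ : E₁ * y₂ = y₂ * E₁
  E₂y₁ : E₂ * y₁ = (q : ℂ)⁻¹ • (y₁ * E₂)
  E₂y₂ : E₂ * y₂ = -(q : ℂ) ^ 2 • (y₁ * K₂) + (q : ℂ) • (y₂ * E₂)
  F₁x₀ : F₁ * x₀ = -(h ^ 3)⁻¹ • (y₁ * K₁) + x₀ * F₁
  F₁y₁ : F₁ * y₁ = (q : ℂ) • (y₁ * F₁)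
  F₁y₂ : F₁ * y₂ = y₂ * F₁
  F₂x₀ : F₂ * x₀ = x₀ * F₂
  F₂x₁ : F₂ * x₁ = (q : ℂ) • (x₁ * F₂)
  F₂y₁ : F₂ * y₁ = -((q : ℂ) ^ 2)⁻¹ • (y₂ * K₂) + (q : ℂ)⁻¹ • (y₁ * F₂)
  F₂y₂ : F₂ * y₂ = (q : ℂ) • (y₂ * F₂)

/-- The relations of `A(S⁴_q)` other than the equation of the sphere follow from one of them. -/
theorem Crossed.relations {y₁ y₂ : P} (H : Crossed q h E₁ E₂ F₁ F₂ K₁ K₂ x₀ x₁ y₁ x₂ y₂)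
    (u : PreSerre q E₁ E₂ F₁ F₂ K₁ K₂ L₁ L₂) (hh : (q : ℂ) = h ^ 2) (h0 : h ≠ 0)
    (q4 : (q : ℂ) ^ 2 + 1 ≠ 0) (R : x₁ * x₂ = (q : ℂ) ^ 2 • (x₂ * x₁)) :
    x₀ * x₂ = (q : ℂ) ^ 2 • (x₂ * x₀) ∧ y₁ * x₂ = (q : ℂ) ^ 2 • (x₂ * y₁) ∧
    x₀ * x₁ = (q : ℂ) ^ 2 • (x₁ * x₀) ∧ y₁ * x₁ = x₁ * y₁ + (1 - (q : ℂ) ^ 4) • (x₀ * x₀) ∧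
    y₂ * x₂ = x₂ * y₂ + (y₁ * x₁ - (q : ℂ) ^ 4 • (x₁ * y₁)) := by
  have q4' : h ^ 4 + 1 ≠ 0 := by rwa [hh, ← pow_mul] at q4
  have e3 : h * ((q : ℂ) + (q : ℂ)⁻¹) = (h ^ 4 + 1) / h := by rw [hh]; field_simp
  have c0 : (h ^ 4 + 1) / h ≠ 0 := div_ne_zero q4' h0
  have cancel : ∀ {A B C K L : P} {c : ℂ}, c ≠ 0 → K * L = 1 → C = 0 →
      (A - B) * K = c • C → A = B := by
    intro A B C K L c hc hKL hC e
    rw [hC, smul_zero] at e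
    refine mul_right_cancel_of_inv hKL (sub_eq_zero.1 ?_)
    rw [← sub_mul, e]
  have r1 : x₀ * x₂ = (q : ℂ) ^ 2 • (x₂ * x₀) := by
    refine cancel (c := ((h ^ 4 + 1) / h)⁻¹) (inv_ne_zero c0) u.K₁L₁ (C := F₁ * (x₁ * x₂ - (q : ℂ) ^ 2 • (x₂ * x₁)) -
      (q : ℂ)⁻¹ • ((x₁ * x₂ - (q : ℂ) ^ 2 • (x₂ * x₁)) * F₁)) (by rw [R, sub_self]; simp) ?_
    simp only [mul_assoc, mul_add, add_mul, mul_sub, sub_mul, mul_smul_comm, smul_mul_assoc, smul_add,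
      smul_sub, H.F₁x₁, mul_reassoc H.F₁x₁, H.F₁x₂, mul_reassoc H.F₁x₂, H.K₁x₂, mul_reassoc H.K₁x₂,
      smul_smul, e3]
    match_scalars <;> (try simp only [hh]) <;> field_simp <;> ring
  have r2 : y₁ * x₂ = (q : ℂ) ^ 2 • (x₂ * y₁) := by
    refine cancel (c := -h ^ 3) (by simp [h0]) u.K₁L₁ (C := F₁ * (x₀ * x₂ - (q : ℂ) ^ 2 • (x₂ * x₀)) -
      (x₀ * x₂ - (q : ℂ) ^ 2 • (x₂ * x₀)) * F₁) (by rw [r1, sub_self]; simp) ?_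
    simp only [mul_assoc, mul_add, add_mul, mul_sub, sub_mul, mul_smul_comm, smul_mul_assoc, smul_add,
      smul_sub, H.F₁x₀, mul_reassoc H.F₁x₀, H.F₁x₂, mul_reassoc H.F₁x₂, H.K₁x₂, mul_reassoc H.K₁x₂,
      smul_smul]
    match_scalars <;> (try simp only [hh]) <;> field_simp <;> ring
  have r3 : x₀ * x₁ = (q : ℂ) ^ 2 • (x₁ * x₀) := by
    refine cancel (c := 1) one_ne_zero u.K₂L₂ (C := F₂ * (x₀ * x₂ - (q : ℂ) ^ 2 • (x₂ * x₀)) -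
      (q : ℂ)⁻¹ • ((x₀ * x₂ - (q : ℂ) ^ 2 • (x₂ * x₀)) * F₂)) (by rw [r1, sub_self]; simp) ?_
    simp only [mul_assoc, mul_add, add_mul, mul_sub, sub_mul, mul_smul_comm, smul_mul_assoc, smul_add,
      smul_sub, H.F₂x₀, mul_reassoc H.F₂x₀, H.F₂x₂, mul_reassoc H.F₂x₂, H.K₂x₀, mul_reassoc H.K₂x₀,
      smul_smul]
    match_scalars <;> (try simp only [hh]) <;> (try field_simp) <;> (try ring)
  refine ⟨r1, r2, r3, ?_, ?_⟩
  · refine cancel (c := -h) (by simp [h0]) u.K₁L₁ (C := F₁ * (x₀ * x₁ - (q : ℂ) ^ 2 • (x₁ * x₀)) -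
      (q : ℂ)⁻¹ • ((x₀ * x₁ - (q : ℂ) ^ 2 • (x₁ * x₀)) * F₁)) (by rw [r3, sub_self]; simp) ?_
    simp only [mul_assoc, mul_add, add_mul, mul_sub, sub_mul, mul_smul_comm, smul_mul_assoc, smul_add,
      smul_sub, H.F₁x₀, mul_reassoc H.F₁x₀, H.F₁x₁, mul_reassoc H.F₁x₁, H.K₁x₁, mul_reassoc H.K₁x₁,
      H.K₁x₀, mul_reassoc H.K₁x₀, smul_smul, e3]
    match_scalars <;> (try simp only [hh]) <;> field_simp <;> ring
  · refine cancel (c := -(q : ℂ)) (by rw [hh]; simp [h0]) u.K₂L₂ (C := F₂ * (y₁ * x₂ - (q : ℂ) ^ 2 • (x₂ * y₁)) -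
      ((q : ℂ) ^ 2)⁻¹ • ((y₁ * x₂ - (q : ℂ) ^ 2 • (x₂ * y₁)) * F₂)) (by rw [r2, sub_self]; simp) ?_
    simp only [mul_assoc, mul_add, add_mul, mul_sub, sub_mul, mul_smul_comm, smul_mul_assoc, smul_add,
      smul_sub, H.F₂x₂, mul_reassoc H.F₂x₂, H.F₂y₁, mul_reassoc H.F₂y₁, H.K₂x₂, mul_reassoc H.K₂x₂,
      H.K₂y₁, mul_reassoc H.K₂y₁, smul_smul]
    match_scalars <;> (try simp only [hh]) <;> field_simp <;> ring

/-- The left hand side of the equation of the sphere is invariant. -/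
theorem Crossed.sphere_comm {y₁ y₂ : P} (H : Crossed q h E₁ E₂ F₁ F₂ K₁ K₂ x₀ x₁ y₁ x₂ y₂)
    (hh : (q : ℂ) = h ^ 2) (h0 : h ≠ 0) (X : P) (hX : X = E₁ ∨ X = E₂ ∨ X = F₁ ∨ X = F₂)
    (r3 : x₀ * x₁ = (q : ℂ) ^ 2 • (x₁ * x₀)) (r5 : y₁ * x₀ = (q : ℂ) ^ 2 • (x₀ * y₁)) :
    X * (x₀ * x₀ + x₁ * y₁ + x₂ * y₂) = (x₀ * x₀ + x₁ * y₁ + x₂ * y₂) * X := by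
  rcases hX with rfl | rfl | rfl | rfl
  all_goals
    simp only [mul_assoc, mul_add, add_mul, mul_smul_comm, smul_mul_assoc, smul_add,
      H.E₁x₀, mul_reassoc H.E₁x₀, H.E₁x₁, mul_reassoc H.E₁x₁, H.E₁x₂, mul_reassoc H.E₁x₂,
      H.E₁y₁, mul_reassoc H.E₁y₁, H.E₁y₂, mul_reassoc H.E₁y₂,
      H.E₂x₀, mul_reassoc H.E₂x₀, H.E₂x₁, mul_reassoc H.E₂x₁, H.E₂x₂, mul_reassoc H.E₂x₂,
      H.E₂y₁, mul_reassoc H.E₂y₁, H.E₂y₂, mul_reassoc H.E₂y₂,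
      H.F₁x₀, mul_reassoc H.F₁x₀, H.F₁x₁, mul_reassoc H.F₁x₁, H.F₁x₂, mul_reassoc H.F₁x₂,
      H.F₁y₁, mul_reassoc H.F₁y₁, H.F₁y₂, mul_reassoc H.F₁y₂,
      H.F₂x₀, mul_reassoc H.F₂x₀, H.F₂x₁, mul_reassoc H.F₂x₁, H.F₂x₂, mul_reassoc H.F₂x₂,
      H.F₂y₁, mul_reassoc H.F₂y₁, H.F₂y₂, mul_reassoc H.F₂y₂,
      H.K₁x₀, mul_reassoc H.K₁x₀, H.K₁x₁, mul_reassoc H.K₁x₁, H.K₁x₂, mul_reassoc H.K₁x₂,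
      H.K₁y₁, mul_reassoc H.K₁y₁, H.K₁y₂, mul_reassoc H.K₁y₂,
      H.K₂x₀, mul_reassoc H.K₂x₀, H.K₂x₁, mul_reassoc H.K₂x₁, H.K₂x₂, mul_reassoc H.K₂x₂,
      H.K₂y₁, mul_reassoc H.K₂y₁, H.K₂y₂, mul_reassoc H.K₂y₂,
      r3, mul_reassoc r3, r5, mul_reassoc r5, smul_smul]
    match_scalars <;> (try simp only [hh]) <;> (try field_simp) <;> (try ring)

/-- `x₁ x₂ - q² x₂ x₁` is a highest weight vector. -/
theorem XRel.comm_x₁x₂ (H : XRel q h E₁ E₂ F₁ F₂ K₁ K₂ x₀ x₁ x₂) (q0 : (q : ℂ) ≠ 0) :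
    E₁ * (x₁ * x₂ - (q : ℂ) ^ 2 • (x₂ * x₁)) =
      (q : ℂ)⁻¹ • ((x₁ * x₂ - (q : ℂ) ^ 2 • (x₂ * x₁)) * E₁) ∧
    E₂ * (x₁ * x₂ - (q : ℂ) ^ 2 • (x₂ * x₁)) = (1 : ℂ) • ((x₁ * x₂ - (q : ℂ) ^ 2 • (x₂ * x₁)) * E₂) := by
  constructor
  all_goals
    simp only [mul_assoc, mul_add, add_mul, mul_sub, sub_mul, mul_smul_comm, smul_mul_assoc, smul_add,
      smul_sub, H.E₁x₁, mul_reassoc H.E₁x₁, H.E₂x₁, mul_reassoc H.E₂x₁, H.E₁x₂, mul_reassoc H.E₁x₂,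
      H.E₂x₂, mul_reassoc H.E₂x₂, H.K₂x₂, mul_reassoc H.K₂x₂, smul_smul]
    match_scalars <;> field_simp <;> ring

end



theorem pow_sub_one_ne {q : ℝ} (hq : q ∈ Set.Ioo (0 : ℝ) 1) {x : ℝ} (hx : 0 < x) : (q ^ x) ^ 2 - 1 ≠ 0 := by
  have h1 := Real.rpow_lt_one hq.1.le hq.2 hx
  have h0 := Real.rpow_pos_of_pos hq.1 x
  nlinarith

theorem rt_four_eq {q : ℝ} (hq : q ∈ Set.Ioo (0 : ℝ) 1) {x : ℝ} (hx : 0 ≤ x) :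
    rt q x ^ 4 = ((q ^ x - (q ^ x)⁻¹) / (q - q⁻¹)) ^ 2 := by
  rw [← rt_sq_eq hq hx, ← pow_mul]

/-! ### Extremal matrix coefficients of the relations -/

set_option maxHeartbeats 1000000 in
theorem comm_x₁x₂_coef {q : ℝ} (hq : q ∈ Set.Ioo (0 : ℝ) 1) {L : ℤ} (hL : L % 2 = 1) (h1 : 1 ≤ L) :
    (3 ≤ L → coefD0 q L 1 (-L) * coefHp q (L - 2) 1 (2 - L) + coefDm q L 1 (-L) * coefH0 q (L - 2) 1 (2 - L) =
      q ^ 2 * (coefH0 q L 1 (-L) * coefDm q L 1 (-L))) ∧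
    coefDm q L 1 (-L) * coefHp q (L - 2) 1 (2 - L) + coefDp q L 1 (-L) * coefHp q L 1 (2 - L) +
        coefD0 q L 1 (-L) * coefH0 q L 1 (2 - L) =
      q ^ 2 * (coefHp q L 1 (-L) * coefDm q (L + 2) 1 (-L) + coefH0 q L 1 (-L) * coefD0 q L 1 (-L)) ∧
    (3 ≤ L → coefDm q L 1 (-L) * coefCp q (L - 2) 1 (2 - L) + coefDp q L 1 (-L) * coefCm q (L + 2) 1 (2 - L) -
        coefD0 q L 1 (-L) * coefC0 q L 1 (2 - L) =
      q ^ 2 * (coefCp q L 1 (-L) * coefDm q (L + 2) 3 (-L))) ∧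
    coefDp q L 1 L * coefH0 q (L + 2) 1 (L + 2) =
      q ^ 2 * (coefH0 q L 1 L * coefDp q L 1 L + coefHp q L 1 L * coefD0 q (L + 2) 1 L) := by
  obtain ⟨i, rfl⟩ : ∃ i, L = 2 * i + 1 := ⟨L / 2, by omega⟩
  refine ⟨?_, ?_, ?_, ?_⟩
  all_goals
    intros
    rify at *
    simp (disch := omega) only [coefDp, coefD0, coefDm, coefa, coefb, coefc, coefCp, coefC0, coefCm,
      coefHp, coefH0, eps_pos, eps_neg, Int.cast_add, Int.cast_sub, Int.cast_mul, Int.cast_one,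
      Int.cast_ofNat, Int.cast_neg, abs_half, abs_neg_half]
    simp (disch := grind) only [sqrt_qnum_div hq, sqrt_qnum_mul hq]
    ring_nf
    try simp (disch := grind) only [rt_sq_eq hq, sub_inv_eq hq, qnum_two_eq hq, qnum_neg_two_eq hq, qnum_zero]
    have N := fun n : ℕ => fun hn : 1 ≤ n => pow_sub_one_ne hq (x := n + i * 2) (by
      have : (1 : ℝ) ≤ n := Nat.one_le_cast.2 hn
      linarith)
    have N₁ := N 1 le_rfl
    have N₂ := N 3 (by norm_num)
    have N₃ := N 5 (by norm_num)
    have N₄ := N 7 (by norm_num)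
    clear N
    try simp only [qnum_eq hq, sub_inv_eq hq]
    have q0 := hq.1
    have q1 := one_sub_sq_ne hq
    obtain ⟨h, h0, hqh, f1, f3, f5, f7, f9⟩ := half_powers q0
    simp only [Nat.cast_one, Nat.cast_ofNat, Real.rpow_add q0, Real.rpow_sub q0, Real.rpow_neg q0.le, neg_div, f1, f3, f5, f7,
      f9, rpow_mul_two q0, Real.rpow_ofNat, Real.rpow_one, one_div] at *
    have hX := Real.rpow_pos_of_pos q0 (i : ℝ)
    try rw [f1]
    clear f1 f3 f5 f7 f9
    generalize q ^ (i : ℝ) = X at *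
    subst hqh
    simp only [mul_pow, ← pow_mul] at N₁ N₂ N₃ N₄ q1
    norm_num at N₁ N₂ N₃ N₄ q1
    field_simp
    try ring

set_option maxHeartbeats 1000000 in
theorem sphere_coef {q : ℝ} (hq : q ∈ Set.Ioo (0 : ℝ) 1) {L : ℤ} (hL : L % 2 = 1) (h1 : 1 ≤ L) :
    (coefAp q 1 (-1) * coefCp q L 1 (-L)) ^ 2 + (coefA0 q 1 (-1) * coefHp q L 1 (-L)) ^ 2 +
      (coefA0 q 1 (-1) * coefH0 q L 1 (-L)) ^ 2 + (coefBm q 3 (-3) * coefCp q L 1 (-L)) ^ 2 +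
      coefDm q (L + 2) 1 (-L - 2) ^ 2 = 1 := by
  obtain ⟨i, rfl⟩ : ∃ i, L = 2 * i + 1 := ⟨L / 2, by omega⟩
  rify at *
  simp (disch := omega) only [coefDp, coefD0, coefDm, coefa, coefb, coefc, coefCp, coefC0, coefCm,
    coefHp, coefAp, coefA0, coefBm, coefH0, eps_pos, eps_neg, Int.cast_add, Int.cast_sub, Int.cast_mul, Int.cast_one,
    Int.cast_ofNat, Int.cast_neg, abs_half, abs_neg_half]
  simp (disch := grind) only [sqrt_qnum_div hq, sqrt_qnum_mul hq]
  ring_nf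
  try simp (disch := grind) only [rt_sq_eq hq, rt_four_eq hq, sub_inv_eq hq, qnum_two_eq hq, qnum_neg_two_eq hq, qnum_zero]
  have N := fun n : ℕ => fun hn : 1 ≤ n => pow_sub_one_ne hq (x := n + i * 2) (by
    have : (1 : ℝ) ≤ n := Nat.one_le_cast.2 hn
    linarith)
  have N₁ := N 1 le_rfl
  have N₂ := N 3 (by norm_num)
  have N₃ := N 5 (by norm_num)
  have N₄ := N 7 (by norm_num)
  clear N
  have N₅ := pow_sub_one_ne hq (x := 3) (by norm_num)
  try simp only [qnum_eq hq, sub_inv_eq hq]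
  have q0 := hq.1
  have q1 := one_sub_sq_ne hq
  obtain ⟨h, h0, hqh, f1, f3, f5, f7, f9⟩ := half_powers q0
  simp only [Nat.cast_one, Nat.cast_ofNat, Real.rpow_add q0, Real.rpow_sub q0, Real.rpow_neg q0.le, neg_div, f1, f3, f5, f7,
    f9, rpow_mul_two q0, Real.rpow_ofNat, Real.rpow_one, one_div] at *
  have hX := Real.rpow_pos_of_pos q0 (i : ℝ)
  try rw [f1]
  clear f1 f3 f5 f7 f9
  generalize q ^ (i : ℝ) = X at *
  subst hqh
  simp only [mul_pow, ← pow_mul] at N₁ N₂ N₃ N₄ N₅ q1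
  norm_num at N₁ N₂ N₃ N₄ N₅ q1
  field_simp
  try ring



/-! ### Matrix blocks of operators of given weight -/

theorem end_eq_zero_of_fip {T : Module.End ℂ Spin}
    (h : ∀ L' L M₁' M₂' J' M₁ M₂ J, fip (ket L' M₁' M₂' J') (T (ket L M₁ M₂ J)) = 0) : T = 0 := by
  refine end_ext fun L M₁ M₂ J _ => ?_
  rw [LinearMap.zero_apply]
  ext i
  have := h i.L L i.M₁ i.M₂ i.J M₁ M₂ J
  rw [ket_idx, fip_single_left, map_one, one_mul] at this
  exact this

/-- The subspace `V_l`. -/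
noncomputable def lspace (L : ℤ) : Submodule ℂ Spin :=
  Submodule.span ℂ {v | ∃ M₁ M₂ J, v = ket L M₁ M₂ J}

theorem ket_mem_lspace (L M₁ M₂ J : ℤ) : ket L M₁ M₂ J ∈ lspace L :=
  Submodule.subset_span ⟨_, _, _, rfl⟩

theorem lspace_induction {L : ℤ} {T : Module.End ℂ Spin} {S : Submodule ℂ Spin}
    (h : ∀ M₁ M₂ J, T (ket L M₁ M₂ J) ∈ S) (v : Spin) (hv : v ∈ lspace L) : T v ∈ S := by
  suffices H : lspace L ≤ S.comap T from H hv
  refine Submodule.span_le.2 ?_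
  rintro _ ⟨M₁, M₂, J, rfl⟩
  exact h _ _ _

theorem sh_lspace (b c d : ℤ) (f : ℤ → ℤ → ℤ → ℤ → ℝ) {L : ℤ} (v : Spin) (hv : v ∈ lspace L) :
    sh 0 b c d f v ∈ lspace L := by
  refine lspace_induction (fun M₁ M₂ J => ?_) v hv
  by_cases h : Admissible L M₁ M₂ J
  · rw [sh_ket _ _ _ _ _ h, add_zero]
    exact Submodule.smul_mem _ _ (ket_mem_lspace _ _ _ _)
  · rw [ket_of_not_adm h, map_zero]; exact Submodule.zero_mem _

section

variable {q : ℝ} {L L' : ℤ} {T : Module.End ℂ Spin}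

theorem opE_lspace (v : Spin) (hv : v ∈ lspace L) : opE₁ q v ∈ lspace L ∧ opE₂ q v ∈ lspace L := by
  rw [opE₁_eq, opE₂_eq]
  exact ⟨sh_lspace _ _ _ _ v hv, Submodule.add_mem _ (Submodule.add_mem _ (sh_lspace _ _ _ _ v hv)
    (sh_lspace _ _ _ _ v hv)) (sh_lspace _ _ _ _ v hv)⟩

theorem opF_lspace (v : Spin) (hv : v ∈ lspace L) : opF₁ q v ∈ lspace L ∧ opF₂ q v ∈ lspace L :=
  ⟨sh_lspace _ _ _ _ v hv, Submodule.add_mem _ (Submodule.add_mem _ (sh_lspace _ _ _ _ v hv)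
    (sh_lspace _ _ _ _ v hv)) (sh_lspace _ _ _ _ v hv)⟩

/-- `T` has weight `(β, γ)` under `K₁`, `K₂`. -/
def HasWt (q : ℝ) (β γ : ℤ) (T : Module.End ℂ Spin) : Prop :=
  opK₁ q * T = (q : ℂ) ^ β • (T * opK₁ q) ∧ opK₂ q * T = (q : ℂ) ^ γ • (T * opK₂ q)

theorem wt_mul {P : Type} [Ring P] [Algebra ℂ P] {K T T' : P} {q : ℂ} (q0 : q ≠ 0) {β β' : ℤ}
    (h : K * T = q ^ β • (T * K)) (h' : K * T' = q ^ β' • (T' * K)) :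
    K * (T * T') = q ^ (β + β') • (T * T' * K) := by
  rw [← mul_assoc, h, smul_mul_assoc, mul_assoc, h', mul_smul_comm, smul_smul, zpow_add₀ q0, mul_assoc]

theorem wt_sub {P : Type} [Ring P] [Algebra ℂ P] {K T T' : P} {c : ℂ}
    (h : K * T = c • (T * K)) (h' : K * T' = c • (T' * K)) : K * (T - T') = c • ((T - T') * K) := by
  rw [mul_sub, h, h', sub_mul, smul_sub]

theorem wt_smul {P : Type} [Ring P] [Algebra ℂ P] {K T : P} {c : ℂ}
    (h : K * T = c • (T * K)) (r : ℂ) : K * (r • T) = c • (r • T * K) := by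
  rw [mul_smul_comm, h, smul_mul_assoc, smul_comm]

theorem wt_add {P : Type} [Ring P] [Algebra ℂ P] {K T T' : P} {c : ℂ}
    (h : K * T = c • (T * K)) (h' : K * T' = c • (T' * K)) : K * (T + T') = c • ((T + T') * K) := by
  rw [mul_add, h, h', add_mul, smul_add]

namespace HasWt

variable {β γ β' γ' : ℤ} {T' : Module.End ℂ Spin}

theorem mul (hq : q ∈ Set.Ioo (0 : ℝ) 1) (h : HasWt q β γ T) (h' : HasWt q β' γ' T') :
    HasWt q (β + β') (γ + γ') (T * T') :=
  ⟨wt_mul (P := Module.End ℂ Spin) (ofReal_ne hq) h.1 h'.1, wt_mul (P := Module.End ℂ Spin) (ofReal_ne hq) h.2 h'.2⟩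

theorem sub (h : HasWt q β γ T) (h' : HasWt q β γ T') : HasWt q β γ (T - T') :=
  ⟨wt_sub (P := Module.End ℂ Spin) h.1 h'.1, wt_sub (P := Module.End ℂ Spin) h.2 h'.2⟩

theorem add (h : HasWt q β γ T) (h' : HasWt q β γ T') : HasWt q β γ (T + T') :=
  ⟨wt_add (P := Module.End ℂ Spin) h.1 h'.1, wt_add (P := Module.End ℂ Spin) h.2 h'.2⟩

theorem smul (h : HasWt q β γ T) (r : ℂ) : HasWt q β γ (r • T) :=
  ⟨wt_smul (P := Module.End ℂ Spin) h.1 r, wt_smul (P := Module.End ℂ Spin) h.2 r⟩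

end HasWt

theorem fip_wt {K : Module.End ℂ Spin} (hK : IsAdj K K) {v w : Spin} {x y : ℝ} {β : ℤ}
    (hq : q ∈ Set.Ioo (0 : ℝ) 1) (hv : K v = ((q ^ x : ℝ) : ℂ) • v) (hw : K w = ((q ^ y : ℝ) : ℂ) • w)
    (hT : K * T = (q : ℂ) ^ β • (T * K)) (h : fip v (T w) ≠ 0) : x = β + y := by
  have e1 := hK v (T w)
  have e2 := LinearMap.congr_fun hT w
  rw [Module.End.mul_apply, LinearMap.smul_apply, Module.End.mul_apply, hw, map_smul] at e2
  rw [hv, e2, fip_smul_left, fip_smul_right, fip_smul_right, Complex.conj_ofReal, ← mul_assoc] at e1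
  have e3 := mul_right_cancel₀ h e1
  rw [← Complex.ofReal_zpow, ← Complex.ofReal_mul, Complex.ofReal_inj, ← Real.rpow_intCast,
    ← Real.rpow_add hq.1] at e3
  exact (Real.rpow_right_inj hq.1 hq.2.ne).1 e3

theorem opK₁_ket {M₁ M₂ J : ℤ} (h : Admissible L M₁ M₂ J) :
    opK₁ q (ket L M₁ M₂ J) = ((q ^ ((M₁ : ℝ) / 2) : ℝ) : ℂ) • ket L M₁ M₂ J := by
  rw [opK₁_eq, sh_ket _ _ _ _ _ h]; simp only [add_zero]

theorem opK₂_ket {M₁ M₂ J : ℤ} (h : Admissible L M₁ M₂ J) :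
    opK₂ q (ket L M₁ M₂ J) = ((q ^ ((M₂ : ℝ) / 2 - (M₁ : ℝ) / 2) : ℝ) : ℂ) • ket L M₁ M₂ J := by
  rw [opK₂_eq, sh_ket _ _ _ _ _ h]; simp only [add_zero]

theorem HasWt.eq_of_ne {β γ : ℤ} (hT : HasWt q β γ T) (hq : q ∈ Set.Ioo (0 : ℝ) 1)
    {M₁ M₂ J M₁' M₂' J' : ℤ} (h : fip (ket L' M₁' M₂' J') (T (ket L M₁ M₂ J)) ≠ 0) :
    M₁' = M₁ + 2 * β ∧ M₂' = M₂ + 2 * (β + γ) ∧ Admissible L' M₁' M₂' J' ∧ Admissible L M₁ M₂ J := by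
  by_cases h1 : Admissible L' M₁' M₂' J'
  swap
  · rw [ket_of_not_adm h1, fip_zero_left] at h; exact absurd rfl h
  by_cases h2 : Admissible L M₁ M₂ J
  swap
  · rw [ket_of_not_adm h2, map_zero, fip_zero_right] at h; exact absurd rfl h
  have e1 := fip_wt opK₁_isAdj hq (opK₁_ket h1) (opK₁_ket h2) hT.1 h
  have e2 := fip_wt opK₂_isAdj hq (opK₂_ket h1) (opK₂_ket h2) hT.2 h
  have e3 : (M₁' : ℝ) = M₁ + 2 * β := by linarith
  have e4 : (M₂' : ℝ) = M₂ + 2 * (β + γ) := by linarith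
  exact ⟨by exact_mod_cast e3, by exact_mod_cast e4, h1, h2⟩

/-- A block of a highest weight operator vanishes if it vanishes on the lowest weight vector. -/
theorem block_lowest (hq : q ∈ Set.Ioo (0 : ℝ) 1) {β γ : ℤ} {c₁ c₂ : ℂ} (hc₁ : c₁ ≠ 0) (hc₂ : c₂ ≠ 0)
    (h₁ : opE₁ q * T = c₁ • (T * opE₁ q)) (h₂ : opE₂ q * T = c₂ • (T * opE₂ q)) (hT : HasWt q β γ T)
    (h : ∀ J', Admissible L' (-1 + 2 * β) (-L + 2 * (β + γ)) J' →
      fip (ket L' (-1 + 2 * β) (-L + 2 * (β + γ)) J') (T (ket L (-1) (-L) 1)) = 0)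
    (M₁' M₂' J' M₁ M₂ J : ℤ) : fip (ket L' M₁' M₂' J') (T (ket L M₁ M₂ J)) = 0 := by
  let S : Submodule ℂ Spin :=
    { carrier := {w | ∀ v ∈ lspace L', fip v (T w) = 0}
      zero_mem' := fun v _ => by rw [map_zero, fip_zero_right]
      add_mem' := fun ha hb v hv => by rw [map_add, fip_add_right, ha v hv, hb v hv, add_zero]
      smul_mem' := fun c a ha v hv => by rw [map_smul, fip_smul_right, ha v hv, mul_zero] }
  have key : ∀ {E F : Module.End ℂ Spin} {c : ℂ}, IsAdj E F → c ≠ 0 → E * T = c • (T * E) →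
      (∀ v ∈ lspace L', F v ∈ lspace L') → ∀ w ∈ S, E w ∈ S := by
    intro E F c hE hc e hF w hw v hv
    have e1 := LinearMap.congr_fun e w
    rw [Module.End.mul_apply, LinearMap.smul_apply, Module.End.mul_apply] at e1
    have e2 := hE.symm v (T w)
    rw [hw _ (hF v hv), e1, fip_smul_right] at e2
    exact (mul_eq_zero.1 e2.symm).resolve_left hc
  have h0 : ket L (-1) (-L) 1 ∈ S := by
    intro v hv
    induction hv using Submodule.span_induction with
    | mem v hv =>
      obtain ⟨M₁', M₂', J', rfl⟩ := hv
      by_contra h'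
      obtain ⟨rfl, rfl, h1, -⟩ := hT.eq_of_ne hq h'
      exact h' (h _ h1)
    | zero => rw [fip_zero_left]
    | add a b _ _ ha hb => rw [fip_add_left, ha, hb, add_zero]
    | smul c a _ ha => rw [fip_smul_left, ha, mul_zero]
  exact ket_mem_of_lowest hq (S := S) (key (opF₁_isAdj q) hc₁ h₁ fun v hv => (opF_lspace v hv).1)
    (key (opF₂_isAdj q) hc₂ h₂ fun v hv => (opF_lspace v hv).2) h0 M₁ M₂ J _ (ket_mem_lspace _ _ _ _)

/-- A block of a highest weight operator vanishes if it vanishes on the highest weight vector. -/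
theorem block_highest (hq : q ∈ Set.Ioo (0 : ℝ) 1) {β γ : ℤ} {c₁ c₂ : ℂ}
    (h₁ : opE₁ q * T = c₁ • (T * opE₁ q)) (h₂ : opE₂ q * T = c₂ • (T * opE₂ q)) (hT : HasWt q β γ T)
    (h : ∀ J, Admissible L (1 - 2 * β) (L' - 2 * (β + γ)) J →
      fip (ket L' 1 L' 1) (T (ket L (1 - 2 * β) (L' - 2 * (β + γ)) J)) = 0)
    (M₁' M₂' J' M₁ M₂ J : ℤ) : fip (ket L' M₁' M₂' J') (T (ket L M₁ M₂ J)) = 0 := by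
  let S : Submodule ℂ Spin :=
    { carrier := {v | ∀ w ∈ lspace L, fip v (T w) = 0}
      zero_mem' := fun w _ => fip_zero_left _
      add_mem' := fun ha hb w hw => by rw [fip_add_left, ha w hw, hb w hw, add_zero]
      smul_mem' := fun c a ha w hw => by rw [fip_smul_left, ha w hw, mul_zero] }
  have key : ∀ {E F : Module.End ℂ Spin} {c : ℂ}, IsAdj E F → E * T = c • (T * E) →
      (∀ v ∈ lspace L, E v ∈ lspace L) → ∀ v ∈ S, F v ∈ S := by
    intro E F c hE e hF v hv w hw
    have e1 := LinearMap.congr_fun e w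
    rw [Module.End.mul_apply, LinearMap.smul_apply, Module.End.mul_apply] at e1
    rw [hE.symm v (T w), e1, fip_smul_right, hv _ (hF w hw), mul_zero]
  have h0 : ket L' 1 L' 1 ∈ S := by
    intro w hw
    induction hw using Submodule.span_induction with
    | mem v hv =>
      obtain ⟨M₁, M₂, J, rfl⟩ := hv
      by_contra h'
      obtain ⟨e1, e2, -, h1⟩ := hT.eq_of_ne hq h'
      obtain rfl : M₁ = 1 - 2 * β := by omega
      obtain rfl : M₂ = L' - 2 * (β + γ) := by omega
      exact h' (h _ h1)
    | zero => rw [map_zero, fip_zero_right]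
    | add a b _ _ ha hb => rw [map_add, fip_add_right, ha, hb, add_zero]
    | smul c a _ ha => rw [map_smul, fip_smul_right, ha, mul_zero]
  exact ket_mem_of_highest hq (S := S) (key (opF₁_isAdj q) h₁ fun v hv => (opE_lspace v hv).1)
    (key (opF₂_isAdj q) h₂ fun v hv => (opE_lspace v hv).2) h0 M₁' M₂' J' _ (ket_mem_lspace _ _ _ _)

end



/-! ### The representations `π_±`: commutation relations -/

section

variable {q : ℝ} {h : ℂ} {P : Type} [Ring P] [Algebra ℂ P] {E₁ E₂ F₁ F₂ K₁ K₂ L₁ L₂ x₀ x₁ x₂ x₀' x₁' x₂' : P}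

theorem HighRel.add (H : HighRel q h E₁ E₂ F₁ F₂ K₁ K₂ x₀ x₁ x₂)
    (H' : HighRel q h E₁ E₂ F₁ F₂ K₁ K₂ x₀' x₁' x₂') :
    HighRel q h E₁ E₂ F₁ F₂ K₁ K₂ (x₀ + x₀') (x₁ + x₁') (x₂ + x₂') := by
  constructor <;> simp only [mul_add, add_mul, smul_add, H.E₁x₂, H.F₁x₂, H.E₂x₂, H.F₂x₂, H.F₁x₁,
    H.K₁x₂, H.K₂x₂, H'.E₁x₂, H'.F₁x₂, H'.E₂x₂, H'.F₂x₂, H'.F₁x₁, H'.K₁x₂, H'.K₂x₂] <;> abel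

theorem HighRel.smul (H : HighRel q h E₁ E₂ F₁ F₂ K₁ K₂ x₀ x₁ x₂) (c : ℂ) :
    HighRel q h E₁ E₂ F₁ F₂ K₁ K₂ (c • x₀) (c • x₁) (c • x₂) := by
  constructor <;> simp only [mul_smul_comm, smul_mul_assoc, smul_add, H.E₁x₂, H.F₁x₂, H.E₂x₂, H.F₂x₂, H.F₁x₁,
    H.K₁x₂, H.K₂x₂] <;> module

theorem solve_rel {A X B Y : P} {a b d : ℂ} (hb : b ≠ 0) (e : X * A = a • (B * Y) + b • (A * X))
    (e' : B * Y = d • (Y * B)) : A * X = -(b⁻¹ * a * d) • (Y * B) + b⁻¹ • (X * A) := by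
  rw [e, e']
  match_scalars <;> field_simp
  ring

end

theorem adj_rel {A A' X Y X' Y' B : Module.End ℂ Spin} {a b : ℂ} (hA : IsAdj A A') (hX : IsAdj X Y)
    (hX' : IsAdj X' Y') (hB : IsAdj B B) (e : A * X = a • (X' * B) + b • (X * A)) :
    Y * A' = starRingEnd ℂ a • (B * Y') + starRingEnd ℂ b • (A' * Y) :=
  (hA.mul hX).eq_of_eq (((hX'.mul hB).smul a).add ((hX.mul hA).smul b)) e

theorem adj_rel' {A A' X Y : Module.End ℂ Spin} {b : ℂ} (hA : IsAdj A A') (hX : IsAdj X Y)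
    (e : A * X = b • (X * A)) : Y * A' = starRingEnd ℂ b • (A' * Y) :=
  (hA.mul hX).eq_of_eq ((hX.mul hA).smul b) e

section

variable {q : ℝ}

theorem highRel_of (hq : q ∈ Set.Ioo (0 : ℝ) 1) {h : ℂ} (h1 : ((q ^ (1 / 2 : ℝ) : ℝ) : ℂ) = h)
    {a : ℤ} {f : ℤ → ℤ → ℤ → ℤ → ℝ} {X₀ X₁ X₂ : Module.End ℂ Spin} (e : X₂ = sh a 0 2 0 f)
    (e1 : opE₁ q * X₂ = X₂ * opE₁ q) (e2 : opF₁ q * X₂ = X₂ * opF₁ q)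
    (e3 : opE₂ q * X₂ = (q : ℂ)⁻¹ • (X₂ * opE₂ q))
    (e4 : opF₂ q * X₂ = X₁ * opK₂ q + (q : ℂ)⁻¹ • (X₂ * opF₂ q))
    (e5 : opF₁ q * X₁ = ((q ^ (1 / 2 : ℝ) * qnum q 2 : ℝ) : ℂ) • (X₀ * opK₁ q) +
      (q : ℂ)⁻¹ • (X₁ * opF₁ q)) :
    HighRel q h (opE₁ q) (opE₂ q) (opF₁ q) (opF₂ q) (opK₁ q) (opK₂ q) X₀ X₁ X₂ where
  E₁x₂ := e1
  F₁x₂ := e2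
  E₂x₂ := e3
  F₂x₂ := e4
  F₁x₁ := by
    rw [← h1, e5, Complex.ofReal_mul, S4.qnum_two q hq, Complex.ofReal_add, Complex.ofReal_inv]
  K₁x₂ := by
    rw [e, opK₁_sh hq.1]; simp
  K₂x₂ := by
    rw [e, opK₂_sh hq.1]; simp

theorem highRel_op (hq : q ∈ Set.Ioo (0 : ℝ) 1) {h : ℂ} (h1 : ((q ^ (1 / 2 : ℝ) : ℝ) : ℂ) = h) :
    HighRel q h (opE₁ q) (opE₂ q) (opF₁ q) (opF₂ q) (opK₁ q) (opK₂ q) (opX₀p q) (opX₁p q) (opX₂p q) ∧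
    HighRel q h (opE₁ q) (opE₂ q) (opF₁ q) (opF₂ q) (opK₁ q) (opK₂ q) (opX₀z q) (opX₁z q) (opX₂z q) ∧
    HighRel q h (opE₁ q) (opE₂ q) (opF₁ q) (opF₂ q) (opK₁ q) (opK₂ q) (opX₀m q) (opX₁m q) (opX₂m q) :=
  ⟨highRel_of hq h1 rfl E₁_X₂p F₁_X₂p (E₂_X₂p hq) (F₂_X₂p hq) (F₁_X₁p hq),
    highRel_of hq h1 rfl E₁_X₂z F₁_X₂z (E₂_X₂z hq) (F₂_X₂z hq) (F₁_X₁z hq),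
    highRel_of hq h1 rfl E₁_X₂m F₁_X₂m (E₂_X₂m hq) (F₂_X₂m hq) (F₁_X₁m hq)⟩

theorem highRel_opX (hq : q ∈ Set.Ioo (0 : ℝ) 1) {h : ℂ} (h1 : ((q ^ (1 / 2 : ℝ) : ℝ) : ℂ) = h) (s : ℤˣ) :
    HighRel q h (opE₁ q) (opE₂ q) (opF₁ q) (opF₂ q) (opK₁ q) (opK₂ q) (opX₀ q s) (opX₁ q s) (opX₂ q s) := by
  obtain ⟨hp, hz, hm⟩ := highRel_op hq h1
  rw [opX₀_eq, opX₁_eq, opX₂_eq]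
  exact (HighRel.add (P := Module.End ℂ Spin) hp (hz.smul _)).add hm

/-- The weights of `x₀`, `x₁`, `x₂`. -/
theorem XRel.hasWt {h : ℂ} {X₀ X₁ X₂ : Module.End ℂ Spin}
    (H : XRel q h (opE₁ q) (opE₂ q) (opF₁ q) (opF₂ q) (opK₁ q) (opK₂ q) X₀ X₁ X₂) :
    HasWt q 0 0 X₀ ∧ HasWt q 1 (-1) X₁ ∧ HasWt q 0 1 X₂ := by
  refine ⟨⟨?_, ?_⟩, ⟨?_, ?_⟩, ⟨?_, ?_⟩⟩
  · rw [H.K₁x₀, zpow_zero, one_smul]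
  · rw [H.K₂x₀, zpow_zero, one_smul]
  · rw [H.K₁x₁, zpow_one]
  · rw [H.K₂x₁, zpow_neg_one]
  · rw [H.K₁x₂, zpow_zero, one_smul]
  · rw [H.K₂x₂, zpow_one]

theorem hasWt_F₂ (hq : q ∈ Set.Ioo (0 : ℝ) 1) : HasWt q 1 (-2) (opF₂ q) := by
  have u := preSerre_op hq
  refine ⟨?_, ?_⟩
  · rw [u.F₂K₁, smul_smul, zpow_one, mul_inv_cancel₀ (ofReal_ne hq), one_smul]
  · rw [u.F₂K₂, smul_smul, zpow_neg, zpow_ofNat, inv_mul_cancel₀ (pow_ne_zero 2 (ofReal_ne hq)), one_smul]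

/-- An operator of highest weight `(3, -3)` vanishes. -/
theorem XRel.F₂x₁_eq (hq : q ∈ Set.Ioo (0 : ℝ) 1) {h : ℂ} {X₀ X₁ X₂ : Module.End ℂ Spin}
    (H : XRel q h (opE₁ q) (opE₂ q) (opF₁ q) (opF₂ q) (opK₁ q) (opK₂ q) X₀ X₁ X₂) :
    opF₂ q * X₁ = (q : ℂ) • (X₁ * opF₂ q) := by
  have q0 := ofReal_ne hq
  obtain ⟨e₁, e₂⟩ := H.F₂x₁_sub (preSerre_op hq) q0 (ofReal_sq_sub_one_ne hq) (ofReal_sq_add_one_ne q)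
  have w1 := H.hasWt.2.1
  have w : HasWt q 2 (-3) (opF₂ q * X₁ - (q : ℂ) • (X₁ * opF₂ q)) :=
    ((hasWt_F₂ hq).mul hq w1).sub ((w1.mul hq (hasWt_F₂ hq)).smul _)
  refine sub_eq_zero.1 (end_eq_zero_of_fip fun L' L M₁' M₂' J' M₁ M₂ J => ?_)
  by_cases hL : L' < L + 4
  · exact block_lowest hq (inv_ne_zero q0) q0 e₁ e₂ w (fun J' ha => by
      rw [admissible_iff] at ha; omega) _ _ _ _ _ _
  · exact block_highest hq e₁ e₂ w (fun J ha => by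
      rw [admissible_iff] at ha; omega) _ _ _ _ _ _

theorem XRel.crossed (hq : q ∈ Set.Ioo (0 : ℝ) 1) {h : ℂ} (h0 : h ≠ 0) (hh : (q : ℂ) = h ^ 2)
    (hc : starRingEnd ℂ h = h) {X₀ X₁ X₂ Y₁ Y₂ : Module.End ℂ Spin}
    (H : XRel q h (opE₁ q) (opE₂ q) (opF₁ q) (opF₂ q) (opK₁ q) (opK₂ q) X₀ X₁ X₂)
    (a₀ : IsAdj X₀ X₀) (a₁ : IsAdj X₁ Y₁) (a₂ : IsAdj X₂ Y₂) :
    Crossed q h (opE₁ q) (opE₂ q) (opF₁ q) (opF₂ q) (opK₁ q) (opK₂ q) X₀ X₁ Y₁ X₂ Y₂ := by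
  have q0 := ofReal_ne hq
  have aE₁ := opF₁_isAdj q
  have aE₂ := opF₂_isAdj q
  have aK₁ := opK₁_isAdj (q := q)
  have aK₂ := opK₂_isAdj (q := q)
  have K₁y₁ : opK₁ q * Y₁ = (q : ℂ)⁻¹ • (Y₁ * opK₁ q) := by
    have := adj_rel' aK₁ a₁ H.K₁x₁
    rw [Complex.conj_ofReal] at this
    exact smul_inv_comm (P := Module.End ℂ Spin) q0 this
  have K₂y₁ : opK₂ q * Y₁ = (q : ℂ) • (Y₁ * opK₂ q) := by
    have := adj_rel' aK₂ a₁ H.K₂x₁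
    rw [map_inv₀, Complex.conj_ofReal] at this
    exact (smul_inv_comm (P := Module.End ℂ Spin) (inv_ne_zero q0) this).trans (by rw [inv_inv])
  have K₁y₂ : opK₁ q * Y₂ = Y₂ * opK₁ q := (aK₁.mul a₂).eq_of_eq (a₂.mul aK₁) H.K₁x₂ |>.symm
  have K₂y₂ : opK₂ q * Y₂ = (q : ℂ)⁻¹ • (Y₂ * opK₂ q) := by
    have := adj_rel' aK₂ a₂ H.K₂x₂
    rw [Complex.conj_ofReal] at this
    exact smul_inv_comm (P := Module.End ℂ Spin) q0 this
  have one : ∀ Z W : Module.End ℂ Spin, Z = W → Z = (1 : ℂ) • W := fun Z W e => by rw [e, one_smul]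
  have lift : ∀ {Z W : Module.End ℂ Spin} {a : ℂ}, Z = a • W → ∀ b, b = a → Z = b • W :=
    fun e b hb => hb ▸ e
  have lift' : ∀ {Z V W : Module.End ℂ Spin} {a b : ℂ}, Z = a • V + b • W → ∀ a' b', a' = a → b' = b →
    Z = a' • V + b' • W := fun e a' b' ha hb => ha ▸ hb ▸ e
  have E₁y₁ := solve_rel (P := Module.End ℂ Spin) (by simpa using q0)
    (adj_rel aE₁.symm a₁ a₀ aK₁ H.F₁x₁) (one _ _ H.K₁x₀)
  have E₂y₂ := solve_rel (P := Module.End ℂ Spin) (by simpa using q0)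
    (adj_rel aE₂.symm a₂ a₁ aK₂ (H.F₂x₂.trans (congrArg (· + _) (one _ _ rfl)))) K₂y₁
  have F₁x₀ := solve_rel (P := Module.End ℂ Spin) (by simp)
    (adj_rel aE₁ a₀ a₁ aK₁ (H.E₁x₀.trans (congrArg (_ + ·) (one _ _ rfl)))) K₁y₁
  have F₂y₁ := solve_rel (P := Module.End ℂ Spin) (by simpa using q0)
    (adj_rel aE₂ a₁ a₂ aK₂ (H.E₂x₁.trans (congrArg (· + _) (one _ _ rfl)))) K₂y₂
  have F₁y₁ := smul_inv_comm (P := Module.End ℂ Spin) (by simpa using q0) (adj_rel' aE₁ a₁ H.E₁x₁)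
  have E₂y₁ := smul_inv_comm (P := Module.End ℂ Spin) (by simpa using q0)
    (adj_rel' aE₂.symm a₁ (H.F₂x₁_eq hq))
  have F₂y₂ := smul_inv_comm (P := Module.End ℂ Spin) (by simpa using q0) (adj_rel' aE₂ a₂ H.E₂x₂)
  have c1 : starRingEnd ℂ (q : ℂ) = q := Complex.conj_ofReal q
  exact { H with
    K₁y₁ := K₁y₁
    K₂y₁ := K₂y₁
    K₁y₂ := K₁y₂
    K₂y₂ := K₂y₂
    E₁y₁ := lift' E₁y₁ _ _ (by
      simp only [map_mul, map_add, map_inv₀, c1, hc]; rw [hh]; field_simp) (by simp [c1])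
    E₁y₂ := (aE₁.symm.mul a₂).eq_of_eq (a₂.mul aE₁.symm) H.F₁x₂ |>.symm
    E₂y₁ := lift E₂y₁ _ (by simp [c1])
    E₂y₂ := lift' E₂y₂ _ _ (by simp [c1, pow_two]) (by simp [c1])
    F₁x₀ := (lift' F₁x₀ (-(h ^ 3)⁻¹) 1 (by simp only [map_inv₀, map_one, hc, hh]; field_simp) (by simp)).trans
      (congrArg (_ + ·) (one_smul ℂ _))
    F₁y₁ := lift F₁y₁ _ (by simp [c1])
    F₁y₂ := (aE₁.mul a₂).eq_of_eq (a₂.mul aE₁) H.E₁x₂ |>.symm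
    F₂x₀ := (aE₂.mul a₀).eq_of_eq (a₀.mul aE₂) H.E₂x₀ |>.symm
    F₂x₁ := H.F₂x₁_eq hq
    F₂y₁ := lift' F₂y₁ _ _ (by simp [c1, pow_two]) (by simp [c1])
    F₂y₂ := lift F₂y₂ _ (by simp [c1]) }

end



/-! ### The representations `π_±`: relations of the sphere -/

section

variable {q : ℝ}

theorem fip_ket_eq {L M₁ M₂ J : ℤ} (h : Admissible L M₁ M₂ J) {L' M₁' M₂' J' : ℤ}
    (e : L = L' ∧ M₁ = M₁' ∧ M₂ = M₂' ∧ J = J') : fip (ket L M₁ M₂ J) (ket L' M₁' M₂' J') = 1 := by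
  obtain ⟨rfl, rfl, rfl, rfl⟩ := e
  exact fip_ket_self h

theorem opX₂_ket (s : ℤˣ) {L M₁ M₂ J : ℤ} (h : Admissible L M₁ M₂ J) : opX₂ q s (ket L M₁ M₂ J) =
    (coefDp q L J M₂ : ℂ) • ket (L + 2) M₁ (M₂ + 2) J +
    (((s : ℤ) : ℂ) * coefD0 q L J M₂) • ket L M₁ (M₂ + 2) J +
    (coefDm q L J M₂ : ℂ) • ket (L - 2) M₁ (M₂ + 2) J := by
  rw [opX₂, opOfKet_ket _ h]
  simp only [← Complex.coe_smul, Complex.ofReal_mul, Complex.ofReal_intCast]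

theorem three_ket (a b : ℤ) (f₁ f₂ f₃ : ℤ → ℤ → ℝ) (g₁ g₂ g₃ : ℤ → ℤ → ℤ → ℝ) {L M₁ M₂ J : ℤ}
    (h : Admissible L M₁ M₂ J) : three a b f₁ f₂ f₃ g₁ g₂ g₃ (ket L M₁ M₂ J) =
    ((f₁ J M₁ * g₁ L J M₂ : ℝ) : ℂ) • ket (L + a) (M₁ + b) M₂ (J + 2) +
    ((f₂ J M₁ * g₂ L J M₂ : ℝ) : ℂ) • ket (L + a) (M₁ + b) M₂ J +
    ((f₃ J M₁ * g₃ L J M₂ : ℝ) : ℂ) • ket (L + a) (M₁ + b) M₂ (J - 2) := by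
  rw [three, LinearMap.add_apply, LinearMap.add_apply, sh_ket _ _ _ _ _ h, sh_ket _ _ _ _ _ h,
    sh_ket _ _ _ _ _ h]
  simp only [add_zero, ← sub_eq_add_neg]

theorem opX₁_ket (s : ℤˣ) {L M₁ M₂ J : ℤ} (h : Admissible L M₁ M₂ J) : opX₁ q s (ket L M₁ M₂ J) =
    ((coefBp q J M₁ * coefCp q L J M₂ : ℝ) : ℂ) • ket (L + 2) (M₁ + 2) M₂ (J + 2) +
    ((coefB0 q J M₁ * coefHp q L J M₂ : ℝ) : ℂ) • ket (L + 2) (M₁ + 2) M₂ J +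
    ((coefBm q J M₁ * coefCm q (L + 2) (J - 2) M₂ : ℝ) : ℂ) • ket (L + 2) (M₁ + 2) M₂ (J - 2) +
    ((s : ℤ) : ℂ) • (((coefBp q J M₁ * -coefC0 q L J M₂ : ℝ) : ℂ) • ket L (M₁ + 2) M₂ (J + 2) +
    ((coefB0 q J M₁ * coefH0 q L J M₂ : ℝ) : ℂ) • ket L (M₁ + 2) M₂ J +
    ((coefBm q J M₁ * -coefC0 q L (J - 2) M₂ : ℝ) : ℂ) • ket L (M₁ + 2) M₂ (J - 2)) +
    (((coefBp q J M₁ * coefCm q L J M₂ : ℝ) : ℂ) • ket (L - 2) (M₁ + 2) M₂ (J + 2) +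
    ((coefB0 q J M₁ * coefHp q (L - 2) J M₂ : ℝ) : ℂ) • ket (L - 2) (M₁ + 2) M₂ J +
    ((coefBm q J M₁ * coefCp q (L - 2) (J - 2) M₂ : ℝ) : ℂ) • ket (L - 2) (M₁ + 2) M₂ (J - 2)) := by
  rw [opX₁_eq, opX₁p, opX₁z, opX₁m]
  simp only [LinearMap.add_apply, LinearMap.smul_apply, three_ket _ _ _ _ _ _ _ _ h, add_zero,
    ← sub_eq_add_neg]

theorem units_sq (s : ℤˣ) : ((s : ℤ) : ℂ) * ((s : ℤ) : ℂ) = 1 := by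
  rw [← Int.cast_mul, Int.units_coe_mul_self, Int.cast_one]

theorem opX_comm (hq : q ∈ Set.Ioo (0 : ℝ) 1) (s : ℤˣ) :
    opX₁ q s * opX₂ q s = (q : ℂ) ^ 2 • (opX₂ q s * opX₁ q s) := by
  obtain ⟨h, h0, hh, h1, -⟩ := S4.rpow_half q hq.1
  have q0 := ofReal_ne hq
  have H := (highRel_opX hq h1 s).xRel (preSerre_op hq) hh h0 (ofReal_sq_sub_one_ne hq)
    (ofReal_sq_add_one_ne q)
  obtain ⟨e₁, e₂⟩ := H.comm_x₁x₂ q0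
  obtain ⟨-, w1, w2⟩ := H.hasWt
  have w : HasWt q 1 0 (opX₁ q s * opX₂ q s - (q : ℂ) ^ 2 • (opX₂ q s * opX₁ q s)) :=
    (w1.mul hq w2).sub ((w2.mul hq w1).smul _)
  have ss := units_sq s
  refine sub_eq_zero.1 (end_eq_zero_of_fip fun L' L M₁' M₂' J' M₁ M₂ J => ?_)
  by_cases hL : L % 2 = 1 ∧ 1 ≤ L
  swap
  · rw [ket_of_not_adm (L := L) (fun ha => hL (by rw [admissible_iff] at ha; omega)), map_zero,
      fip_zero_right]
  obtain ⟨hL, hL1⟩ := hL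
  obtain ⟨c1, c2, c3, c4⟩ := comm_x₁x₂_coef hq hL hL1
  by_cases hL' : L' < L + 2
  · refine block_lowest hq (inv_ne_zero q0) one_ne_zero e₁ e₂ w (fun J' ha => ?_) _ _ _ _ _ _
    norm_num at ha ⊢
    have u : Admissible L (-1) (-L) 1 := by rw [admissible_iff]; omega
    have u1 : Admissible L (-1) (-L + 2) 1 := by rw [admissible_iff]; omega
    have u2 : Admissible (L + 2) (-1) (-L + 2) 1 := by rw [admissible_iff]; omega
    have u3 : Admissible L 1 (-L) 1 := by rw [admissible_iff]; omega
    have u4 : Admissible (L + 2) 1 (-L) 1 := by rw [admissible_iff]; omega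
    have u5 : Admissible (L + 2) 1 (-L) 3 := by rw [admissible_iff]; omega
    have ha' := admissible_iff.1 ha
    rw [show 2 - L = -L + 2 by ring] at c1 c2 c3
    have hx : (L = 1 ∧ opX₁ q s (ket (L - 2) (-1) (-L + 2) 1) = 0 ∧ coefDm q L 1 (-L) = 0) ∨
        3 ≤ L ∧ Admissible (L - 2) (-1) (-L + 2) 1 := by
      by_cases h3 : 3 ≤ L
      · exact Or.inr ⟨h3, by rw [admissible_iff]; omega⟩
      · rw [ket_of_not_adm (fun h => by rw [admissible_iff] at h; omega), map_zero]
        exact Or.inl ⟨by omega, rfl, coefDm_zero u (by omega)⟩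
    have hL1' : ket (L - 2) 1 (-L) 1 = 0 := ket_of_not_adm fun h => by rw [admissible_iff] at h; omega
    have hL2' : ket L 1 (-L) 3 = 0 := ket_of_not_adm fun h => by rw [admissible_iff] at h; omega
    have hL3' : ket (L - 2) 1 (-L) 3 = 0 := ket_of_not_adm fun h => by rw [admissible_iff] at h; omega
    have hL4' : ∀ N, ket N 1 (-L) (-1) = 0 := fun N => ket_of_not_adm fun h => by
      rw [admissible_iff] at h; omega
    simp only [LinearMap.sub_apply, LinearMap.smul_apply, Module.End.mul_apply, opX₂_ket s u, opX₁_ket s u]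
    norm_num only
    simp only [hL1', hL2', hL3', hL4', smul_zero, add_zero, zero_add, map_add, map_smul, opX₂_ket s u3,
      opX₂_ket s u4, opX₂_ket s u5, opX₁_ket s u1, opX₁_ket s u2]
    obtain rfl | rfl : J' = 1 ∨ J' = 3 := by omega
    · obtain rfl | rfl : L' = L - 2 ∨ L' = L := by omega
      · obtain ⟨rfl, -, -⟩ | ⟨h3, u6⟩ := hx
        · norm_num at ha'
        simp only [opX₁_ket s u6]
        simp only [fip_add_right, fip_sub_right, fip_smul_right]
        simp (disch := omega) only [fip_ket_eq ha, fip_ket_of_ne]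
        have c := congrArg (Complex.ofReal) (c1 h3)
        push_cast at c ⊢
        linear_combination ((s : ℤ) : ℂ) * coefB0 q 1 (-1) * c
      · obtain ⟨-, hx, hz⟩ | ⟨h3, u6⟩ := hx
        · simp only [hx, hz, Complex.ofReal_zero, zero_smul, add_zero]
          simp only [fip_add_right, fip_sub_right, fip_smul_right]
          simp (disch := omega) only [fip_ket_eq ha, fip_ket_of_ne]
          have c := congrArg (Complex.ofReal) c2
          rw [hz] at c
          push_cast at c ⊢
          simp only [add_sub_cancel_right]
          linear_combination coefB0 q 1 (-1) * c + (coefB0 q 1 (-1) * coefD0 q L' 1 (-L') *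
            coefH0 q L' 1 (-L' + 2) - q ^ 2 * coefB0 q 1 (-1) * coefH0 q L' 1 (-L') * coefD0 q L' 1 (-L')) * ss
        · simp only [opX₁_ket s u6]
          simp only [fip_add_right, fip_sub_right, fip_smul_right]
          simp (disch := omega) only [fip_ket_eq ha, fip_ket_of_ne]
          have c := congrArg (Complex.ofReal) c2
          push_cast at c ⊢
          simp only [add_sub_cancel_right]
          linear_combination coefB0 q 1 (-1) * c + (coefB0 q 1 (-1) * coefD0 q L' 1 (-L') *
            coefH0 q L' 1 (-L' + 2) - q ^ 2 * coefB0 q 1 (-1) * coefH0 q L' 1 (-L') * coefD0 q L' 1 (-L')) * ss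
    · obtain rfl : L' = L := by omega
      obtain ⟨rfl, -, -⟩ | ⟨h3, u6⟩ := hx
      · norm_num at ha'
      simp only [opX₁_ket s u6]
      simp only [fip_add_right, fip_sub_right, fip_smul_right]
      simp (disch := omega) only [fip_ket_eq ha, fip_ket_of_ne]
      have c := congrArg (Complex.ofReal) (c3 h3)
      push_cast at c ⊢
      simp only [add_sub_cancel_right]
      linear_combination coefBp q 1 (-1) * c -
        coefBp q 1 (-1) * coefD0 q L' 1 (-L') * coefC0 q L' 1 (-L' + 2) * ss
  · refine block_highest hq e₁ e₂ w (fun J ha => ?_) _ _ _ _ _ _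
    have ha' := admissible_iff.1 ha
    obtain rfl : L' = L + 2 := by omega
    obtain rfl : J = 1 := by omega
    norm_num at ha ⊢
    have v : Admissible (L + 2) 1 (L + 2) 1 := by rw [admissible_iff]; omega
    have v1 : Admissible (L + 2) (-1) (L + 2) 1 := by rw [admissible_iff]; omega
    have v2 : Admissible (L + 2) 1 L 1 := by rw [admissible_iff]; omega
    have v3 : Admissible L 1 L 1 := by rw [admissible_iff]; omega
    have z : ∀ {N M M' J : ℤ}, N + 1 - J < M' ∨ J < 1 → ket N M M' J = 0 := fun h => ket_of_not_adm fun h' => by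
      rw [admissible_iff] at h'; omega
    simp only [opX₂_ket s ha, opX₁_ket s ha]
    norm_num only
    have v4 : Admissible (L + 2) 1 L 3 ∨ ket (L + 2) 1 L 3 = 0 := by
      by_cases h' : Admissible (L + 2) 1 L 3
      · exact Or.inl h'
      · exact Or.inr (ket_of_not_adm h')
    simp (disch := omega) only [z, smul_zero, add_zero, zero_add, map_add, map_smul, opX₁_ket s v1,
      opX₂_ket s v2, opX₂_ket s v3]
    have h3 : fip (ket (L + 2) 1 (L + 2) 1) (opX₂ q s (ket (L + 2) 1 L 3)) = 0 := by
      rcases v4 with v4 | v4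
      · rw [opX₂_ket s v4]
        simp only [fip_add_right, fip_smul_right]
        simp (disch := omega) only [fip_ket_of_ne, mul_zero, add_zero]
      · rw [v4, map_zero, fip_zero_right]
    simp only [fip_add_right, fip_sub_right, fip_smul_right, h3]
    simp (disch := omega) only [fip_ket_eq v, fip_ket_of_ne]
    have c := congrArg (Complex.ofReal) c4
    push_cast at c ⊢
    linear_combination ((s : ℤ) : ℂ) * coefB0 q 1 (-1) * c

end



/-! ### The representations `π_±` -/

section

variable {q : ℝ}

variable (q) in
/-- The adjoint of `three`. -/
noncomputable def threeAdj (a b : ℤ) (f₁ f₂ f₃ : ℤ → ℤ → ℝ) (g₁ g₂ g₃ : ℤ → ℤ → ℤ → ℝ) :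
    Module.End ℂ Spin :=
  three (-a) (-b) (fun J M₁ => f₃ (J + 2) (M₁ - b)) (fun J M₁ => f₂ J (M₁ - b))
    (fun J M₁ => f₁ (J - 2) (M₁ - b)) (fun L J M₂ => g₃ (L - a) (J + 2) M₂)
    (fun L J M₂ => g₂ (L - a) J M₂) fun L J M₂ => g₁ (L - a) (J - 2) M₂

variable (q) in
/-- The adjoint of `x₁`. -/
noncomputable def opY₁ (s : ℤˣ) : Module.End ℂ Spin :=
  threeAdj 2 2 (coefBp q) (coefB0 q) (coefBm q) (coefCp q) (coefHp q) (fun L J M₂ => coefCm q (L + 2) (J - 2) M₂) +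
  ((s : ℤ) : ℂ) • threeAdj 0 2 (coefBp q) (coefB0 q) (coefBm q)
    (fun L J M₂ => -coefC0 q L J M₂) (coefH0 q) (fun L J M₂ => -coefC0 q L (J - 2) M₂) +
  threeAdj (-2) 2 (coefBp q) (coefB0 q) (coefBm q) (coefCm q) (fun L J M₂ => coefHp q (L - 2) J M₂)
    fun L J M₂ => coefCp q (L - 2) (J - 2) M₂

variable (q) in
/-- The adjoint of `x₂`. -/
noncomputable def opY₂ (s : ℤˣ) : Module.End ℂ Spin :=
  sh (-2) 0 (-2) 0 (fun L M₁ M₂ J => cXp q (L - 2) M₁ (M₂ - 2) J) +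
  ((s : ℤ) : ℂ) • sh 0 0 (-2) 0 (fun L M₁ M₂ J => cXz q L M₁ (M₂ - 2) J) +
  sh 2 0 (-2) 0 (fun L M₁ M₂ J => cXm q (L + 2) M₁ (M₂ - 2) J)

theorem opX₁_isAdj (s : ℤˣ) : IsAdj (opX₁ q s) (opY₁ q s) := by
  rw [opX₁_eq]
  refine ((three_isAdj _ _ _ _ _ _ _ _).add ?_).add (three_isAdj _ _ _ _ _ _ _ _)
  rw [← Complex.ofReal_intCast]
  exact (three_isAdj _ _ _ _ _ _ _ _).smul_real _

theorem opX₂_isAdj (s : ℤˣ) : IsAdj (opX₂ q s) (opY₂ q s) := by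
  rw [opX₂_eq]
  have h1 := sh_isAdj 2 0 2 0 (cXp q)
  have h2 := sh_isAdj 0 0 2 0 (cXz q)
  have h3 := sh_isAdj (-2) 0 2 0 (cXm q)
  simp only [neg_zero, sub_zero, neg_neg, sub_neg_eq_add] at h1 h2 h3
  refine (h1.add ?_).add h3
  rw [← Complex.ofReal_intCast]
  exact h2.smul_real _

theorem opX₀_isAdj (s : ℤˣ) : IsAdj (opX₀ q s) (opX₀ q s) := by
  rw [opX₀_eq]
  have h := ((X₀p_isAdj (q := q)).add ((X₀z_isAdj (q := q)).smul_real ((s : ℤ) : ℝ))).add (X₀p_isAdj (q := q)).symm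
  rw [Complex.ofReal_intCast] at h
  exact (congrArg (IsAdj _) (add_rev (opX₀p q) (((s : ℤ) : ℂ) • opX₀z q) (opX₀m q))).mp h

theorem crossed_op (hq : q ∈ Set.Ioo (0 : ℝ) 1) {h : ℂ} (h0 : h ≠ 0) (hh : (q : ℂ) = h ^ 2)
    (h1 : ((q ^ (1 / 2 : ℝ) : ℝ) : ℂ) = h) (s : ℤˣ) :
    Crossed q h (opE₁ q) (opE₂ q) (opF₁ q) (opF₂ q) (opK₁ q) (opK₂ q) (opX₀ q s) (opX₁ q s) (opY₁ q s)
      (opX₂ q s) (opY₂ q s) :=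
  ((highRel_opX hq h1 s).xRel (preSerre_op hq) hh h0 (ofReal_sq_sub_one_ne hq)
    (ofReal_sq_add_one_ne q)).crossed hq h0 hh (by rw [← h1, Complex.conj_ofReal]) (opX₀_isAdj s) (opX₁_isAdj s)
    (opX₂_isAdj s)

/-- The norms of the images of the lowest weight vectors. -/
theorem opX₀_lowest (s : ℤˣ) {L : ℤ} (u : Admissible L (-1) (-L) 1) : opX₀ q s (ket L (-1) (-L) 1) =
    ((coefAp q 1 (-1) * coefCp q L 1 (-L) : ℝ) : ℂ) • ket (L + 2) (-1) (-L) 3 +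
    ((coefA0 q 1 (-1) * coefHp q L 1 (-L) : ℝ) : ℂ) • ket (L + 2) (-1) (-L) 1 +
    (((s : ℤ) : ℂ) * (coefA0 q 1 (-1) * coefH0 q L 1 (-L) : ℝ)) • ket L (-1) (-L) 1 := by
  have z : ∀ {N M M' J : ℤ}, M' < -(N + 1 - J) ∨ J < 1 → ket N M M' J = 0 := fun h =>
    ket_of_not_adm fun h' => by rw [admissible_iff] at h'; omega
  rw [opX₀_eq, opX₀p, opX₀z, opX₀m]
  simp only [LinearMap.add_apply, LinearMap.smul_apply, three_ket _ _ _ _ _ _ _ _ u]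
  norm_num only
  simp (disch := omega) only [z, smul_zero, add_zero, zero_add, smul_smul]

theorem opY₁_lowest (s : ℤˣ) {L : ℤ} (u : Admissible L (-1) (-L) 1) : opY₁ q s (ket L (-1) (-L) 1) =
    ((coefBm q 3 (-3) * coefCp q L 1 (-L) : ℝ) : ℂ) • ket (L + 2) (-3) (-L) 3 := by
  have z : ∀ {N M M' J : ℤ}, M' < -(N + 1 - J) ∨ J < 1 ∨ M < -J → ket N M M' J = 0 := fun h =>
    ket_of_not_adm fun h' => by rw [admissible_iff] at h'; omega
  rw [opY₁, threeAdj, threeAdj, threeAdj]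
  simp only [LinearMap.add_apply, LinearMap.smul_apply, three_ket _ _ _ _ _ _ _ _ u]
  norm_num only
  simp (disch := omega) only [z, smul_zero, add_zero, zero_add, smul_smul]
  rw [sub_neg_eq_add, add_sub_cancel_right]

theorem opY₂_lowest (s : ℤˣ) {L : ℤ} (u : Admissible L (-1) (-L) 1) : opY₂ q s (ket L (-1) (-L) 1) =
    (coefDm q (L + 2) 1 (-L - 2) : ℂ) • ket (L + 2) (-1) (-L - 2) 1 := by
  have z : ∀ {N M M' J : ℤ}, M' < -(N + 1 - J) ∨ J < 1 ∨ M < -J → ket N M M' J = 0 := fun h =>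
    ket_of_not_adm fun h' => by rw [admissible_iff] at h'; omega
  rw [opY₂]
  simp only [LinearMap.add_apply, LinearMap.smul_apply, sh_ket _ _ _ _ _ u, cXp, cXz, cXm]
  norm_num only
  simp (disch := omega) only [z, smul_zero, add_zero, zero_add, smul_smul]
  rw [← sub_eq_add_neg]

theorem comm_sub_one {P : Type} [Ring P] [Algebra ℂ P] {X Z : P} (h : X * Z = Z * X) :
    X * (Z - 1) = (1 : ℂ) • ((Z - 1) * X) := by
  rw [one_smul, mul_sub, sub_mul, h, mul_one, one_mul]

theorem opX_sphere (hq : q ∈ Set.Ioo (0 : ℝ) 1) (s : ℤˣ) :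
    opX₀ q s * opX₀ q s + opX₁ q s * opY₁ q s + opX₂ q s * opY₂ q s = 1 := by
  obtain ⟨h, h0, hh, h1, -⟩ := S4.rpow_half q hq.1
  have H := crossed_op hq h0 hh h1 s
  obtain ⟨-, -, r3, -, -⟩ := H.relations (preSerre_op hq) hh h0 (ofReal_sq_add_one_ne q) (opX_comm hq s)
  have a₀ := opX₀_isAdj (q := q) s
  have a₁ := opX₁_isAdj (q := q) s
  have a₂ := opX₂_isAdj (q := q) s
  have r5 : opY₁ q s * opX₀ q s = (q : ℂ) ^ 2 • (opX₀ q s * opY₁ q s) := by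
    have := adj_rel' a₀ a₁ r3
    rwa [map_pow, Complex.conj_ofReal] at this
  set Z := opX₀ q s * opX₀ q s + opX₁ q s * opY₁ q s + opX₂ q s * opY₂ q s with hZ
  have hE : ∀ X, X = opE₁ q ∨ X = opE₂ q ∨ X = opF₁ q ∨ X = opF₂ q → X * Z = Z * X :=
    fun X hX => H.sphere_comm hh h0 X hX r3 r5
  have hE' : ∀ X, X = opE₁ q ∨ X = opE₂ q ∨ X = opF₁ q ∨ X = opF₂ q →
      X * (Z - 1) = (1 : ℂ) • ((Z - 1) * X) := fun X hX =>
    comm_sub_one (P := Module.End ℂ Spin) (hE X hX)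
  obtain ⟨w0, w1, w2⟩ := H.hasWt
  have v1 : HasWt q (-1) 1 (opY₁ q s) := ⟨by rw [zpow_neg_one]; exact H.K₁y₁, by rw [zpow_one]; exact H.K₂y₁⟩
  have v2 : HasWt q 0 (-1) (opY₂ q s) :=
    ⟨by rw [zpow_zero, one_smul]; exact H.K₁y₂, by rw [zpow_neg_one]; exact H.K₂y₂⟩
  have p0 : HasWt q 0 0 (opX₀ q s * opX₀ q s) := w0.mul hq w0
  have p1 : HasWt q 0 0 (opX₁ q s * opY₁ q s) := by simpa using w1.mul hq v1
  have p2 : HasWt q 0 0 (opX₂ q s * opY₂ q s) := by simpa using w2.mul hq v2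
  have p3 : HasWt q 0 0 (1 : Module.End ℂ Spin) := by
    constructor <;> rw [mul_one, zpow_zero, one_smul, one_mul]
  have w : HasWt q 0 0 (Z - 1) := ((p0.add p1).add p2).sub p3
  refine sub_eq_zero.1 (end_eq_zero_of_fip fun L' L M₁' M₂' J' M₁ M₂ J => ?_)
  by_cases hL' : L' ≤ L
  · refine block_lowest hq one_ne_zero one_ne_zero (hE' _ (Or.inl rfl)) (hE' _ (Or.inr (Or.inl rfl))) w
      (fun J' ha => ?_) _ _ _ _ _ _
    have ha' := admissible_iff.1 ha
    obtain rfl : L' = L := by omega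
    obtain rfl : J' = 1 := by omega
    norm_num at ha ⊢
    have t1 : Admissible (L' + 2) (-1) (-L') 3 := by rw [admissible_iff]; omega
    have t2 : Admissible (L' + 2) (-1) (-L') 1 := by rw [admissible_iff]; omega
    have t3 : Admissible (L' + 2) (-3) (-L') 3 := by rw [admissible_iff]; omega
    have t4 : Admissible (L' + 2) (-1) (-L' - 2) 1 := by rw [admissible_iff]; omega
    rw [fip_sub_right, hZ]
    simp only [LinearMap.add_apply, Module.End.mul_apply, fip_add_right]
    rw [← a₀, ← a₁.symm, ← a₂.symm, opX₀_lowest s ha, opY₁_lowest s ha, opY₂_lowest s ha]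
    simp only [fip_add_right, fip_smul_right, fip_add_left, fip_smul_left]
    simp (disch := omega) only [fip_ket_eq ha, fip_ket_eq t1, fip_ket_eq t2, fip_ket_eq t3, fip_ket_eq t4,
      fip_ket_of_ne]
    have c := congrArg Complex.ofReal (sphere_coef hq (L := L') (by omega) (by omega))
    simp only [map_mul, Complex.conj_ofReal, map_intCast]
    push_cast at c ⊢
    linear_combination c + (coefA0 q 1 (-1) * coefH0 q L' 1 (-L')) ^ 2 * units_sq s
  · exact block_highest hq (hE' _ (Or.inl rfl)) (hE' _ (Or.inr (Or.inl rfl))) w (fun J ha => by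
      rw [admissible_iff] at ha; omega) _ _ _ _ _ _

end

/-! ### Representations given on generators -/

theorem isStarRep_of_gen {q : ℝ} {ρ : S4 q →ₐ[ℂ] Module.End ℂ Spin}
    (h : ∀ x, IsAdj (ρ (S4.gen q x)) (ρ (S4.gen q x.star))) : IsStarRep ρ := by
  suffices H : ∀ a, IsAdj (ρ a) (ρ (star a)) from H
  intro a
  induction a using S4.induction with
  | hc c =>
    rw [← algebraMap_star_comm, AlgHom.commutes, AlgHom.commutes]
    exact IsAdj.algebraMap c
  | hg x => rw [S4.star_gen]; exact h x
  | hm a b ha hb => rw [star_mul, map_mul, map_mul]; exact ha.mul hb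
  | ha a b ha hb => rw [star_add, map_add, map_add]; exact ha.add hb

theorem act_algebraMap {q : ℝ} (hq : q ∈ Set.Ioo (0 : ℝ) 1) (h : UGen) (c : ℂ) :
    S4.act q hq h (algebraMap ℂ (S4 q) c) = h.counit • algebraMap ℂ (S4 q) c := by
  cases h with
  | K i => rw [UGen.counit, one_smul]; exact AlgHom.commutes (S4.scale q _ _) c
  | Kinv i => rw [UGen.counit, one_smul]; exact AlgHom.commutes (S4.scale q _ _) c
  | E i =>
    rw [UGen.counit, zero_smul]
    change S4.twE q hq i (algebraMap ℂ (S4 q) c) 0 1 = 0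
    rw [AlgHom.commutes]; simp [Matrix.algebraMap_matrix_apply]
  | F i =>
    rw [UGen.counit, zero_smul]
    change S4.twF q hq i (algebraMap ℂ (S4 q) c) 0 1 = 0
    rw [AlgHom.commutes]; simp [Matrix.algebraMap_matrix_apply]

theorem crossed_mul {P : Type} [Ring P] {X K A B XA LA XB LB KB : P} (h₁ : X * A = XA * K + LA * X)
    (h₂ : X * B = XB * K + LB * X) (h₃ : K * B = KB * K) :
    X * (A * B) = (XA * KB + LA * XB) * K + LA * LB * X := by
  rw [← mul_assoc, h₁, add_mul, mul_assoc XA, h₃, mul_assoc LA, h₂]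
  noncomm_ring

/-- Equivariance has to be checked only on the generators of `A(S⁴_q)`. -/
theorem crossed_of_gen {q : ℝ} (hq : q ∈ Set.Ioo (0 : ℝ) 1) {σ : UGen → Module.End ℂ Spin}
    {ρ : S4 q →ₐ[ℂ] Module.End ℂ Spin}
    (H : ∀ h x, σ h * ρ (S4.gen q x) =
      (h.coprod.map fun p => ρ (S4.act q hq p.1 (S4.gen q x)) * σ p.2).sum) (h : UGen) (a : S4 q) :
    σ h * ρ a = (h.coprod.map fun p => ρ (S4.act q hq p.1 a) * σ p.2).sum := by
  induction a using S4.induction generalizing h with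
  | hc c =>
    cases h <;> simp only [UGen.coprod, List.map_cons, List.map_nil, List.sum_cons, List.sum_nil, add_zero,
      act_algebraMap, UGen.counit, one_smul, zero_smul, map_zero, zero_mul, zero_add, AlgHom.commutes,
      Algebra.commutes]
  | hg x => exact H _ x
  | hm a b ha hb =>
    cases h with
    | K i =>
      have h₁ := ha (UGen.K i)
      have h₂ := hb (UGen.K i)
      simp only [UGen.coprod, List.map_cons, List.map_nil, List.sum_cons, List.sum_nil, add_zero, S4.act_mul,
        map_mul] at h₁ h₂ ⊢
      rw [← mul_assoc, h₁, mul_assoc, h₂, mul_assoc]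
    | Kinv i =>
      have h₁ := ha (UGen.Kinv i)
      have h₂ := hb (UGen.Kinv i)
      simp only [UGen.coprod, List.map_cons, List.map_nil, List.sum_cons, List.sum_nil, add_zero, S4.act_mul,
        map_mul] at h₁ h₂ ⊢
      rw [← mul_assoc, h₁, mul_assoc, h₂, mul_assoc]
    | E i =>
      have h₁ := ha (UGen.E i)
      have h₂ := hb (UGen.E i)
      have h₃ := hb (UGen.K i)
      simp only [UGen.coprod, List.map_cons, List.map_nil, List.sum_cons, List.sum_nil, add_zero, S4.act_mul,
        map_mul, map_add] at h₁ h₂ h₃ ⊢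
      exact crossed_mul (P := Module.End ℂ Spin) h₁ h₂ h₃
    | F i =>
      have h₁ := ha (UGen.F i)
      have h₂ := hb (UGen.F i)
      have h₃ := hb (UGen.K i)
      simp only [UGen.coprod, List.map_cons, List.map_nil, List.sum_cons, List.sum_nil, add_zero, S4.act_mul,
        map_mul, map_add] at h₁ h₂ h₃ ⊢
      exact crossed_mul (P := Module.End ℂ Spin) h₁ h₂ h₃
  | ha a b ha hb =>
    rw [map_add, mul_add, ha, hb]
    cases h <;> simp only [UGen.coprod, List.map_cons, List.map_nil, List.sum_cons, List.sum_nil, add_zero,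
      map_add, add_mul]
    all_goals abel



section

variable {q : ℝ}

theorem inv_comm_of_comm {P : Type} [Ring P] [Algebra ℂ P] {K L X : P} {c : ℂ} (hc : c ≠ 0)
    (h₁ : K * L = 1) (h₂ : L * K = 1) (h : K * X = c • (X * K)) : L * X = c⁻¹ • (X * L) :=
  PreSerre.inv_comm (inv_mul_cancel₀ hc) h₁ h₂ h

/-- Operators satisfying `Crossed` form an equivariant representation. -/
theorem Crossed.equivariant (hq : q ∈ Set.Ioo (0 : ℝ) 1) {h : ℂ}
    (e₁ : ((q ^ (1 / 2 : ℝ) : ℝ) : ℂ) = h) (e₂ : ((q ^ (-1 / 2 : ℝ) : ℝ) : ℂ) = h⁻¹)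
    (e₃ : ((q ^ (3 / 2 : ℝ) : ℝ) : ℂ) = h ^ 3) (e₄ : ((q ^ (-3 / 2 : ℝ) : ℝ) : ℂ) = (h ^ 3)⁻¹)
    {X₀ X₁ Y₁ X₂ Y₂ : Module.End ℂ Spin}
    (H : Crossed q h (opE₁ q) (opE₂ q) (opF₁ q) (opF₂ q) (opK₁ q) (opK₂ q) X₀ X₁ Y₁ X₂ Y₂)
    {ρ : S4 q →ₐ[ℂ] Module.End ℂ Spin} (x₀ : ρ (S4.x₀ q) = X₀) (x₁ : ρ (S4.x₁ q) = X₁)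
    (y₁ : ρ (S4.y₁ q) = Y₁) (x₂ : ρ (S4.x₂ q) = X₂) (y₂ : ρ (S4.y₂ q) = Y₂) (g : UGen) (a : S4 q) :
    opU q g * ρ a = (g.coprod.map fun p => ρ (S4.act q hq p.1 a) * opU q p.2).sum := by
  have u := preSerre_op hq
  have hq0 := ofReal_ne hq
  have one : ∀ {Z W : Module.End ℂ Spin}, Z = W → Z = (1 : ℂ) • W := fun e => by rw [e, one_smul]
  have l1 : ∀ {X : Module.End ℂ Spin} {c : ℂ}, c ≠ 0 → opK₁ q * X = c • (X * opK₁ q) →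
    opKi₁ q * X = c⁻¹ • (X * opKi₁ q) := fun hc => inv_comm_of_comm (P := Module.End ℂ Spin) hc u.K₁L₁ u.L₁K₁
  have l2 : ∀ {X : Module.End ℂ Spin} {c : ℂ}, c ≠ 0 → opK₂ q * X = c • (X * opK₂ q) →
    opKi₂ q * X = c⁻¹ • (X * opKi₂ q) := fun hc => inv_comm_of_comm (P := Module.End ℂ Spin) hc u.K₂L₂ u.L₂K₂
  refine crossed_of_gen hq (fun g x => ?_) g a
  have k0 := l1 one_ne_zero (one H.K₁x₀)
  have k1 := l1 hq0 H.K₁x₁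
  have k2 := l1 (inv_ne_zero hq0) H.K₁y₁
  have k3 := l1 one_ne_zero (one H.K₁x₂)
  have k4 := l1 one_ne_zero (one H.K₁y₂)
  have m0 := l2 one_ne_zero (one H.K₂x₀)
  have m1 := l2 (inv_ne_zero hq0) H.K₂x₁
  have m2 := l2 hq0 H.K₂y₁
  have m3 := l2 hq0 H.K₂x₂
  have m4 := l2 (inv_ne_zero hq0) H.K₂y₂
  cases g with
  | K i =>
    fin_cases i <;> cases x <;> simp only [UGen.coprod, List.map_cons, List.map_nil, List.sum_cons, List.sum_nil,
      add_zero, S4.act_gen q hq, S4.wt, Fin.zero_eta, Fin.mk_one, opU, map_smul, map_zero,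
      zero_mul, zero_add, smul_mul_assoc, x₀, x₁, x₂, y₁, y₂, inv_one, one_smul, inv_inv, S4.qnum_two q hq,
      Complex.ofReal_mul, Complex.ofReal_add, Complex.ofReal_inv, H.K₁x₀, H.K₁x₁, H.K₁y₁, H.K₁x₂, H.K₁y₂, H.K₂x₀, H.K₂x₁, H.K₂y₁, H.K₂x₂, H.K₂y₂]
  | Kinv i =>
    fin_cases i <;> cases x <;> simp only [UGen.coprod, List.map_cons, List.map_nil, List.sum_cons, List.sum_nil,
      add_zero, S4.act_gen q hq, S4.wt, Fin.zero_eta, Fin.mk_one, opU, map_smul, map_zero,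
      zero_mul, zero_add, smul_mul_assoc, x₀, x₁, x₂, y₁, y₂, inv_one, one_smul, inv_inv, S4.qnum_two q hq,
      Complex.ofReal_mul, Complex.ofReal_add, Complex.ofReal_inv, k0, k1, k2, k3, k4, m0, m1, m2, m3, m4]
  | E i =>
    fin_cases i <;> cases x <;> simp only [UGen.coprod, List.map_cons, List.map_nil, List.sum_cons, List.sum_nil,
      add_zero, S4.act_gen q hq, S4.wt, S4.actE, Fin.zero_eta, Fin.mk_one, opU, map_smul, map_zero,
      zero_mul, zero_add, smul_mul_assoc, x₀, x₁, x₂, y₁, y₂, inv_one, one_smul, inv_inv, S4.qnum_two q hq,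
      Complex.ofReal_mul, Complex.ofReal_add, Complex.ofReal_inv, H.E₁x₀, H.E₁x₁, H.E₁y₁, H.E₁x₂, H.E₁y₂, H.E₂x₀, H.E₂x₁, H.E₂y₁, H.E₂x₂, H.E₂y₂, e₂, e₃]
  | F i =>
    fin_cases i <;> cases x <;> simp only [UGen.coprod, List.map_cons, List.map_nil, List.sum_cons, List.sum_nil,
      add_zero, S4.act_gen q hq, S4.wt, S4.actF, Fin.zero_eta, Fin.mk_one, opU, map_smul, map_zero,
      zero_mul, zero_add, smul_mul_assoc, x₀, x₁, x₂, y₁, y₂, inv_one, one_smul, inv_inv, S4.qnum_two q hq,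
      Complex.ofReal_mul, Complex.ofReal_add, Complex.ofReal_inv, H.F₁x₀, H.F₁x₁, H.F₁y₁, H.F₁x₂, H.F₁y₂, H.F₂x₀, H.F₂x₁, H.F₂y₁, H.F₂x₂, H.F₂y₂, e₁, e₄]

/-- Elements satisfying the relations of `A(S⁴_q)`. -/
structure SphereRel (q : ℝ) {P : Type} [Ring P] [Algebra ℂ P] (f : SGen → P) : Prop where
  x₀x₁ : f .x₀ * f .x₁ = (q : ℂ) ^ 2 • (f .x₁ * f .x₀)
  x₀x₂ : f .x₀ * f .x₂ = (q : ℂ) ^ 2 • (f .x₂ * f .x₀)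
  x₁x₂ : f .x₁ * f .x₂ = (q : ℂ) ^ 2 • (f .x₂ * f .x₁)
  y₁x₀ : f .y₁ * f .x₀ = (q : ℂ) ^ 2 • (f .x₀ * f .y₁)
  y₂x₀ : f .y₂ * f .x₀ = (q : ℂ) ^ 2 • (f .x₀ * f .y₂)
  y₂y₁ : f .y₂ * f .y₁ = (q : ℂ) ^ 2 • (f .y₁ * f .y₂)
  y₁x₂ : f .y₁ * f .x₂ = (q : ℂ) ^ 2 • (f .x₂ * f .y₁)
  y₂x₁ : f .y₂ * f .x₁ = (q : ℂ) ^ 2 • (f .x₁ * f .y₂)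
  comm₁ : f .y₁ * f .x₁ = f .x₁ * f .y₁ + (1 - (q : ℂ) ^ 4) • (f .x₀ * f .x₀)
  comm₂ : f .y₂ * f .x₂ = f .x₂ * f .y₂ + (f .y₁ * f .x₁ - (q : ℂ) ^ 4 • (f .x₁ * f .y₁))
  sphere : f .x₀ * f .x₀ + f .x₁ * f .y₁ + f .x₂ * f .y₂ = 1

theorem SphereRel.lift_eq {P : Type} [Ring P] [Algebra ℂ P] {f : SGen → P} (h : SphereRel q f)
    ⦃a b : FreeAlgebra ℂ SGen⦄ (hab : SRel q a b) : FreeAlgebra.lift ℂ f a = FreeAlgebra.lift ℂ f b := by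
  cases hab <;> simp only [map_mul, map_smul, map_sub, map_add, map_one, FreeAlgebra.lift_ι_apply]
  case comm₁ => rw [h.comm₁, add_sub_cancel_left]
  case comm₂ => rw [h.comm₂, add_sub_cancel_left]
  exacts [h.x₀x₁, h.x₀x₂, h.x₁x₂, h.y₁x₀, h.y₂x₀, h.y₂y₁, h.y₁x₂, h.y₂x₁, h.sphere]

variable (q) in
/-- The operators representing the generators of `A(S⁴_q)`. -/
noncomputable def opGen (s : ℤˣ) : SGen → Module.End ℂ Spin
  | .x₀ => opX₀ q s
  | .x₁ => opX₁ q s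
  | .y₁ => opY₁ q s
  | .x₂ => opX₂ q s
  | .y₂ => opY₂ q s

theorem sphereRel_opGen (hq : q ∈ Set.Ioo (0 : ℝ) 1) (s : ℤˣ) : SphereRel q (opGen q s) := by
  obtain ⟨h, h0, hh, h1, -⟩ := S4.rpow_half q hq.1
  have R := opX_comm hq s
  obtain ⟨r1, r2, r3, r4, r5⟩ := (crossed_op hq h0 hh h1 s).relations (preSerre_op hq) hh h0
    (ofReal_sq_add_one_ne q) R
  have a₀ := opX₀_isAdj (q := q) s
  have a₁ := opX₁_isAdj (q := q) s
  have a₂ := opX₂_isAdj (q := q) s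
  have s1 := adj_rel' a₀ a₁ r3
  have s2 := adj_rel' a₀ a₂ r1
  have s3 := adj_rel' a₁ a₂ R
  have s4 := adj_rel' a₁.symm a₂ r2
  rw [map_pow, Complex.conj_ofReal] at s1 s2 s3 s4
  exact ⟨r3, r1, R, s1, s2, s3, r2, s4, r4, r5, opX_sphere hq s⟩

/-- The representations `π_±`. -/
noncomputable def sphereRep (hq : q ∈ Set.Ioo (0 : ℝ) 1) (s : ℤˣ) : S4 q →ₐ[ℂ] Module.End ℂ Spin :=
  S4.lift q (opGen q s) (sphereRel_opGen hq s).lift_eq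

section

variable (hq : q ∈ Set.Ioo (0 : ℝ) 1) (s : ℤˣ)

theorem sphereRep_x₀ : sphereRep hq s (S4.x₀ q) = opX₀ q s := S4.lift_gen q (opGen q s) _ _
theorem sphereRep_x₁ : sphereRep hq s (S4.x₁ q) = opX₁ q s := S4.lift_gen q (opGen q s) _ _
theorem sphereRep_y₁ : sphereRep hq s (S4.y₁ q) = opY₁ q s := S4.lift_gen q (opGen q s) _ _
theorem sphereRep_x₂ : sphereRep hq s (S4.x₂ q) = opX₂ q s := S4.lift_gen q (opGen q s) _ _
theorem sphereRep_y₂ : sphereRep hq s (S4.y₂ q) = opY₂ q s := S4.lift_gen q (opGen q s) _ _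

theorem sphereRep_isEquivariant : IsEquivariant hq (spinRep hq) (sphereRep hq s) where
  star := isStarRep_of_gen fun x => by
    cases x <;> simp only [SGen.star, sphereRep_x₀, sphereRep_x₁, sphereRep_y₁, sphereRep_x₂, sphereRep_y₂]
    exacts [opX₀_isAdj s, opX₁_isAdj s, (opX₁_isAdj s).symm, opX₂_isAdj s, (opX₂_isAdj s).symm]
  crossed g a := by
    obtain ⟨h, h0, hh, e₁, e₂, e₃, e₄⟩ := S4.rpow_half q hq.1
    simp only [spinRep_gen]
    exact (crossed_op hq h0 hh e₁ s).equivariant hq e₁ e₂ e₃ e₄ (sphereRep_x₀ hq s) (sphereRep_x₁ hq s)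
      (sphereRep_y₁ hq s) (sphereRep_x₂ hq s) (sphereRep_y₂ hq s) g a

end

end

/-! ### Extension to the completion -/

theorem inner_toH (v w : Spin) : inner ℂ (toH v) (toH w) = fip v w := by
  classical
  induction v using Finsupp.induction_linear with
  | zero => simp [fip_zero_left]
  | add f g hf hg => rw [map_add, inner_add_left, hf, hg, fip_add_left]
  | single i a =>
    induction w using Finsupp.induction_linear with
    | zero => simp [fip_zero_right]
    | add f g hf hg => rw [map_add, inner_add_right, hf, hg, fip_add_right]
    | single j b =>
      rw [fip_single_left, toH, Finsupp.linearCombination_single, Finsupp.linearCombination_single,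
        inner_smul_left, inner_smul_right, lp.inner_single_left, lp.single_apply]
      by_cases h : i = j
      · subst h; simp
      · simp [Finsupp.single_apply, h, Ne.symm h, Pi.single_apply]

theorem norm_toH_sq (v : Spin) : ‖toH v‖ ^ 2 = fnsq v := by
  have h := inner_self_eq_norm_sq_to_K (𝕜 := ℂ) (toH v)
  rw [inner_toH, fip_self] at h
  exact Complex.ofReal_injective (by rw [h]; push_cast; rfl)

theorem denseRange_toH : DenseRange toH := by
  intro f
  classical
  have h : HasSum (fun i => lp.single 2 i (f i)) f := lp.hasSum_single (by norm_num) f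
  refine mem_closure_of_tendsto h (Filter.Eventually.of_forall fun t => ?_)
  refine ⟨∑ i ∈ t, Finsupp.single i (f i), ?_⟩
  rw [map_sum]
  refine Finset.sum_congr rfl fun i _ => ?_
  rw [toH, Finsupp.linearCombination_single, ← lp.single_smul, smul_eq_mul, mul_one]

/-- Operators which are bounded for the norm of the completion. -/
def IsBdd (T : Module.End ℂ Spin) : Prop := ∃ C, ∀ v, ‖(toH ∘ₗ T) v‖ ≤ C * ‖toH v‖

theorem isBdd_of_fnsq {T : Module.End ℂ Spin} (h : ∀ v, fnsq (T v) ≤ fnsq v) : IsBdd T :=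
  ⟨1, fun v => by
    rw [one_mul]
    refine le_of_sq_le_sq ?_ (norm_nonneg _)
    rw [LinearMap.comp_apply, norm_toH_sq, norm_toH_sq]
    exact h v⟩

theorem IsAdj.isBdd {T T' : Module.End ℂ Spin} (h : IsAdj T T') (hT : IsBdd T) : IsBdd T' := by
  obtain ⟨C, hC⟩ := hT
  refine ⟨C, fun v => ?_⟩
  rcases (norm_nonneg (toH (T' v))).eq_or_lt with h0 | h0
  · rw [LinearMap.comp_apply, ← h0]
    by_contra! hn
    have := hC v
    nlinarith [norm_nonneg ((toH ∘ₗ T) v)]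
  have e : (‖toH (T' v)‖ ^ 2 : ℝ) = ‖inner ℂ (toH (T (T' v))) (toH v)‖ := by
    rw [inner_toH, h, fip_self, norm_toH_sq, Complex.norm_real, Real.norm_of_nonneg (fnsq_nonneg _)]
  have e' := (norm_inner_le_norm (𝕜 := ℂ) (toH (T (T' v))) (toH v)).trans
    (mul_le_mul_of_nonneg_right (hC (T' v)) (norm_nonneg _))
  rw [← e] at e'
  rw [LinearMap.comp_apply]
  exact le_of_mul_le_mul_right (by linarith) h0

theorem ext_of_toH {A B : HSpin →L[ℂ] HSpin} (h : ∀ v, A (toH v) = B (toH v)) : A = B :=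
  DFunLike.coe_injective (denseRange_toH.equalizer A.continuous B.continuous (funext h))

/-- A `*`-representation by bounded operators extends to the completion. -/
theorem exists_extension {P : Type} [Ring P] [Algebra ℂ P] [StarRing P] {ρ : P →ₐ[ℂ] Module.End ℂ Spin}
    (hρ : IsStarRep ρ) (hb : ∀ a, IsBdd (ρ a)) :
    ∃ R : P →⋆ₐ[ℂ] (HSpin →L[ℂ] HSpin), ∀ a v, R a (toH v) = toH (ρ a v) := by
  have key : ∀ a v, (toH ∘ₗ ρ a).extendOfNorm toH (toH v) = toH (ρ a v) := fun a v =>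
    LinearMap.extendOfNorm_eq denseRange_toH (hb a) v
  refine ⟨{ toFun := fun a => (toH ∘ₗ ρ a).extendOfNorm toH, map_one' := ?_, map_mul' := ?_, map_zero' := ?_,
            map_add' := ?_, commutes' := ?_, map_star' := ?_ }, key⟩
  · exact ext_of_toH fun v => by rw [key, map_one]; rfl
  · exact fun a b => ext_of_toH fun v => by
      rw [key, mul_apply_eq_comp, key, key, map_mul]; rfl
  · exact ext_of_toH fun v => by rw [key, map_zero]; simp
  · exact fun a b => ext_of_toH fun v => by
      rw [key, add_apply, key, key, map_add, LinearMap.add_apply, map_add]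
  · exact fun c => ext_of_toH fun v => by
      rw [key, AlgHom.commutes, Module.algebraMap_end_apply, map_smul]; rfl
  · intro a
    rw [ContinuousLinearMap.star_eq_adjoint, ContinuousLinearMap.eq_adjoint_iff]
    intro x y
    refine denseRange_toH.induction_on₂ (p := fun x y => inner ℂ ((toH ∘ₗ ρ (star a)).extendOfNorm toH x) y =
      inner ℂ x ((toH ∘ₗ ρ a).extendOfNorm toH y)) ?_ (fun v w => ?_) x y
    · exact isClosed_eq (by fun_prop) (by fun_prop)
    · rw [key, key, inner_toH, inner_toH]
      have := hρ (star a) v w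
      rwa [star_star] at this

theorem sphereRep_isBdd {q : ℝ} (hq : q ∈ Set.Ioo (0 : ℝ) 1) (s : ℤˣ) (a : S4 q) : IsBdd (sphereRep hq s a) := by
  have sph : ∀ v, fnsq v = fnsq (opX₀ q s v) + fnsq (opY₁ q s v) + fnsq (opY₂ q s v) := fun v => by
    have h : fip v v = fip (opX₀ q s v) (opX₀ q s v) + fip (opY₁ q s v) (opY₁ q s v) +
        fip (opY₂ q s v) (opY₂ q s v) := by
      rw [opX₀_isAdj s, (opX₁_isAdj s).symm, (opX₂_isAdj s).symm, ← fip_add_right, ← fip_add_right]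
      exact congrArg (fip v) (LinearMap.congr_fun (opX_sphere hq s) v).symm
    simp only [fip_self] at h
    exact_mod_cast h
  have b₀ : IsBdd (opX₀ q s) := isBdd_of_fnsq fun v => by
    linarith [sph v, fnsq_nonneg (opY₁ q s v), fnsq_nonneg (opY₂ q s v)]
  have b₁ : IsBdd (opY₁ q s) := isBdd_of_fnsq fun v => by
    linarith [sph v, fnsq_nonneg (opX₀ q s v), fnsq_nonneg (opY₂ q s v)]
  have b₂ : IsBdd (opY₂ q s) := isBdd_of_fnsq fun v => by
    linarith [sph v, fnsq_nonneg (opX₀ q s v), fnsq_nonneg (opY₁ q s v)]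
  induction a using S4.induction with
  | hc c => exact ⟨‖c‖, fun v => by
      rw [AlgHom.commutes, LinearMap.comp_apply, Module.algebraMap_end_apply, map_smul, norm_smul]⟩
  | hg x =>
    cases x
    · rw [sphereRep_x₀]; exact b₀
    · rw [sphereRep_x₁]; exact (opX₁_isAdj s).symm.isBdd b₁
    · rw [sphereRep_y₁]; exact b₁
    · rw [sphereRep_x₂]; exact (opX₂_isAdj s).symm.isBdd b₂
    · rw [sphereRep_y₂]; exact b₂
  | hm a b ha hb =>
    obtain ⟨C, hC⟩ := ha
    obtain ⟨D, hD⟩ := hb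
    refine ⟨|C| * D, fun v => ?_⟩
    rw [map_mul]
    calc _ ≤ C * ‖toH (sphereRep hq s b v)‖ := hC _
      _ ≤ |C| * ‖toH (sphereRep hq s b v)‖ := mul_le_mul_of_nonneg_right (le_abs_self C) (norm_nonneg _)
      _ ≤ |C| * (D * ‖toH v‖) := mul_le_mul_of_nonneg_left (hD v) (abs_nonneg C)
      _ = _ := by ring
  | ha a b ha hb =>
    obtain ⟨C, hC⟩ := ha
    obtain ⟨D, hD⟩ := hb
    refine ⟨C + D, fun v => ?_⟩
    rw [map_add, LinearMap.comp_apply, LinearMap.add_apply, map_add, add_mul]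
    exact (norm_add_le _ _).trans (add_le_add (hC v) (hD v))



/-! ### Generation of `A(S⁴_q)` by the powers of `x₂` -/

namespace S4

section

variable {q : ℝ} (hq : q ∈ Set.Ioo (0 : ℝ) 1)

theorem act_K_mul (i : Fin 2) (a b : S4 q) :
    act q hq (.K i) (a * b) = act q hq (.K i) a * act q hq (.K i) b := by
  simp [act_mul, UGen.coprod]

theorem act_Kinv_mul (i : Fin 2) (a b : S4 q) :
    act q hq (.Kinv i) (a * b) = act q hq (.Kinv i) a * act q hq (.Kinv i) b := by
  simp [act_mul, UGen.coprod]

theorem act_E_mul (i : Fin 2) (a b : S4 q) : act q hq (.E i) (a * b) =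
    act q hq (.E i) a * act q hq (.K i) b + act q hq (.Kinv i) a * act q hq (.E i) b := by
  simp [act_mul, UGen.coprod]

theorem act_F_mul (i : Fin 2) (a b : S4 q) : act q hq (.F i) (a * b) =
    act q hq (.F i) a * act q hq (.K i) b + act q hq (.Kinv i) a * act q hq (.F i) b := by
  simp [act_mul, UGen.coprod]

theorem act_K_gen (i : Fin 2) (x : SGen) : act q hq (.K i) (gen q x) = wt q i x • gen q x :=
  (act_gen q hq i x).1

theorem act_Kinv_gen (i : Fin 2) (x : SGen) : act q hq (.Kinv i) (gen q x) = (wt q i x)⁻¹ • gen q x :=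
  (act_gen q hq i x).2.1

theorem act_E_gen (i : Fin 2) (x : SGen) : act q hq (.E i) (gen q x) = actE q i x :=
  (act_gen q hq i x).2.2.1

theorem act_F_gen (i : Fin 2) (x : SGen) : act q hq (.F i) (gen q x) = actF q i x :=
  (act_gen q hq i x).2.2.2

theorem act_one (h : UGen) : act q hq h 1 = h.counit • 1 := by
  have := act_algebraMap hq h 1
  rwa [map_one] at this

theorem act_K_pow (i : Fin 2) (x : SGen) (n : ℕ) :
    act q hq (.K i) (gen q x ^ n) = wt q i x ^ n • gen q x ^ n := by
  induction n with
  | zero => simp [act_one, UGen.counit]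
  | succ n ih => rw [pow_succ, act_K_mul, ih, act_K_gen, smul_mul_smul_comm, ← pow_succ]

theorem act_F₁_x₂_pow (n : ℕ) : act q hq (.F 0) (x₂ q ^ n) = 0 := by
  induction n with
  | zero => simp [act_one, UGen.counit]
  | succ n ih => rw [pow_succ, act_F_mul, ih, act_F_gen]; simp [actF]

theorem act_F₂_x₂_pow (n : ℕ) : ∃ c : ℝ, 0 < c ∧
    act q hq (.F 1) (x₂ q ^ (n + 1)) = (c : ℂ) • (x₁ q * x₂ q ^ n) := by
  have hq0 : (q : ℂ) ≠ 0 := ofReal_ne hq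
  have h0 := hq.1
  induction n with
  | zero => exact ⟨1, one_pos, by simp [act_F_gen, actF]⟩
  | succ n ih =>
    obtain ⟨c, hc, e⟩ := ih
    refine ⟨q ^ (n + 1) + (q ^ 3)⁻¹ * c, by positivity, ?_⟩
    rw [pow_succ' _ (n + 1), act_F_mul, e, act_K_pow, act_F_gen, act_Kinv_gen]
    simp only [wt, actF, mul_smul_comm, smul_mul_assoc, ← mul_assoc]
    have : x₂ q * x₁ q = ((q : ℂ) ^ 2)⁻¹ • (x₁ q * x₂ q) := by
      rw [r_x₁x₂, inv_smul_smul₀ (by positivity)]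
    rw [this, smul_mul_assoc, mul_assoc _ _ (x₂ q ^ n), ← pow_succ']
    push_cast
    module

/-- Subspaces which contain the powers of `x₂` and are stable under `U_q(so(5))`. -/
def IsHarmonic (M : Submodule ℂ (S4 q)) : Prop :=
  (∀ h, ∀ a ∈ M, act q hq h a ∈ M) ∧ ∀ n, x₂ q ^ n ∈ M

variable {hq}

theorem IsHarmonic.gen_mul_pow {M : Submodule ℂ (S4 q)} (h : IsHarmonic hq M) (x : SGen) (n : ℕ) :
    gen q x * x₂ q ^ n ∈ M := by
  obtain ⟨t, h0, hh, e₁, e₂, e₃, e₄⟩ := S4.rpow_half q hq.1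
  have hq0 : (q : ℂ) ≠ 0 := ofReal_ne hq
  have hp := hq.1
  have q2 : ((q : ℂ) ^ 2 + 1) ≠ 0 := ofReal_sq_add_one_ne q
  obtain ⟨hs, hp⟩ := h
  have sm : ∀ {c : ℂ} {a : S4 q}, c ≠ 0 → c • a ∈ M → a ∈ M := fun hc ha => (M.smul_mem_iff hc).1 ha
  have F₁ : ∀ (a : S4 q) n, act q hq (.F 0) (a * x₂ q ^ n) = act q hq (.F 0) a * x₂ q ^ n := fun a n => by
    rw [act_F_mul, act_F₁_x₂_pow, act_K_pow]; simp [wt]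
  have m₁ : ∀ n, x₁ q * x₂ q ^ n ∈ M := fun n => by
    obtain ⟨c, hc, e⟩ := act_F₂_x₂_pow hq n
    exact sm (by exact_mod_cast hc.ne') (e ▸ hs (.F 1) _ (hp (n + 1)))
  have qn : (((q ^ (1 / 2 : ℝ) * qnum q 2 : ℝ)) : ℂ) ≠ 0 := by
    rw [S4.qnum_two q hq]
    have : 0 < q ^ (1 / 2 : ℝ) := Real.rpow_pos_of_pos hq.1 _
    have := hq.1
    exact_mod_cast (by positivity : 0 < q ^ (1 / 2 : ℝ) * (q + q⁻¹)).ne'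
  have m₀ : ∀ n, x₀ q * x₂ q ^ n ∈ M := fun n => by
    have := hs (.F 0) _ (m₁ n)
    rw [F₁, act_F_gen, actF, smul_mul_assoc] at this
    exact sm qn this
  have my₁ : ∀ n, y₁ q * x₂ q ^ n ∈ M := fun n => by
    have := hs (.F 0) _ (m₀ n)
    rw [F₁, act_F_gen, actF, smul_mul_assoc, e₄] at this
    exact sm (by simp [h0]) this
  cases x with
  | x₀ => exact m₀ n
  | x₁ => exact m₁ n
  | y₁ => exact my₁ n
  | x₂ => rw [← pow_succ']; exact hp _
  | y₂ =>
    cases n with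
    | zero =>
      have := hs (.F 1) _ (my₁ 0)
      rw [pow_zero, mul_one, act_F_gen, actF] at this
      rw [pow_zero, mul_one]
      exact sm (by simp [hq0]) this
    | succ n =>
      obtain ⟨c, hc, e⟩ := act_F₂_x₂_pow hq n
      have m₁₁ : x₁ q * x₁ q * x₂ q ^ n ∈ M := by
        have := hs (.F 1) _ (m₁ (n + 1))
        rw [act_F_mul, act_F_gen, e, act_Kinv_gen] at this
        simp only [actF, wt, zero_mul, zero_add, inv_inv, smul_mul_smul_comm, ← mul_assoc] at this
        exact sm (mul_ne_zero hq0 (by exact_mod_cast hc.ne')) this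
      have m₀₁ : x₀ q * x₁ q * x₂ q ^ n ∈ M := by
        have := hs (.F 0) _ m₁₁
        rw [F₁, act_F_mul, act_F_gen, act_Kinv_gen, act_K_gen] at this
        simp only [actF, wt, smul_mul_smul_comm] at this
        have e' : x₁ q * x₀ q = ((q : ℂ) ^ 2)⁻¹ • (x₀ q * x₁ q) := by
          rw [r_x₀x₁, inv_smul_smul₀ (by positivity)]
        rw [e', smul_smul, ← add_smul, smul_mul_assoc] at this
        refine sm ?_ this
        have : 0 < q ^ (1 / 2 : ℝ) := Real.rpow_pos_of_pos hq.1 _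
        have := hq.1
        rw [S4.qnum_two q hq]
        exact_mod_cast (by positivity : 0 < q ^ (1 / 2 : ℝ) * (q + q⁻¹) * q +
          q⁻¹ * (q ^ (1 / 2 : ℝ) * (q + q⁻¹)) * (q ^ 2)⁻¹).ne'
      have r₁ := hs (.F 0) _ m₀₁
      have r₂ := hs (.F 1) _ (my₁ (n + 1))
      rw [F₁, act_F_mul, act_F_gen, act_F_gen, act_K_gen, act_Kinv_gen] at r₁
      simp only [actF, wt, S4.qnum_two q hq, Complex.ofReal_mul, e₁, e₄] at r₁
      rw [act_F_mul, act_F_gen, act_K_pow, act_Kinv_gen, e] at r₂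
      simp only [actF, wt] at r₂
      set A := x₀ q * x₀ q * x₂ q ^ n with hA
      set B := x₁ q * y₁ q * x₂ q ^ n with hB
      have hn : x₂ q ^ n ∈ M := hp n
      have hBm : B - ((q : ℂ) ^ 2 + (q : ℂ) ^ 4) • A ∈ M := by
        refine sm (c := -t⁻¹) (by simp [h0]) ?_
        convert r₁ using 1
        simp only [hA, hB, add_mul, mul_smul_comm, smul_mul_assoc, r_comm₁', neg_smul, neg_mul]
        push_cast
        match_scalars <;> simp only [hh] <;> field_simp <;> ring
      have hy : y₂ q * x₂ q ^ (n + 1) = x₂ q ^ n - (q : ℂ) ^ 4 • (A + B) := by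
        rw [pow_succ', ← mul_assoc, r_comm₂', sub_mul, one_mul, smul_mul_assoc, add_mul]
      have hAm : A ∈ M := by
        refine sm (c := ((q ^ (n + 3) + q⁻¹ * c * (1 - q ^ 4) + (q ^ 2 + q ^ 4) * (q ^ (n + 3) + q⁻¹ * c) : ℝ) : ℂ))
          ?_ ?_
        · have h4 : 0 < 1 - q ^ 4 := by
            have := pow_lt_one₀ hq.1.le hq.2 (n := 4) (by norm_num)
            linarith
          have := hq.1
          exact_mod_cast (by positivity : 0 < q ^ (n + 3) + q⁻¹ * c * (1 - q ^ 4) +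
            (q ^ 2 + q ^ 4) * (q ^ (n + 3) + q⁻¹ * c)).ne'
        · have := M.add_mem (M.sub_mem r₂ (M.smul_mem ((q ^ (n + 3) + q⁻¹ * c : ℝ) : ℂ) hBm))
            (M.smul_mem ((q : ℂ) ^ (n + 1) * ((q : ℂ) ^ 2)⁻¹) hn)
          convert this using 1
          rw [smul_mul_smul_comm, hy, smul_mul_smul_comm, ← mul_assoc (y₁ q), r_comm₁', add_mul (x₁ q * y₁ q),
            smul_mul_assoc (1 - (q : ℂ) ^ 4), ← hA, ← hB]
          push_cast
          match_scalars <;> field_simp <;> ring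
      have hBm' : B ∈ M := by
        have := M.add_mem hBm (M.smul_mem ((q : ℂ) ^ 2 + (q : ℂ) ^ 4) hAm)
        rwa [sub_add_cancel] at this
      rw [hy]
      exact M.sub_mem hn (M.smul_mem _ (M.add_mem hAm hBm'))

/-- `A(S⁴_q)` is generated by the powers of `x₂` as a module over `U_q(so(5))`. -/
theorem IsHarmonic.eq_top {M : Submodule ℂ (S4 q)} (hM : IsHarmonic hq M) : M = ⊤ := by
  let M₀ : Submodule ℂ (S4 q) := sInf {N | IsHarmonic hq N}
  have h₀ : IsHarmonic hq M₀ := by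
    constructor
    · intro h a ha
      rw [Submodule.mem_sInf] at ha ⊢
      exact fun N hN => hN.1 h a (ha N hN)
    · exact fun n => Submodule.mem_sInf.2 fun N hN => hN.2 n
  have hmul : ∀ a ∈ M₀, ∀ x, gen q x * a ∈ M₀ := by
    let M' : Submodule ℂ (S4 q) := M₀ ⊓ ⨅ x, M₀.comap (LinearMap.mulLeft ℂ (gen q x))
    have mem : ∀ {a}, a ∈ M' ↔ a ∈ M₀ ∧ ∀ x, gen q x * a ∈ M₀ := by simp [M']
    have hM' : IsHarmonic hq M' := by
      constructor
      · intro h a ha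
        rw [mem] at ha ⊢
        refine ⟨h₀.1 h a ha.1, ?_⟩
        have hK : ∀ i x, gen q x * act q hq (.K i) a ∈ M₀ := fun i x => by
          have := h₀.1 (.K i) _ (ha.2 x)
          rw [act_K_mul, act_K_gen, smul_mul_assoc] at this
          exact (M₀.smul_mem_iff (by fin_cases i <;> cases x <;> simp [wt, (ofReal_ne hq)])).1 this
        have hw : ∀ i x, (wt q i x)⁻¹ ≠ 0 := fun i x => by
          fin_cases i <;> cases x <;> simp [wt, (ofReal_ne hq)]
        cases h with
        | K i => exact hK i
        | Kinv i =>
          intro x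
          have := h₀.1 (.Kinv i) _ (ha.2 x)
          rw [act_Kinv_mul, act_Kinv_gen, smul_mul_assoc] at this
          exact (M₀.smul_mem_iff (hw i x)).1 this
        | E i =>
          intro x
          have := h₀.1 (.E i) _ (ha.2 x)
          rw [act_E_mul, act_Kinv_gen, act_E_gen, smul_mul_assoc] at this
          refine (M₀.smul_mem_iff (hw i x)).1 ((M₀.add_mem_iff_right ?_).1 this)
          fin_cases i <;> cases x <;> simp only [Fin.zero_eta, Fin.mk_one, actE, smul_mul_assoc, zero_mul, M₀.zero_mem] <;>
            first | exact M₀.smul_mem _ (hK _ _) | exact hK _ _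
        | F i =>
          intro x
          have := h₀.1 (.F i) _ (ha.2 x)
          rw [act_F_mul, act_Kinv_gen, act_F_gen, smul_mul_assoc] at this
          refine (M₀.smul_mem_iff (hw i x)).1 ((M₀.add_mem_iff_right ?_).1 this)
          fin_cases i <;> cases x <;> simp only [Fin.zero_eta, Fin.mk_one, actF, smul_mul_assoc, zero_mul, M₀.zero_mem] <;>
            first | exact M₀.smul_mem _ (hK _ _) | exact hK _ _
      · exact fun n => mem.2 ⟨h₀.2 n, fun x => h₀.gen_mul_pow x n⟩
    exact fun a ha => (mem.1 ((sInf_le hM' : M₀ ≤ M') ha)).2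
  have key : ∀ a b : S4 q, b ∈ M₀ → a * b ∈ M₀ := by
    intro a
    induction a using induction with
    | hc c => exact fun b hb => by rw [← Algebra.smul_def]; exact M₀.smul_mem _ hb
    | hg x => exact fun b hb => hmul b hb x
    | hm a a' ha ha' => exact fun b hb => by rw [mul_assoc]; exact ha _ (ha' _ hb)
    | ha a a' ha ha' => exact fun b hb => by rw [add_mul]; exact M₀.add_mem (ha _ hb) (ha' _ hb)
  refine top_le_iff.1 fun a _ => (sInf_le hM : M₀ ≤ M) ?_
  have := key a 1 (by simpa using h₀.2 0)
  rwa [mul_one] at this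

end

end S4



/-! ### Spinor matrix coefficients -/

section

variable {q : ℝ}

/-- The basis of `V_{1/2}`. -/
noncomputable def xi : Fin 4 → Spin := ![ket 1 1 1 1, ket 1 1 (-1) 1, ket 1 (-1) 1 1, ket 1 (-1) (-1) 1]

theorem adm_xi : Admissible 1 1 1 1 ∧ Admissible 1 1 (-1) 1 ∧ Admissible 1 (-1) 1 1 ∧ Admissible 1 (-1) (-1) 1 := by
  refine ⟨?_, ?_, ?_, ?_⟩ <;> rw [admissible_iff] <;> omega

theorem fip_xi (k l : Fin 4) : fip (xi k) (xi l) = if k = l then 1 else 0 := by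
  obtain ⟨h1, h2, h3, h4⟩ := adm_xi
  fin_cases k <;> fin_cases l <;> simp [xi, fip_ket_ket, h1, h2, h3, h4]

theorem fac₁_one (hq : q ∈ Set.Ioo (0 : ℝ) 1) : fac₁ q 1 (-1) = 1 := by
  have := qnum_one hq
  rw [fac₁]; norm_num [this]

theorem facb_mul_coefb_one (hq : q ∈ Set.Ioo (0 : ℝ) 1) : facb q 1 1 * coefb q 1 (-1) 1 = 1 := by
  have h1 := qnum_one hq
  have h3 : 0 < qnum q 3 := qnum_pos hq (by norm_num)
  have e : eps 1 (-1) 1 = -1 / 2 := by unfold eps; norm_num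
  rw [facb, coefb, e]; norm_num [h1]
  rw [Real.sqrt_mul_self h3.le, div_self h3.ne']

theorem opU_xi (hq : q ∈ Set.Ioo (0 : ℝ) 1) (h : UGen) (l : Fin 4) :
    opU q h (xi l) = ∑ k, spinMat q h k l • xi k := by
  obtain ⟨h1, h2, h3, h4⟩ := adm_xi
  have z : ∀ {N M M' J : ℤ}, M < -J ∨ J < M ∨ J < 1 ∨ N < J ∨ M' < -(N + 1 - J) ∨ N + 1 - J < M' →
      ket N M M' J = 0 := fun h => ket_of_not_adm fun h' => by rw [admissible_iff] at h'; omega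
  have k1 : ∀ {L M₁ M₂ J : ℤ}, Admissible L M₁ M₂ J → opKi₁ q (ket L M₁ M₂ J) =
      ((q ^ (-((M₁ : ℝ) / 2)) : ℝ) : ℂ) • ket L M₁ M₂ J := fun h => by
    rw [opKi₁, sh_ket _ _ _ _ _ h]; simp only [add_zero]
  have k2 : ∀ {L M₁ M₂ J : ℤ}, Admissible L M₁ M₂ J → opKi₂ q (ket L M₁ M₂ J) =
      ((q ^ (-((M₂ : ℝ) / 2 - (M₁ : ℝ) / 2)) : ℝ) : ℂ) • ket L M₁ M₂ J := fun h => by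
    rw [opKi₂, sh_ket _ _ _ _ _ h]; simp only [add_zero]
  have v1 := fac₁_one hq
  have v2 := facb_mul_coefb_one hq
  have p1 : q ^ ((-1 : ℝ) / 2 - 2⁻¹) = q⁻¹ := by norm_num [Real.rpow_neg_one]
  have p2 : q ^ ((2 : ℝ)⁻¹ - -1 / 2) = q := by norm_num
  have p3 : q ^ (-((-1 : ℝ) / 2)) = q ^ (2⁻¹ : ℝ) := by norm_num
  have p4 : q ^ (-(2 : ℝ)⁻¹) = q ^ ((-1 : ℝ) / 2) := by norm_num
  rw [Fin.sum_univ_four]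
  cases h with
  | K i =>
    fin_cases i <;> fin_cases l <;> simp [opU, xi, spinMat, opK₁_ket, opK₂_ket, h1, h2, h3, h4, p1, p2]
  | Kinv i =>
    fin_cases i <;> fin_cases l <;> simp [opU, xi, spinMat, k1, k2, h1, h2, h3, h4, p1, p2, p3, p4]
  | E i =>
    fin_cases i <;> fin_cases l <;> simp [opU, xi, spinMat, opE₁_ket, opE₂_ket, h1, h2, h3, h4, -Complex.ofReal_mul, v1, v2, z]
  | F i =>
    fin_cases i <;> fin_cases l <;> simp [opU, xi, spinMat, opF₁_ket, opF₂_ket, h1, h2, h3, h4, -Complex.ofReal_mul, v1, v2, z]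


/-- Linear maps to `4 × 4` matrices which transform like matrix coefficients of spinors. -/
def IsSpinTensor (hq : q ∈ Set.Ioo (0 : ℝ) 1) (X : S4 q →ₗ[ℂ] Matrix (Fin 4) (Fin 4) ℂ) : Prop :=
  ∀ h a, spinMat q h * X a = (h.coprod.map fun p => X (S4.act q hq p.1 a) * spinMat q p.2).sum

theorem spinMat_K_mul_Kinv (hq : q ∈ Set.Ioo (0 : ℝ) 1) (i : Fin 2) :
    spinMat q (.K i) * spinMat q (.Kinv i) = 1 := by
  have hq0 := ofReal_ne hq
  have h1 : ((q ^ ((2 : ℝ)⁻¹) : ℝ) : ℂ) * ((q ^ (-(2 : ℝ)⁻¹) : ℝ) : ℂ) = 1 := by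
    rw [← Complex.ofReal_mul, ← Real.rpow_add hq.1]; simp
  have h2 : ((q ^ (-(2 : ℝ)⁻¹) : ℝ) : ℂ) * ((q ^ ((2 : ℝ)⁻¹) : ℝ) : ℂ) = 1 := by rw [mul_comm, h1]
  have h3 : (-1 / 2 : ℝ) = -2⁻¹ := by norm_num
  fin_cases i <;> rw [← Matrix.diagonal_one] <;> simp only [spinMat, Fin.zero_eta, Fin.mk_one, Matrix.diagonal_mul_diagonal] <;> congr 1 <;>
    ext k <;> fin_cases k <;> simp [hq0, h3, h1, h2]

theorem IsSpinTensor.ext {hq : q ∈ Set.Ioo (0 : ℝ) 1} {X Y : S4 q →ₗ[ℂ] Matrix (Fin 4) (Fin 4) ℂ}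
    (hX : IsSpinTensor hq X) (hY : IsSpinTensor hq Y) (h : ∀ n, X (S4.x₂ q ^ n) = Y (S4.x₂ q ^ n)) : X = Y := by
  have key : S4.IsHarmonic hq (LinearMap.eqLocus X Y) := by
    refine ⟨fun g a ha => ?_, h⟩
    simp only [LinearMap.mem_eqLocus] at ha ⊢
    have c : ∀ i {A B : Matrix (Fin 4) (Fin 4) ℂ}, A * spinMat q (.K i) = B * spinMat q (.K i) → A = B :=
      fun i A B e => mul_right_cancel_of_inv (spinMat_K_mul_Kinv hq i) e
    have hK : ∀ i, X (S4.act q hq (.Kinv i) a) = Y (S4.act q hq (.Kinv i) a) := fun i => by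
      have e₁ := hX (.Kinv i) a
      have e₂ := hY (.Kinv i) a
      simp only [UGen.coprod, List.map_cons, List.map_nil, List.sum_cons, List.sum_nil, add_zero] at e₁ e₂
      rw [ha, e₂] at e₁
      exact mul_right_cancel_of_inv (mul_eq_one_comm.1 (spinMat_K_mul_Kinv hq i)) e₁.symm
    cases g with
    | K i =>
      have e₁ := hX (.K i) a
      have e₂ := hY (.K i) a
      simp only [UGen.coprod, List.map_cons, List.map_nil, List.sum_cons, List.sum_nil, add_zero] at e₁ e₂
      exact c i (by rw [← e₁, ← e₂, ha])
    | Kinv i => exact hK i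
    | E i =>
      have e₁ := hX (.E i) a
      have e₂ := hY (.E i) a
      simp only [UGen.coprod, List.map_cons, List.map_nil, List.sum_cons, List.sum_nil, add_zero] at e₁ e₂
      rw [ha, e₂, hK] at e₁
      exact c i (add_right_cancel e₁.symm)
    | F i =>
      have e₁ := hX (.F i) a
      have e₂ := hY (.F i) a
      simp only [UGen.coprod, List.map_cons, List.map_nil, List.sum_cons, List.sum_nil, add_zero] at e₁ e₂
      rw [ha, e₂, hK] at e₁
      exact c i (add_right_cancel e₁.symm)
  refine LinearMap.ext fun a => ?_
  have : a ∈ LinearMap.eqLocus X Y := key.eq_top ▸ Submodule.mem_top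
  exact this

/-- Matrix coefficients of `π_±` on `V_{1/2}`. -/
noncomputable def spinCoef (hq : q ∈ Set.Ioo (0 : ℝ) 1) (s : ℤˣ) : S4 q →ₗ[ℂ] Matrix (Fin 4) (Fin 4) ℂ where
  toFun a := Matrix.of fun k l => fip (xi k) (sphereRep hq s a (xi l))
  map_add' a b := by ext k l; simp [fip_add_right]
  map_smul' c a := by ext k l; simp [fip_smul_right]

theorem spinMat_star (h : UGen) (k l : Fin 4) : spinMat q h.star k l = starRingEnd ℂ (spinMat q h l k) := by
  cases h with
  | K i => fin_cases i <;> fin_cases k <;> fin_cases l <;> simp [spinMat, UGen.star]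
  | Kinv i => fin_cases i <;> fin_cases k <;> fin_cases l <;> simp [spinMat, UGen.star]
  | E i => fin_cases i <;> fin_cases k <;> fin_cases l <;> simp [spinMat, UGen.star]
  | F i => fin_cases i <;> fin_cases k <;> fin_cases l <;> simp [spinMat, UGen.star]

theorem UGen.star_star (h : UGen) : h.star.star = h := by cases h <;> rfl

theorem spinCoef_isSpinTensor (hq : q ∈ Set.Ioo (0 : ℝ) 1) (s : ℤˣ) : IsSpinTensor hq (spinCoef hq s) := by
  intro h a
  have e := (sphereRep_isEquivariant hq s).crossed h a
  simp only [spinRep_gen] at e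
  have left : ∀ k l, (spinMat q h * spinCoef hq s a) k l = fip (xi k) ((opU q h * sphereRep hq s a) (xi l)) :=
    fun k l => by
    rw [Module.End.mul_apply, ← (opU_isAdj h).symm, opU_xi hq, fip_sum_left, Matrix.mul_apply]
    refine Finset.sum_congr rfl fun j _ => ?_
    rw [fip_smul_left, ← spinMat_star, UGen.star_star]; rfl
  have right : ∀ g b k l, (spinCoef hq s b * spinMat q g) k l = fip (xi k) ((sphereRep hq s b * opU q g) (xi l)) :=
    fun g b k l => by
    rw [Module.End.mul_apply, opU_xi hq, map_sum, fip_sum_right, Matrix.mul_apply]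
    refine Finset.sum_congr rfl fun j _ => ?_
    rw [map_smul, fip_smul_right, mul_comm]; rfl
  ext k l
  rw [left, e]
  cases h <;> simp only [UGen.coprod, List.map_cons, List.map_nil, List.sum_cons, List.sum_nil, add_zero,
    LinearMap.add_apply, fip_add_right, right, Matrix.add_apply, Matrix.zero_apply, add_zero]

/-- The matrix `2e - 1`. -/
noncomputable def sphMat (q : ℝ) : Matrix (Fin 4) (Fin 4) (S4 q) :=
  !![S4.x₀ q, (q : ℂ) ^ 3 • S4.x₂ q, -(q : ℂ) • S4.x₁ q, 0;
    ((q : ℂ) ^ 3)⁻¹ • S4.y₂ q, -(q : ℂ) ^ 2 • S4.x₀ q, 0, (q : ℂ) ^ 3 • S4.x₁ q;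
    -(q : ℂ)⁻¹ • S4.y₁ q, 0, -(q : ℂ) ^ 2 • S4.x₀ q, (q : ℂ) ^ 3 • S4.x₂ q;
    0, (q : ℂ) • S4.y₁ q, ((q : ℂ) ^ 3)⁻¹ • S4.y₂ q, (q : ℂ) ^ 4 • S4.x₀ q]

theorem idem_eq : idem q = (1 / 2 : ℂ) • (1 + sphMat q) := by
  rw [idem, sphMat]
  congr 1
  ext k l
  fin_cases k <;> fin_cases l <;> simp [sub_eq_add_neg]

theorem sphMat_mul_self (hq : q ∈ Set.Ioo (0 : ℝ) 1) : sphMat q * sphMat q = 1 := by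
  have hq0 := ofReal_ne hq
  have e1 := S4.r_sphere' q
  ext k l
  fin_cases k <;> fin_cases l <;>
    simp only [sphMat, Matrix.mul_apply, Fin.sum_univ_four, Fin.zero_eta, Fin.mk_one, Fin.reduceFinMk, Matrix.of_apply, Matrix.cons_val,
      Matrix.one_apply, Fin.reduceEq, if_true, if_false, mul_zero, zero_mul, add_zero, zero_add, smul_mul_smul_comm,
      mul_smul_comm, smul_mul_assoc, S4.r_x₀x₁, S4.r_x₀x₂, S4.r_x₁x₂, S4.r_y₁x₀, S4.r_y₂x₀, S4.r_y₂y₁, S4.r_y₁x₂,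
        S4.r_y₂x₁, S4.r_comm₁', S4.r_comm₂', S4.r_sphere'] <;>
    match_scalars <;> field_simp <;> ring

end



/-! ### The invariant state -/

section

variable {q : ℝ}

/-- Equivariance of an entry of the matrix `2e - 1`. -/
def SphEquiv (hq : q ∈ Set.Ioo (0 : ℝ) 1) (h : UGen) (k l : Fin 4) : Prop :=
  (h.coprod.map fun p => ∑ j, spinMat q p.2 k j • S4.act q hq p.1 (sphMat q l j)).sum =
      ∑ j, spinMat q h j l • sphMat q j k

theorem sphEquiv_K₁ (hq : q ∈ Set.Ioo (0 : ℝ) 1) (k l : Fin 4) :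
    SphEquiv hq (.K 0) k l := by
  obtain ⟨t, t0, hh, e₁, e₂, e₃, e₄⟩ := S4.rpow_half q hq.1
  have hq0 := ofReal_ne hq
  unfold SphEquiv
  fin_cases k <;> fin_cases l <;>
    simp only [UGen.coprod, List.map_cons, List.map_nil, List.sum_cons, List.sum_nil, add_zero, sphMat, spinMat,
      Fin.sum_univ_four, Fin.zero_eta, Fin.mk_one, Fin.reduceFinMk, Matrix.of_apply, Matrix.cons_val,
      Matrix.diagonal_apply, Fin.reduceEq, if_true, if_false, zero_smul, one_smul, zero_add, map_smul, map_zero,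
      smul_zero, e₁, e₂, Complex.ofReal_one, Complex.ofReal_inv, S4.wt, S4.act_K_gen] <;>
    match_scalars <;> (try simp only [hh]) <;> field_simp

theorem sphEquiv_Kinv₁ (hq : q ∈ Set.Ioo (0 : ℝ) 1) (k l : Fin 4) :
    SphEquiv hq (.Kinv 0) k l := by
  obtain ⟨t, t0, hh, e₁, e₂, e₃, e₄⟩ := S4.rpow_half q hq.1
  have hq0 := ofReal_ne hq
  unfold SphEquiv
  fin_cases k <;> fin_cases l <;>
    simp only [UGen.coprod, List.map_cons, List.map_nil, List.sum_cons, List.sum_nil, add_zero, sphMat, spinMat,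
      Fin.sum_univ_four, Fin.zero_eta, Fin.mk_one, Fin.reduceFinMk, Matrix.of_apply, Matrix.cons_val,
      Matrix.diagonal_apply, Fin.reduceEq, if_true, if_false, zero_smul, one_smul, zero_add, map_smul, map_zero,
      smul_zero, e₁, e₂, Complex.ofReal_one, Complex.ofReal_inv, S4.wt, S4.act_Kinv_gen] <;>
    match_scalars <;> (try simp only [hh]) <;> field_simp

theorem sphEquiv_E₁ (hq : q ∈ Set.Ioo (0 : ℝ) 1) (k l : Fin 4) :
    SphEquiv hq (.E 0) k l := by
  obtain ⟨t, t0, hh, e₁, e₂, e₃, e₄⟩ := S4.rpow_half q hq.1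
  have hq0 := ofReal_ne hq
  unfold SphEquiv
  fin_cases k <;> fin_cases l <;>
    simp only [UGen.coprod, List.map_cons, List.map_nil, List.sum_cons, List.sum_nil, add_zero, sphMat, spinMat,
      Fin.sum_univ_four, Fin.zero_eta, Fin.mk_one, Fin.reduceFinMk, Matrix.of_apply, Matrix.cons_val,
      Matrix.diagonal_apply, Fin.reduceEq, if_true, if_false, zero_smul, one_smul, zero_add, map_smul, map_zero,
      smul_zero, e₁, e₂, Complex.ofReal_one, Complex.ofReal_inv, S4.wt, 
      S4.act_Kinv_gen, S4.act_E_gen, S4.actE, S4.qnum_two q hq, e₃, Complex.ofReal_mul, Complex.ofReal_add] <;>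
    match_scalars <;> (try simp only [hh]) <;> field_simp <;> ring

theorem sphEquiv_F₁ (hq : q ∈ Set.Ioo (0 : ℝ) 1) (k l : Fin 4) :
    SphEquiv hq (.F 0) k l := by
  obtain ⟨t, t0, hh, e₁, e₂, e₃, e₄⟩ := S4.rpow_half q hq.1
  have hq0 := ofReal_ne hq
  unfold SphEquiv
  fin_cases k <;> fin_cases l <;>
    simp only [UGen.coprod, List.map_cons, List.map_nil, List.sum_cons, List.sum_nil, add_zero, sphMat, spinMat,
      Fin.sum_univ_four, Fin.zero_eta, Fin.mk_one, Fin.reduceFinMk, Matrix.of_apply, Matrix.cons_val,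
      Matrix.diagonal_apply, Fin.reduceEq, if_true, if_false, zero_smul, one_smul, zero_add, map_smul, map_zero,
      smul_zero, e₁, e₂, Complex.ofReal_one, Complex.ofReal_inv, S4.wt, 
      S4.act_Kinv_gen, S4.act_F_gen, S4.actF, S4.qnum_two q hq, e₄, Complex.ofReal_mul, Complex.ofReal_add] <;>
    match_scalars <;> (try simp only [hh]) <;> field_simp <;> ring

theorem sphEquiv_K₂ (hq : q ∈ Set.Ioo (0 : ℝ) 1) (k l : Fin 4) :
    SphEquiv hq (.K 1) k l := by
  obtain ⟨t, t0, hh, e₁, e₂, e₃, e₄⟩ := S4.rpow_half q hq.1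
  have hq0 := ofReal_ne hq
  unfold SphEquiv
  fin_cases k <;> fin_cases l <;>
    simp only [UGen.coprod, List.map_cons, List.map_nil, List.sum_cons, List.sum_nil, add_zero, sphMat, spinMat,
      Fin.sum_univ_four, Fin.zero_eta, Fin.mk_one, Fin.reduceFinMk, Matrix.of_apply, Matrix.cons_val,
      Matrix.diagonal_apply, Fin.reduceEq, if_true, if_false, zero_smul, one_smul, zero_add, map_smul, map_zero,
      smul_zero, e₁, e₂, Complex.ofReal_one, Complex.ofReal_inv, S4.wt, S4.act_K_gen] <;>
    match_scalars <;> (try simp only [hh]) <;> field_simp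

theorem sphEquiv_Kinv₂ (hq : q ∈ Set.Ioo (0 : ℝ) 1) (k l : Fin 4) :
    SphEquiv hq (.Kinv 1) k l := by
  obtain ⟨t, t0, hh, e₁, e₂, e₃, e₄⟩ := S4.rpow_half q hq.1
  have hq0 := ofReal_ne hq
  unfold SphEquiv
  fin_cases k <;> fin_cases l <;>
    simp only [UGen.coprod, List.map_cons, List.map_nil, List.sum_cons, List.sum_nil, add_zero, sphMat, spinMat,
      Fin.sum_univ_four, Fin.zero_eta, Fin.mk_one, Fin.reduceFinMk, Matrix.of_apply, Matrix.cons_val,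
      Matrix.diagonal_apply, Fin.reduceEq, if_true, if_false, zero_smul, one_smul, zero_add, map_smul, map_zero,
      smul_zero, e₁, e₂, Complex.ofReal_one, Complex.ofReal_inv, S4.wt, S4.act_Kinv_gen] <;>
    match_scalars <;> (try simp only [hh]) <;> field_simp

theorem sphEquiv_E₂ (hq : q ∈ Set.Ioo (0 : ℝ) 1) (k l : Fin 4) :
    SphEquiv hq (.E 1) k l := by
  obtain ⟨t, t0, hh, e₁, e₂, e₃, e₄⟩ := S4.rpow_half q hq.1
  have hq0 := ofReal_ne hq
  unfold SphEquiv
  fin_cases k <;> fin_cases l <;>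
    simp only [UGen.coprod, List.map_cons, List.map_nil, List.sum_cons, List.sum_nil, add_zero, sphMat, spinMat,
      Fin.sum_univ_four, Fin.zero_eta, Fin.mk_one, Fin.reduceFinMk, Matrix.of_apply, Matrix.cons_val,
      Matrix.diagonal_apply, Fin.reduceEq, if_true, if_false, zero_smul, one_smul, zero_add, map_smul, map_zero,
      smul_zero, e₁, e₂, Complex.ofReal_one, Complex.ofReal_inv, S4.wt, 
      S4.act_Kinv_gen, S4.act_E_gen, S4.actE, S4.qnum_two q hq, e₃, Complex.ofReal_mul, Complex.ofReal_add] <;>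
    match_scalars <;> (try simp only [hh]) <;> field_simp <;> ring

theorem sphEquiv_F₂ (hq : q ∈ Set.Ioo (0 : ℝ) 1) (k l : Fin 4) :
    SphEquiv hq (.F 1) k l := by
  obtain ⟨t, t0, hh, e₁, e₂, e₃, e₄⟩ := S4.rpow_half q hq.1
  have hq0 := ofReal_ne hq
  unfold SphEquiv
  fin_cases k <;> fin_cases l <;>
    simp only [UGen.coprod, List.map_cons, List.map_nil, List.sum_cons, List.sum_nil, add_zero, sphMat, spinMat,
      Fin.sum_univ_four, Fin.zero_eta, Fin.mk_one, Fin.reduceFinMk, Matrix.of_apply, Matrix.cons_val,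
      Matrix.diagonal_apply, Fin.reduceEq, if_true, if_false, zero_smul, one_smul, zero_add, map_smul, map_zero,
      smul_zero, e₁, e₂, Complex.ofReal_one, Complex.ofReal_inv, S4.wt, 
      S4.act_Kinv_gen, S4.act_F_gen, S4.actF, S4.qnum_two q hq, e₄, Complex.ofReal_mul, Complex.ofReal_add] <;>
    match_scalars <;> (try simp only [hh]) <;> field_simp <;> ring

theorem sphEquiv (hq : q ∈ Set.Ioo (0 : ℝ) 1) (h : UGen) (k l : Fin 4) : SphEquiv hq h k l := by
  cases h with
  | K i => fin_cases i; exacts [sphEquiv_K₁ hq k l, sphEquiv_K₂ hq k l]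
  | Kinv i => fin_cases i; exacts [sphEquiv_Kinv₁ hq k l, sphEquiv_Kinv₂ hq k l]
  | E i => fin_cases i; exacts [sphEquiv_E₁ hq k l, sphEquiv_E₂ hq k l]
  | F i => fin_cases i; exacts [sphEquiv_F₁ hq k l, sphEquiv_F₂ hq k l]

end



section

variable {q : ℝ}

theorem trace_eq_zero_of_tensor {n : Type} [Fintype n] [DecidableEq n] {A K Ki R X X' X'' : Matrix n n ℂ}
    (hK : K * Ki = 1) (h₁ : A * X = X' * K + X'' * A) (h₂ : Ki * X = X'' * Ki)
    (h₃ : Ki * R * A = K * A * Ki * R * Ki) : (R * X').trace = 0 := by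
  have hK' : Ki * K = 1 := mul_eq_one_comm.1 hK
  have e₂ : X'' = Ki * X * K := by rw [h₂, mul_assoc, hK', mul_one]
  have e₁ : X' = A * X * Ki - X'' * A * Ki := by
    rw [h₁, add_mul, mul_assoc X', hK, mul_one, add_sub_cancel_right]
  rw [e₁, e₂, mul_sub, Matrix.trace_sub, sub_eq_zero]
  calc (R * (A * X * Ki)).trace = (Ki * R * A * X).trace := by
        rw [← mul_assoc, Matrix.trace_mul_comm, ← mul_assoc, ← mul_assoc]
    _ = ((K * A * Ki * R * Ki) * X).trace := by rw [h₃]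
    _ = ((K * A * Ki) * (R * Ki * X)).trace := by simp only [mul_assoc]
    _ = _ := by rw [Matrix.trace_mul_comm]; simp only [mul_assoc]

theorem trace_eq_of_tensor {n : Type} [Fintype n] [DecidableEq n] {K Ki R X X' : Matrix n n ℂ}
    (hK : K * Ki = 1) (h₁ : K * X = X' * K) (h₂ : R * K = K * R) : (R * X').trace = (R * X).trace := by
  have e₁ : X' = K * X * Ki := by rw [h₁, mul_assoc, hK, mul_one]
  rw [e₁, ← mul_assoc, Matrix.trace_mul_comm, ← mul_assoc, ← mul_assoc]
  rw [mul_assoc Ki, h₂, ← mul_assoc, mul_eq_one_comm.1 hK, one_mul]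

variable (q) in
/-- The weights of the quantum trace on `V_{1/2}`. -/
def haarWt : Fin 4 → ℝ := ![q ^ 8, q ^ 2, q ^ 6, 1]

variable (q) in
/-- The quantum dimension of `V_{1/2}`, up to normalization. -/
def haarDim : ℝ := q ^ 8 + q ^ 2 + q ^ 6 + 1

theorem haarDim_pos (q : ℝ) : 0 < haarDim q := by
  unfold haarDim; positivity

/-- The invariant state: the normalized quantum trace on `V_{1/2}` of the operators `π_+(a)`. -/
noncomputable def haar (hq : q ∈ Set.Ioo (0 : ℝ) 1) : S4 q →ₗ[ℂ] ℂ :=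
  ((haarDim q)⁻¹ : ℂ) • ((Matrix.traceLinearMap (Fin 4) ℂ ℂ ∘ₗ
    LinearMap.mulLeft ℂ (Matrix.diagonal fun k => (haarWt q k : ℂ))) ∘ₗ spinCoef hq 1)

theorem haar_apply (hq : q ∈ Set.Ioo (0 : ℝ) 1) (a : S4 q) : haar hq a =
    ((haarDim q)⁻¹ : ℂ) * (Matrix.diagonal (fun k => (haarWt q k : ℂ)) * spinCoef hq 1 a).trace := rfl

theorem haar_eq_sum (hq : q ∈ Set.Ioo (0 : ℝ) 1) (a : S4 q) : haar hq a =
    ((haarDim q)⁻¹ : ℂ) * ∑ k, (haarWt q k : ℂ) * fip (xi k) (sphereRep hq 1 a (xi k)) := by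
  rw [haar_apply, Matrix.trace]
  congr 1
  refine Finset.sum_congr rfl fun k _ => ?_
  rw [Matrix.diag_apply, Matrix.diagonal_mul]; rfl

theorem haar_one (hq : q ∈ Set.Ioo (0 : ℝ) 1) : haar hq 1 = 1 := by
  rw [haar_eq_sum, Fin.sum_univ_four, map_one]
  simp only [Module.End.one_apply, fip_xi, if_true, mul_one]
  have := (haarDim_pos q).ne'
  rw [← Complex.ofReal_add, ← Complex.ofReal_add, ← Complex.ofReal_add]
  simp only [haarWt, Matrix.cons_val]
  exact inv_mul_cancel₀ (Complex.ofReal_ne_zero.2 this)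

theorem haar_invariant (hq : q ∈ Set.Ioo (0 : ℝ) 1) (h : UGen) (a : S4 q) :
    haar hq (S4.act q hq h a) = h.counit * haar hq a := by
  obtain ⟨t, t0, hh, e₁, e₂, e₃, e₄⟩ := S4.rpow_half q hq.1
  have hq0 := ofReal_ne hq
  have hX := spinCoef_isSpinTensor hq 1
  have kK := fun i => spinMat_K_mul_Kinv hq i
  have hKi := fun i => hX (.Kinv i) a
  have hh' := hX h a
  rw [haar_apply, haar_apply]
  cases h with
  | K i =>
    simp only [UGen.coprod, List.map_cons, List.map_nil, List.sum_cons, List.sum_nil, add_zero] at hh'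
    rw [trace_eq_of_tensor (kK i) hh', UGen.counit, one_mul]
    fin_cases i <;> simp only [spinMat, Fin.zero_eta, Fin.mk_one, Matrix.diagonal_mul_diagonal, mul_comm]
  | Kinv i =>
    simp only [UGen.coprod, List.map_cons, List.map_nil, List.sum_cons, List.sum_nil, add_zero] at hh'
    rw [trace_eq_of_tensor (mul_eq_one_comm.1 (kK i)) hh', UGen.counit, one_mul]
    fin_cases i <;> simp only [spinMat, Fin.zero_eta, Fin.mk_one, Matrix.diagonal_mul_diagonal, mul_comm]
  | E i =>
    simp only [UGen.coprod, List.map_cons, List.map_nil, List.sum_cons, List.sum_nil, add_zero] at hh' hKi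
    rw [trace_eq_zero_of_tensor (kK i) hh' (hKi i), UGen.counit, mul_zero, zero_mul]
    fin_cases i <;> ext k l <;> fin_cases k <;> fin_cases l <;>
    simp only [spinMat, haarWt, Matrix.mul_apply, Fin.sum_univ_four, Fin.zero_eta, Fin.mk_one, Fin.reduceFinMk, Matrix.of_apply, Matrix.cons_val,
      Matrix.diagonal_apply, Fin.reduceEq, if_true, if_false, zero_mul, mul_zero, zero_add, add_zero, mul_one, one_mul, e₁, e₂, Complex.ofReal_one, Complex.ofReal_inv, Complex.ofReal_pow] <;> (try simp only [hh]) <;> field_simp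
  | F i =>
    simp only [UGen.coprod, List.map_cons, List.map_nil, List.sum_cons, List.sum_nil, add_zero] at hh' hKi
    rw [trace_eq_zero_of_tensor (kK i) hh' (hKi i), UGen.counit, mul_zero, zero_mul]
    fin_cases i <;> ext k l <;> fin_cases k <;> fin_cases l <;>
    simp only [spinMat, haarWt, Matrix.mul_apply, Fin.sum_univ_four, Fin.zero_eta, Fin.mk_one, Fin.reduceFinMk, Matrix.of_apply, Matrix.cons_val,
      Matrix.diagonal_apply, Fin.reduceEq, if_true, if_false, zero_mul, mul_zero, zero_add, add_zero, mul_one, one_mul, e₁, e₂, Complex.ofReal_one, Complex.ofReal_inv, Complex.ofReal_pow] <;> (try simp only [hh]) <;> field_simp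

theorem haar_star_mul_self (hq : q ∈ Set.Ioo (0 : ℝ) 1) (a : S4 q) : haar hq (star a * a) =
    (((haarDim q)⁻¹ * ∑ k, haarWt q k * fnsq (sphereRep hq 1 a (xi k)) : ℝ) : ℂ) := by
  rw [haar_eq_sum]
  push_cast
  congr 1
  refine Finset.sum_congr rfl fun k _ => ?_
  rw [map_mul, Module.End.mul_apply, ← fip_self]
  congr 1
  have := (sphereRep_isEquivariant hq 1).star a (xi k) (sphereRep hq 1 a (xi k))
  exact this.symm

section

variable {φ : S4 q →ₗ[ℂ] ℂ}

/-- Invariant functionals. -/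
def IsInvFunctional (hq : q ∈ Set.Ioo (0 : ℝ) 1) (φ : S4 q →ₗ[ℂ] ℂ) : Prop :=
  ∀ h a, φ (S4.act q hq h a) = h.counit * φ a

theorem invariant_x₀ {hq : q ∈ Set.Ioo (0 : ℝ) 1} (h : IsInvFunctional hq φ) : φ (S4.x₀ q) = 0 := by
  obtain ⟨t, t0, hh, e₁, e₂, e₃, e₄⟩ := S4.rpow_half q hq.1
  have := h (.F 0) (S4.x₁ q)
  rw [S4.act_F_gen, S4.actF, map_smul, UGen.counit, zero_mul, S4.qnum_two q hq, Complex.ofReal_mul, e₁] at this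
  refine (smul_eq_zero.1 this).resolve_left (mul_ne_zero t0 ?_)
  have := hq.1
  exact_mod_cast (by positivity : 0 < q + q⁻¹).ne'

theorem invariant_x₂y₂ {hq : q ∈ Set.Ioo (0 : ℝ) 1} (h : IsInvFunctional hq φ) :
    (1 + (q : ℂ) ^ 2 + (q : ℂ) ^ 4 + (q : ℂ) ^ 6 + (q : ℂ) ^ 8) * φ (S4.x₂ q * S4.y₂ q) =
      ((q : ℂ) ^ 6 + (q : ℂ) ^ 8) * φ 1 := by
  obtain ⟨t, t0, hh, e₁, e₂, e₃, e₄⟩ := S4.rpow_half q hq.1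
  have hq0 := ofReal_ne hq
  have a₁ := h (.F 1) (S4.x₂ q * S4.y₁ q)
  have a₂ := h (.F 0) (S4.x₁ q * S4.x₀ q)
  rw [S4.act_F_mul, S4.act_F_gen, S4.act_F_gen, S4.act_K_gen, S4.act_Kinv_gen, UGen.counit, zero_mul] at a₁ a₂
  simp only [S4.actF, S4.wt, S4.qnum_two q hq, Complex.ofReal_mul, e₁, e₄, map_add, smul_mul_smul_comm, map_smul,
    mul_smul_comm, smul_mul_assoc, smul_eq_mul, Complex.ofReal_add, Complex.ofReal_inv] at a₁ a₂
  have a₃ := congrArg φ (S4.r_sphere q)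
  rw [map_add, map_add] at a₃
  have b₁ : φ (S4.x₂ q * S4.y₂ q) = (q : ℂ) ^ 4 * φ (S4.x₁ q * S4.y₁ q) := by
    field_simp at a₁
    linear_combination -a₁
  have b₂ : φ (S4.x₁ q * S4.y₁ q) = ((q : ℂ) ^ 2 + (q : ℂ) ^ 4) * φ (S4.x₀ q * S4.x₀ q) := by
    rw [hh] at a₂ ⊢
    field_simp at a₂
    linear_combination -a₂
  rw [b₁, b₂] at a₃ ⊢
  linear_combination ((q : ℂ) ^ 6 + (q : ℂ) ^ 8) * a₃

end

theorem haar_isInvFunctional (hq : q ∈ Set.Ioo (0 : ℝ) 1) : IsInvFunctional hq (haar hq) := haar_invariant hq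

/-- The matrix coefficients of spinors, expressed by an invariant functional. -/
noncomputable def spinorOf (φ : S4 q →ₗ[ℂ] ℂ) (s : ℤˣ) : S4 q →ₗ[ℂ] Matrix (Fin 4) (Fin 4) ℂ where
  toFun a := Matrix.of fun k l => (if k = l then φ a else 0) + ((s : ℤ) : ℂ) * φ (a * sphMat q l k)
  map_add' a b := by
    ext k l; simp only [add_mul, map_add, mul_add, Matrix.of_apply, Matrix.add_apply]; split_ifs <;> ring
  map_smul' c a := by
    ext k l
    simp only [smul_mul_assoc, map_smul, Matrix.of_apply, Matrix.smul_apply, smul_eq_mul, RingHom.id_apply]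
    split_ifs <;> ring

theorem spinorOf_isSpinTensor {hq : q ∈ Set.Ioo (0 : ℝ) 1} {φ : S4 q →ₗ[ℂ] ℂ} (h : IsInvFunctional hq φ)
    (s : ℤˣ) : IsSpinTensor hq (spinorOf φ s) := by
  have right : ∀ g b k l, (spinorOf φ s b * spinMat q g) k l = spinMat q g k l * φ b +
      ((s : ℤ) : ℂ) * φ (b * ∑ j, spinMat q g j l • sphMat q j k) := fun g b k l => by
    simp only [spinorOf, LinearMap.coe_mk, AddHom.coe_mk, Matrix.mul_apply, Matrix.of_apply, add_mul, Finset.sum_add_distrib,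
      ite_mul, zero_mul, Finset.sum_ite_eq, Finset.mem_univ, if_true, Finset.mul_sum, map_sum, mul_smul_comm, map_smul,
      smul_eq_mul]
    congr 1
    · ring
    · exact Finset.sum_congr rfl fun j _ => by ring
  have left : ∀ g b k l, (spinMat q g * spinorOf φ s b) k l = spinMat q g k l * φ b +
      ((s : ℤ) : ℂ) * ∑ j, spinMat q g k j * φ (b * sphMat q l j) := fun g b k l => by
    simp only [spinorOf, LinearMap.coe_mk, AddHom.coe_mk, Matrix.mul_apply, Matrix.of_apply, mul_add, Finset.sum_add_distrib,
      mul_ite, mul_zero, Finset.sum_ite_eq', Finset.mem_univ, if_true, Finset.mul_sum]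
    congr 1
    exact Finset.sum_congr rfl fun j _ => by ring
  have sum : ∀ g b k l, φ (b * ∑ j, spinMat q g k j • sphMat q l j) = ∑ j, spinMat q g k j * φ (b * sphMat q l j) :=
    fun g b k l => by simp only [Finset.mul_sum, map_sum, mul_smul_comm, map_smul, smul_eq_mul]
  have group : ∀ i g a k l (b : S4 q → S4 q), φ (b a * ∑ j, spinMat q g k j • S4.act q hq i (sphMat q l j)) =
      ∑ j, spinMat q g k j * φ (b a * S4.act q hq i (sphMat q l j)) := fun i g a k l b => by
    simp only [Finset.mul_sum, map_sum, mul_smul_comm, map_smul, smul_eq_mul]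
  intro g a
  ext k l
  rw [left]
  have e := sphEquiv hq g k l
  unfold SphEquiv at e
  cases g with
  | K i =>
    simp only [UGen.coprod, List.map_cons, List.map_nil, List.sum_cons, List.sum_nil, add_zero] at e ⊢
    rw [right, ← e, group, h, UGen.counit, one_mul]
    simp only [← S4.act_K_mul, h _ _, UGen.counit, one_mul]
  | Kinv i =>
    simp only [UGen.coprod, List.map_cons, List.map_nil, List.sum_cons, List.sum_nil, add_zero] at e ⊢
    rw [right, ← e, group, h, UGen.counit, one_mul]
    simp only [← S4.act_Kinv_mul, h _ _, UGen.counit, one_mul]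
  | E i =>
    have eK := sphEquiv hq (.K i) k l
    unfold SphEquiv at eK
    simp only [UGen.coprod, List.map_cons, List.map_nil, List.sum_cons, List.sum_nil, add_zero] at e eK ⊢
    rw [Matrix.add_apply, right, right, ← e, ← eK, h, h, UGen.counit, UGen.counit, zero_mul, mul_zero, zero_add, one_mul,
      mul_add, map_add, group, group, group]
    have z : ∀ j, φ (S4.act q hq (.E i) a * S4.act q hq (.K i) (sphMat q l j)) +
        φ (S4.act q hq (.Kinv i) a * S4.act q hq (.E i) (sphMat q l j)) = 0 := fun j => by
      rw [← map_add, ← S4.act_E_mul, h, UGen.counit, zero_mul]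
    simp only [← S4.act_Kinv_mul, h (.Kinv i), UGen.counit, one_mul]
    have z' : ∑ j, spinMat q (.K i) k j * φ (S4.act q hq (.E i) a * S4.act q hq (.K i) (sphMat q l j)) +
        ∑ j, spinMat q (.K i) k j * φ (S4.act q hq (.Kinv i) a * S4.act q hq (.E i) (sphMat q l j)) = 0 := by
      rw [← Finset.sum_add_distrib]
      exact Finset.sum_eq_zero fun j _ => by rw [← mul_add, z, mul_zero]
    linear_combination -((s : ℤ) : ℂ) * z'
  | F i =>
    have eK := sphEquiv hq (.K i) k l
    unfold SphEquiv at eK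
    simp only [UGen.coprod, List.map_cons, List.map_nil, List.sum_cons, List.sum_nil, add_zero] at e eK ⊢
    rw [Matrix.add_apply, right, right, ← e, ← eK, h, h, UGen.counit, UGen.counit, zero_mul, mul_zero, zero_add, one_mul,
      mul_add, map_add, group, group, group]
    have z : ∀ j, φ (S4.act q hq (.F i) a * S4.act q hq (.K i) (sphMat q l j)) +
        φ (S4.act q hq (.Kinv i) a * S4.act q hq (.F i) (sphMat q l j)) = 0 := fun j => by
      rw [← map_add, ← S4.act_F_mul, h, UGen.counit, zero_mul]
    simp only [← S4.act_Kinv_mul, h (.Kinv i), UGen.counit, one_mul]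
    have z' : ∑ j, spinMat q (.K i) k j * φ (S4.act q hq (.F i) a * S4.act q hq (.K i) (sphMat q l j)) +
        ∑ j, spinMat q (.K i) k j * φ (S4.act q hq (.Kinv i) a * S4.act q hq (.F i) (sphMat q l j)) = 0 := by
      rw [← Finset.sum_add_distrib]
      exact Finset.sum_eq_zero fun j _ => by rw [← mul_add, z, mul_zero]
    linear_combination -((s : ℤ) : ℂ) * z'

end



/-! ### Comparison of the matrix coefficients -/

section

variable {q : ℝ}

theorem ofReal_zpow_inj (hq : q ∈ Set.Ioo (0 : ℝ) 1) {a b : ℤ} (h : (q : ℂ) ^ a = (q : ℂ) ^ b) : a = b :=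
  zpow_right_injective₀ hq.1 hq.2.ne (by exact_mod_cast h)

theorem IsSpinTensor.pow_eq_zero {hq : q ∈ Set.Ioo (0 : ℝ) 1} {X : S4 q →ₗ[ℂ] Matrix (Fin 4) (Fin 4) ℂ}
    (hX : IsSpinTensor hq X) (n : ℕ) (k l : Fin 4) (h : X (S4.x₂ q ^ n) k l ≠ 0) :
    (n = 0 ∧ k = l) ∨ (n = 1 ∧ (k = 0 ∧ l = 1 ∨ k = 2 ∧ l = 3)) := by
  have e₁ := congrFun (congrFun (hX (.K 0) (S4.x₂ q ^ n)) k) l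
  have e₂ := congrFun (congrFun (hX (.K 1) (S4.x₂ q ^ n)) k) l
  simp only [UGen.coprod, List.map_cons, List.map_nil, List.sum_cons, List.sum_nil, add_zero, S4.act_K_pow, S4.wt,
    map_smul, spinMat, Matrix.diagonal_mul, Matrix.mul_diagonal, Matrix.smul_apply, smul_eq_mul, one_pow, one_mul] at e₁ e₂
  rw [mul_comm] at e₁
  have f₁ := mul_left_cancel₀ h e₁
  rw [mul_right_comm, mul_comm] at e₂
  have f₂ := mul_right_cancel₀ h ((mul_comm _ _).trans e₂)
  have hlt : q ^ (1 / 2 : ℝ) < q ^ (-1 / 2 : ℝ) := Real.rpow_lt_rpow_of_exponent_gt hq.1 hq.2 (by norm_num)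
  have f₁' := Complex.ofReal_injective f₁
  have z : ∀ a b c : ℤ, (q : ℂ) ^ a = (q : ℂ) ^ b * (q : ℂ) ^ c → a = b + c := fun a b c e =>
    ofReal_zpow_inj hq (by rw [e, zpow_add₀ (ofReal_ne hq)])
  have g : ∀ k : Fin 4, ((![1, q⁻¹, q, 1] k : ℝ) : ℂ) = (q : ℂ) ^ (![0, -1, 1, 0] k : ℤ) := fun k => by
    fin_cases k <;> simp
  rw [g, g, ← zpow_natCast] at f₂
  have f₂' := z _ _ _ f₂
  fin_cases k <;> fin_cases l <;> simp at f₁' f₂' ⊢ <;> first | omega | (norm_num at f₁' hlt; exfalso; linarith)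

theorem qnum_five (hq : q ∈ Set.Ioo (0 : ℝ) 1) : qnum q 5 = q ^ 4 + q ^ 2 + 1 + (q ^ 2)⁻¹ + (q ^ 4)⁻¹ := by
  have hq0 := hq.1.ne'
  have h1 : q ^ 2 - 1 ≠ 0 := by have := pow_lt_one₀ hq.1.le hq.2 (n := 2) (by norm_num); linarith
  have e : q - q⁻¹ = (q ^ 2 - 1) / q := by field_simp
  have e5 : q ^ (5 : ℝ) = q ^ 5 := by exact_mod_cast Real.rpow_natCast q 5
  rw [qnum, Real.rpow_neg hq.1.le, e5, e]
  field_simp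
  ring

theorem coefD0_one (hq : q ∈ Set.Ioo (0 : ℝ) 1) : coefD0 q 1 1 (-1) = qnum q 2 / qnum q 5 := by
  have h3 : 0 < qnum q 3 := qnum_pos hq (by norm_num)
  have h5 : 0 < qnum q 5 := qnum_pos hq (by norm_num)
  have e : eps 1 (-1) 1 = -1 / 2 := by unfold eps; norm_num
  rw [coefD0, e]; norm_num
  rw [Real.sqrt_mul_self h3.le]
  field_simp

theorem spinCoef_eq (hq : q ∈ Set.Ioo (0 : ℝ) 1) (s : ℤˣ) : spinCoef hq s = spinorOf (haar hq) s := by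
  have hX := spinCoef_isSpinTensor hq s
  have hY := spinorOf_isSpinTensor (haar_isInvFunctional hq) s
  refine hX.ext hY fun n => ?_
  ext k l
  by_cases hn : (n = 0 ∧ k = l) ∨ (n = 1 ∧ (k = 0 ∧ l = 1 ∨ k = 2 ∧ l = 3))
  swap
  · rw [not_imp_comm.1 (hX.pow_eq_zero n k l) hn, not_imp_comm.1 (hY.pow_eq_zero n k l) hn]
  have x0 : haar hq (S4.x₀ q) = 0 := invariant_x₀ (haar_isInvFunctional hq)
  rcases hn with ⟨rfl, rfl⟩ | ⟨rfl, hkl⟩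
  · have e₁ : spinCoef hq s 1 k k = 1 := by simp [spinCoef, fip_xi]
    have e₂ : spinorOf (haar hq) s 1 k k = 1 := by
      have : haar hq (sphMat q k k) = 0 := by
        fin_cases k <;> simp [sphMat, x0]
      simp [spinorOf, haar_one, this]
    rw [pow_zero, e₁, e₂]
  · have v := invariant_x₂y₂ (haar_isInvFunctional hq)
    have hq0 := hq.1
    have d : (coefD0 q 1 1 (-1) : ℂ) = ((q : ℂ) ^ 3)⁻¹ * haar hq (S4.x₂ q * S4.y₂ q) := by
      rw [haar_one] at v
      have hp : 0 < 1 + q ^ 2 + q ^ 4 + q ^ 6 + q ^ 8 := by positivity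
      have hp' : (1 + (q : ℂ) ^ 2 + (q : ℂ) ^ 4 + (q : ℂ) ^ 6 + (q : ℂ) ^ 8) ≠ 0 := by exact_mod_cast hp.ne'
      have hx : haar hq (S4.x₂ q * S4.y₂ q) = ((q ^ 6 + q ^ 8) / (1 + q ^ 2 + q ^ 4 + q ^ 6 + q ^ 8) : ℝ) := by
        push_cast
        rw [eq_div_iff hp']
        linear_combination v
      rw [hx, coefD0_one hq, qnum_five hq, S4.qnum_two q hq]
      norm_cast
      have : q ^ 4 + q ^ 2 + 1 + (q ^ 2)⁻¹ + (q ^ 4)⁻¹ = (1 + q ^ 2 + q ^ 4 + q ^ 6 + q ^ 8) / q ^ 4 := by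
        field_simp; ring
      rw [this]
      field_simp
      ring
    obtain ⟨h1, h2, h3, h4⟩ := adm_xi
    rw [pow_one]
    rcases hkl with ⟨rfl, rfl⟩ | ⟨rfl, rfl⟩
    · simp only [spinCoef, spinorOf, LinearMap.coe_mk, AddHom.coe_mk, Matrix.of_apply, sphereRep_x₂, xi, Matrix.cons_val,
        opX₂_ket s h2, fip_add_right, fip_smul_right, sphMat, mul_smul_comm, map_smul, smul_eq_mul]
      norm_num only
      simp (disch := omega) only [fip_ket_eq h1, fip_ket_of_ne, mul_zero, zero_add, add_zero, mul_one, d, if_false,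
        Fin.reduceEq]
    · simp only [spinCoef, spinorOf, LinearMap.coe_mk, AddHom.coe_mk, Matrix.of_apply, sphereRep_x₂, xi, Matrix.cons_val,
        opX₂_ket s h4, fip_add_right, fip_smul_right, sphMat, mul_smul_comm, map_smul, smul_eq_mul]
      norm_num only
      simp (disch := omega) only [fip_ket_eq h3, fip_ket_of_ne, mul_zero, zero_add, add_zero, mul_one, d, if_false,
        Fin.reduceEq]

end



/-! ### The modules of chiral spinors -/

section

variable {q : ℝ}

theorem coefDm_ne_zero (hq : q ∈ Set.Ioo (0 : ℝ) 1) {L J M₂ : ℤ} (h₁ : 0 < (L : ℝ) / 2 - J / 2 - M₂ / 2 + eps L M₂ J)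
    (h₂ : 0 < (L : ℝ) / 2 + J / 2 - M₂ / 2 + 1 - eps L M₂ J) (h₃ : 0 ≤ L) : coefDm q L J M₂ ≠ 0 := by
  have h4 : 0 < 2 * ((L : ℝ) / 2) + 2 := by have : (0 : ℝ) ≤ L := by exact_mod_cast h₃
                                            linarith
  rw [coefDm]
  exact mul_ne_zero (neg_ne_zero.2 (Real.rpow_pos_of_pos hq.1 _).ne') (div_ne_zero (Real.sqrt_ne_zero'.2
    (mul_pos (qnum_pos hq h₁) (qnum_pos hq h₂))) (qnum_pos hq h4).ne')

/-- The map `v ↦ ∑ π(vⱼ) ξⱼ`. -/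
noncomputable def spinorMap (hq : q ∈ Set.Ioo (0 : ℝ) 1) (s : ℤˣ) : (Fin 4 → S4 q) →ₗ[ℂ] Spin where
  toFun v := ∑ j, sphereRep hq s (v j) (xi j)
  map_add' v w := by simp [Finset.sum_add_distrib]
  map_smul' c v := by simp [Finset.smul_sum]

theorem spinorMap_apply (hq : q ∈ Set.Ioo (0 : ℝ) 1) (s : ℤˣ) (v : Fin 4 → S4 q) :
    spinorMap hq s v = ∑ j, sphereRep hq s (v j) (xi j) := rfl

theorem spinorMap_smul (hq : q ∈ Set.Ioo (0 : ℝ) 1) (s : ℤˣ) (a : S4 q) (v : Fin 4 → S4 q) :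
    spinorMap hq s (a • v) = sphereRep hq s a (spinorMap hq s v) := by
  simp [spinorMap_apply, map_sum]

theorem spinorMap_tensorAct (hq : q ∈ Set.Ioo (0 : ℝ) 1) (s : ℤˣ) (h : UGen) (v : Fin 4 → S4 q) :
    spinorMap hq s (tensorAct hq h v) = opU q h (spinorMap hq s v) := by
  have e : ∀ a k, opU q h (sphereRep hq s a (xi k)) =
      (h.coprod.map fun p => sphereRep hq s (S4.act q hq p.1 a) (opU q p.2 (xi k))).sum := fun a k => by
    have := LinearMap.congr_fun ((sphereRep_isEquivariant hq s).crossed h a) (xi k)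
    simp only [spinRep_gen] at this
    refine this.trans ?_
    cases h <;> simp [UGen.coprod]
  have key : ∀ g (f : S4 q →ₗ[ℂ] S4 q), ∑ i, sphereRep hq s (∑ j, spinMat q g i j • f (v j)) (xi i) =
      ∑ j, sphereRep hq s (f (v j)) (opU q g (xi j)) := fun g f => by
    simp only [opU_xi hq, map_sum, map_smul, LinearMap.sum_apply, LinearMap.smul_apply]
    exact Finset.sum_comm
  rw [spinorMap_apply, spinorMap_apply, map_sum]
  simp only [e, tensorAct]
  cases h with
  | K i => simp only [UGen.coprod, List.map_cons, List.map_nil, List.sum_cons, List.sum_nil, add_zero, key]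
  | Kinv i => simp only [UGen.coprod, List.map_cons, List.map_nil, List.sum_cons, List.sum_nil, add_zero, key]
  | E i => simp only [UGen.coprod, List.map_cons, List.map_nil, List.sum_cons, List.sum_nil, add_zero, map_add,
      LinearMap.add_apply, Finset.sum_add_distrib, key]
  | F i => simp only [UGen.coprod, List.map_cons, List.map_nil, List.sum_cons, List.sum_nil, add_zero, map_add,
      LinearMap.add_apply, Finset.sum_add_distrib, key]

/-- A subspace which is stable under `U_q(so(5))` and `A(S⁴_q)` and contains `V_{1/2}` is everything. -/
theorem eq_top_of_stable (hq : q ∈ Set.Ioo (0 : ℝ) 1) (s : ℤˣ) {R : Submodule ℂ Spin}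
    (h₁ : ∀ h, ∀ v ∈ R, opU q h v ∈ R) (h₂ : ∀ a, ∀ v ∈ R, sphereRep hq s a v ∈ R) (h₃ : ∀ k, xi k ∈ R) : R = ⊤ := by
  have low : ∀ n : ℕ, ket (2 * n + 1) (-1) (-(2 * n + 1)) 1 ∈ R := by
    intro n
    induction n with
    | zero => exact h₃ 3
    | succ n ih =>
      have ha : Admissible (2 * n + 1) (-1) (-(2 * n + 1)) 1 := by rw [admissible_iff]; omega
      have := h₂ (S4.y₂ q) _ ih
      rw [sphereRep_y₂, opY₂_lowest s ha] at this
      have e : eps (2 * n + 1 + 2) (-(2 * n + 1) - 2) 1 = -1 / 2 := eps_neg (by omega)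
      have hn : (0 : ℝ) ≤ n := Nat.cast_nonneg n
      have hne : coefDm q (2 * n + 1 + 2) 1 (-(2 * n + 1) - 2) ≠ 0 := by
        refine coefDm_ne_zero hq ?_ ?_ (by omega) <;> rw [e] <;> push_cast <;> linarith
      have := (R.smul_mem_iff (by exact_mod_cast hne)).1 this
      convert this using 2 <;> push_cast <;> ring
  refine top_le_iff.1 fun v _ => ?_
  induction v using Finsupp.induction_linear with
  | zero => exact R.zero_mem
  | add f g hf hg => exact R.add_mem (hf trivial) (hg trivial)
  | single i c =>
    have ha := admissible_iff.1 i.adm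
    have hk : ket i.L i.M₁ i.M₂ i.J ∈ R := by
      obtain ⟨n, hn⟩ : ∃ n : ℕ, i.L = 2 * n + 1 := ⟨(i.L / 2).toNat, by omega⟩
      rw [hn]
      exact ket_mem_of_lowest hq (fun v hv => h₁ (.E 0) v hv) (fun v hv => h₁ (.E 1) v hv) (low n) _ _ _
    rw [ket_of_adm i.adm] at hk
    have := R.smul_mem c hk
    rwa [Finsupp.smul_single, smul_eq_mul, mul_one] at this

theorem spinorMap_surjective (hq : q ∈ Set.Ioo (0 : ℝ) 1) (s : ℤˣ) : Function.Surjective (spinorMap hq s) := by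
  rw [← LinearMap.range_eq_top]
  refine eq_top_of_stable hq s ?_ ?_ fun k => ?_
  · rintro h _ ⟨v, rfl⟩
    exact ⟨_, spinorMap_tensorAct hq s h v⟩
  · rintro a _ ⟨v, rfl⟩
    exact ⟨_, spinorMap_smul hq s a v⟩
  · refine ⟨Pi.single k 1, ?_⟩
    rw [spinorMap_apply, Finset.sum_eq_single k]
    · simp
    · intro j _ hj; simp [hj]
    · simp

theorem spinCoef_apply (hq : q ∈ Set.Ioo (0 : ℝ) 1) (s : ℤˣ) (a : S4 q) (k l : Fin 4) :
    spinCoef hq s a k l = fip (xi k) (sphereRep hq s a (xi l)) := rfl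

theorem fip_spinorMap (hq : q ∈ Set.Ioo (0 : ℝ) 1) (s : ℤˣ) (v w : Fin 4 → S4 q) :
    fip (spinorMap hq s v) (spinorMap hq s w) =
      ∑ j, haar hq (star (v j) * (w + ((s : ℤ) : ℂ) • Matrix.vecMul w (sphMat q)) j) := by
  rw [spinorMap_apply, spinorMap_apply, fip_sum_left]
  refine Finset.sum_congr rfl fun j _ => ?_
  rw [fip_sum_right]
  have e : ∀ k, fip (sphereRep hq s (v j) (xi j)) (sphereRep hq s (w k) (xi k)) =
      (if j = k then haar hq (star (v j) * w k) else 0) + ((s : ℤ) : ℂ) * haar hq (star (v j) * w k * sphMat q k j) :=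
    fun k => by
    have h₁ : fip (sphereRep hq s (v j) (xi j)) (sphereRep hq s (w k) (xi k)) =
        spinCoef hq s (star (v j) * w k) j k := by
      refine ((sphereRep_isEquivariant hq s).star _ _ _).trans ?_
      rw [spinCoef_apply, map_mul]; rfl
    rw [h₁, spinCoef_eq]; rfl
  simp only [e, Finset.sum_add_distrib, Finset.sum_ite_eq, Finset.mem_univ, if_true]
  rw [Pi.add_apply, Pi.smul_apply, mul_add, map_add, mul_smul_comm, map_smul, smul_eq_mul, Matrix.vecMul,
    dotProduct, Finset.mul_sum, map_sum, Finset.mul_sum]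
  simp only [mul_assoc]

/-- The idempotents `e` and `1 - e`. -/
noncomputable def idemOf (q : ℝ) (s : ℤˣ) : Matrix (Fin 4) (Fin 4) (S4 q) :=
  (1 / 2 : ℂ) • (1 + ((s : ℤ) : ℂ) • sphMat q)

theorem idemOf_one : idemOf q 1 = idem q := by rw [idemOf, idem_eq]; simp

theorem idemOf_add (s : ℤˣ) : idemOf q s + idemOf q (-s) = 1 := by
  rw [idemOf, idemOf]; push_cast; module

theorem idemOf_neg_one : idemOf q (-1) = 1 - idem q := by
  rw [← idemOf_one, eq_sub_iff_add_eq', idemOf_add]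

theorem idemOf_mul_self (hq : q ∈ Set.Ioo (0 : ℝ) 1) (s : ℤˣ) : idemOf q s * idemOf q s = idemOf q s := by
  have h := sphMat_mul_self hq
  rw [idemOf, smul_mul_smul_comm, add_mul, mul_add, mul_add, smul_mul_smul_comm, h, one_mul, one_mul, mul_one,
    units_sq s]
  module

theorem idemOf_mul_neg (hq : q ∈ Set.Ioo (0 : ℝ) 1) (s : ℤˣ) : idemOf q s * idemOf q (-s) = 0 := by
  have h := idemOf_add (q := q) s
  rw [← eq_sub_iff_add_eq'] at h
  rw [h, mul_sub, mul_one, idemOf_mul_self hq, sub_self]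

theorem fip_spinorMap' (hq : q ∈ Set.Ioo (0 : ℝ) 1) (s : ℤˣ) (v w : Fin 4 → S4 q) :
    fip (spinorMap hq s v) (spinorMap hq s w) = 2 * ∑ j, haar hq (star (v j) * Matrix.vecMul w (idemOf q s) j) := by
  rw [fip_spinorMap, Finset.mul_sum]
  refine Finset.sum_congr rfl fun j _ => ?_
  rw [← smul_eq_mul (2 : ℂ), ← map_smul, ← mul_smul_comm]
  congr 2
  rw [idemOf, Matrix.vecMul_smul, Matrix.vecMul_add, Matrix.vecMul_one, Matrix.vecMul_smul, Pi.smul_apply, smul_smul]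
  norm_num

theorem spinorMap_vecMul (hq : q ∈ Set.Ioo (0 : ℝ) 1) (s : ℤˣ) (v : Fin 4 → S4 q) :
    spinorMap hq s (Matrix.vecMul v (idemOf q s)) = spinorMap hq s v := by
  refine fip_ext fun u => ?_
  obtain ⟨w, rfl⟩ := spinorMap_surjective hq s u
  rw [fip_spinorMap', fip_spinorMap', Matrix.vecMul_vecMul, idemOf_mul_self hq]

theorem mem_rowModule {p : Matrix (Fin 4) (Fin 4) (S4 q)} (hp : p * p = p) {v : Fin 4 → S4 q} :
    v ∈ rowModule p ↔ Matrix.vecMul v p = v := by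
  constructor
  · rintro ⟨w, rfl⟩
    simp only [Matrix.vecMulLinear_apply, Matrix.vecMul_vecMul, hp]
  · exact fun h => ⟨v, h⟩

/-- The functional `haar` is faithful if `π_+` is. -/
theorem haar_faithful (hq : q ∈ Set.Ioo (0 : ℝ) 1) (hinj : Function.Injective (sphereRep hq 1)) {a : S4 q}
    (ha : haar hq (star a * a) = 0) : a = 0 := by
  have mem : ∀ {a}, haar hq (star a * a) = 0 → ∀ k, sphereRep hq 1 a (xi k) = 0 := fun {a} ha k => by
    rw [haar_star_mul_self, Complex.ofReal_eq_zero, mul_eq_zero_iff_left (inv_ne_zero (haarDim_pos q).ne')] at ha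
    have hp := hq.1
    have w : ∀ k, 0 < haarWt q k := fun k => by fin_cases k <;> simp [haarWt] <;> positivity
    have := (Finset.sum_eq_zero_iff_of_nonneg fun k _ => mul_nonneg (w k).le (fnsq_nonneg _)).1 ha k (Finset.mem_univ k)
    exact fnsq_eq_zero ((mul_eq_zero_iff_left (w k).ne').1 this)
  have right : ∀ {a}, (∀ k, sphereRep hq 1 a (xi k) = 0) → ∀ k l, ∀ m, sphereRep hq 1 (a * sphMat q l k) (xi m) = 0 :=
    fun {a} ha k l => mem (by
      have z : ∀ b k, sphereRep hq 1 (b * a) (xi k) = 0 := fun b k => by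
        rw [map_mul, Module.End.mul_apply, ha, map_zero]
      set b := star (a * sphMat q l k)
      have h₁ : haar hq (b * a) = 0 := by
        rw [haar_eq_sum]; simp only [z, fip_zero_right, mul_zero, Finset.sum_const_zero]
      have h₂ : spinCoef hq 1 (b * a) k l = 0 := by
        rw [spinCoef_apply, z, fip_zero_right]
      rw [spinCoef_eq] at h₂
      simp only [spinorOf, LinearMap.coe_mk, AddHom.coe_mk, Matrix.of_apply, h₁, ite_self, zero_add, Units.val_one,
        Int.cast_one, one_mul] at h₂
      rw [← mul_assoc, h₂])
  have hq0 := ofReal_ne hq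
  have sm : ∀ {a b : S4 q} {c : ℂ}, c ≠ 0 → (∀ m, sphereRep hq 1 (a * c • b) (xi m) = 0) →
      ∀ m, sphereRep hq 1 (a * b) (xi m) = 0 := fun hc h m => by
    have := h m
    rw [mul_smul_comm, map_smul, LinearMap.smul_apply] at this
    exact (smul_eq_zero.1 this).resolve_left hc
  have all : ∀ b a, (∀ k, sphereRep hq 1 a (xi k) = 0) → ∀ k, sphereRep hq 1 (a * b) (xi k) = 0 := by
    intro b
    induction b using S4.induction with
    | hc c =>
      intro a ha k
      rw [← Algebra.commutes, ← Algebra.smul_def, map_smul, LinearMap.smul_apply, ha, smul_zero]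
    | hg x =>
      intro a ha
      cases x with
      | x₀ => exact right ha 0 0
      | x₁ => exact sm (c := (q : ℂ) ^ 3) (by simp [hq0]) (right ha 3 1)
      | y₁ => exact sm (c := (q : ℂ)) (by simp [hq0]) (right ha 1 3)
      | x₂ => exact sm (c := (q : ℂ) ^ 3) (by simp [hq0]) (right ha 1 0)
      | y₂ => exact sm (c := ((q : ℂ) ^ 3)⁻¹) (by simp [hq0]) (right ha 0 1)
    | hm b b' hb hb' =>
      intro a ha
      rw [← mul_assoc]; exact hb' _ (hb a ha)
    | ha b b' hb hb' =>
      intro a ha k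
      rw [mul_add, map_add, LinearMap.add_apply, hb a ha, hb' a ha, add_zero]
  refine hinj ?_
  rw [map_zero]
  refine LinearMap.ext fun u => ?_
  obtain ⟨v, rfl⟩ := spinorMap_surjective hq 1 u
  rw [spinorMap_apply, map_sum, LinearMap.zero_apply]
  refine Finset.sum_eq_zero fun j _ => ?_
  have := all (v j) a (mem ha) j
  rwa [map_mul] at this

theorem haar_isHaarState (hq : q ∈ Set.Ioo (0 : ℝ) 1) (hinj : Function.Injective (sphereRep hq 1)) :
    IsHaarState hq (haar hq) where
  one := haar_one hq
  invariant := haar_invariant hq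
  faithful a ha := by
    have h₁ := haar_star_mul_self hq a
    have hp := hq.1
    have w : ∀ k, 0 ≤ haarWt q k := fun k => by fin_cases k <;> simp [haarWt] <;> positivity
    rw [h₁, Complex.ofReal_re, Complex.ofReal_im]
    refine ⟨lt_of_le_of_ne ?_ fun h => ha (haar_faithful hq hinj (by rw [h₁, ← h, Complex.ofReal_zero])), rfl⟩
    exact mul_nonneg (inv_nonneg.2 (haarDim_pos q).le) (Finset.sum_nonneg fun k _ => mul_nonneg (w k) (fnsq_nonneg _))

theorem eq_zero_of_haar (hq : q ∈ Set.Ioo (0 : ℝ) 1) (hinj : Function.Injective (sphereRep hq 1))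
    {v : Fin 4 → S4 q} (h : ∑ j, haar hq (star (v j) * v j) = 0) : v = 0 := by
  have H := (haar_isHaarState hq hinj).faithful
  have nn : ∀ a : S4 q, 0 ≤ (haar hq (star a * a)).re := fun a => by
    by_cases ha : a = 0
    · simp [ha]
    · exact (H a ha).1.le
  have h' := congrArg Complex.re h
  rw [Complex.re_sum, Complex.zero_re] at h'
  have := (Finset.sum_eq_zero_iff_of_nonneg fun j _ => nn (v j)).1 h'
  funext j
  by_contra hj
  exact (H _ hj).1.ne' (this j (Finset.mem_univ j))

theorem eq_zero_of_spinorMap (hq : q ∈ Set.Ioo (0 : ℝ) 1) (hinj : Function.Injective (sphereRep hq 1)) {s : ℤˣ}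
    {v : Fin 4 → S4 q} (hv : Matrix.vecMul v (idemOf q s) = v) (h : spinorMap hq s v = 0) : v = 0 := by
  refine eq_zero_of_haar hq hinj ?_
  have := fip_spinorMap' hq s v v
  rw [h, fip_zero_left, hv] at this
  exact (mul_eq_zero.1 this.symm).resolve_left two_ne_zero

theorem correspondsTo (hq : q ∈ Set.Ioo (0 : ℝ) 1) (hinj : Function.Injective (sphereRep hq 1)) (s : ℤˣ) :
    CorrespondsTo hq (spinRep hq) (sphereRep hq s) (haar hq) (idemOf q s) := by
  have hp := idemOf_mul_self hq s
  let c : ℂ := ((√2)⁻¹ : ℝ)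
  have hc : c ≠ 0 := by
    simp only [c]; exact_mod_cast inv_ne_zero (Real.sqrt_ne_zero'.2 two_pos)
  have hcc : starRingEnd ℂ c * (c * 2) = 1 := by
    simp only [c, Complex.conj_ofReal]
    rw [← mul_assoc, ← Complex.ofReal_mul, ← mul_inv, Real.mul_self_sqrt (by norm_num)]
    push_cast; norm_num
  let T₀ : rowModule (idemOf q s) →ₗ[ℂ] Spin :=
    { toFun := fun v => c • spinorMap hq s v
      map_add' := fun v w => by rw [Submodule.coe_add, map_add, smul_add]
      map_smul' := fun d v => by
        change c • spinorMap hq s (d • (v : Fin 4 → S4 q)) = d • c • spinorMap hq s v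
        rw [map_smul, smul_comm] }
  have inj : Function.Injective T₀ := by
    refine (injective_iff_map_eq_zero T₀).2 fun v hv => ?_
    exact Subtype.ext (eq_zero_of_spinorMap hq hinj ((mem_rowModule hp).1 v.2) ((smul_eq_zero.1 hv).resolve_left hc))
  have surj : Function.Surjective T₀ := fun u => by
    obtain ⟨v, hv⟩ := spinorMap_surjective hq s (c⁻¹ • u)
    refine ⟨⟨_, v, rfl⟩, ?_⟩
    change c • spinorMap hq s (Matrix.vecMul v (idemOf q s)) = u
    rw [spinorMap_vecMul, hv, smul_inv_smul₀ hc]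
  refine ⟨LinearEquiv.ofBijective T₀ ⟨inj, surj⟩, fun v w => ?_, fun a v => ?_, fun h v => ?_⟩
  · change fip (c • spinorMap hq s v) (c • spinorMap hq s w) = _
    rw [fip_smul_left, fip_smul_right, fip_spinorMap', (mem_rowModule hp).1 w.2, ← mul_assoc c, ← mul_assoc, hcc, one_mul]
  · change c • spinorMap hq s (a • (v : Fin 4 → S4 q)) = sphereRep hq s a (c • spinorMap hq s v)
    rw [spinorMap_smul, map_smul]
  · have hv := (mem_rowModule hp).1 v.2
    have z : spinorMap hq (-s) v = 0 := by
      rw [← spinorMap_vecMul, ← hv, Matrix.vecMul_vecMul, idemOf_mul_neg hq, Matrix.vecMul_zero, map_zero]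
    have z' : Matrix.vecMul (tensorAct hq h v) (idemOf q (-s)) = 0 := by
      refine eq_zero_of_spinorMap hq hinj (s := -s) ?_ ?_
      · rw [Matrix.vecMul_vecMul, idemOf_mul_self hq]
      · rw [spinorMap_vecMul, spinorMap_tensorAct, z, map_zero]
    have hm : tensorAct hq h v ∈ rowModule (idemOf q s) := by
      rw [mem_rowModule hp, ← add_zero (Matrix.vecMul _ _), ← z', ← Matrix.vecMul_add, idemOf_add,
        Matrix.vecMul_one]
    refine ⟨hm, ?_⟩
    change c • spinorMap hq s (tensorAct hq h v) = spinRep hq (Uq.gen q h) (c • spinorMap hq s v)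
    rw [spinorMap_tensorAct, map_smul, spinRep_gen]

theorem idem_isIdempotentElem (hq : q ∈ Set.Ioo (0 : ℝ) 1) : IsIdempotentElem (idem q) := by
  rw [← idemOf_one]; exact idemOf_mul_self hq 1

end



/-! ### Leading terms and faithfulness -/

section

variable {q : ℝ}

/-- Vectors of given weight with labels `(j, l)` below given ones in the lexicographic order. -/
noncomputable def low (L M₁ M₂ J : ℤ) : Submodule ℂ Spin :=
  Submodule.span ℂ {v | ∃ L' J', (J' < J ∨ J' = J ∧ L' < L) ∧ v = ket L' M₁ M₂ J'}

theorem smul_ket_mem_low {L M₁ M₂ J L' J' : ℤ} (c : ℂ) (h : J' < J ∨ J' = J ∧ L' < L) :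
    c • ket L' M₁ M₂ J' ∈ low L M₁ M₂ J :=
  (low L M₁ M₂ J).smul_mem c (Submodule.subset_span ⟨L', J', h, rfl⟩)

theorem low_mono {L M₁ M₂ J L' J' : ℤ} (h : J' < J ∨ J' = J ∧ L' < L) : low L' M₁ M₂ J' ≤ low L M₁ M₂ J := by
  refine Submodule.span_mono ?_
  rintro _ ⟨L'', J'', h', rfl⟩
  exact ⟨L'', J'', by omega, rfl⟩

theorem fip_ket_low {L M₁ M₂ J M₁' M₂' L' J' : ℤ} {v : Spin} (hv : v ∈ low L M₁ M₂ J)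
    (h : M₁' = M₁ ∧ M₂' = M₂ → J < J' ∨ J = J' ∧ L ≤ L') : fip (ket L' M₁' M₂' J') v = 0 := by
  induction hv using Submodule.span_induction with
  | mem x hx =>
    obtain ⟨L'', J'', h', rfl⟩ := hx
    refine fip_ket_of_ne ?_
    rintro ⟨rfl, rfl, rfl, rfl⟩
    have := h ⟨rfl, rfl⟩
    omega
  | zero => exact fip_zero_right _
  | add x y _ _ hx hy => rw [fip_add_right, hx, hy, add_zero]
  | smul c x _ hx => rw [fip_smul_right, hx, mul_zero]

/-- Operators which shift the leading term of a vector by given labels. -/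
def Lead (T : Module.End ℂ Spin) (a b c d : ℤ) : Prop :=
  ∀ L M₁ M₂ J, Admissible L M₁ M₂ J → Admissible (L + a) (M₁ + b) (M₂ + c) (J + d) ∧ ∃ z : ℂ, z ≠ 0 ∧
    ∃ r ∈ low (L + a) (M₁ + b) (M₂ + c) (J + d), T (ket L M₁ M₂ J) = z • ket (L + a) (M₁ + b) (M₂ + c) (J + d) + r

theorem Lead.map_low {T : Module.End ℂ Spin} {a b c d : ℤ} (h : Lead T a b c d) {L M₁ M₂ J : ℤ} {v : Spin}
    (hv : v ∈ low L M₁ M₂ J) : T v ∈ low (L + a) (M₁ + b) (M₂ + c) (J + d) := by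
  induction hv using Submodule.span_induction with
  | mem x hx =>
    obtain ⟨L', J', h', rfl⟩ := hx
    by_cases ha : Admissible L' M₁ M₂ J'
    · obtain ⟨-, z, -, r, hr, e⟩ := h _ _ _ _ ha
      rw [e]
      exact Submodule.add_mem _ (smul_ket_mem_low z (by omega)) (low_mono (by omega) hr)
    · rw [ket_of_not_adm ha, map_zero]; exact Submodule.zero_mem _
  | zero => rw [map_zero]; exact Submodule.zero_mem _
  | add x y _ _ hx hy => rw [map_add]; exact Submodule.add_mem _ hx hy
  | smul c x _ hx => rw [map_smul]; exact Submodule.smul_mem _ _ hx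

theorem Lead.mul {S T : Module.End ℂ Spin} {a b c d a' b' c' d' : ℤ} (hS : Lead S a b c d) (hT : Lead T a' b' c' d') :
    Lead (S * T) (a' + a) (b' + b) (c' + c) (d' + d) := by
  intro L M₁ M₂ J h
  simp only [← add_assoc]
  obtain ⟨h₁, z, hz, r, hr, e⟩ := hT L M₁ M₂ J h
  obtain ⟨h₂, z', hz', r', hr', e'⟩ := hS _ _ _ _ h₁
  refine ⟨h₂, z * z', mul_ne_zero hz hz', z • r' + S r, Submodule.add_mem _ (Submodule.smul_mem _ _ hr')
    (hS.map_low hr), ?_⟩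
  rw [Module.End.mul_apply, e, map_add, map_smul, e', smul_add, smul_smul, add_assoc]

theorem Lead.one : Lead 1 0 0 0 0 := by
  intro L M₁ M₂ J h
  simp only [add_zero]
  exact ⟨h, 1, one_ne_zero, 0, Submodule.zero_mem _, by simp⟩

theorem Lead.pow {T : Module.End ℂ Spin} {a b c d : ℤ} (h : Lead T a b c d) (n : ℕ) :
    Lead (T ^ n) (n * a) (n * b) (n * c) (n * d) := by
  induction n with
  | zero => simpa using Lead.one
  | succ n ih =>
    have := h.mul ih
    rw [← pow_succ'] at this
    convert this using 1 <;> push_cast <;> ring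

theorem adm_bounds {L M₁ M₂ J : ℤ} (h : Admissible L M₁ M₂ J) :
    (1 : ℝ) ≤ J ∧ (J : ℝ) ≤ L ∧ -(J : ℝ) ≤ M₁ ∧ (M₁ : ℝ) ≤ J ∧ -((L : ℝ) + 1 - J) ≤ M₂ ∧ (M₂ : ℝ) ≤ L + 1 - J := by
  have := admissible_iff.1 h
  refine ⟨?_, ?_, ?_, ?_, ?_, ?_⟩ <;> norm_cast <;> omega

theorem eps_le (L M₂ J : ℤ) : -1 / 2 ≤ eps L M₂ J ∧ eps L M₂ J ≤ 1 / 2 := by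
  unfold eps; split_ifs <;> norm_num

section

variable (hq : q ∈ Set.Ioo (0 : ℝ) 1) {L M₁ M₂ J : ℤ} (h : Admissible L M₁ M₂ J)

include hq h

theorem coefCp_ne_zero : coefCp q L J M₂ ≠ 0 := by
  obtain ⟨h1, h2, h3, h4, h5, h6⟩ := adm_bounds h
  obtain ⟨e1, e2⟩ := eps_le L M₂ J
  rw [coefCp]
  refine mul_ne_zero (neg_ne_zero.2 (Real.rpow_pos_of_pos hq.1 _).ne') (div_ne_zero (Real.sqrt_ne_zero'.2
    (mul_pos (qnum_pos hq ?_) (qnum_pos hq ?_))) (qnum_pos hq ?_).ne') <;> linarith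

theorem coefDp_ne_zero : coefDp q L J M₂ ≠ 0 := by
  obtain ⟨h1, h2, h3, h4, h5, h6⟩ := adm_bounds h
  obtain ⟨e1, e2⟩ := eps_le L M₂ J
  rw [coefDp]
  refine mul_ne_zero (Real.rpow_pos_of_pos hq.1 _).ne' (div_ne_zero (Real.sqrt_ne_zero'.2
    (mul_pos (qnum_pos hq ?_) (qnum_pos hq ?_))) (qnum_pos hq ?_).ne') <;> linarith

theorem coefDm_ne_zero' : coefDm q (L + 2) J (M₂ - 2) ≠ 0 := by
  obtain ⟨h1, h2, h3, h4, h5, h6⟩ := adm_bounds h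
  obtain ⟨e1, e2⟩ := eps_le (L + 2) (M₂ - 2) J
  have := admissible_iff.1 h
  refine coefDm_ne_zero hq ?_ ?_ (by omega) <;> push_cast <;> linarith

theorem coefAp_ne_zero : coefAp q J M₁ ≠ 0 := by
  obtain ⟨h1, h2, h3, h4, h5, h6⟩ := adm_bounds h
  rw [coefAp]
  refine mul_ne_zero (Real.rpow_pos_of_pos hq.1 _).ne' (div_ne_zero (Real.sqrt_ne_zero'.2
    (mul_pos (qnum_pos hq ?_) (qnum_pos hq ?_))) (qnum_pos hq ?_).ne') <;> linarith

theorem coefBp_ne_zero : coefBp q J M₁ ≠ 0 := by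
  obtain ⟨h1, h2, h3, h4, h5, h6⟩ := adm_bounds h
  rw [coefBp]
  refine mul_ne_zero (Real.rpow_pos_of_pos hq.1 _).ne' (div_ne_zero (Real.sqrt_ne_zero'.2
    (mul_pos (qnum_pos hq ?_) (qnum_pos hq ?_))) (qnum_pos hq ?_).ne') <;> linarith

theorem coefBm_ne_zero' : coefBm q (J + 2) (M₁ - 2) ≠ 0 := by
  obtain ⟨h1, h2, h3, h4, h5, h6⟩ := adm_bounds h
  rw [coefBm]
  refine mul_ne_zero (neg_ne_zero.2 (Real.rpow_pos_of_pos hq.1 _).ne') (div_ne_zero (Real.sqrt_ne_zero'.2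
    (mul_pos (qnum_pos hq ?_) (qnum_pos hq ?_))) (qnum_pos hq ?_).ne') <;> push_cast <;> linarith

end

theorem lead_x₀ (hq : q ∈ Set.Ioo (0 : ℝ) 1) (s : ℤˣ) : Lead (opX₀ q s) 2 0 0 2 := by
  intro L M₁ M₂ J h
  refine ⟨by rw [admissible_iff] at h ⊢; omega, ((coefAp q J M₁ * coefCp q L J M₂ : ℝ) : ℂ),
    by exact_mod_cast mul_ne_zero (coefAp_ne_zero hq h) (coefCp_ne_zero hq h), ?r, ?mem, ?eq⟩
  case eq =>
    rw [opX₀_eq, opX₀p, opX₀z, opX₀m]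
    simp only [LinearMap.add_apply, LinearMap.smul_apply, three_ket _ _ _ _ _ _ _ _ h, add_zero, add_assoc, smul_add,
      smul_smul]
    rfl
  case mem =>
    simp only [add_zero, ← sub_eq_add_neg]
    repeat' apply Submodule.add_mem
    all_goals exact smul_ket_mem_low _ (by omega)

theorem lead_x₁ (hq : q ∈ Set.Ioo (0 : ℝ) 1) (s : ℤˣ) : Lead (opX₁ q s) 2 2 0 2 := by
  intro L M₁ M₂ J h
  refine ⟨by rw [admissible_iff] at h ⊢; omega, ((coefBp q J M₁ * coefCp q L J M₂ : ℝ) : ℂ),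
    by exact_mod_cast mul_ne_zero (coefBp_ne_zero hq h) (coefCp_ne_zero hq h), ?r, ?mem, ?eq⟩
  case eq =>
    rw [opX₁_eq, opX₁p, opX₁z, opX₁m]
    simp only [LinearMap.add_apply, LinearMap.smul_apply, three_ket _ _ _ _ _ _ _ _ h, add_zero, add_assoc, smul_add,
      smul_smul]
    rfl
  case mem =>
    simp only [add_zero, ← sub_eq_add_neg]
    repeat' apply Submodule.add_mem
    all_goals exact smul_ket_mem_low _ (by omega)

theorem lead_y₁ (hq : q ∈ Set.Ioo (0 : ℝ) 1) (s : ℤˣ) : Lead (opY₁ q s) 2 (-2) 0 2 := by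
  intro L M₁ M₂ J h
  refine ⟨by rw [admissible_iff] at h ⊢; omega, ((coefBm q (J + 2) (M₁ - 2) * coefCp q L J M₂ : ℝ) : ℂ),
    by exact_mod_cast mul_ne_zero (coefBm_ne_zero' hq h) (coefCp_ne_zero hq h), ?r, ?mem, ?eq⟩
  case eq =>
    rw [opY₁, add_comm, threeAdj, threeAdj, threeAdj]
    simp only [LinearMap.add_apply, LinearMap.smul_apply, three_ket _ _ _ _ _ _ _ _ h, add_zero, add_assoc, smul_add,
      smul_smul, neg_neg, sub_neg_eq_add, add_sub_cancel_right]
    rfl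
  case mem =>
    simp only [add_zero, ← sub_eq_add_neg]
    repeat' apply Submodule.add_mem
    all_goals exact smul_ket_mem_low _ (by omega)

theorem lead_x₂ (hq : q ∈ Set.Ioo (0 : ℝ) 1) (s : ℤˣ) : Lead (opX₂ q s) 2 0 2 0 := by
  intro L M₁ M₂ J h
  refine ⟨by rw [admissible_iff] at h ⊢; omega, (coefDp q L J M₂ : ℂ),
    by exact_mod_cast coefDp_ne_zero hq h, ?r, ?mem, ?eq⟩
  case eq =>
    rw [opX₂_ket s h, add_assoc]
    simp only [add_zero]
    rfl
  case mem =>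
    simp only [add_zero]
    exact Submodule.add_mem _ (smul_ket_mem_low _ (by omega)) (smul_ket_mem_low _ (by omega))

theorem lead_y₂ (hq : q ∈ Set.Ioo (0 : ℝ) 1) (s : ℤˣ) : Lead (opY₂ q s) 2 0 (-2) 0 := by
  intro L M₁ M₂ J h
  refine ⟨by rw [admissible_iff] at h ⊢; omega, (coefDm q (L + 2) J (M₂ - 2) : ℂ),
    by exact_mod_cast coefDm_ne_zero' hq h, ?r, ?mem, ?eq⟩
  case eq =>
    rw [opY₂, add_comm]
    simp only [LinearMap.add_apply, LinearMap.smul_apply, sh_ket _ _ _ _ _ h, cXp, cXz, cXm, add_zero, smul_smul]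
    rfl
  case mem =>
    simp only [add_zero]
    exact Submodule.add_mem _ (smul_ket_mem_low _ (by omega)) (smul_ket_mem_low _ (by omega))

/-- Powers of `x₁` and `y₁`. -/
noncomputable def S4.pow₁ (q : ℝ) : ℤ → S4 q
  | Int.ofNat n => S4.x₁ q ^ n
  | Int.negSucc n => S4.y₁ q ^ (n + 1)

/-- Powers of `x₂` and `y₂`. -/
noncomputable def S4.pow₂ (q : ℝ) : ℤ → S4 q
  | Int.ofNat n => S4.x₂ q ^ n
  | Int.negSucc n => S4.y₂ q ^ (n + 1)

/-- The monomials `x₀ᵃ (x₂y₂)ᵇ x₁ᵏ x₂ˡ`, with `y`'s instead of `x`'s for negative exponents. -/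
noncomputable def S4.monom (q : ℝ) (i : ℕ × ℕ × ℤ × ℤ) : S4 q :=
  S4.x₀ q ^ i.1 * (S4.x₂ q * S4.y₂ q) ^ i.2.1 * S4.pow₁ q i.2.2.1 * S4.pow₂ q i.2.2.2

theorem lead_pow₁ (hq : q ∈ Set.Ioo (0 : ℝ) 1) (s : ℤˣ) (k : ℤ) :
    Lead (sphereRep hq s (S4.pow₁ q k)) (2 * |k|) (2 * k) 0 (2 * |k|) := by
  cases k with
  | ofNat n =>
    have := (lead_x₁ hq s).pow n
    rw [S4.pow₁, map_pow, sphereRep_x₁]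
    convert this using 1 <;> simp [mul_comm]
  | negSucc n =>
    have := (lead_y₁ hq s).pow (n + 1)
    rw [S4.pow₁, map_pow, sphereRep_y₁, Int.negSucc_eq, abs_neg, abs_of_nonneg (by omega)]
    convert this using 1 <;> push_cast <;> ring

theorem lead_pow₂ (hq : q ∈ Set.Ioo (0 : ℝ) 1) (s : ℤˣ) (k : ℤ) :
    Lead (sphereRep hq s (S4.pow₂ q k)) (2 * |k|) 0 (2 * k) 0 := by
  cases k with
  | ofNat n =>
    have := (lead_x₂ hq s).pow n
    rw [S4.pow₂, map_pow, sphereRep_x₂]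
    convert this using 1 <;> simp [mul_comm]
  | negSucc n =>
    have := (lead_y₂ hq s).pow (n + 1)
    rw [S4.pow₂, map_pow, sphereRep_y₂, Int.negSucc_eq, abs_neg, abs_of_nonneg (by omega)]
    convert this using 1 <;> push_cast <;> ring

theorem lead_monom (hq : q ∈ Set.Ioo (0 : ℝ) 1) (s : ℤˣ) (i : ℕ × ℕ × ℤ × ℤ) :
    Lead (sphereRep hq s (S4.monom q i)) (2 * i.1 + 4 * i.2.1 + 2 * |i.2.2.1| + 2 * |i.2.2.2|) (2 * i.2.2.1)
      (2 * i.2.2.2) (2 * i.1 + 2 * |i.2.2.1|) := by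
  have h := ((((lead_x₀ hq s).pow i.1).mul (((lead_x₂ hq s).mul (lead_y₂ hq s)).pow i.2.1)).mul
    (lead_pow₁ hq s i.2.2.1)).mul (lead_pow₂ hq s i.2.2.2)
  rw [S4.monom, map_mul, map_mul, map_mul, map_pow, map_pow, map_mul, sphereRep_x₀, sphereRep_x₂, sphereRep_y₂]
  convert h using 1 <;> ring

/-- The vacuum vector separates linear combinations of monomials. -/
theorem eq_zero_of_linearCombination_monom (hq : q ∈ Set.Ioo (0 : ℝ) 1) (s : ℤˣ) (f : (ℕ × ℕ × ℤ × ℤ) →₀ ℂ)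
    (e : sphereRep hq s (Finsupp.linearCombination ℂ (S4.monom q) f) (ket 1 1 1 1) = 0) : f = 0 := by
  by_contra hne
  obtain ⟨i, hi, hmax⟩ := Finset.exists_max_image f.support
    (fun i => toLex ((2 * i.1 + 2 * |i.2.2.1| : ℤ), (2 * i.1 + 4 * i.2.1 + 2 * |i.2.2.1| + 2 * |i.2.2.2| : ℤ)))
    (Finsupp.support_nonempty_iff.2 hne)
  have hu : Admissible 1 1 1 1 := adm_xi.1
  have hs := lead_monom hq s
  obtain ⟨ha, z, hz, r, hr, ez⟩ := hs i 1 1 1 1 hu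
  set w := ket (1 + (2 * i.1 + 4 * i.2.1 + 2 * |i.2.2.1| + 2 * |i.2.2.2|)) (1 + 2 * i.2.2.1) (1 + 2 * i.2.2.2)
    (1 + (2 * i.1 + 2 * |i.2.2.1|)) with hw
  have e' := congrArg (fip w) e
  rw [Finsupp.linearCombination_apply, Finsupp.sum, map_sum, LinearMap.sum_apply, fip_sum_right, fip_zero_right,
    Finset.sum_eq_single_of_mem i hi] at e'
  · rw [map_smul, LinearMap.smul_apply, fip_smul_right, ez, fip_add_right, fip_smul_right, fip_ket_self ha,
      fip_ket_low hr (by omega), mul_one, add_zero] at e'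
    exact mul_ne_zero (Finsupp.mem_support_iff.1 hi) hz e'
  · intro i' hi' hne
    rw [map_smul, LinearMap.smul_apply, fip_smul_right]
    have hm := hmax i' hi'
    rw [Prod.Lex.toLex_le_toLex] at hm
    obtain ⟨ha', z', hz', r', hr', ez'⟩ := hs i' 1 1 1 1 hu
    rw [ez', fip_add_right, fip_smul_right, fip_ket_low hr', fip_ket_of_ne, mul_zero, add_zero, mul_zero]
    · rintro ⟨h1, h2, h3, h4⟩
      refine hne ?_
      obtain ⟨a, b, c, d⟩ := i
      obtain ⟨a', b', c', d'⟩ := i'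
      simp only [Prod.mk.injEq] at h1 h2 h3 h4 ⊢
      obtain rfl : c' = c := by omega
      obtain rfl : d' = d := by omega
      omega
    · rintro ⟨h2, h3⟩
      have h2' : i'.2.2.1 = i.2.2.1 := by omega
      have h3' : i'.2.2.2 = i.2.2.2 := by omega
      simp only [h2', h3'] at hm ⊢
      omega

end



/-! ### The monomial basis and injectivity of the representations -/

section

variable {q : ℝ}

namespace S4

/-- `a` and `b` commute up to a scalar. -/
def QComm (a b : S4 q) : Prop := ∃ c : ℂ, a * b = c • (b * a)

theorem QComm.pow {a b : S4 q} (h : QComm a b) (n : ℕ) : QComm a (b ^ n) := by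
  obtain ⟨c, h⟩ := h
  refine ⟨c ^ n, ?_⟩
  induction n with
  | zero => simp
  | succ n ih => rw [pow_succ, ← mul_assoc, ih, smul_mul_assoc, mul_assoc, h, mul_smul_comm, smul_smul, mul_assoc,
      pow_succ]

theorem QComm.of_eq_smul {a b : S4 q} {c : ℂ} (hc : c ≠ 0) (h : b * a = c • (a * b)) : QComm a b :=
  ⟨c⁻¹, by rw [h, inv_smul_smul₀ hc]⟩

variable (q) in
/-- The product `x₂y₂`. -/
noncomputable def w₂ : S4 q := x₂ q * y₂ q

theorem x₁_mul_y₁ : x₁ q * y₁ q = 1 - x₀ q * x₀ q - w₂ q := by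
  rw [w₂, ← r_sphere q]; abel

theorem y₁_mul_x₁ : y₁ q * x₁ q = 1 - (q : ℂ) ^ 4 • (x₀ q * x₀ q) - w₂ q := by
  have h := r_comm₁ q
  rw [sub_eq_iff_eq_add, x₁_mul_y₁] at h
  rw [h, sub_smul, one_smul]; abel

theorem y₂_mul_x₂ : y₂ q * x₂ q = (1 - (q : ℂ) ^ 4) • (1 : S4 q) + (q : ℂ) ^ 4 • w₂ q := by
  have h := r_comm₂ q
  rw [sub_eq_iff_eq_add, x₁_mul_y₁, y₁_mul_x₁] at h
  rw [h, w₂]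
  match_scalars <;> ring

theorem q_sq_ne (hq : q ∈ Set.Ioo (0 : ℝ) 1) : (q : ℂ) ^ 2 ≠ 0 := pow_ne_zero 2 (ofReal_ne hq)

theorem x₀_w₂ : x₀ q * w₂ q = w₂ q * x₀ q := by
  rw [w₂, ← mul_assoc, r_x₀x₂, smul_mul_assoc, mul_assoc, mul_assoc, r_y₂x₀, mul_smul_comm]

theorem x₁_w₂ : x₁ q * w₂ q = w₂ q * x₁ q := by
  rw [w₂, ← mul_assoc, r_x₁x₂, smul_mul_assoc, mul_assoc, mul_assoc, r_y₂x₁, mul_smul_comm]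

theorem y₁_w₂ : y₁ q * w₂ q = w₂ q * y₁ q := by
  rw [w₂, ← mul_assoc, r_y₁x₂, smul_mul_assoc, mul_assoc, mul_assoc, r_y₂y₁, mul_smul_comm]

theorem y₂_w₂ : y₂ q * w₂ q = ((1 - (q : ℂ) ^ 4) • (1 : S4 q) + (q : ℂ) ^ 4 • w₂ q) * y₂ q := by
  rw [w₂, ← mul_assoc, y₂_mul_x₂]; rfl

theorem x₂_w₂ (hq : q ∈ Set.Ioo (0 : ℝ) 1) : x₂ q * w₂ q = ((q : ℂ) ^ 4)⁻¹ • (w₂ q - (1 - (q : ℂ) ^ 4) • (1 : S4 q)) * x₂ q := by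
  have h : w₂ q * x₂ q = x₂ q * ((1 - (q : ℂ) ^ 4) • (1 : S4 q) + (q : ℂ) ^ 4 • w₂ q) := by
    rw [← y₂_mul_x₂, w₂, mul_assoc]
  have hne := ofReal_ne hq
  rw [smul_mul_assoc, sub_mul, h, mul_add, mul_smul_comm, smul_mul_assoc, one_mul, mul_one, add_sub_cancel_left,
    mul_smul_comm, inv_smul_smul₀ (pow_ne_zero 4 hne)]

theorem qComm_x₁ (hq : q ∈ Set.Ioo (0 : ℝ) 1) : QComm (x₁ q) (x₀ q) := .of_eq_smul (q_sq_ne hq) (r_x₀x₁ q)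
theorem qComm_x₂ (hq : q ∈ Set.Ioo (0 : ℝ) 1) : QComm (x₂ q) (x₀ q) := .of_eq_smul (q_sq_ne hq) (r_x₀x₂ q)

theorem qComm_x₂_pow₁ (hq : q ∈ Set.Ioo (0 : ℝ) 1) (k : ℤ) : QComm (x₂ q) (pow₁ q k) := by
  cases k with
  | ofNat n => exact QComm.pow (.of_eq_smul (q_sq_ne hq) (r_x₁x₂ q)) n
  | negSucc n => exact QComm.pow (.of_eq_smul (q_sq_ne hq) (r_y₁x₂ q)) (n + 1)

theorem qComm_y₂_pow₁ (k : ℤ) : QComm (y₂ q) (pow₁ q k) := by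
  cases k with
  | ofNat n => exact QComm.pow ⟨_, r_y₂x₁ q⟩ n
  | negSucc n => exact QComm.pow ⟨_, r_y₂y₁ q⟩ (n + 1)

theorem pow₁_w₂ (k : ℤ) : Commute (pow₁ q k) (w₂ q) := by
  cases k with
  | ofNat n => exact Commute.pow_left (x₁_w₂) n
  | negSucc n => exact Commute.pow_left (y₁_w₂) (n + 1)

theorem x₁_pow₁ (k : ℤ) : ∃ p ∈ Algebra.adjoin ℂ {x₀ q, w₂ q}, x₁ q * pow₁ q k = p * pow₁ q (k + 1) := by
  have h₀ : x₀ q ∈ Algebra.adjoin ℂ {x₀ q, w₂ q} := Algebra.subset_adjoin (by simp)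
  have h₂ : w₂ q ∈ Algebra.adjoin ℂ {x₀ q, w₂ q} := Algebra.subset_adjoin (by simp)
  match k with
  | Int.ofNat n => exact ⟨1, one_mem _, by rw [one_mul]; exact (pow_succ' _ n).symm⟩
  | Int.negSucc 0 =>
    refine ⟨_, sub_mem (sub_mem (one_mem _) (mul_mem h₀ h₀)) h₂, ?_⟩
    rw [← x₁_mul_y₁]
    simp [pow₁]
  | Int.negSucc (n + 1) =>
    refine ⟨_, sub_mem (sub_mem (one_mem _) (mul_mem h₀ h₀)) h₂, ?_⟩
    rw [← x₁_mul_y₁]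
    change x₁ q * y₁ q ^ (n + 2) = x₁ q * y₁ q * y₁ q ^ (n + 1)
    rw [pow_succ' _ (n + 1), mul_assoc]

theorem y₁_pow₁ (k : ℤ) : ∃ p ∈ Algebra.adjoin ℂ {x₀ q, w₂ q}, y₁ q * pow₁ q k = p * pow₁ q (k - 1) := by
  have h₀ : x₀ q ∈ Algebra.adjoin ℂ {x₀ q, w₂ q} := Algebra.subset_adjoin (by simp)
  have h₂ : w₂ q ∈ Algebra.adjoin ℂ {x₀ q, w₂ q} := Algebra.subset_adjoin (by simp)
  match k with
  | Int.negSucc n => exact ⟨1, one_mem _, by rw [one_mul]; exact (pow_succ' _ (n + 1)).symm⟩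
  | Int.ofNat 0 => exact ⟨1, one_mem _, by rw [one_mul]; change y₁ q * x₁ q ^ 0 = y₁ q ^ 1; simp⟩
  | Int.ofNat (n + 1) =>
    refine ⟨_, sub_mem (sub_mem (one_mem _) (Subalgebra.smul_mem _ (mul_mem h₀ h₀) ((q : ℂ) ^ 4))) h₂, ?_⟩
    rw [← y₁_mul_x₁, show Int.ofNat (n + 1) - 1 = Int.ofNat n by simp]
    change y₁ q * x₁ q ^ (n + 1) = y₁ q * x₁ q * x₁ q ^ n
    rw [pow_succ', mul_assoc]

theorem x₂_pow₂ (k : ℤ) : ∃ c d : ℂ, x₂ q * pow₂ q k = (c • 1 + d • w₂ q) * pow₂ q (k + 1) := by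
  match k with
  | Int.ofNat n => exact ⟨1, 0, by rw [one_smul, zero_smul, add_zero, one_mul]; exact (pow_succ' _ n).symm⟩
  | Int.negSucc 0 => exact ⟨0, 1, by simp [pow₂, w₂]⟩
  | Int.negSucc (n + 1) =>
    refine ⟨0, 1, ?_⟩
    rw [zero_smul, one_smul, zero_add]
    change x₂ q * y₂ q ^ (n + 2) = x₂ q * y₂ q * y₂ q ^ (n + 1)
    rw [pow_succ' _ (n + 1), mul_assoc]

theorem y₂_pow₂ (k : ℤ) : ∃ c d : ℂ, y₂ q * pow₂ q k = (c • 1 + d • w₂ q) * pow₂ q (k - 1) := by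
  match k with
  | Int.negSucc n => exact ⟨1, 0, by rw [one_smul, zero_smul, add_zero, one_mul]; exact (pow_succ' _ (n + 1)).symm⟩
  | Int.ofNat 0 => exact ⟨1, 0, by rw [one_smul, zero_smul, add_zero, one_mul]; change y₂ q * x₂ q ^ 0 = y₂ q ^ 1; simp⟩
  | Int.ofNat (n + 1) =>
    refine ⟨1 - (q : ℂ) ^ 4, (q : ℂ) ^ 4, ?_⟩
    rw [← y₂_mul_x₂, show Int.ofNat (n + 1) - 1 = Int.ofNat n by simp]
    change y₂ q * x₂ q ^ (n + 1) = y₂ q * x₂ q * x₂ q ^ n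
    rw [pow_succ', mul_assoc]

variable (q) in
/-- The elements which preserve the span of the monomials under left multiplication. -/
noncomputable def monomStab : Subalgebra ℂ (S4 q) where
  carrier := {a | ∀ m ∈ Submodule.span ℂ (Set.range (monom q)), a * m ∈ Submodule.span ℂ (Set.range (monom q))}
  mul_mem' := fun {a b} ha hb m hm => by rw [mul_assoc]; exact ha _ (hb _ hm)
  add_mem' := fun {a b} ha hb m hm => by rw [add_mul]; exact Submodule.add_mem _ (ha _ hm) (hb _ hm)
  algebraMap_mem' := fun c m hm => by rw [Algebra.algebraMap_eq_smul_one, smul_mul_assoc, one_mul]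
                                      exact Submodule.smul_mem _ _ hm

theorem mem_monomStab {a : S4 q} (h : ∀ i, a * monom q i ∈ Submodule.span ℂ (Set.range (monom q))) :
    a ∈ monomStab q := by
  intro m hm
  induction hm using Submodule.span_induction with
  | mem x hx => obtain ⟨i, rfl⟩ := hx; exact h i
  | zero => rw [mul_zero]; exact Submodule.zero_mem _
  | add x y _ _ hx hy => rw [mul_add]; exact Submodule.add_mem _ hx hy
  | smul c x _ hx => rw [mul_smul_comm]; exact Submodule.smul_mem _ _ hx

theorem monom_mem (i : ℕ × ℕ × ℤ × ℤ) : monom q i ∈ Submodule.span ℂ (Set.range (monom q)) :=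
  Submodule.subset_span ⟨i, rfl⟩

theorem x₀_mem_monomStab : x₀ q ∈ monomStab q :=
  mem_monomStab fun ⟨a, b, k, l⟩ => Submodule.subset_span ⟨(a + 1, b, k, l), by
    simp only [monom, pow_succ', mul_assoc]⟩

theorem w₂_mem_monomStab : w₂ q ∈ monomStab q :=
  mem_monomStab fun ⟨a, b, k, l⟩ => Submodule.subset_span ⟨(a, b + 1, k, l), by
    have h : w₂ q * x₀ q ^ a = x₀ q ^ a * w₂ q := (Commute.pow_left (x₀_w₂) a).symm
    rw [monom, monom, ← w₂, pow_succ', ← mul_assoc, ← mul_assoc, ← mul_assoc, ← mul_assoc, h]⟩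

theorem adjoin_le_monomStab : Algebra.adjoin ℂ {x₀ q, w₂ q} ≤ monomStab q := by
  rw [Algebra.adjoin_le_iff]
  rintro _ (rfl | rfl)
  exacts [x₀_mem_monomStab, w₂_mem_monomStab]

theorem mul_monom_mem {g p p' : S4 q} (h₀ : QComm g (x₀ q)) (h₂ : g * w₂ q = p * g) (hp : p ∈ monomStab q)
    (hp' : p' ∈ monomStab q) {a b : ℕ} {k l k' l' : ℤ} {c : ℂ}
    (h : g * (pow₁ q k * pow₂ q l) = c • (p' * (pow₁ q k' * pow₂ q l'))) :
    g * monom q (a, b, k, l) ∈ Submodule.span ℂ (Set.range (monom q)) := by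
  obtain ⟨c', h'⟩ := h₀.pow a
  have e : g * w₂ q ^ b = p ^ b * g := (SemiconjBy.pow_right (h₂ : SemiconjBy g (w₂ q) p) b).eq
  have hm : pow₁ q k' * pow₂ q l' ∈ Submodule.span ℂ (Set.range (monom q)) := by
    have := monom_mem (q := q) (0, 0, k', l')
    simpa only [monom, pow_zero, one_mul] using this
  have : g * monom q (a, b, k, l) = (c' * c) • (x₀ q ^ a * p ^ b * p' * (pow₁ q k' * pow₂ q l')) := by
    rw [monom, ← w₂, mul_assoc, ← mul_assoc g, ← mul_assoc g, h', smul_mul_assoc, mul_assoc (x₀ q ^ a), e,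
      smul_mul_assoc, mul_assoc, mul_assoc (p ^ b)]
    simp only [mul_assoc] at h ⊢
    rw [h]
    simp only [mul_smul_comm, smul_smul, mul_assoc]
  rw [this]
  exact Submodule.smul_mem _ _ (mul_mem (mul_mem (pow_mem (x₀_mem_monomStab) a) (pow_mem hp b)) hp' _ hm)

theorem gen_mem_monomStab (hq : q ∈ Set.Ioo (0 : ℝ) 1) (x : SGen) : gen q x ∈ monomStab q := by
  have hw : ∀ c d : ℂ, c • (1 : S4 q) + d • w₂ q ∈ monomStab q := fun c d =>
    add_mem (Subalgebra.smul_mem _ (one_mem _) _) (Subalgebra.smul_mem _ (w₂_mem_monomStab) _)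
  have cw : ∀ (k : ℤ) (c d : ℂ), pow₁ q k * (c • (1 : S4 q) + d • w₂ q) = (c • 1 + d • w₂ q) * pow₁ q k := by
    intro k c d
    rw [mul_add, add_mul, mul_smul_comm, mul_smul_comm, smul_mul_assoc, smul_mul_assoc, mul_one, one_mul,
      (pow₁_w₂ k).eq]
  cases x with
  | x₀ => exact x₀_mem_monomStab
  | x₁ =>
    refine mem_monomStab ?_
    rintro ⟨a, b, k, l⟩
    obtain ⟨p, hp, e⟩ := x₁_pow₁ (q := q) k
    refine mul_monom_mem (qComm_x₁ hq) (x₁_w₂) (w₂_mem_monomStab) (adjoin_le_monomStab hp) (c := 1)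
      (k' := k + 1) (l' := l) ?_
    rw [one_smul, ← mul_assoc, ← mul_assoc, e]
  | y₁ =>
    refine mem_monomStab ?_
    rintro ⟨a, b, k, l⟩
    obtain ⟨p, hp, e⟩ := y₁_pow₁ (q := q) k
    refine mul_monom_mem ⟨_, r_y₁x₀ q⟩ (y₁_w₂) (w₂_mem_monomStab) (adjoin_le_monomStab hp) (c := 1)
      (k' := k - 1) (l' := l) ?_
    rw [one_smul, ← mul_assoc, ← mul_assoc, e]
  | x₂ =>
    refine mem_monomStab ?_
    rintro ⟨a, b, k, l⟩
    obtain ⟨z, hz⟩ := qComm_x₂_pow₁ hq k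
    obtain ⟨c, d, e⟩ := x₂_pow₂ (q := q) l
    refine mul_monom_mem (qComm_x₂ hq) (x₂_w₂ hq) (Subalgebra.smul_mem _ (sub_mem (w₂_mem_monomStab)
      (Subalgebra.smul_mem _ (one_mem _) _)) _) (hw c d) (c := z) (k' := k) (l' := l + 1) ?_
    rw [← mul_assoc, hz, smul_mul_assoc, mul_assoc, e, ← mul_assoc, ← mul_assoc, cw]
  | y₂ =>
    refine mem_monomStab ?_
    rintro ⟨a, b, k, l⟩
    obtain ⟨z, hz⟩ := qComm_y₂_pow₁ k
    obtain ⟨c, d, e⟩ := y₂_pow₂ (q := q) l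
    refine mul_monom_mem ⟨_, r_y₂x₀ q⟩ (y₂_w₂) (hw _ _) (hw c d) (c := z) (k' := k) (l' := l - 1) ?_
    rw [← mul_assoc, hz, smul_mul_assoc, mul_assoc, e, ← mul_assoc, ← mul_assoc, cw]

/-- The monomials span `A(S⁴_q)`. -/
theorem span_monom (hq : q ∈ Set.Ioo (0 : ℝ) 1) : Submodule.span ℂ (Set.range (monom q)) = ⊤ := by
  have h₁ : (1 : S4 q) ∈ Submodule.span ℂ (Set.range (monom q)) := by
    simpa [monom, pow₁, pow₂] using monom_mem (q := q) (0, 0, 0, 0)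
  rw [eq_top_iff]
  intro a _
  have ha : a ∈ monomStab q := by
    induction a using induction with
    | hc c => exact Subalgebra.algebraMap_mem _ c
    | hg x => exact gen_mem_monomStab hq x
    | hm a b ha hb => exact mul_mem (ha trivial) (hb trivial)
    | ha a b ha hb => exact add_mem (ha trivial) (hb trivial)
  simpa using ha 1 h₁

end S4

theorem sphereRep_injective (hq : q ∈ Set.Ioo (0 : ℝ) 1) (s : ℤˣ) : Function.Injective (sphereRep hq s) := by
  rw [injective_iff_map_eq_zero]
  intro a ha
  have hm : a ∈ Submodule.span ℂ (Set.range (S4.monom q)) := by rw [S4.span_monom hq]; trivial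
  obtain ⟨f, rfl⟩ := Finsupp.mem_span_range_iff_exists_finsupp.1 hm
  have : f = 0 := eq_zero_of_linearCombination_monom hq s f (by
    rw [Finsupp.linearCombination_apply, ha]; rfl)
  rw [this, Finsupp.sum_zero_index]

end



/-! ### A trace on the sphere and inequivalence of the two modules -/

section

open scoped ENNReal

/-- The space with basis `ℕ × ℕ`. -/
abbrev Quad : Type := (ℕ × ℕ) →₀ ℂ

namespace Quad

/-- The basis vectors. -/
noncomputable def e (n : ℕ × ℕ) : Quad := Finsupp.single n 1

/-- The `ℓ¹`-norm. -/
noncomputable def nrm (v : Quad) : ℝ≥0∞ := ∑' n, ‖v n‖ₑ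

theorem nrm_add_le (v w : Quad) : nrm (v + w) ≤ nrm v + nrm w := by
  rw [nrm, nrm, nrm, ← ENNReal.tsum_add]
  exact ENNReal.tsum_le_tsum fun n => enorm_add_le _ _

theorem nrm_smul (c : ℂ) (v : Quad) : nrm (c • v) = ‖c‖ₑ * nrm v := by
  rw [nrm, nrm, ← ENNReal.tsum_mul_left]
  exact tsum_congr fun n => by rw [Finsupp.smul_apply, smul_eq_mul, enorm_mul]

theorem nrm_e (n : ℕ × ℕ) : nrm (e n) = 1 := by
  rw [nrm, tsum_eq_single n fun m hm => by rw [e, Finsupp.single_eq_of_ne hm, enorm_zero], e,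
    Finsupp.single_eq_same, enorm_one]

theorem nrm_sum_le {ι : Type} (s : Finset ι) (f : ι → Quad) : nrm (∑ i ∈ s, f i) ≤ ∑ i ∈ s, nrm (f i) := by
  classical
  induction s using Finset.induction_on with
  | empty => simp [nrm]
  | insert i s hi ih =>
    rw [Finset.sum_insert hi, Finset.sum_insert hi]
    exact (nrm_add_le _ _).trans (by gcongr)

theorem apply_eq_sum (T : Module.End ℂ Quad) (v : Quad) : T v = ∑ n ∈ v.support, v n • T (e n) := by
  conv_lhs => rw [← Finsupp.sum_single v, Finsupp.sum, map_sum]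
  refine Finset.sum_congr rfl fun n _ => ?_
  rw [e, ← map_smul, Finsupp.smul_single, smul_eq_mul, mul_one]

theorem nrm_apply_le (T : Module.End ℂ Quad) {C : ℝ≥0∞} (hT : ∀ n, nrm (T (e n)) ≤ C) (v : Quad) :
    nrm (T v) ≤ C * nrm v := by
  rw [apply_eq_sum]
  refine (nrm_sum_le _ _).trans ?_
  rw [nrm, ← ENNReal.tsum_mul_left]
  refine le_trans (Finset.sum_le_sum fun n _ => ?_) (ENNReal.sum_le_tsum v.support)
  rw [nrm_smul, mul_comm]
  gcongr
  exact hT n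

/-- Bounded operators. -/
def Bdd (T : Module.End ℂ Quad) : Prop := ∃ C : ℝ≥0∞, C ≠ ∞ ∧ ∀ n, nrm (T (e n)) ≤ C

/-- The weight `q^{2(n₁+n₂)}`. -/
noncomputable def wgt (q : ℝ) (n : ℕ × ℕ) : ℝ≥0∞ := ENNReal.ofReal (q ^ 2) ^ (n.1 + n.2)

/-- Operators whose matrix decays like the weight. -/
def Dec (q : ℝ) (T : Module.End ℂ Quad) : Prop := ∃ C : ℝ≥0∞, C ≠ ∞ ∧ ∀ n, nrm (T (e n)) ≤ C * wgt q n

variable {q : ℝ}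

theorem Bdd.add {S T : Module.End ℂ Quad} (hS : Bdd S) (hT : Bdd T) : Bdd (S + T) := by
  obtain ⟨C, hC, h⟩ := hS
  obtain ⟨C', hC', h'⟩ := hT
  exact ⟨C + C', ENNReal.add_ne_top.2 ⟨hC, hC'⟩, fun n => (nrm_add_le _ _).trans (add_le_add (h n) (h' n))⟩

theorem Bdd.mul {S T : Module.End ℂ Quad} (hS : Bdd S) (hT : Bdd T) : Bdd (S * T) := by
  obtain ⟨C, hC, h⟩ := hS
  obtain ⟨C', hC', h'⟩ := hT
  exact ⟨C * C', ENNReal.mul_ne_top hC hC', fun n => (nrm_apply_le S h _).trans (mul_le_mul_right (h' n) C)⟩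

theorem Bdd.algebraMap (c : ℂ) : Bdd (algebraMap ℂ (Module.End ℂ Quad) c) :=
  ⟨‖c‖ₑ, enorm_ne_top, fun n => by rw [Module.algebraMap_end_apply, nrm_smul, nrm_e, mul_one]⟩

theorem Dec.add {S T : Module.End ℂ Quad} (hS : Dec q S) (hT : Dec q T) : Dec q (S + T) := by
  obtain ⟨C, hC, h⟩ := hS
  obtain ⟨C', hC', h'⟩ := hT
  exact ⟨C + C', ENNReal.add_ne_top.2 ⟨hC, hC'⟩, fun n => (nrm_add_le _ _).trans
    ((add_le_add (h n) (h' n)).trans_eq (add_mul _ _ _).symm)⟩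

theorem Bdd.mul_dec {S T : Module.End ℂ Quad} (hS : Bdd S) (hT : Dec q T) : Dec q (S * T) := by
  obtain ⟨C, hC, h⟩ := hS
  obtain ⟨C', hC', h'⟩ := hT
  refine ⟨C * C', ENNReal.mul_ne_top hC hC', fun n => (nrm_apply_le S h _).trans ?_⟩
  rw [mul_assoc]
  exact mul_le_mul_right (h' n) C

theorem Dec.smul {T : Module.End ℂ Quad} (hT : Dec q T) (c : ℂ) : Dec q (c • T) := by
  have := (Bdd.algebraMap c).mul_dec hT
  rwa [← Algebra.smul_def] at this

/-- The diagonal part is summable. -/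
theorem tsum_wgt (hq : q ∈ Set.Ioo (0 : ℝ) 1) : ∑' n, wgt q n ≠ ∞ := by
  have h : ENNReal.ofReal (q ^ 2) < 1 := by
    rw [ENNReal.ofReal_lt_one]; nlinarith [hq.1, hq.2]
  have h' : (1 - ENNReal.ofReal (q ^ 2))⁻¹ ≠ ∞ := ENNReal.inv_ne_top.2 (tsub_pos_of_lt h).ne'
  simp only [wgt, pow_add]
  rw [ENNReal.tsum_prod']
  simp only [ENNReal.tsum_mul_left, ENNReal.tsum_mul_right, ENNReal.tsum_geometric]
  exact ENNReal.mul_ne_top h' h'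

theorem summable_of_enorm {ι : Type} {f : ι → ℂ} (h : ∑' i, ‖f i‖ₑ ≠ ∞) : Summable f := by
  exact Summable.of_norm (ENNReal.tsum_coe_ne_top_iff_summable_coe.1 h)

theorem enorm_apply_le (v : Quad) (n : ℕ × ℕ) : ‖v n‖ₑ ≤ nrm v := ENNReal.le_tsum n

theorem Dec.summable (hq : q ∈ Set.Ioo (0 : ℝ) 1) {T : Module.End ℂ Quad} (hT : Dec q T) :
    Summable fun n => T (e n) n := by
  obtain ⟨C, hC, h⟩ := hT
  refine summable_of_enorm (ne_top_of_le_ne_top (ENNReal.mul_ne_top hC (tsum_wgt hq)) ?_)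
  rw [← ENNReal.tsum_mul_left]
  exact ENNReal.tsum_le_tsum fun n => (enorm_apply_le _ n).trans (h n)

/-- The trace. -/
noncomputable def tr (T : Module.End ℂ Quad) : ℂ := ∑' n, T (e n) n

theorem mul_apply_e (S T : Module.End ℂ Quad) (n : ℕ × ℕ) : (S * T) (e n) n = ∑' m, T (e n) m * S (e m) n := by
  rw [Module.End.mul_apply, apply_eq_sum, Finsupp.finsetSum_apply, tsum_eq_sum (s := (T (e n)).support)]
  · rfl
  · intro m hm
    rw [Finsupp.notMem_support_iff.1 hm, zero_mul]

theorem tr_mul_comm (hq : q ∈ Set.Ioo (0 : ℝ) 1) {S T : Module.End ℂ Quad} (hS : Bdd S) (hT : Dec q T) :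
    tr (S * T) = tr (T * S) := by
  obtain ⟨C, hC, h⟩ := hS
  obtain ⟨C', hC', h'⟩ := hT
  rw [tr, tr]
  simp only [mul_apply_e]
  rw [Summable.tsum_comm (f := fun m n => T (e n) m * S (e m) n)]
  · simp only [mul_comm]
  refine summable_of_enorm (ne_top_of_le_ne_top (ENNReal.mul_ne_top (ENNReal.mul_ne_top hC' hC) (tsum_wgt hq)) ?_)
  rw [ENNReal.tsum_prod', ENNReal.tsum_comm, ← ENNReal.tsum_mul_left]
  refine ENNReal.tsum_le_tsum fun n => ?_
  calc ∑' m, ‖T (e n) m * S (e m) n‖ₑ ≤ ∑' m, ‖T (e n) m‖ₑ * C := ENNReal.tsum_le_tsum fun m => by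
        rw [enorm_mul]; gcongr; exact (enorm_apply_le _ n).trans (h m)
    _ = nrm (T (e n)) * C := ENNReal.tsum_mul_right
    _ ≤ C' * wgt q n * C := by gcongr; exact h' n
    _ = C' * C * wgt q n := by ring

/-- The operator `e n ↦ f n • e (t n)`. -/
noncomputable def mon (f : ℕ × ℕ → ℝ) (t : ℕ × ℕ → ℕ × ℕ) : Module.End ℂ Quad :=
  Finsupp.linearCombination ℂ fun n => (f n : ℂ) • e (t n)

theorem mon_e (f : ℕ × ℕ → ℝ) (t : ℕ × ℕ → ℕ × ℕ) (n : ℕ × ℕ) : mon f t (e n) = (f n : ℂ) • e (t n) := by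
  rw [mon, e, Finsupp.linearCombination_single, one_smul]

theorem end_ext {S T : Module.End ℂ Quad} (h : ∀ n, S (e n) = T (e n)) : S = T :=
  Finsupp.lhom_ext' fun n => LinearMap.ext_ring (h n)

theorem mon_bdd {f : ℕ × ℕ → ℝ} (hf : ∀ n, |f n| ≤ 1) (t : ℕ × ℕ → ℕ × ℕ) : Bdd (mon f t) :=
  ⟨1, ENNReal.one_ne_top, fun n => by
    rw [mon_e, nrm_smul, nrm_e, mul_one, ← ofReal_norm, Complex.norm_real, Real.norm_eq_abs]
    exact ENNReal.ofReal_le_one.2 (hf n)⟩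

theorem Dec.mul_mon (hq : q ∈ Set.Ioo (0 : ℝ) 1) {f : ℕ × ℕ → ℝ} (hf : ∀ n, |f n| ≤ 1) {t : ℕ × ℕ → ℕ × ℕ}
    (ht : ∀ n, n.1 + n.2 ≤ (t n).1 + (t n).2 + 1) {T : Module.End ℂ Quad} (hT : Dec q T) : Dec q (T * mon f t) := by
  obtain ⟨C, hC, h⟩ := hT
  have h1 : ENNReal.ofReal (q ^ 2) ≤ 1 := by rw [ENNReal.ofReal_le_one]; nlinarith [hq.1, hq.2]
  have h0 : ENNReal.ofReal (q ^ 2) ≠ 0 := by rw [Ne, ENNReal.ofReal_eq_zero, not_le]; exact pow_pos hq.1 2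
  refine ⟨C * (ENNReal.ofReal (q ^ 2))⁻¹, ENNReal.mul_ne_top hC (ENNReal.inv_ne_top.2 h0), fun n => ?_⟩
  rw [Module.End.mul_apply, mon_e, map_smul, nrm_smul, mul_assoc]
  have hf' : ‖(f n : ℂ)‖ₑ ≤ 1 := by
    rw [← ofReal_norm, Complex.norm_real, Real.norm_eq_abs]
    exact ENNReal.ofReal_le_one.2 (hf n)
  refine (mul_le_mul' hf' (h (t n))).trans ?_
  rw [one_mul]
  gcongr
  rw [wgt, wgt, ← ENNReal.mul_le_mul_iff_right h0 ENNReal.ofReal_ne_top, ← mul_assoc,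
    ENNReal.mul_inv_cancel h0 ENNReal.ofReal_ne_top, one_mul, ← pow_succ']
  exact pow_le_pow_right_of_le_one' h1 (ht n)

/-- The generators of the sphere acting on `Quad`. -/
noncomputable def genOp (q : ℝ) (s : ℤˣ) : SGen → Module.End ℂ Quad
  | .x₀ => mon (fun n => (s : ℤ) * q ^ (2 * (n.1 + n.2))) id
  | .x₁ => mon (fun n => q ^ (2 * n.2)) fun n => (n.1 + 1, n.2)
  | .y₁ => mon (fun n => q ^ (2 * n.2) * (1 - q ^ (4 * n.1))) fun n => (n.1 - 1, n.2)
  | .x₂ => mon (fun _ => 1) fun n => (n.1, n.2 + 1)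
  | .y₂ => mon (fun n => 1 - q ^ (4 * n.2)) fun n => (n.1, n.2 - 1)

theorem sphereRel_genOp (s : ℤˣ) : SphereRel q (genOp q s) := by
  rcases Int.units_eq_one_or s with rfl | rfl <;> constructor <;> refine end_ext ?_ <;> rintro ⟨_ | m, _ | n⟩ <;>
    simp only [genOp, Module.End.mul_apply, LinearMap.smul_apply, LinearMap.add_apply, LinearMap.sub_apply, mon_e,
      map_smul, smul_smul, Module.End.one_apply, id, Nat.add_sub_cancel, Complex.ofReal_mul, Complex.ofReal_sub,
      Complex.ofReal_pow, Complex.ofReal_one, Complex.ofReal_intCast, mul_zero, pow_zero, sub_self, zero_smul,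
      zero_add, add_zero, mul_one, one_smul, zero_mul, smul_zero, Units.val_one, Units.val_neg, Int.cast_one, Int.cast_neg] <;>
    match_scalars <;> ring

variable (q) in
/-- The representation on `Quad`. -/
noncomputable def rep (s : ℤˣ) : S4 q →ₐ[ℂ] Module.End ℂ Quad := S4.lift q (genOp q s) (sphereRel_genOp s).lift_eq

theorem rep_gen (s : ℤˣ) (x : SGen) : rep q s (S4.gen q x) = genOp q s x := S4.lift_gen q _ _ x

section

variable (hq : q ∈ Set.Ioo (0 : ℝ) 1)

include hq

theorem abs_pow_le (n : ℕ) : |q ^ n| ≤ 1 := by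
  rw [abs_of_nonneg (pow_nonneg hq.1.le n)]; exact pow_le_one₀ hq.1.le hq.2.le

theorem abs_one_sub_pow_le (n : ℕ) : |1 - q ^ n| ≤ 1 := by
  have h1 := pow_le_one₀ hq.1.le hq.2.le (n := n)
  have h0 := pow_nonneg hq.1.le n
  rw [abs_le]; constructor <;> linarith

omit hq in
theorem abs_mul_le {a b : ℝ} (ha : |a| ≤ 1) (hb : |b| ≤ 1) : |a * b| ≤ 1 := by
  rw [abs_mul]; exact mul_le_one₀ ha (abs_nonneg b) hb

theorem genOp_eq_mon (s : ℤˣ) (x : SGen) : ∃ f t, genOp q s x = mon f t ∧ (∀ n, |f n| ≤ 1) ∧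
    ∀ n, n.1 + n.2 ≤ (t n).1 + (t n).2 + 1 := by
  have hs : |((s : ℤ) : ℝ)| ≤ 1 := by rcases Int.units_eq_one_or s with rfl | rfl <;> simp
  cases x with
  | x₀ => exact ⟨_, _, rfl, fun n => abs_mul_le hs (abs_pow_le hq _), fun n => by simp only [id]; omega⟩
  | x₁ => exact ⟨_, _, rfl, fun n => abs_pow_le hq _, fun n => by dsimp only; omega⟩
  | y₁ => exact ⟨_, _, rfl, fun n => abs_mul_le (abs_pow_le hq _) (abs_one_sub_pow_le hq _), fun n => by
      dsimp only; omega⟩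
  | x₂ => exact ⟨_, _, rfl, fun n => by simp, fun n => by dsimp only; omega⟩
  | y₂ => exact ⟨_, _, rfl, fun n => abs_one_sub_pow_le hq _, fun n => by dsimp only; omega⟩

theorem rep_bdd (s : ℤˣ) (a : S4 q) : Bdd (rep q s a) := by
  induction a using S4.induction with
  | hc c => rw [AlgHom.commutes]; exact Bdd.algebraMap c
  | hg x => obtain ⟨f, t, h, hf, -⟩ := genOp_eq_mon hq s x; rw [rep_gen, h]; exact mon_bdd hf t
  | hm a b ha hb => rw [map_mul]; exact ha.mul hb
  | ha a b ha hb => rw [map_add]; exact ha.add hb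

theorem dec_mul_rep (s : ℤˣ) (a : S4 q) {T : Module.End ℂ Quad} (hT : Dec q T) : Dec q (T * rep q s a) := by
  induction a using S4.induction generalizing T with
  | hc c => rw [AlgHom.commutes, ← Algebra.commutes, ← Algebra.smul_def]; exact hT.smul c
  | hg x => obtain ⟨f, t, h, hf, ht⟩ := genOp_eq_mon hq s x; rw [rep_gen, h]; exact hT.mul_mon hq hf ht
  | hm a b ha hb => rw [map_mul, ← mul_assoc]; exact hb (ha hT)
  | ha a b ha hb => rw [map_add, mul_add]; exact (ha hT).add (hb hT)

omit hq in
theorem dec_zero : Dec q 0 := ⟨0, ENNReal.zero_ne_top, fun n => by simp [nrm]⟩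

variable (q) in
/-- The difference of the two representations. -/
noncomputable def dif (a : S4 q) : Module.End ℂ Quad := rep q 1 a - rep q (-1) a

omit hq in
theorem dif_apply (a : S4 q) (v : Quad) : dif q a v = rep q 1 a v - rep q (-1) a v := rfl

omit hq in
theorem dif_add (a b : S4 q) : dif q (a + b) = dif q a + dif q b := LinearMap.ext fun v => by
  rw [LinearMap.add_apply, dif_apply, dif_apply, dif_apply, map_add, map_add]; exact add_sub_add_comm _ _ _ _

omit hq in
theorem dif_smul (c : ℂ) (a : S4 q) : dif q (c • a) = c • dif q a := LinearMap.ext fun v => by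
  rw [LinearMap.smul_apply, dif_apply, dif_apply, map_smul, map_smul]; exact (smul_sub c _ _).symm

omit hq in
theorem dif_mul (a b : S4 q) : dif q (a * b) = rep q 1 a * dif q b + dif q a * rep q (-1) b :=
  LinearMap.ext fun v => by
    rw [LinearMap.add_apply, Module.End.mul_apply, Module.End.mul_apply, dif_apply, dif_apply, dif_apply, map_mul, map_mul,
      map_sub]
    exact (sub_add_sub_cancel _ _ _).symm

omit hq in
theorem dif_mul' (a b : S4 q) : dif q (a * b) = dif q a * rep q 1 b + rep q (-1) a * dif q b :=
  LinearMap.ext fun v => by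
    rw [LinearMap.add_apply, Module.End.mul_apply, Module.End.mul_apply, dif_apply, dif_apply, dif_apply, map_mul, map_mul,
      map_sub]
    exact (sub_add_sub_cancel _ _ _).symm

omit hq in
theorem dif_eq_zero {a : S4 q} (h : rep q 1 a = rep q (-1) a) : dif q a = 0 := LinearMap.ext fun v => by
  rw [dif_apply, h]; exact sub_self _

theorem dec_dif (a : S4 q) : Dec q (dif q a) := by
  induction a using S4.induction with
  | hc c => rw [dif_eq_zero (by rw [AlgHom.commutes, AlgHom.commutes])]; exact dec_zero
  | hg x =>
    cases x with
    | x₀ =>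
      refine ⟨2, ENNReal.ofNat_ne_top, fun n => ?_⟩
      have e' : dif q (S4.x₀ q) (e n) = (2 : ℂ) • ((q ^ (2 * (n.1 + n.2)) : ℝ) : ℂ) • e n := by
        rw [dif_apply, rep_gen, rep_gen]
        simp only [genOp, mon_e, id]
        push_cast
        match_scalars
        ring
      rw [e', nrm_smul, nrm_smul, nrm_e, mul_one, wgt, ← ENNReal.ofReal_pow (sq_nonneg q), ← pow_mul]
      refine mul_le_mul' (by rw [← ofReal_norm]; simp) ?_
      rw [← ofReal_norm, Complex.norm_real, Real.norm_eq_abs, abs_of_nonneg (pow_nonneg hq.1.le _)]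
    | _ => rw [dif_eq_zero (by rw [rep_gen, rep_gen]; rfl)]; exact dec_zero
  | hm a b ha hb =>
    rw [dif_mul]; exact ((rep_bdd hq 1 a).mul_dec hb).add (dec_mul_rep hq (-1) b ha)
  | ha a b ha hb => rw [dif_add]; exact ha.add hb

omit hq in
theorem tr_add {S T : Module.End ℂ Quad} (hq : q ∈ Set.Ioo (0 : ℝ) 1) (hS : Dec q S) (hT : Dec q T) :
    tr (S + T) = tr S + tr T := (hS.summable hq).tsum_add (hT.summable hq)

omit hq in
/-- The trace on the algebra of the sphere which detects `x₀`. -/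
noncomputable def trace (hq : q ∈ Set.Ioo (0 : ℝ) 1) : S4 q →ₗ[ℂ] ℂ where
  toFun a := tr (dif q a)
  map_add' a b := by rw [dif_add, tr_add hq (dec_dif hq a) (dec_dif hq b)]
  map_smul' c a := by rw [dif_smul, RingHom.id_apply, smul_eq_mul, tr, tr, ← tsum_mul_left]; rfl

theorem trace_mul_comm (a b : S4 q) : trace hq (a * b) = trace hq (b * a) := by
  change tr _ = tr _
  rw [dif_mul, dif_mul', tr_add hq ((rep_bdd hq 1 a).mul_dec (dec_dif hq b)) (dec_mul_rep hq _ b (dec_dif hq a)),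
    tr_add hq (dec_mul_rep hq _ a (dec_dif hq b)) ((rep_bdd hq _ b).mul_dec (dec_dif hq a)),
    tr_mul_comm hq (rep_bdd hq 1 a) (dec_dif hq b), tr_mul_comm hq (rep_bdd hq _ b) (dec_dif hq a)]

theorem trace_x₀_ne_zero : trace hq (S4.x₀ q) ≠ 0 := by
  have hd := (dec_dif hq (S4.x₀ q)).summable hq
  have e' : ∀ n, dif q (S4.x₀ q) (e n) n = ((2 * q ^ (2 * (n.1 + n.2)) : ℝ) : ℂ) := by
    intro n
    rw [dif_apply, rep_gen, rep_gen, genOp, genOp, mon_e, mon_e, id, Finsupp.sub_apply, Finsupp.smul_apply,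
      Finsupp.smul_apply, e, Finsupp.single_eq_same]
    push_cast
    simp
    ring
  change tr _ ≠ 0
  rw [tr]
  simp only [e'] at hd ⊢
  rw [← Complex.ofReal_tsum, Complex.ofReal_ne_zero]
  exact ((Complex.summable_ofReal.1 hd).tsum_pos (fun n => by have := hq.1; positivity) (0, 0) (by simp)).ne'

end

end Quad

variable {q : ℝ}

theorem trace_sphMat (hq : q ∈ Set.Ioo (0 : ℝ) 1) (f : S4 q →ₗ[ℂ] ℂ) (h : ∑ i, f (idemOf q 1 i i) = ∑ i, f (idemOf q (-1) i i)) :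
    f (S4.x₀ q) = 0 := by
  rw [idemOf_neg_one, idemOf_one] at h
  simp only [Matrix.sub_apply, map_sub, Finset.sum_sub_distrib, Fin.sum_univ_four, Matrix.one_apply_eq, idem,
    Matrix.smul_apply, Matrix.of_apply, Matrix.cons_val, map_smul, map_add, map_sub, smul_eq_mul] at h
  have h1 := ofReal_sq_sub_one_ne hq
  have : ((q : ℂ) ^ 2 - 1) ^ 2 * f (S4.x₀ q) = 0 := by linear_combination h
  exact (mul_eq_zero.1 this).resolve_left (pow_ne_zero 2 h1)

theorem trace_mul_comm_matrix (f : S4 q →ₗ[ℂ] ℂ) (hf : ∀ a b, f (a * b) = f (b * a))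
    (M N : Matrix (Fin 4) (Fin 4) (S4 q)) : ∑ i, f ((M * N) i i) = ∑ i, f ((N * M) i i) := by
  simp only [Matrix.mul_apply, map_sum]
  rw [Finset.sum_comm]
  exact Finset.sum_congr rfl fun i _ => Finset.sum_congr rfl fun j _ => hf _ _

/-- Isomorphic modules `A⁴p` and `A⁴p'` come from equivalent idempotents. -/
theorem exists_equiv_idem {p p' : Matrix (Fin 4) (Fin 4) (S4 q)} (hp : p * p = p) (hp' : p' * p' = p')
    (Φ : rowModule p ≃ₗ[S4 q] rowModule p') : ∃ M N, M * N = p ∧ N * M = p' := by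
  have hr : ∀ (p : Matrix (Fin 4) (Fin 4) (S4 q)) i, p i ∈ rowModule p := fun p i =>
    ⟨Pi.single i 1, by simp [Matrix.vecMulLinear]; rfl⟩
  have key : ∀ (p p' : Matrix (Fin 4) (Fin 4) (S4 q)), p * p = p → ∀ (Φ : rowModule p →ₗ[S4 q] rowModule p')
      (v : rowModule p), Matrix.vecMul (v : Fin 4 → S4 q) (Matrix.of fun i => (Φ ⟨p i, hr p i⟩ : Fin 4 → S4 q)) = Φ v := by
    intro p p' hp Φ v
    have hv : v = ∑ i, (v : Fin 4 → S4 q) i • (⟨p i, hr p i⟩ : rowModule p) := by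
      refine Subtype.ext ?_
      conv_lhs => rw [← (mem_rowModule hp).1 v.2]
      ext j
      simp [Matrix.vecMul, dotProduct]
    conv_rhs => rw [hv]
    simp only [map_sum, map_smul]
    ext j
    simp only [Matrix.vecMul, dotProduct, Matrix.of_apply, Submodule.coe_sum, Submodule.coe_smul, Finset.sum_apply,
      Pi.smul_apply, smul_eq_mul]
  refine ⟨Matrix.of fun i => (Φ ⟨p i, hr p i⟩ : Fin 4 → S4 q), Matrix.of fun i => (Φ.symm ⟨p' i, hr p' i⟩ : Fin 4 → S4 q),
    ?_, ?_⟩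
  · ext i j
    have := key p' p hp' Φ.symm.toLinearMap (Φ ⟨p i, hr p i⟩)
    rw [LinearEquiv.coe_coe, Φ.symm_apply_apply] at this
    exact congrFun this j
  · ext i j
    have := key p p' hp Φ.toLinearMap (Φ.symm ⟨p' i, hr p' i⟩)
    rw [LinearEquiv.coe_coe, Φ.apply_symm_apply] at this
    exact congrFun this j

theorem not_moduleEquivalent (hq : q ∈ Set.Ioo (0 : ℝ) 1) : ¬ ModuleEquivalent (sphereRep hq 1) (sphereRep hq (-1)) := by
  rintro ⟨W, hW⟩
  obtain ⟨T, -, hT, -⟩ := correspondsTo hq (sphereRep_injective hq 1) 1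
  obtain ⟨T', -, hT', -⟩ := correspondsTo hq (sphereRep_injective hq 1) (-1)
  let Φ : rowModule (idemOf q 1) ≃ₗ[S4 q] rowModule (idemOf q (-1)) :=
    { (T.trans W).trans T'.symm with
      map_smul' := fun a v => by
        change T'.symm (W (T (a • v))) = a • T'.symm (W (T v))
        rw [LinearEquiv.symm_apply_eq, hT, hW, hT', T'.apply_symm_apply] }
  obtain ⟨M, N, h, h'⟩ := exists_equiv_idem (idemOf_mul_self hq 1) (idemOf_mul_self hq (-1)) Φ
  refine Quad.trace_x₀_ne_zero hq (trace_sphMat hq _ ?_)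
  rw [← h, ← h']
  exact trace_mul_comm_matrix _ (Quad.trace_mul_comm hq) M N

end



/-! ### Equivariant representations: decomposition of the generators -/

section

variable {q : ℝ}

/-- The operator acting by the scalar `φ l` on each `V_l`. -/
noncomputable def scal (φ : ℤ → ℂ) : Module.End ℂ Spin := opOfKet fun L M₁ M₂ J => φ L • ket L M₁ M₂ J

theorem scal_ket (φ : ℤ → ℂ) (L M₁ M₂ J : ℤ) : scal φ (ket L M₁ M₂ J) = φ L • ket L M₁ M₂ J := by
  by_cases h : Admissible L M₁ M₂ J
  · exact opOfKet_ket _ h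
  · rw [ket_of_not_adm h, map_zero, smul_zero]

theorem scal_isAdj (φ : ℤ → ℂ) : IsAdj (scal φ) (scal fun L => starRingEnd ℂ (φ L)) := by
  refine isAdj_of_ket fun L M₁ M₂ J _ L' M₁' M₂' J' _ => ?_
  rw [scal_ket, scal_ket, fip_smul_left, fip_smul_right]
  by_cases h : L = L'
  · rw [h]
  · rw [fip_ket_of_ne fun h' => h h'.1, mul_zero, mul_zero]

theorem scal_mul (φ ψ : ℤ → ℂ) : scal φ * scal ψ = scal fun L => φ L * ψ L :=
  end_ext fun L M₁ M₂ J _ => by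
    rw [Module.End.mul_apply, scal_ket, map_smul, scal_ket, scal_ket, smul_smul, mul_comm]

theorem scal_one : scal (fun _ => 1) = 1 := end_ext fun L M₁ M₂ J _ => by
  rw [scal_ket, one_smul, Module.End.one_apply]

/-- `T` shifts `2l` by `a`. -/
def ShiftL (a : ℤ) (T : Module.End ℂ Spin) : Prop := ∀ φ, scal φ * T = T * scal fun L => φ (L + a)

theorem ShiftL.add {a : ℤ} {S T : Module.End ℂ Spin} (hS : ShiftL a S) (hT : ShiftL a T) : ShiftL a (S + T) :=
  fun φ => by rw [mul_add, add_mul, hS, hT]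

theorem shiftL_sh (a b c d : ℤ) (f : ℤ → ℤ → ℤ → ℤ → ℝ) : ShiftL a (sh a b c d f) := fun φ =>
  end_ext fun L M₁ M₂ J h => by
    rw [Module.End.mul_apply, Module.End.mul_apply, sh_ket _ _ _ _ _ h, scal_ket, map_smul, map_smul, scal_ket,
      sh_ket _ _ _ _ _ h, smul_comm]

theorem shiftL_three (a b : ℤ) (f₁ f₂ f₃ : ℤ → ℤ → ℝ) (g₁ g₂ g₃ : ℤ → ℤ → ℤ → ℝ) :
    ShiftL a (three a b f₁ f₂ f₃ g₁ g₂ g₃) :=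
  ((shiftL_sh _ _ _ _ _).add (shiftL_sh _ _ _ _ _)).add (shiftL_sh _ _ _ _ _)

theorem ShiftL.comm {T : Module.End ℂ Spin} (hT : ShiftL 0 T) (φ : ℤ → ℂ) : scal φ * T = T * scal φ := by
  simpa only [add_zero] using hT φ

theorem shiftL_opU (g : UGen) : ShiftL 0 (opU q g) := by
  have hE₁ : ShiftL 0 (opE₁ q) := by rw [opE₁_eq]; exact shiftL_sh _ _ _ _ _
  have hE₂ : ShiftL 0 (opE₂ q) := by
    rw [opE₂_eq]; exact ((shiftL_sh _ _ _ _ _).add (shiftL_sh _ _ _ _ _)).add (shiftL_sh _ _ _ _ _)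
  have hF₂ : ShiftL 0 (opF₂ q) := ((shiftL_sh _ _ _ _ _).add (shiftL_sh _ _ _ _ _)).add (shiftL_sh _ _ _ _ _)
  have hK₁ : ShiftL 0 (opK₁ q) := by rw [opK₁_eq]; exact shiftL_sh _ _ _ _ _
  have hK₂ : ShiftL 0 (opK₂ q) := by rw [opK₂_eq]; exact shiftL_sh _ _ _ _ _
  have hF₁ : ShiftL 0 (opF₁ q) := shiftL_sh _ _ _ _ _
  have hL₁ : ShiftL 0 (opKi₁ q) := shiftL_sh _ _ _ _ _
  have hL₂ : ShiftL 0 (opKi₂ q) := shiftL_sh _ _ _ _ _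
  match g with
  | .K 0 => exact hK₁
  | .K 1 => exact hK₂
  | .Kinv 0 => exact hL₁
  | .Kinv 1 => exact hL₂
  | .E 0 => exact hE₁
  | .E 1 => exact hE₂
  | .F 0 => exact hF₁
  | .F 1 => exact hF₂

section

variable {h : ℂ} {P : Type} [Ring P] [Algebra ℂ P] {E₁ E₂ F₁ F₂ K₁ K₂ L₁ L₂ x₀ x₁ x₂ x₀' x₁' d : P}

theorem HighRel.mul_right (H : HighRel q h E₁ E₂ F₁ F₂ K₁ K₂ x₀ x₁ x₂) (hE₁ : d * E₁ = E₁ * d) (hE₂ : d * E₂ = E₂ * d)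
    (hF₁ : d * F₁ = F₁ * d) (hF₂ : d * F₂ = F₂ * d) (hK₁ : d * K₁ = K₁ * d) (hK₂ : d * K₂ = K₂ * d) :
    HighRel q h E₁ E₂ F₁ F₂ K₁ K₂ (x₀ * d) (x₁ * d) (x₂ * d) := by
  constructor <;> rw [← mul_assoc] <;> simp only [H.E₁x₂, H.F₁x₂, H.E₂x₂, H.F₂x₂, H.F₁x₁, H.K₁x₂, H.K₂x₂, mul_assoc,
    hE₁, hE₂, hF₁, hF₂, hK₁, hK₂, add_mul, smul_mul_assoc]

theorem HighRel.unique (H : HighRel q h E₁ E₂ F₁ F₂ K₁ K₂ x₀ x₁ x₂) (H' : HighRel q h E₁ E₂ F₁ F₂ K₁ K₂ x₀' x₁' x₂)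
    (h₁ : K₁ * L₁ = 1) (h₂ : K₂ * L₂ = 1) (hc : h * (q + (q : ℂ)⁻¹) ≠ 0) : x₀ = x₀' ∧ x₁ = x₁' := by
  have e : x₁ = x₁' := mul_right_cancel_of_inv h₂ (add_right_cancel (H.F₂x₂.symm.trans H'.F₂x₂))
  subst e
  exact ⟨mul_right_cancel_of_inv h₁ (smul_right_injective _ hc (add_right_cancel (H.F₁x₁.symm.trans H'.F₁x₁))), rfl⟩

end

variable (hq : q ∈ Set.Ioo (0 : ℝ) 1)

include hq

/-- An operator commuting with `E₁`, `F₁` preserves `j`. -/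
theorem fip_ket_three {T : Module.End ℂ Spin} (hF : opF₁ q * T = T * opF₁ q) {L L' M₂ M₂' : ℤ}
    (ha : Admissible L' (-1) M₂' 3) (hb : Admissible L (-1) M₂ 1) : fip (ket L' (-1) M₂' 3) (T (ket L (-1) M₂ 1)) = 0 := by
  have ha' : Admissible L' (-3) M₂' 3 := by rw [admissible_iff] at ha ⊢; omega
  have e := opE₁_eq (q := q) ▸ sh_ket 0 2 0 0 (cE₁ q) ha'
  have hz : opF₁ q (ket L (-1) M₂ 1) = 0 := by
    rw [opF₁, sh_ket _ _ _ _ _ hb, ket_of_not_adm (fun h => by rw [admissible_iff] at h; omega), smul_zero]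
  have hne : (cE₁ q L' (-3) M₂' 3 : ℂ) ≠ 0 := by
    rw [cE₁]
    refine Complex.ofReal_ne_zero.2 (Real.sqrt_ne_zero'.2 (mul_pos (qnum_pos hq ?_) (qnum_pos hq ?_))) <;> norm_num
  have e2 := opF₁_isAdj q (ket L' (-3) M₂' 3) (T (ket L (-1) M₂ 1))
  rw [← Module.End.mul_apply, hF, Module.End.mul_apply, hz, map_zero, fip_zero_right, e, fip_smul_left] at e2
  norm_num at e2
  exact e2.resolve_left (by exact_mod_cast hne)

theorem coefD0_ne_zero {L : ℤ} (h : Admissible L (-1) (-L) 1) : coefD0 q L 1 (-L) ≠ 0 := by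
  have h1 : (1 : ℝ) ≤ L := by norm_cast; rw [admissible_iff] at h; omega
  rw [coefD0, eps_neg (by rw [admissible_iff] at h; omega)]
  push_cast
  refine mul_ne_zero (mul_ne_zero (qnum_pos hq two_pos).ne' (Real.rpow_pos_of_pos hq.1 _).ne') (div_ne_zero
    (Real.sqrt_ne_zero'.2 (mul_pos (qnum_pos hq ?_) (qnum_pos hq ?_))) (mul_ne_zero (qnum_pos hq ?_).ne'
      (qnum_pos hq ?_).ne')) <;> linarith

theorem coefH0_ne_zero {L : ℤ} (h : Admissible L (-1) (-L) 1) : coefH0 q L 1 (-L) ≠ 0 := by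
  have h1 : (1 : ℝ) ≤ L := by norm_cast; rw [admissible_iff] at h; omega
  rw [coefH0, eps_neg (by rw [admissible_iff] at h; omega)]
  push_cast
  have e : (L : ℝ) / 2 + -1 / 2 * (2 * (1 / 2) + 1) + -L / 2 + 1 = 0 := by ring
  rw [e, qnum_zero, mul_zero, mul_zero, sub_zero]
  refine div_ne_zero (mul_ne_zero (qnum_pos hq ?_).ne' (qnum_pos hq ?_).ne') (mul_ne_zero (qnum_pos hq ?_).ne'
      (qnum_pos hq ?_).ne') <;> linarith

/-- The generators in an equivariant representation agree with those of `π` up to scalars on the components. -/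
theorem HighRel.decomp {h : ℂ} (h0 : h ≠ 0) (h1 : ((q ^ (1 / 2 : ℝ) : ℝ) : ℂ) = h) {X₀ X₁ X₂ : Module.End ℂ Spin}
    (H : HighRel q h (opE₁ q) (opE₂ q) (opF₁ q) (opF₂ q) (opK₁ q) (opK₂ q) X₀ X₁ X₂) :
    ∃ α β γ : ℤ → ℂ, X₀ = opX₀p q * scal α + opX₀z q * scal β + opX₀m q * scal γ ∧
      X₁ = opX₁p q * scal α + opX₁z q * scal β + opX₁m q * scal γ ∧
      X₂ = opX₂p q * scal α + opX₂z q * scal β + opX₂m q * scal γ := by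
  have q0 := ofReal_ne hq
  let α : ℤ → ℂ := fun L => fip (ket (L + 2) 1 (L + 2) 1) (X₂ (ket L 1 L 1)) / coefDp q L 1 L
  let β : ℤ → ℂ := fun L => fip (ket L (-1) (-L + 2) 1) (X₂ (ket L (-1) (-L) 1)) / coefD0 q L 1 (-L)
  let γ : ℤ → ℂ := fun L => fip (ket (L - 2) (-1) (-L + 2) 1) (X₂ (ket L (-1) (-L) 1)) / coefDm q L 1 (-L)
  have hr : ∀ {x₀ x₁ x₂} (φ), HighRel q h (opE₁ q) (opE₂ q) (opF₁ q) (opF₂ q) (opK₁ q) (opK₂ q) x₀ x₁ x₂ →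
      HighRel q h (opE₁ q) (opE₂ q) (opF₁ q) (opF₂ q) (opK₁ q) (opK₂ q) (x₀ * scal φ) (x₁ * scal φ) (x₂ * scal φ) :=
    fun φ H => H.mul_right (P := Module.End ℂ Spin) ((shiftL_opU (q := q) (.E 0)).comm φ) ((shiftL_opU (q := q) (.E 1)).comm φ)
      ((shiftL_opU (q := q) (.F 0)).comm φ) ((shiftL_opU (q := q) (.F 1)).comm φ) ((shiftL_opU (q := q) (.K 0)).comm φ)
      ((shiftL_opU (q := q) (.K 1)).comm φ)
  obtain ⟨hp, hz, hm⟩ := highRel_op hq h1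
  have H' := HighRel.add (P := Module.End ℂ Spin) (HighRel.add (P := Module.End ℂ Spin) (hr α hp) (hr β hz)) (hr γ hm)
  have key : X₂ = opX₂p q * scal α + opX₂z q * scal β + opX₂m q * scal γ := by
    set Y := opX₂p q * scal α + opX₂z q * scal β + opX₂m q * scal γ with hY
    have Yk : ∀ {L M₁ M₂ J}, Admissible L M₁ M₂ J → Y (ket L M₁ M₂ J) =
        (α L * coefDp q L J M₂) • ket (L + 2) M₁ (M₂ + 2) J + (β L * coefD0 q L J M₂) • ket L M₁ (M₂ + 2) J +
        (γ L * coefDm q L J M₂) • ket (L - 2) M₁ (M₂ + 2) J := by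
      intro L M₁ M₂ J ha
      simp only [hY, LinearMap.add_apply, Module.End.mul_apply, scal_ket, map_smul, opX₂p, opX₂z, opX₂m,
        sh_ket _ _ _ _ _ ha, cXp, cXz, cXm, add_zero, smul_smul, ← sub_eq_add_neg]
    have e₁ : opE₁ q * (X₂ - Y) = (1 : ℂ) • ((X₂ - Y) * opE₁ q) :=
      wt_sub (P := Module.End ℂ Spin) (by rw [H.E₁x₂, one_smul]) (by rw [H'.E₁x₂, one_smul])
    have f₁ : opF₁ q * (X₂ - Y) = (1 : ℂ) • ((X₂ - Y) * opF₁ q) :=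
      wt_sub (P := Module.End ℂ Spin) (by rw [H.F₁x₂, one_smul]) (by rw [H'.F₁x₂, one_smul])
    rw [one_smul] at f₁
    have e₂ : opE₂ q * (X₂ - Y) = (q : ℂ)⁻¹ • ((X₂ - Y) * opE₂ q) := wt_sub (P := Module.End ℂ Spin) H.E₂x₂ H'.E₂x₂
    have w : HasWt q 0 1 (X₂ - Y) :=
      HasWt.sub ⟨by rw [H.K₁x₂, zpow_zero, one_smul], by rw [H.K₂x₂, zpow_one]⟩
        ⟨by rw [H'.K₁x₂, zpow_zero, one_smul], by rw [H'.K₂x₂, zpow_one]⟩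
    refine sub_eq_zero.1 (end_eq_zero_of_fip fun L' L M₁' M₂' J' M₁ M₂ J => ?_)
    by_cases hL : L % 2 = 1 ∧ 1 ≤ L
    swap
    · rw [ket_of_not_adm (L := L) (fun ha => hL (by rw [admissible_iff] at ha; omega)), map_zero, fip_zero_right]
    by_cases hL' : L' < L + 2
    · refine block_lowest hq one_ne_zero (inv_ne_zero q0) e₁ e₂ w (fun J' ha => ?_) _ _ _ _ _ _
      norm_num at ha ⊢
      have u : Admissible L (-1) (-L) 1 := by rw [admissible_iff]; omega
      have ha' := admissible_iff.1 ha
      obtain rfl | rfl : J' = 1 ∨ J' = 3 := by omega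
      · rw [fip_sub_right, Yk u]
        simp only [fip_add_right, fip_smul_right]
        obtain rfl | rfl : L' = L - 2 ∨ L' = L := by omega
        · simp (disch := omega) only [fip_ket_self ha, fip_ket_of_ne]
          have : (coefDm q L 1 (-L) : ℂ) ≠ 0 := by
            have := coefDm_ne_zero' hq ha
            rw [sub_add_cancel, add_sub_cancel_right] at this
            exact_mod_cast this
          simp only [γ]
          field_simp
          ring
        · simp (disch := omega) only [fip_ket_self ha, fip_ket_of_ne]
          have : (coefD0 q L' 1 (-L') : ℂ) ≠ 0 := by
            exact_mod_cast coefD0_ne_zero hq u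
          simp only [β]
          field_simp
          ring
      · exact fip_ket_three hq f₁ ha u
    · refine block_highest hq e₁ e₂ w (fun J ha => ?_) _ _ _ _ _ _
      have ha' := admissible_iff.1 ha
      obtain rfl : L' = L + 2 := by omega
      obtain rfl : J = 1 := by omega
      norm_num at ha ⊢
      have v : Admissible (L + 2) 1 (L + 2) 1 := by rw [admissible_iff]; omega
      rw [fip_sub_right, Yk ha]
      simp only [fip_add_right, fip_smul_right]
      simp (disch := omega) only [fip_ket_self v, fip_ket_of_ne]
      have : (coefDp q L 1 L : ℂ) ≠ 0 := by exact_mod_cast coefDp_ne_zero hq ha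
      simp only [α]
      field_simp
      ring
  rw [← key] at H'
  have hu := H.unique (P := Module.End ℂ Spin) H' (preSerre_op hq).K₁L₁ (preSerre_op hq).K₂L₂ (by
    refine mul_ne_zero h0 ?_
    have : (q : ℂ) + (q : ℂ)⁻¹ = ((q : ℂ) ^ 2 + 1) * (q : ℂ)⁻¹ := by field_simp
    rw [this]
    exact mul_ne_zero (ofReal_sq_add_one_ne q) (inv_ne_zero q0))
  exact ⟨α, β, γ, hu.1, hu.2, key⟩

end



/-! ### Equivariant representations: the scalars -/

section

variable {q : ℝ}

theorem comb_x₂_ket {α β γ : ℤ → ℂ} {L M₁ M₂ J : ℤ} (h : Admissible L M₁ M₂ J) :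
    (opX₂p q * scal α + opX₂z q * scal β + opX₂m q * scal γ) (ket L M₁ M₂ J) =
      (α L * coefDp q L J M₂) • ket (L + 2) M₁ (M₂ + 2) J + (β L * coefD0 q L J M₂) • ket L M₁ (M₂ + 2) J +
      (γ L * coefDm q L J M₂) • ket (L - 2) M₁ (M₂ + 2) J := by
  simp only [LinearMap.add_apply, Module.End.mul_apply, scal_ket, map_smul, opX₂p, opX₂z, opX₂m,
    sh_ket _ _ _ _ _ h, cXp, cXz, cXm, add_zero, smul_smul, ← sub_eq_add_neg]

theorem comb_x₀_ket {α β γ : ℤ → ℂ} {L M₁ M₂ J : ℤ} (h : Admissible L M₁ M₂ J) :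
    (opX₀p q * scal α + opX₀z q * scal β + opX₀m q * scal γ) (ket L M₁ M₂ J) =
      α L • (((coefAp q J M₁ * coefCp q L J M₂ : ℝ) : ℂ) • ket (L + 2) M₁ M₂ (J + 2) +
        ((coefA0 q J M₁ * coefHp q L J M₂ : ℝ) : ℂ) • ket (L + 2) M₁ M₂ J +
        ((coefAp q (J - 2) M₁ * coefCm q (L + 2) (J - 2) M₂ : ℝ) : ℂ) • ket (L + 2) M₁ M₂ (J - 2)) +
      β L • (((coefAp q J M₁ * -coefC0 q L J M₂ : ℝ) : ℂ) • ket L M₁ M₂ (J + 2) +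
        ((coefA0 q J M₁ * coefH0 q L J M₂ : ℝ) : ℂ) • ket L M₁ M₂ J +
        ((coefAp q (J - 2) M₁ * -coefC0 q L (J - 2) M₂ : ℝ) : ℂ) • ket L M₁ M₂ (J - 2)) +
      γ L • (((coefAp q J M₁ * coefCm q L J M₂ : ℝ) : ℂ) • ket (L - 2) M₁ M₂ (J + 2) +
        ((coefA0 q J M₁ * coefHp q (L - 2) J M₂ : ℝ) : ℂ) • ket (L - 2) M₁ M₂ J +
        ((coefAp q (J - 2) M₁ * coefCp q (L - 2) (J - 2) M₂ : ℝ) : ℂ) • ket (L - 2) M₁ M₂ (J - 2)) := by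
  simp only [LinearMap.add_apply, Module.End.mul_apply, scal_ket, map_smul, opX₀p, opX₀z, opX₀m,
    three_ket _ _ _ _ _ _ _ _ h, add_zero, ← sub_eq_add_neg]

/-- The matrix coefficients of `x₀` which preserve `j`. -/
theorem comb_x₀_fip {α β γ : ℤ → ℂ} {L M₁ M₂ J : ℤ} (h : Admissible L M₁ M₂ J) {X₀ : Module.End ℂ Spin}
    (e : X₀ = opX₀p q * scal α + opX₀z q * scal β + opX₀m q * scal γ) :
    (Admissible (L + 2) M₁ M₂ J → fip (ket (L + 2) M₁ M₂ J) (X₀ (ket L M₁ M₂ J)) =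
      α L * (coefA0 q J M₁ * coefHp q L J M₂ : ℝ)) ∧
    fip (ket L M₁ M₂ J) (X₀ (ket L M₁ M₂ J)) = β L * (coefA0 q J M₁ * coefH0 q L J M₂ : ℝ) ∧
    (Admissible (L - 2) M₁ M₂ J → fip (ket (L - 2) M₁ M₂ J) (X₀ (ket L M₁ M₂ J)) =
      γ L * (coefA0 q J M₁ * coefHp q (L - 2) J M₂ : ℝ)) := by
  rw [e, comb_x₀_ket h]
  simp only [fip_add_right, fip_smul_right]
  refine ⟨fun h' => ?_, ?_, fun h' => ?_⟩
  · simp (disch := omega) only [fip_ket_self h', fip_ket_of_ne]; ring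
  · simp (disch := omega) only [fip_ket_self h, fip_ket_of_ne]; ring
  · simp (disch := omega) only [fip_ket_self h', fip_ket_of_ne]; ring

variable (hq : q ∈ Set.Ioo (0 : ℝ) 1) {α β γ : ℤ → ℂ} {X₀ X₂ : Module.End ℂ Spin}
  (e₀ : X₀ = opX₀p q * scal α + opX₀z q * scal β + opX₀m q * scal γ)
  (e₂ : X₂ = opX₂p q * scal α + opX₂z q * scal β + opX₂m q * scal γ)

include hq

theorem coefA0_ne_zero : (coefA0 q 1 (-1) : ℂ) ≠ 0 := by
  refine Complex.ofReal_ne_zero.2 ?_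
  rw [coefA0]
  norm_num
  have h1 := qnum_one hq
  refine ⟨hq.1.ne', ?_, (qnum_pos hq one_pos).ne', (qnum_pos hq (by norm_num)).ne'⟩
  rw [h1, S4.qnum_two q hq]
  have := hq.1
  field_simp
  nlinarith

theorem coef_pos {L : ℤ} (u : Admissible L (-1) (-L) 1) : 0 < coefDp q L 1 (-L) * coefHp q L 1 (-L + 2) -
    q ^ 2 * (coefHp q L 1 (-L) * coefDm q (L + 2) 1 (-L)) := by
  have h1 : (1 : ℝ) ≤ L := by norm_cast; rw [admissible_iff] at u; omega
  have a1 : 0 < coefDp q L 1 (-L) := lt_of_le_of_ne (mul_nonneg (Real.rpow_nonneg hq.1.le _)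
    (div_nonneg (Real.sqrt_nonneg _) (qnum_pos hq (by linarith)).le)) (coefDp_ne_zero hq u).symm
  have a2 : 0 < coefHp q L 1 (-L + 2) := by
    rw [coefHp, eps_pos (by rw [admissible_iff] at u; omega)]
    push_cast
    refine mul_pos (Real.rpow_pos_of_pos hq.1 _) (div_pos (Real.sqrt_pos.2 (mul_pos (qnum_pos hq ?_) (qnum_pos hq ?_)))
      (qnum_pos hq ?_)) <;> linarith
  have a3 : 0 ≤ coefHp q L 1 (-L) := mul_nonneg (Real.rpow_nonneg hq.1.le _)
    (div_nonneg (Real.sqrt_nonneg _) (qnum_pos hq (by linarith)).le)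
  have a4 : coefDm q (L + 2) 1 (-L) ≤ 0 := mul_nonpos_of_nonpos_of_nonneg (neg_nonpos.2 (Real.rpow_nonneg hq.1.le _))
    (div_nonneg (Real.sqrt_nonneg _) (qnum_pos hq (by push_cast; linarith)).le)
  have := mul_pos a1 a2
  have := mul_nonneg (sq_nonneg q) (mul_nonneg a3 (neg_nonneg.2 a4))
  linarith

include e₀

theorem beta_real (a₀ : IsAdj X₀ X₀) {L : ℤ} (u : Admissible L (-1) (-L) 1) : starRingEnd ℂ (β L) = β L := by
  have h := (comb_x₀_fip u e₀).2.1
  have h' := congrArg (starRingEnd ℂ) h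
  rw [fip_conj, a₀, h, map_mul, Complex.conj_ofReal] at h'
  have : ((coefA0 q 1 (-1) * coefH0 q L 1 (-L) : ℝ) : ℂ) ≠ 0 := by
    rw [Complex.ofReal_mul]; exact mul_ne_zero (coefA0_ne_zero hq) (by exact_mod_cast coefH0_ne_zero hq u)
  exact (mul_right_cancel₀ this h').symm

theorem gamma_eq (a₀ : IsAdj X₀ X₀) {L : ℤ} (u : Admissible L (-1) (-L) 1) : γ (L + 2) = starRingEnd ℂ (α L) := by
  have u' : Admissible (L + 2) (-1) (-L) 3 := by rw [admissible_iff] at u ⊢; omega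
  have h := a₀ (ket L (-1) (-L) 1) (ket (L + 2) (-1) (-L) 3)
  rw [e₀, comb_x₀_ket u, comb_x₀_ket u'] at h
  simp only [fip_add_right, fip_smul_right, fip_add_left, fip_smul_left] at h
  simp (disch := omega) only [fip_ket_eq u, fip_ket_eq u', fip_ket_of_ne] at h
  norm_num at h
  rw [fip_ket_self u', mul_one] at h
  have : (coefAp q 1 (-1) : ℂ) * coefCp q L 1 (-L) ≠ 0 :=
    mul_ne_zero (by exact_mod_cast coefAp_ne_zero hq u) (by exact_mod_cast coefCp_ne_zero hq u)
  exact (mul_right_cancel₀ this h).symm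

include e₂

/-- The consequences of `x₀x₂ = q²x₂x₀` on lowest weight vectors. -/
theorem scal_rel (a₀ : IsAdj X₀ X₀) (R : X₀ * X₂ = (q : ℂ) ^ 2 • (X₂ * X₀)) {L : ℤ} (u : Admissible L (-1) (-L) 1) :
    (3 ≤ L → γ L * (β (L - 2) - β L) = 0) ∧ (L = 1 ∨ α (L - 2) * starRingEnd ℂ (α (L - 2)) = β L * β L →
      α L * starRingEnd ℂ (α L) = β L * β L) := by
  have hL : L % 2 = 1 ∧ 1 ≤ L := by rw [admissible_iff] at u; omega
  obtain ⟨c1, c2, -, -⟩ := comm_x₁x₂_coef hq hL.1 hL.2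
  rw [show 2 - L = -L + 2 by ring] at c1 c2
  have hA := coefA0_ne_zero hq
  have u1 : Admissible L (-1) (-L + 2) 1 := by rw [admissible_iff]; omega
  have u2 : Admissible (L + 2) (-1) (-L + 2) 1 := by rw [admissible_iff]; omega
  have u3 : Admissible (L + 2) (-1) (-L) 1 := by rw [admissible_iff]; omega
  have u4 : Admissible (L + 2) (-1) (-L) 3 := by rw [admissible_iff]; omega
  have hx : (L = 1 ∧ ket (L - 2) (-1) (-L + 2) 1 = 0 ∧ coefDm q L 1 (-L) = 0) ∨
      3 ≤ L ∧ Admissible (L - 2) (-1) (-L + 2) 1 ∧ Admissible (L - 2) (-1) (-(L - 2)) 1 := by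
    by_cases h3 : 3 ≤ L
    · exact Or.inr ⟨h3, by rw [admissible_iff]; omega, by rw [admissible_iff]; omega⟩
    · exact Or.inl ⟨by omega, ket_of_not_adm (fun h => by rw [admissible_iff] at h; omega), coefDm_zero u (by omega)⟩
  have z : ∀ {N M J}, J < 1 ∨ N + 1 - J < L → ket N M (-L) J = 0 := fun h =>
    ket_of_not_adm fun h' => by rw [admissible_iff] at h'; omega
  have E := LinearMap.congr_fun R (ket L (-1) (-L) 1)
  rw [LinearMap.smul_apply, Module.End.mul_apply, Module.End.mul_apply] at E
  have E₂ := comb_x₂_ket (q := q) (α := α) (β := β) (γ := γ) u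
  have E₀ := comb_x₀_ket (q := q) (α := α) (β := β) (γ := γ) u
  norm_num only at E₀
  simp (disch := omega) only [z, smul_zero, add_zero, zero_add] at E₀
  rw [← e₀] at E₀
  rw [← e₂] at E₂
  have F₂ := fun {N M₁ M₂ J} (h : Admissible N M₁ M₂ J) => e₂ ▸ comb_x₂_ket (q := q) (α := α) (β := β) (γ := γ) h
  rw [E₀, E₂] at E
  simp only [map_add, map_smul, F₂ u, F₂ u3, F₂ u4] at E
  have F₀ := fun {N M₁ M₂ J} (h : Admissible N M₁ M₂ J) => e₀ ▸ comb_x₀_ket (q := q) (α := α) (β := β) (γ := γ) h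
  simp only [F₀ u1, F₀ u2] at E
  constructor
  · intro h3
    obtain ⟨h, -, -⟩ | ⟨-, u5, u6⟩ := hx
    · omega
    have E' := congrArg (fip (ket (L - 2) (-1) (-L + 2) 1)) E
    simp only [F₀ u5, fip_add_right, fip_smul_right] at E'
    simp (disch := omega) only [fip_ket_eq u5, fip_ket_of_ne, add_sub_cancel_right] at E'
    have c := congrArg (Complex.ofReal) (c1 h3)
    have hm : (coefDm q L 1 (-L) : ℂ) ≠ 0 := by
      have := coefDm_ne_zero' hq u5
      rw [sub_add_cancel, add_sub_cancel_right] at this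
      exact_mod_cast this
    have h0 : (coefH0 q (L - 2) 1 (-L + 2) : ℂ) ≠ 0 := by
      have := coefH0_ne_zero hq u6
      rw [show -(L - 2) = -L + 2 by ring] at this
      exact_mod_cast this
    push_cast at c E'
    refine (mul_eq_zero.1 (?_ : (coefA0 q 1 (-1) : ℂ) * (coefDm q L 1 (-L) * coefH0 q (L - 2) 1 (-L + 2)) * _ = 0)).resolve_left
      (mul_ne_zero hA (mul_ne_zero hm h0))
    linear_combination E' - coefA0 q 1 (-1) * γ L * β L * c
  · intro hp
    have E' := congrArg (fip (ket L (-1) (-L + 2) 1)) E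
    have c := congrArg (Complex.ofReal) c2
    have hg := gamma_eq hq e₀ a₀ u
    have hb : (coefDp q L 1 (-L) : ℂ) * coefHp q L 1 (-L + 2) - q ^ 2 * (coefHp q L 1 (-L) * coefDm q (L + 2) 1 (-L)) ≠ 0 := by
      exact_mod_cast (coef_pos hq u).ne'
    refine mul_left_cancel₀ (mul_ne_zero hA hb) ?_
    obtain ⟨rfl, hk, hm⟩ | ⟨h3, u5, u6⟩ := hx
    · rw [hk, hm] at E'
      rw [hm] at c
      simp only [fip_add_right, fip_smul_right, map_zero, fip_zero_right] at E'
      simp (disch := omega) only [fip_ket_eq u1, fip_ket_of_ne, hg, add_sub_cancel_right] at E'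
      push_cast at c E' ⊢
      linear_combination E' - coefA0 q 1 (-1) * β 1 * β 1 * c
    · have hg' := gamma_eq hq e₀ a₀ u6
      rw [sub_add_cancel] at hg'
      have hp := hp.resolve_left (by omega)
      simp only [F₀ u5, fip_add_right, fip_smul_right] at E'
      simp (disch := omega) only [fip_ket_eq u1, fip_ket_of_ne, hg, hg', add_sub_cancel_right] at E'
      push_cast at c E' ⊢
      linear_combination E' - coefA0 q 1 (-1) * β L * β L * c - coefA0 q 1 (-1) * coefDm q L 1 (-L) *
        coefHp q (L - 2) 1 (-L + 2) * hp

end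



/-! ### Uniqueness -/

section

variable {P : Type} [Ring P] [Algebra ℂ P] {U V X₀ X₁ Y₁ X₂ Y₂ A₀ A₁ B₁ A₂ B₂ : P} {r : ℂ}

theorem conj_intertwiner (hU : U * V = 1) (hU' : V * U = 1) (h : X₁ * V = r • (V * A₁)) : U * X₁ = r • (A₁ * U) := by
  calc U * X₁ = U * (X₁ * V) * U := by rw [mul_assoc, mul_assoc, hU', mul_one]
    _ = r • (U * V * (A₁ * U)) := by rw [h, mul_smul_comm, smul_mul_assoc]; simp only [mul_assoc]
    _ = r • (A₁ * U) := by rw [hU, one_mul]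

theorem intertwiner_mul (h : U * X₁ = r • (A₁ * U)) (h' : U * X₂ = r • (A₂ * U)) :
    U * (X₁ * X₂) = (r * r) • (A₁ * A₂ * U) := by
  rw [← mul_assoc, h, smul_mul_assoc, mul_assoc, h', mul_smul_comm, smul_smul, mul_assoc]

theorem intertwiner_scalar (h₀ : U * X₀ = r • (A₀ * U)) (h₁ : U * X₁ = r • (A₁ * U)) (h₁' : U * Y₁ = r • (B₁ * U))
    (h₂ : U * X₂ = r • (A₂ * U)) (h₂' : U * Y₂ = r • (B₂ * U)) (hX : X₀ * X₀ + X₁ * Y₁ + X₂ * Y₂ = 1)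
    (hA : A₀ * A₀ + A₁ * B₁ + A₂ * B₂ = 1) : U = (r * r) • U := by
  have h : U * (X₀ * X₀ + X₁ * Y₁ + X₂ * Y₂) = (r * r) • ((A₀ * A₀ + A₁ * B₁ + A₂ * B₂) * U) := by
    rw [mul_add, mul_add, intertwiner_mul h₀ h₀, intertwiner_mul h₁ h₁', intertwiner_mul h₂ h₂', add_mul, add_mul,
      smul_add, smul_add]
  rwa [hX, hA, mul_one, one_mul] at h

end

section

variable {q : ℝ} (hq : q ∈ Set.Ioo (0 : ℝ) 1) {ρ : S4 q →ₐ[ℂ] Module.End ℂ Spin}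
  (hρ : IsEquivariant hq (spinRep hq) ρ)

include hρ

namespace IsEquivariant

theorem isAdj (x : SGen) : IsAdj (ρ (S4.gen q x)) (ρ (S4.gen q x.star)) := fun v w => by
  have := hρ.star (S4.gen q x) v w
  rwa [S4.star_gen] at this

theorem K_mul (i : Fin 2) (x : SGen) : opU q (.K i) * ρ (S4.gen q x) =
    S4.wt q i x • (ρ (S4.gen q x) * opU q (.K i)) := by
  have h := hρ.crossed (.K i) (S4.gen q x)
  simp only [spinRep_gen, UGen.coprod, List.map_cons, List.map_nil, List.sum_cons, List.sum_nil, add_zero,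
    (S4.act_gen q hq i x).1, map_smul] at h
  exact h.trans (smul_mul_assoc _ _ _)

theorem E_mul (i : Fin 2) (x : SGen) : opU q (.E i) * ρ (S4.gen q x) =
    ρ (S4.actE q i x) * opU q (.K i) + (S4.wt q i x)⁻¹ • (ρ (S4.gen q x) * opU q (.E i)) := by
  have h := hρ.crossed (.E i) (S4.gen q x)
  simp only [spinRep_gen, UGen.coprod, List.map_cons, List.map_nil, List.sum_cons, List.sum_nil, add_zero,
    (S4.act_gen q hq i x).2.1, (S4.act_gen q hq i x).2.2.1, map_smul] at h
  exact h.trans (congrArg (_ + ·) (smul_mul_assoc _ _ _))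

theorem F_mul (i : Fin 2) (x : SGen) : opU q (.F i) * ρ (S4.gen q x) =
    ρ (S4.actF q i x) * opU q (.K i) + (S4.wt q i x)⁻¹ • (ρ (S4.gen q x) * opU q (.F i)) := by
  have h := hρ.crossed (.F i) (S4.gen q x)
  simp only [spinRep_gen, UGen.coprod, List.map_cons, List.map_nil, List.sum_cons, List.sum_nil, add_zero,
    (S4.act_gen q hq i x).2.1, (S4.act_gen q hq i x).2.2.2, map_smul] at h
  exact h.trans (congrArg (_ + ·) (smul_mul_assoc _ _ _))

theorem highRel {h : ℂ} (h1 : ((q ^ (1 / 2 : ℝ) : ℝ) : ℂ) = h) : HighRel q h (opE₁ q) (opE₂ q) (opF₁ q) (opF₂ q) (opK₁ q)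
    (opK₂ q) (ρ (S4.x₀ q)) (ρ (S4.x₁ q)) (ρ (S4.x₂ q)) := by
  have K₁ := hρ.K_mul hq 0 .x₂
  have K₂ := hρ.K_mul hq 1 .x₂
  have E₁ := hρ.E_mul hq 0 .x₂
  have E₂ := hρ.E_mul hq 1 .x₂
  have F₁ := hρ.F_mul hq 0 .x₂
  have F₂ := hρ.F_mul hq 1 .x₂
  have F₁' := hρ.F_mul hq 0 .x₁
  simp only [S4.wt, S4.actE, S4.actF, map_zero, zero_mul, zero_add, inv_one, one_smul, map_smul] at K₁ K₂ E₁ E₂ F₁ F₂ F₁'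
  have c : (((q ^ (1 / 2 : ℝ) * qnum q 2 : ℝ)) : ℂ) = h * (q + (q : ℂ)⁻¹) := by
    rw [Complex.ofReal_mul, h1, S4.qnum_two q hq, Complex.ofReal_add, Complex.ofReal_inv]
  rw [c] at F₁'
  exact ⟨E₁, F₁, E₂, F₂, F₁'.trans (congrArg (· + _) (smul_mul_assoc _ _ _)), K₁, K₂⟩

/-- The scalars in the decomposition of the generators. -/
theorem decomp : ∃ (s : ℤˣ) (r : ℝ) (α γ : ℤ → ℂ), 0 < r ∧ (∀ L, L % 2 = 1 ∧ 1 ≤ L → ‖α L‖ = r ∧ γ (L + 2) = starRingEnd ℂ (α L)) ∧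
      ρ (S4.x₀ q) = opX₀p q * scal α + opX₀z q * scal (fun _ => (s : ℤ) * r) + opX₀m q * scal γ ∧
      ρ (S4.x₁ q) = opX₁p q * scal α + opX₁z q * scal (fun _ => (s : ℤ) * r) + opX₁m q * scal γ ∧
      ρ (S4.x₂ q) = opX₂p q * scal α + opX₂z q * scal (fun _ => (s : ℤ) * r) + opX₂m q * scal γ := by
  obtain ⟨h, h0, hh, h1, -⟩ := S4.rpow_half q hq.1
  obtain ⟨α, β, γ, e₀, e₁, e₂⟩ := (hρ.highRel hq h1).decomp hq h0 h1
  have a₀ := hρ.isAdj hq .x₀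
  have a₂ : IsAdj (ρ (S4.x₂ q)) (ρ (S4.y₂ q)) := hρ.isAdj hq .x₂
  have adm : ∀ {L : ℤ}, L % 2 = 1 ∧ 1 ≤ L → Admissible L (-1) (-L) 1 := fun h => by rw [admissible_iff]; omega
  have R : ρ (S4.x₀ q) * ρ (S4.x₂ q) = (q : ℂ) ^ 2 • (ρ (S4.x₂ q) * ρ (S4.x₀ q)) := by
    rw [← map_mul, S4.r_x₀x₂, map_smul, map_mul]
  have rel := fun {L : ℤ} (u : Admissible L (-1) (-L) 1) => scal_rel hq e₀ e₂ a₀ R u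
  have real := fun {L : ℤ} (u : Admissible L (-1) (-L) 1) => beta_real hq e₀ a₀ u
  have gam := fun {L : ℤ} (u : Admissible L (-1) (-L) 1) => gamma_eq hq e₀ a₀ u
  have u₁ : Admissible 1 (-1) (-1) 1 := adm (by norm_num)
  have α₁ := (rel u₁).2 (Or.inl rfl)
  have hβ : β 1 ≠ 0 := by
    intro hβ
    rw [hβ, mul_zero, Complex.mul_conj, Complex.ofReal_eq_zero, Complex.normSq_eq_zero] at α₁
    have hx : ρ (S4.x₂ q) (ket 1 (-1) (-1) 1) = 0 := by
      rw [e₂, comb_x₂_ket u₁, hβ, α₁, ket_of_not_adm (L := 1 - 2) (fun h => by rw [admissible_iff] at h; omega)]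
      simp only [zero_mul, zero_smul, smul_zero, add_zero]
    have e := LinearMap.congr_fun (congrArg ρ (S4.y₂_mul_x₂ (q := q))) (ket 1 (-1) (-1) 1)
    rw [map_mul, Module.End.mul_apply, hx, map_zero, map_add, map_smul, map_smul, map_one, S4.w₂, map_mul] at e
    have e' := congrArg (fip (ket 1 (-1) (-1) 1)) e
    rw [fip_zero_right, LinearMap.add_apply, LinearMap.smul_apply, LinearMap.smul_apply, Module.End.one_apply,
      fip_add_right, fip_smul_right, fip_smul_right, fip_ket_self u₁, Module.End.mul_apply, ← a₂.symm, fip_self] at e'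
    have hp := fnsq_nonneg (ρ (S4.y₂ q) (ket 1 (-1) (-1) 1))
    have hq4 : q ^ 4 < 1 := pow_lt_one₀ hq.1.le hq.2 (by norm_num)
    have : (1 - q ^ 4) * 1 + q ^ 4 * fnsq (ρ (S4.y₂ q) (ket 1 (-1) (-1) 1)) = 0 := by exact_mod_cast e'.symm
    have := mul_nonneg (pow_pos hq.1 4).le hp
    linarith
  have key : ∀ n : ℕ, β (2 * n + 1) = β 1 ∧ α (2 * n + 1) * starRingEnd ℂ (α (2 * n + 1)) = β 1 * β 1 := by
    intro n
    induction n with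
    | zero => simpa using α₁
    | succ n ih =>
      have u : Admissible (2 * (n + 1 : ℕ) + 1) (-1) (-(2 * (n + 1 : ℕ) + 1)) 1 := adm (by omega)
      have u' : Admissible (2 * n + 1) (-1) (-(2 * n + 1)) 1 := adm (by omega)
      have hn : (2 * (n + 1 : ℕ) + 1 : ℤ) - 2 = 2 * n + 1 := by push_cast; ring
      have r := rel u
      rw [hn] at r
      have hb : β (2 * (n + 1 : ℕ) + 1) = β 1 := by
        have := (mul_eq_zero.1 (r.1 (by push_cast; omega))).resolve_left ?_
        · rw [← ih.1]; exact (sub_eq_zero.1 this).symm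
        · have hg := gam u'
          rw [show (2 * n + 1 : ℤ) + 2 = 2 * (n + 1 : ℕ) + 1 by push_cast; ring] at hg
          rw [hg]
          intro h
          rw [h, mul_zero] at ih
          exact mul_ne_zero hβ hβ ih.2.symm
      exact ⟨hb, by rw [r.2 (Or.inr (by rw [hb]; exact ih.2)), hb]⟩
  have key' : ∀ L : ℤ, L % 2 = 1 ∧ 1 ≤ L → β L = β 1 ∧ α L * starRingEnd ℂ (α L) = β 1 * β 1 := by
    intro L hL
    obtain ⟨n, rfl⟩ : ∃ n : ℕ, L = 2 * n + 1 := ⟨(L / 2).toNat, by omega⟩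
    exact key n
  obtain ⟨b, hb⟩ := Complex.conj_eq_iff_real.1 (real u₁)
  have hb0 : b ≠ 0 := by rintro rfl; exact hβ (by rw [hb, Complex.ofReal_zero])
  obtain ⟨s, hs⟩ : ∃ s : ℤˣ, b = (s : ℤ) * |b| := by
    rcases le_total 0 b with h | h
    · exact ⟨1, by rw [abs_of_nonneg h]; simp⟩
    · exact ⟨-1, by rw [abs_of_nonpos h]; simp⟩
  have hsb : scal β = scal fun _ => (s : ℤ) * (|b| : ℝ) := end_ext fun L M₁ M₂ J ha => by
    rw [scal_ket, scal_ket, (key' L (by rw [admissible_iff] at ha; omega)).1, hb]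
    congr 1
    exact_mod_cast hs
  rw [hsb] at e₀ e₁ e₂
  refine ⟨s, |b|, α, γ, abs_pos.2 hb0, fun L hL => ⟨?_, gam (adm hL)⟩, e₀, e₁, e₂⟩
  have := (key' L hL).2
  rw [hb, Complex.mul_conj, Complex.normSq_eq_norm_sq] at this
  have : ‖α L‖ ^ 2 = |b| ^ 2 := by rw [sq_abs, sq b]; exact_mod_cast this
  exact (sq_eq_sq₀ (norm_nonneg _) (abs_nonneg _)).1 this

/-- An equivariant representation is conjugate to one of `π_±` by phases on the `V_l`. -/
theorem exists_intertwiner : ∃ (s : ℤˣ) (φ : ℤ → ℂ), (∀ L, φ L * starRingEnd ℂ (φ L) = 1) ∧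
    ∀ x, scal φ * ρ (S4.gen q x) = sphereRep hq s (S4.gen q x) * scal φ := by
  obtain ⟨s, r, α, γ, hr, hα, e₀, e₁, e₂⟩ := hρ.decomp hq
  have hr' : (r : ℂ) ≠ 0 := by exact_mod_cast hr.ne'
  let f : ℕ → ℂ := fun n => ∏ k ∈ Finset.range n, (starRingEnd ℂ (α (2 * k + 1)) * (r : ℂ)⁻¹)
  let φ : ℤ → ℂ := fun L => f (L / 2).toNat
  have hα' : ∀ L, L % 2 = 1 ∧ 1 ≤ L → α L * starRingEnd ℂ (α L) = r * r := fun L hL => by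
    rw [Complex.mul_conj, Complex.normSq_eq_norm_sq, (hα L hL).1, sq, Complex.ofReal_mul]
  have hf : ∀ n, f n * starRingEnd ℂ (f n) = 1 := by
    intro n
    induction n with
    | zero => simp [f]
    | succ n ih =>
      have e : f (n + 1) = f n * (starRingEnd ℂ (α (2 * n + 1)) * (r : ℂ)⁻¹) := Finset.prod_range_succ _ _
      have := hα' (2 * n + 1) (by omega)
      rw [e, map_mul, map_mul, Complex.conj_conj, map_inv₀, Complex.conj_ofReal]
      calc _ = (f n * starRingEnd ℂ (f n)) * (α (2 * n + 1) * starRingEnd ℂ (α (2 * n + 1))) * ((r : ℂ)⁻¹ * (r : ℂ)⁻¹) := by ring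
        _ = 1 := by rw [ih, this]; field_simp
  have hφ : ∀ L, φ L * starRingEnd ℂ (φ L) = 1 := fun L => hf _
  have step : ∀ L, L % 2 = 1 ∧ 1 ≤ L → φ (L + 2) * r = φ L * starRingEnd ℂ (α L) := by
    intro L hL
    obtain ⟨n, rfl⟩ : ∃ n : ℕ, L = 2 * n + 1 := ⟨(L / 2).toNat, by omega⟩
    have i1 : ((2 * n + 1 + 2 : ℤ) / 2).toNat = n + 1 := by omega
    have i2 : ((2 * n + 1 : ℤ) / 2).toNat = n := by omega
    simp only [φ, i1, i2, f, Finset.prod_range_succ]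
    field_simp
  have comb : ∀ {A B C : Module.End ℂ Spin}, ShiftL 2 A → ShiftL 0 B → ShiftL (-2) C → (∀ M₁ M₂ J, C (ket 1 M₁ M₂ J) = 0) →
      scal φ * (A * scal α + B * scal (fun _ => (s : ℤ) * r) + C * scal γ) =
        (r : ℂ) • ((A + ((s : ℤ) : ℂ) • B + C) * scal φ) := by
    intro A B C hA hB hC hC1
    rw [mul_add, mul_add, ← mul_assoc, ← mul_assoc, ← mul_assoc, hA, hB, hC, mul_assoc, mul_assoc, mul_assoc, scal_mul,
      scal_mul, scal_mul]
    refine end_ext fun L M₁ M₂ J ha => ?_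
    have hL : L % 2 = 1 ∧ 1 ≤ L := by rw [admissible_iff] at ha; omega
    simp only [LinearMap.add_apply, LinearMap.smul_apply, Module.End.mul_apply, scal_ket, map_smul, add_zero, smul_add]
    have e1 : φ (L + 2) * α L = r * φ L := by
      have := step L hL
      have h2 := hα' L hL
      refine mul_right_cancel₀ hr' ?_
      linear_combination α L * this + φ L * h2
    rw [e1, smul_smul, smul_smul, smul_smul, smul_smul]
    have e3 : (φ (L + -2) * γ L) • C (ket L M₁ M₂ J) = ((r : ℂ) * φ L) • C (ket L M₁ M₂ J) := by
      by_cases h1 : L = 1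
      · rw [h1, hC1, smul_zero, smul_zero]
      · have h3 : (L + -2) % 2 = 1 ∧ 1 ≤ L + -2 := by omega
        have hg := (hα _ h3).2
        have hs := step _ h3
        rw [neg_add_cancel_right] at hg hs
        rw [hg, ← hs, mul_comm]
    rw [e3]
    congr 2
    congr 1
    ring
  have hm : ∀ (b : ℤ) (f₁ f₂ f₃ : ℤ → ℤ → ℝ) (g₁ g₂ g₃ : ℤ → ℤ → ℤ → ℝ) (M₁ M₂ J : ℤ),
      three (-2) b f₁ f₂ f₃ g₁ g₂ g₃ (ket 1 M₁ M₂ J) = 0 := by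
    intro b f₁ f₂ f₃ g₁ g₂ g₃ M₁ M₂ J
    by_cases h : Admissible 1 M₁ M₂ J
    · have z : ∀ M M' J, ket (1 + -2) M M' J = 0 := fun M M' J => ket_of_not_adm fun h => by
        rw [admissible_iff] at h; omega
      rw [three_ket _ _ _ _ _ _ _ _ h, z, z, z]; simp only [smul_zero, add_zero]
    · rw [ket_of_not_adm h, map_zero]
  have c₀ : scal φ * ρ (S4.x₀ q) = (r : ℂ) • (sphereRep hq s (S4.x₀ q) * scal φ) := by
    rw [sphereRep_x₀, opX₀_eq, e₀]
    exact comb (shiftL_three _ _ _ _ _ _ _ _) (shiftL_three _ _ _ _ _ _ _ _) (shiftL_three _ _ _ _ _ _ _ _)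
      (hm _ _ _ _ _ _ _)
  have c₁ : scal φ * ρ (S4.x₁ q) = (r : ℂ) • (sphereRep hq s (S4.x₁ q) * scal φ) := by
    rw [sphereRep_x₁, opX₁_eq, e₁]
    exact comb (shiftL_three _ _ _ _ _ _ _ _) (shiftL_three _ _ _ _ _ _ _ _) (shiftL_three _ _ _ _ _ _ _ _)
      (hm _ _ _ _ _ _ _)
  have c₂ : scal φ * ρ (S4.x₂ q) = (r : ℂ) • (sphereRep hq s (S4.x₂ q) * scal φ) := by
    rw [sphereRep_x₂, opX₂_eq, e₂]
    refine comb (shiftL_sh _ _ _ _ _) (shiftL_sh _ _ _ _ _) (shiftL_sh _ _ _ _ _) fun M₁ M₂ J => ?_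
    by_cases h : Admissible 1 M₁ M₂ J
    · rw [opX₂m, sh_ket _ _ _ _ _ h, ket_of_not_adm fun h => by rw [admissible_iff] at h; omega, smul_zero]
    · rw [ket_of_not_adm h, map_zero]
  have hU : scal φ * scal (fun L => starRingEnd ℂ (φ L)) = 1 := by
    rw [scal_mul, ← scal_one]; exact congrArg scal (funext hφ)
  have hU' : scal (fun L => starRingEnd ℂ (φ L)) * scal φ = 1 := by
    rw [scal_mul, ← scal_one]; exact congrArg scal (funext fun L => (mul_comm _ _).trans (hφ L))
  have adj : ∀ x, scal φ * ρ (S4.gen q x) = (r : ℂ) • (sphereRep hq s (S4.gen q x) * scal φ) →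
      scal φ * ρ (S4.gen q x.star) = (r : ℂ) • (sphereRep hq s (S4.gen q x.star) * scal φ) := fun x hx => by
    have h1 := (scal_isAdj φ).mul (hρ.isAdj hq x)
    rw [hx] at h1
    have h2 := h1.eq ((((sphereRep_isEquivariant hq s).isAdj hq x).mul (scal_isAdj φ)).smul_real r)
    exact conj_intertwiner (P := Module.End ℂ Spin) hU hU' h2
  have d₁ : scal φ * ρ (S4.y₁ q) = (r : ℂ) • (sphereRep hq s (S4.y₁ q) * scal φ) := adj .x₁ c₁
  have d₂ : scal φ * ρ (S4.y₂ q) = (r : ℂ) • (sphereRep hq s (S4.y₂ q) * scal φ) := adj .x₂ c₂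
  have hr1 : (r : ℂ) * r = 1 := by
    have h := intertwiner_scalar (P := Module.End ℂ Spin) c₀ c₁ d₁ c₂ d₂
      (by rw [← map_mul, ← map_mul, ← map_mul, ← map_add, ← map_add, S4.r_sphere, map_one])
      (by rw [← map_mul, ← map_mul, ← map_mul, ← map_add, ← map_add, S4.r_sphere, map_one])
    have e := congrArg (fip (ket 1 (-1) (-1) 1)) (LinearMap.congr_fun h (ket 1 (-1) (-1) 1))
    have u : Admissible 1 (-1) (-1) 1 := by rw [admissible_iff]; omega
    rw [LinearMap.smul_apply, scal_ket, fip_smul_right, fip_smul_right, fip_smul_right, fip_ket_self u, mul_one] at e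
    have h0 : φ 1 ≠ 0 := fun h => by simpa [h] using hφ 1
    exact mul_right_cancel₀ h0 (e.symm.trans (one_mul _).symm)
  have hr2 : (r : ℂ) = 1 := by
    have : r * r = 1 := by exact_mod_cast hr1
    exact_mod_cast (mul_self_eq_one_iff.1 this).resolve_right (by linarith)
  rw [hr2, one_smul] at c₀ c₁ c₂ d₁ d₂
  exact ⟨s, φ, hφ, fun x => by cases x <;> assumption⟩

theorem unitarilyEquivalent_sphereRep : ∃ s, UnitarilyEquivalent (spinRep hq) ρ (sphereRep hq s) := by
  obtain ⟨s, φ, hφ, H⟩ := hρ.exists_intertwiner hq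
  have hU : scal φ * scal (fun L => starRingEnd ℂ (φ L)) = 1 := by
    rw [scal_mul, ← scal_one]; exact congrArg scal (funext hφ)
  have hU' : scal (fun L => starRingEnd ℂ (φ L)) * scal φ = 1 := by
    rw [scal_mul, ← scal_one]; exact congrArg scal (funext fun L => (mul_comm _ _).trans (hφ L))
  refine ⟨s, LinearEquiv.ofLinearMap (scal φ) (scal fun L => starRingEnd ℂ (φ L)) hU hU', fun v w => ?_, fun h v => ?_,
    fun a v => ?_⟩
  · refine (scal_isAdj φ v (scal φ w)).trans ?_
    rw [← Module.End.mul_apply, hU']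
    rfl
  · refine LinearMap.congr_fun (?_ : scal φ * spinRep hq h = spinRep hq h * scal φ) v
    induction h using Uq.induction with
    | hc c => rw [AlgHom.commutes, Algebra.commutes]
    | hg x => rw [spinRep_gen]; exact (shiftL_opU x).comm φ
    | hm a b ha hb => rw [map_mul, ← mul_assoc, ha, mul_assoc, hb, mul_assoc]
    | ha a b ha hb => rw [map_add, mul_add, ha, hb, add_mul]
  · refine LinearMap.congr_fun (?_ : scal φ * ρ a = sphereRep hq s a * scal φ) v
    induction a using S4.induction with
    | hc c => rw [AlgHom.commutes, AlgHom.commutes, Algebra.commutes]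
    | hg x => exact H x
    | hm a b ha hb => rw [map_mul, map_mul, ← mul_assoc, ha, mul_assoc, hb, mul_assoc]
    | ha a b ha hb => rw [map_add, map_add, mul_add, ha, hb, add_mul]

end IsEquivariant

end


theorem mainTheorem6 (q : ℝ) (hq : q ∈ Set.Ioo (0 : ℝ) 1) :
    ∃ σ : Uq q →ₐ[ℂ] Module.End ℂ Spin, IsSpinRep q σ ∧
    ∃ π : ℤˣ → (S4 q →ₐ[ℂ] Module.End ℂ Spin),
      (∀ s, IsEquivariant hq σ (π s) ∧
        π s (S4.x₀ q) = opX₀ q s ∧ π s (S4.x₁ q) = opX₁ q s ∧ π s (S4.x₂ q) = opX₂ q s) ∧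
      (∀ s, ∃ R : S4 q →⋆ₐ[ℂ] (HSpin →L[ℂ] HSpin), ∀ a v, R a (toH v) = toH (π s a v)) ∧
      (∀ ρ : S4 q →ₐ[ℂ] Module.End ℂ Spin, IsEquivariant hq σ ρ →
        ∃ s, UnitarilyEquivalent σ ρ (π s)) ∧
      ¬ UnitarilyEquivalent σ (π 1) (π (-1)) ∧
      ¬ ModuleEquivalent (π 1) (π (-1)) ∧
      IsIdempotentElem (idem q) ∧
      ∃ φ : S4 q →ₗ[ℂ] ℂ, IsHaarState hq φ ∧
        CorrespondsTo hq σ (π 1) φ (idem q) ∧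
        CorrespondsTo hq σ (π (-1)) φ (1 - idem q) := by
  refine ⟨spinRep hq, spinRep_isSpinRep hq, sphereRep hq, fun s => ⟨sphereRep_isEquivariant hq s, sphereRep_x₀ hq s,
    sphereRep_x₁ hq s, sphereRep_x₂ hq s⟩, fun s => exists_extension (sphereRep_isEquivariant hq s).star
      (sphereRep_isBdd hq s), fun ρ hρ => hρ.unitarilyEquivalent_sphereRep hq, ?_, not_moduleEquivalent hq,
    idem_isIdempotentElem hq, haar hq, haar_isHaarState hq (sphereRep_injective hq 1), ?_, ?_⟩
  · rintro ⟨W, -, -, hW⟩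
    exact not_moduleEquivalent hq ⟨W, hW⟩
  · rw [← idemOf_one]
    exact correspondsTo hq (sphereRep_injective hq 1) 1
  · rw [← idemOf_neg_one]
    exact correspondsTo hq (sphereRep_injective hq 1) (-1)
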